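/- **Setting.** Let $2\le n\le 4$ and let $(M,g_0)$ be a closed smooth Riemannian $n$-manifold. All norms, gradients, covariant derivatives, the geodesic balls $B_r=B_r(x)$ and the integrals are taken with respect to $g_0$. Let $N\subset\mathbb R^L$ be a smooth embedded submanifold (with the induced metric) whose second fundamental form $A$ satisfies $\|A\|\le C_N$; the sign of $A$ is the one for which the normal component of $\gamma''$ is $-A(\gamma)(\gamma',\gamma')$ for curves $\gamma$ in $N$. Let $0\le\varepsilon\le1$, $a>0$, and let $b$ be so large that $C_b:=\frac{nb}{2}-C_N-2C_N^2>0$. For $f:M\to N\subset\mathbb R^L$ put $$e_2(f)=\varepsilon+|df|^2,\qquad E^\varepsilon(f)=\frac1n\int_M e_2(f)^{n/2}.$$ A smooth solution of the regularized $n$-conformal heat flow on $M\times[0,T)$ is a pair of smooth maps $f:M\times[0,T)\to N$, $u:M\times[0,T)\to\mathbb R$ with $u(\cdot,0)=0$ and $$f_t=e^{-nu}\Big(\operatorname{div}\big(e_2(f)^{\frac n2-1}df\big)+e_2(f)^{\frac n2-1}A(f)(df,df)\Big),\qquad u_t=b\,e^{-nu}e_2(f)^{\frac n2}-a .$$ **Theorem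 5.1 ($\varepsilon$-regularity).** There is $\varepsilon_1>0$, depending only on $n$, $L$, $C_N$ and a bound $\Lambda$ for the Ricci curvature of $g_0$ ($|\mathrm{Ric}(\xi,\xi)|\le\Lambda|\xi|^2$), with the following property. Let $(f,u)$ be a smooth solution on $M\times[0,T)$ with $E^\varepsilon(f(0))\le E$, let $x\in M$, $0<\rho<r$, $0\le t_1<t_2<T$, $t_1'=\frac{t_1+t_2}2$, and suppose that $$\sup_{t\in[t_1,t_2]}\int_{B_r(x)}e_2(f)^{\frac n2}(t)\le\varepsilon_1,\qquad \int_{B_r(x)}e^{nu}|f_t|^2(t_1)\le\varepsilon_1,\qquad \int_{B_r(x)}e^{3nu}(t_1')\le\varepsilon_1 .$$ Then for every $t\in[t_1',t_2]$ $$\int_{B_\rho(x)}|\nabla^2f|^2\,e_2(f)^{n-2}(t)\le C_{13},\qquad \int_{B_\rho(x)}e_2(f)^{\frac{3n}2}(t)\le C_{13},$$ where $C_{13}$ depends only on $n,L,C_N,a,b,E,\rho,r,t_1,t_2$ and $(M,g_0)$ (and not on $\varepsilon$, $N$, $x$, $T$ or $(f,u)$). Moreover there is $r_0=r_0(M,g_0,n,L,C_N,\Lambda)>0$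 such that, for $r\le r_0$, the constant $C_{13}$ depends on $(M,g_0)$ only through the Ricci bound $\Lambda$. -/

import Mathlib

open Set MeasureTheory Manifold Bundle
open scoped ContDiff Matrix

noncomputable section

/-! ### The target: embedded submanifolds of Euclidean space -/

section Target

variable {L : ℕ}

/-- `N` is a smooth embedded submanifold (without boundary) of `ℝ^L`: near each of its points there
is a smooth diffeomorphism between open sets of `ℝ^L` which maps `N` to a linear subspace. -/
def IsSmoothSubmanifold (N : Set (EuclideanSpace ℝ (Fin L))) : Prop :=
  ∀ y ∈ N, ∃ (Φ : OpenPartialHomeomorph (EuclideanSpace ℝ (Fin L)) (EuclideanSpace ℝ (Fin L)))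
    (S : Submodule ℝ (EuclideanSpace ℝ (Fin L))),
    y ∈ Φ.source ∧ ContDiffOn ℝ ∞ Φ Φ.source ∧ ContDiffOn ℝ ∞ Φ.symm Φ.target ∧
      ∀ z ∈ Φ.source, z ∈ N ↔ Φ z ∈ S

/-- The tangent space `T_y N`, as a linear subspace of `ℝ^L`. -/
def tangentSub (N : Set (EuclideanSpace ℝ (Fin L))) (y : EuclideanSpace ℝ (Fin L)) :
    Submodule ℝ (EuclideanSpace ℝ (Fin L)) :=
  Submodule.span ℝ (tangentConeAt ℝ N y)

/-- The orthogonal projection of `ℝ^L` onto `T_y N`. -/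
def tangentProj (N : Set (EuclideanSpace ℝ (Fin L))) (y : EuclideanSpace ℝ (Fin L)) :
    EuclideanSpace ℝ (Fin L) →L[ℝ] EuclideanSpace ℝ (Fin L) :=
  (tangentSub N y).starProjection

/-- The second fundamental form `A(y)(v, w) = -(D_v P)(w)` for `v, w ∈ T_y N`, where `P` is the
field of orthogonal projections onto the tangent spaces of `N`. For a curve `γ` in `N` the normal
component of `γ''` is `-A(γ)(γ', γ')`; this is the sign for which `Δ f + A(f)(df, df)` is
the component of `Δ f` tangent to `N` (so `A(v, v) = |v|² y` on the unit sphere). Only its values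
on tangent vectors are meaningful. -/
def secondFF (N : Set (EuclideanSpace ℝ (Fin L))) (y : EuclideanSpace ℝ (Fin L)) :
    EuclideanSpace ℝ (Fin L) →L[ℝ] EuclideanSpace ℝ (Fin L) →L[ℝ] EuclideanSpace ℝ (Fin L) :=
  -fderivWithin ℝ (tangentProj N) N y

/-- `‖A‖ ≤ K` on `N`. -/
def SecondFFBound (N : Set (EuclideanSpace ℝ (Fin L))) (K : ℝ) : Prop :=
  ∀ y ∈ N, ∀ v ∈ tangentSub N y, ∀ w ∈ tangentSub N y, ‖secondFF N y v w‖ ≤ K * ‖v‖ * ‖w‖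

end Target

/-! ### Riemannian calculus in a coordinate patch of `ℝ^n`

`G` is the matrix field of a metric, `F` an `ℝ^L`-valued function of the coordinates. -/

section Coordinates

variable {n L : ℕ}

/-- The `i`-th partial derivative. -/
def pd {W : Type*} [NormedAddCommGroup W] [NormedSpace ℝ W] (i : Fin n)
    (F : EuclideanSpace ℝ (Fin n) → W) (y : EuclideanSpace ℝ (Fin n)) : W :=
  fderiv ℝ F y (EuclideanSpace.single i 1)

/-- Christoffel symbols `Γ^k_{ij}`. -/
def christoffel (G : EuclideanSpace ℝ (Fin n) → Matrix (Fin n) (Fin n) ℝ) (k i j : Fin n)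
    (y : EuclideanSpace ℝ (Fin n)) : ℝ :=
  (1 / 2) * ∑ l, (G y)⁻¹ k l *
    (pd i (fun z => G z j l) y + pd j (fun z => G z i l) y - pd l (fun z => G z i j) y)

/-- Components `R_{ij}` of the Ricci tensor. -/
def ricciCoord (G : EuclideanSpace ℝ (Fin n) → Matrix (Fin n) (Fin n) ℝ) (i j : Fin n)
    (y : EuclideanSpace ℝ (Fin n)) : ℝ :=
  ∑ k, (pd k (christoffel G k i j) y - pd j (christoffel G k i k) y
    + ∑ l, (christoffel G k k l y * christoffel G l i j y
        - christoffel G k j l y * christoffel G l i k y))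

/-- `|dF|² = g^{ij} ⟨∂_i F, ∂_j F⟩`. -/
def gradSqCoord (G : EuclideanSpace ℝ (Fin n) → Matrix (Fin n) (Fin n) ℝ)
    (F : EuclideanSpace ℝ (Fin n) → EuclideanSpace ℝ (Fin L))
    (y : EuclideanSpace ℝ (Fin n)) : ℝ :=
  ∑ i, ∑ j, (G y)⁻¹ i j * inner ℝ (pd i F y) (pd j F y)

/-- Components `∂_i ∂_j F - Γ^k_{ij} ∂_k F` of the covariant Hessian `∇²F` of the `ℝ^L`-valued
function `F`. -/
def hessCoord (G : EuclideanSpace ℝ (Fin n) → Matrix (Fin n) (Fin n) ℝ)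
    (F : EuclideanSpace ℝ (Fin n) → EuclideanSpace ℝ (Fin L)) (i j : Fin n)
    (y : EuclideanSpace ℝ (Fin n)) : EuclideanSpace ℝ (Fin L) :=
  pd i (pd j F) y - ∑ k, christoffel G k i j y • pd k F y

/-- `|∇²F|² = g^{ik} g^{jl} ⟨∇²_{ij} F, ∇²_{kl} F⟩`. -/
def hessSqCoord (G : EuclideanSpace ℝ (Fin n) → Matrix (Fin n) (Fin n) ℝ)
    (F : EuclideanSpace ℝ (Fin n) → EuclideanSpace ℝ (Fin L))
    (y : EuclideanSpace ℝ (Fin n)) : ℝ :=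
  ∑ i, ∑ j, ∑ k, ∑ l, (G y)⁻¹ i k * (G y)⁻¹ j l *
    inner ℝ (hessCoord G F i j y) (hessCoord G F k l y)

/-- The regularized `n`-Laplacian
`div (e₂^{n/2-1} dF) = (det g)^{-1/2} ∂_i ((det g)^{1/2} e₂^{n/2-1} g^{ij} ∂_j F)` with
`e₂ = ε + |dF|²`. -/
def nLaplaceCoord (ε : ℝ) (G : EuclideanSpace ℝ (Fin n) → Matrix (Fin n) (Fin n) ℝ)
    (F : EuclideanSpace ℝ (Fin n) → EuclideanSpace ℝ (Fin L))
    (y : EuclideanSpace ℝ (Fin n)) : EuclideanSpace ℝ (Fin L) :=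
  (√(G y).det)⁻¹ • ∑ i, pd i (fun z => (√(G z).det * (ε + gradSqCoord G F z) ^ ((n : ℝ) / 2 - 1)) •
    ∑ j, (G z)⁻¹ i j • pd j F z) y

end Coordinates

/-! ### The domain: a Riemannian manifold `(M, g₀)` of dimension `n` -/

section Domain

variable {n L : ℕ} {M : Type*} [EMetricSpace M] [ChartedSpace (EuclideanSpace ℝ (Fin n)) M]

/-- The matrix `g_{ij}` of the metric in the chart `c`, as a function of the coordinates. -/
def gram [RiemannianBundle (fun p : M => TangentSpace (𝓡 n) p)]
    (c : OpenPartialHomeomorph M (EuclideanSpace ℝ (Fin n))) (y : EuclideanSpace ℝ (Fin n)) :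
    Matrix (Fin n) (Fin n) ℝ :=
  Matrix.of fun i j => inner ℝ
    (mfderiv (𝓡 n) (𝓡 n) c.symm y (EuclideanSpace.single i 1) : TangentSpace (𝓡 n) (c.symm y))
    (mfderiv (𝓡 n) (𝓡 n) c.symm y (EuclideanSpace.single j 1) : TangentSpace (𝓡 n) (c.symm y))

variable (n M) in
/-- The Riemannian volume measure: the least measure on `M` that dominates `√(det g) dx` in each
preferred chart. (These local measures agree on overlaps of charts, so in each chart it is equal to
`√(det g) dx`.) -/
def riemVol [MeasurableSpace M] [RiemannianBundle (fun p : M => TangentSpace (𝓡 n) p)] :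
    Measure M :=
  ⨆ p : M, Measure.map (chartAt (EuclideanSpace ℝ (Fin n)) p).symm
    ((volume.restrict (chartAt (EuclideanSpace ℝ (Fin n)) p).target).withDensity
      fun y => ENNReal.ofReal √(gram (chartAt (EuclideanSpace ℝ (Fin n)) p) y).det)

variable [RiemannianBundle (fun p : M => TangentSpace (𝓡 n) p)]

variable (n M) in
/-- `|Ric(ξ, ξ)| ≤ Λ |ξ|²` for all tangent vectors `ξ` of `M`. -/
def RicciBound (Λ : ℝ) : Prop :=
  ∀ (p : M) (ξ : Fin n → ℝ),
    |∑ i, ∑ j, ricciCoord (gram (chartAt (EuclideanSpace ℝ (Fin n)) p)) i j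
        (chartAt (EuclideanSpace ℝ (Fin n)) p p) * ξ i * ξ j| ≤
      Λ * ∑ i, ∑ j, gram (chartAt (EuclideanSpace ℝ (Fin n)) p)
        (chartAt (EuclideanSpace ℝ (Fin n)) p p) i j * ξ i * ξ j

variable (n) in
/-- `f` read in the preferred chart at `p`. -/
def inChart (p : M) (f : M → EuclideanSpace ℝ (Fin L)) :
    EuclideanSpace ℝ (Fin n) → EuclideanSpace ℝ (Fin L) :=
  f ∘ (chartAt (EuclideanSpace ℝ (Fin n)) p).symm

variable (n) in
/-- `e₂(f) = ε + |df|²`. -/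
def e2 (ε : ℝ) (f : M → EuclideanSpace ℝ (Fin L)) (p : M) : ℝ :=
  ε + gradSqCoord (gram (chartAt (EuclideanSpace ℝ (Fin n)) p)) (inChart n p f)
    (chartAt (EuclideanSpace ℝ (Fin n)) p p)

variable (n) in
/-- `|∇²f|²`. -/
def hessSq (f : M → EuclideanSpace ℝ (Fin L)) (p : M) : ℝ :=
  hessSqCoord (gram (chartAt (EuclideanSpace ℝ (Fin n)) p)) (inChart n p f)
    (chartAt (EuclideanSpace ℝ (Fin n)) p p)

variable (n) in
/-- `div (e₂(f)^{n/2-1} df)`. -/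
def nLaplace (ε : ℝ) (f : M → EuclideanSpace ℝ (Fin L)) (p : M) : EuclideanSpace ℝ (Fin L) :=
  nLaplaceCoord ε (gram (chartAt (EuclideanSpace ℝ (Fin n)) p)) (inChart n p f)
    (chartAt (EuclideanSpace ℝ (Fin n)) p p)

variable (n) in
/-- `A(f)(df, df) = g^{ij} A(f)(∂_i f, ∂_j f)`. -/
def secondFFTrace (N : Set (EuclideanSpace ℝ (Fin L))) (f : M → EuclideanSpace ℝ (Fin L)) (p : M) :
    EuclideanSpace ℝ (Fin L) :=
  ∑ i, ∑ j, (gram (chartAt (EuclideanSpace ℝ (Fin n)) p)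
      (chartAt (EuclideanSpace ℝ (Fin n)) p p))⁻¹ i j •
    secondFF N (f p) (pd i (inChart n p f) (chartAt (EuclideanSpace ℝ (Fin n)) p p))
      (pd j (inChart n p f) (chartAt (EuclideanSpace ℝ (Fin n)) p p))

/-- The time derivative (one-sided at the initial time `0`). -/
def timeDeriv {W : Type*} [NormedAddCommGroup W] [NormedSpace ℝ W] {M : Type*} (f : ℝ → M → W)
    (t : ℝ) (p : M) : W :=
  derivWithin (fun s => f s p) (Ici 0) t

variable (n) in
/-- The regularized `n`-energy `E^ε(f) = (1/n) ∫_M (ε + |df|²)^{n/2} dvol`. -/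
def nEnergy [MeasurableSpace M] (ε : ℝ) (f : M → EuclideanSpace ℝ (Fin L)) : ℝ :=
  1 / (n : ℝ) * ∫ p, e2 n ε f p ^ ((n : ℝ) / 2) ∂riemVol n M

variable (n) in
/-- `(f, u)` is a smooth solution, with values in `N` and with `u(0) = 0`, of the regularized
`n`-conformal heat flow
`f_t = e^{-nu} (div (e₂(f)^{n/2-1} df) + e₂(f)^{n/2-1} A(f)(df, df))`,
`u_t = b e^{-nu} e₂(f)^{n/2} - a` on `M × [0, T)`. -/
structure IsRegularizedCHF (N : Set (EuclideanSpace ℝ (Fin L))) (ε a b T : ℝ)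
    (f : ℝ → M → EuclideanSpace ℝ (Fin L)) (u : ℝ → M → ℝ) : Prop where
  smooth_f : ContMDiffOn (𝓘(ℝ, ℝ).prod (𝓡 n)) 𝓘(ℝ, EuclideanSpace ℝ (Fin L)) ∞
    (fun q : ℝ × M => f q.1 q.2) (Ico 0 T ×ˢ univ)
  smooth_u : ContMDiffOn (𝓘(ℝ, ℝ).prod (𝓡 n)) 𝓘(ℝ, ℝ) ∞
    (fun q : ℝ × M => u q.1 q.2) (Ico 0 T ×ˢ univ)
  mem : ∀ t ∈ Ico 0 T, ∀ p, f t p ∈ N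
  map_eq : ∀ t ∈ Ico 0 T, ∀ p, timeDeriv f t p = Real.exp (-(n * u t p)) •
    (nLaplace n ε (f t) p + e2 n ε (f t) p ^ ((n : ℝ) / 2 - 1) • secondFFTrace n N (f t) p)
  conf_eq : ∀ t ∈ Ico 0 T, ∀ p, timeDeriv u t p =
    b * Real.exp (-(n * u t p)) * e2 n ε (f t) p ^ ((n : ℝ) / 2) - a
  init : ∀ p, u 0 p = 0

end Domain

end

noncomputable section

namespace CHF

open Filter Topology Metric
open EuclideanSpace (single)
open WithLp (toLp)
open ENNReal (ofReal ofReal_rpow_of_nonneg ofReal_mul ofReal_le_ofReal)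
open ContinuousLinearMap (comp_apply smulRight_apply coe_snd')
open Matrix (nonsing_inv_mul mul_nonsing_inv)
open Finset (sum_nonneg sum_le_sum sum_mul sum_add_distrib smul_sum sum_comm sum_congr
  sum_sub_distrib mul_sum sum_const sum_eq_zero sum_smul)
open Real (sqrt_zero sqrt_pos sq_sqrt norm_eq_abs rpow_natCast rpow_mul
  norm_of_nonneg rpow_nonneg sqrt_eq_rpow mul_self_sqrt sqrt_nonneg exp exp_pos)
open scoped NNReal ENNReal

/-- Square matrices. -/
abbrev Mat (n : ℕ) := Matrix (Fin n) (Fin n) ℝ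

/-- Coordinate space. -/
abbrev Eu (n : ℕ) := EuclideanSpace ℝ (Fin n)

/-- Charts with values in `Eu n`. -/
abbrev Chart (n : ℕ) (M : Type*) [TopologicalSpace M] := OpenPartialHomeomorph M (Eu n)

local notation "𝔹" => ball (0 : Eu _)
local notation "𝔻" => closedBall (0 : Eu _)
local notation "𝕋" n:max M:max => fun p : M => TangentSpace (𝓡 n) p

variable {n L : ℕ} {V : Type*} [NormedAddCommGroup V] [NormedSpace ℝ V] {W : Type*}
  [NormedAddCommGroup W] [InnerProductSpace ℝ W]

/-! ### Powers of a degenerate weight -/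

section PowSmul

variable {P H : Type*} [NormedAddCommGroup P] [NormedSpace ℝ P] [NormedAddCommGroup H]
  [NormedSpace ℝ H]

/-- The derivative of `√w ^ c • X` when `‖X‖² ≤ C w`, also where `w` vanishes. -/
lemma hasFDerivAt_sqrt_pow_smul (c : ℕ) {w : P → ℝ} {X : P → H} {p : P} {C : ℝ} (hw0 : ∀ z, 0 ≤ w z)
    (hX : ∀ z, ‖X z‖ ^ 2 ≤ C * w z) {w' : P →L[ℝ] ℝ} {X' : P →L[ℝ] H} (hw : HasFDerivAt w w' p)
    (hX' : HasFDerivAt X X' p) : HasFDerivAt (fun z => √(w z) ^ c • X z)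
      (√(w p) ^ c • X' + (((c : ℝ) / 2 * √(w p) ^ c / w p) • w').smulRight (X p)) p := by
  rcases (hw0 p).eq_or_lt with h0 | hpos
  · have hXp : X p = 0 := by
      have := hX p
      rw [← h0, mul_zero] at this
      simpa using le_antisymm this (by positivity)
    rcases Nat.eq_zero_or_pos c with rfl | hc
    · simpa [hXp] using hX'
    · rw [hXp, ← h0]
      simp only [sqrt_zero, zero_pow hc.ne', zero_smul, ContinuousLinearMap.smulRight_zero,
        add_zero]
      rw [hasFDerivAt_iff_isLittleO]
      simp only [hXp, smul_zero, sub_zero, zero_apply]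
      have h1 : (fun z => √(w z) ^ c) =o[𝓝 p] (fun _ => (1 : ℝ)) := by
        rw [Asymptotics.isLittleO_one_iff]
        have : ContinuousAt (fun z => √(w z) ^ c) p := (hw.continuousAt.sqrt).pow c
        simpa [ContinuousAt, ← h0, zero_pow hc.ne'] using this
      have h2 : X =O[𝓝 p] (fun z => z - p) := by
        simpa [hXp] using hX'.isBigO_sub
      simpa using h1.smul_isBigO h2
  · have h1 := (hw.sqrt hpos.ne').pow c
    have h2 := h1.smul hX'
    refine HasFDerivAt.congr_fderiv (f := fun z => √(w z) ^ c • X z) h2 ?_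
    ext z
    simp only [_root_.add_apply, _root_.smul_apply, smulRight_apply, smul_eq_mul]
    congr 2
    rcases Nat.eq_zero_or_pos c with rfl | hc
    · simp
    · have hs : 0 < √(w p) := sqrt_pos.2 hpos
      obtain ⟨k, rfl⟩ : ∃ k, c = k + 1 := ⟨c - 1, by omega⟩
      simp only [Nat.add_sub_cancel, nsmul_eq_mul]
      have hdiv : √(w p) ^ (k + 1) / w p = √(w p) ^ k / √(w p) := by
        rw [div_eq_div_iff hpos.ne' hs.ne']
        calc √(w p) ^ (k + 1) * √(w p) = √(w p) ^ k * √(w p) ^ 2 := by ring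
          _ = _ := by rw [sq_sqrt hpos.le]
      rw [mul_div_assoc, hdiv]
      field_simp

lemma fderiv_sqrt_pow_smul (c : ℕ) {w : P → ℝ} {X : P → H} {C : ℝ} (hw0 : ∀ z, 0 ≤ w z)
    (hX : ∀ z, ‖X z‖ ^ 2 ≤ C * w z) (p : P) (hw : DifferentiableAt ℝ w p)
    (hX' : DifferentiableAt ℝ X p) (u : P) : fderiv ℝ (fun z => √(w z) ^ c • X z) p u
      = √(w p) ^ c • fderiv ℝ X p u + ((c : ℝ) / 2 * √(w p) ^ c / w p * fderiv ℝ w p u) • X p := by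
  rw [(hasFDerivAt_sqrt_pow_smul c hw0 hX hw.hasFDerivAt hX'.hasFDerivAt).fderiv]
  simp

lemma contDiff_sqrt_pow_smul (c : ℕ) {w : P → ℝ} {X : P → H} {C : ℝ} (hw0 : ∀ z, 0 ≤ w z)
    (hX : ∀ z, ‖X z‖ ^ 2 ≤ C * w z) (hw : ContDiff ℝ 1 w) (hX' : ContDiff ℝ 1 X) :
    ContDiff ℝ 1 (fun z => √(w z) ^ c • X z) := by
  have hwd : Differentiable ℝ w := hw.differentiable one_ne_zero
  have hXd : Differentiable ℝ X := hX'.differentiable one_ne_zero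
  have hF := fun p => hasFDerivAt_sqrt_pow_smul c hw0 hX (hwd p).hasFDerivAt (hXd p).hasFDerivAt
  rw [contDiff_one_iff_fderiv]
  refine ⟨fun p => (hF p).differentiableAt, ?_⟩
  rw [show fderiv ℝ (fun z => √(w z) ^ c • X z) = _ from funext fun p => (hF p).fderiv]
  have hw'c : Continuous (fderiv ℝ w) := hw.continuous_fderiv one_ne_zero
  have hX'c : Continuous (fderiv ℝ X) := hX'.continuous_fderiv one_ne_zero
  have hwc : Continuous w := hw.continuous
  have hXc : Continuous X := hX'.continuous
  refine Continuous.add (by fun_prop) ?_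
  rcases Nat.eq_zero_or_pos c with rfl | hc
  · simpa using continuous_const
  rw [continuous_iff_continuousAt]
  intro p
  rcases (hw0 p).eq_or_lt with h0 | hpos
  · have hXp : X p = 0 := by
      have := hX p
      rw [← h0, mul_zero] at this
      simpa using le_antisymm this (by positivity)
    have hC : ∀ z, ‖X z‖ ≤ √C * √(w z) := by
      intro z
      rcases le_or_gt 0 C with hC | hC
      · rw [← Real.sqrt_mul hC]
        exact Real.le_sqrt_of_sq_le (hX z)
      · have h1 := hX z
        have h2 := hw0 z
        have : ‖X z‖ = 0 := by nlinarith [norm_nonneg (X z)]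
        rw [this]; positivity
    have hw'p : fderiv ℝ w p = 0 := by
      apply IsLocalMin.fderiv_eq_zero
      filter_upwards with z
      rw [← h0]; exact hw0 z
    rw [ContinuousAt, hXp, ContinuousLinearMap.smulRight_zero, tendsto_zero_iff_norm_tendsto_zero]
    refine squeeze_zero (g := fun z => (c : ℝ) / 2 * √(w z) ^ (c - 1) * √C * ‖fderiv ℝ w z‖)
      (fun _ => norm_nonneg _) (fun z => ?_) ?_
    · rw [ContinuousLinearMap.norm_smulRight_apply, norm_smul, norm_eq_abs,
        abs_of_nonneg (by have := hw0 z; positivity)]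
      rcases (hw0 z).eq_or_lt with h0 | hpos
      · simp [← h0]; positivity
      · have hs : 0 < √(w z) := sqrt_pos.2 hpos
        obtain ⟨k, rfl⟩ : ∃ k, c = k + 1 := ⟨c - 1, by omega⟩
        calc _ ≤ (↑(k + 1) / 2 * √(w z) ^ (k + 1) / w z * ‖fderiv ℝ w z‖) * (√C * √(w z)) := by
              gcongr; exact hC z
          _ = _ := by
              simp only [Nat.add_sub_cancel]
              have hw2 : w z = √(w z) ^ 2 := (sq_sqrt hpos.le).symm
              conv_lhs => rw [show ∀ x : ℝ, x / w z = x / √(w z) ^ 2 from fun x => by rw [← hw2]]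
              field_simp
              ring
    · have : Continuous (fun z => (c : ℝ) / 2 * √(w z) ^ (c - 1) * √C * ‖fderiv ℝ w z‖) := by
        fun_prop
      simpa [hw'p] using this.tendsto p
  · have : ContinuousAt (fun z => (c : ℝ) / 2 * √(w z) ^ c / w z) p :=
      ContinuousAt.div (by fun_prop) hwc.continuousAt hpos.ne'
    have h2 : Continuous fun q : (P →L[ℝ] ℝ) × H => q.1.smulRight q.2 := by fun_prop
    exact h2.continuousAt.comp ((this.smul hw'c.continuousAt).prodMk hXc.continuousAt)

end PowSmul

/-! ### Integrals of compactly supported functions -/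

section Integrals

variable {E : Type*} [NormedAddCommGroup E] [InnerProductSpace ℝ E] [FiniteDimensional ℝ E]
  [MeasurableSpace E] [BorelSpace E]

/-- `h` vanishes outside the closed ball of radius `s`. -/
def SuppIn {V : Type*} [Zero V] (s : ℝ) (h : E → V) : Prop :=
  ∀ x, x ∉ closedBall (0 : E) s → h x = 0

lemma SuppIn.integrable {s : ℝ} {h : E → V}
    (hs : SuppIn s h) (hc : Continuous h := by fun_prop) : Integrable h :=
  hc.integrable_of_hasCompactSupport (HasCompactSupport.intro (isCompact_closedBall 0 s) hs)

lemma SuppIn.integrable_of {V' : Type*} [Zero V'] {s : ℝ} {f : E → V'} {h : E → V} (hf : SuppIn s f)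
    (hh : ∀ x, f x = 0 → h x = 0 := by intro x hx; simp [hx])
    (hc : Continuous h := by fun_prop) : Integrable h :=
  SuppIn.integrable (fun x hx => hh x (hf x hx)) hc

lemma SuppIn.fderiv {s : ℝ} {h : E → V}
    (hs : SuppIn s h) (v : E) : SuppIn s (fun x => fderiv ℝ h x v) := by
  intro x hx
  have : h =ᶠ[𝓝 x] fun _ => 0 := by
    filter_upwards [isClosed_closedBall.isOpen_compl.mem_nhds hx] with y hy using hs y hy
  simp [this.fderiv_eq]

lemma integral_fderiv_eq_zero {s : ℝ} {h : E → ℝ} (hs : SuppIn s h) (hc : ContDiff ℝ 1 h) (v : E) :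
    ∫ x, fderiv ℝ h x v = 0 := by
  have hc' : Continuous fun x => fderiv ℝ h x v := (hc.continuous_fderiv one_ne_zero).clm_apply continuous_const
  have := integral_mul_fderiv_eq_neg_fderiv_mul_of_integrable (μ := (volume : Measure E))
    (f := fun _ => (1 : ℝ)) (g := h) (v := v) (by simp)
    (by simpa using (hs.fderiv v).integrable hc')
    (by simpa using hs.integrable hc.continuous) (fun _ _ => by fun_prop)
    (fun x _ => hc.differentiable one_ne_zero x)
  simpa using this

lemma continuous_integral {s : ℝ} {φ : ℝ × E → ℝ} (hφ : Continuous φ)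
    (hs : ∀ t, SuppIn s fun x => φ (t, x)) : Continuous fun t => ∫ x, φ (t, x) := by
  rw [← continuousOn_univ]
  exact continuousOn_integral_of_compact_support (f := fun t x => φ (t, x))
    (isCompact_closedBall (0 : E) s) (hφ.continuousOn) (fun t x _ hx => hs t x hx)

lemma hasDerivAt_integral_inner {s : ℝ} {c d : ℝ × E → W} (hc : Continuous c) (hd : ContDiff ℝ 1 d)
    (hs : ∀ t, SuppIn s fun x => c (t, x)) (t : ℝ) (h0 : ∀ x, d (t, x) = 0) :
    HasDerivAt (fun r => ∫ x, inner ℝ (c (r, x)) (d (r, x)))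
      (∫ x, inner ℝ (c (t, x)) (fderiv ℝ d (t, x) (1, 0))) t := by
  have hd' : Continuous (fderiv ℝ d) := hd.continuous_fderiv one_ne_zero
  have hdc := hd.continuous
  set K : Set (ℝ × E) := Icc (t - 1) (t + 1) ×ˢ closedBall (0 : E) s
  have hK : IsCompact K := isCompact_Icc.prod (isCompact_closedBall _ _)
  obtain ⟨C1, hC1⟩ := hK.exists_bound_of_continuousOn hc.continuousOn
  obtain ⟨C2, hC2⟩ := hK.exists_bound_of_continuousOn (f := fderiv ℝ d) (by exact hd'.continuousOn)
  have hC2' : ∀ r ∈ Icc (t - 1) (t + 1), ∀ x ∈ closedBall (0 : E) s, ‖d (r, x)‖ ≤ C2 * ‖r - t‖ := by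
    intro r hr x hx
    have hconv : Convex ℝ K := (convex_Icc _ _).prod (convex_closedBall _ _)
    have := hconv.norm_image_sub_le_of_norm_fderiv_le (f := d)
      (fun y _ => hd.differentiable one_ne_zero y) hC2
      (show (t, x) ∈ K from ⟨by simp, hx⟩) (show (r, x) ∈ K from ⟨hr, hx⟩)
    rw [h0 x, sub_zero] at this
    refine this.trans_eq ?_
    congr 1
    simp [Prod.norm_def]
  have hdiff : ∀ x, HasDerivAt (fun r => d (r, x)) (fderiv ℝ d (t, x) (1, 0)) t := by
    intro x
    have h1 : HasDerivAt (fun r : ℝ => (r, x)) ((1 : ℝ), (0 : E)) t :=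
      (hasDerivAt_id t).prodMk (hasDerivAt_const t x)
    exact (hd.differentiable one_ne_zero (t, x)).hasFDerivAt.comp_hasDerivAt t h1
  have hin : ∀ r, SuppIn s fun x => (inner ℝ (c (r, x)) (d (r, x)) : ℝ) := fun r x hx => by
    simp [show c (r, x) = 0 from hs r x hx]
  have hder : ∀ x, HasDerivAt (fun r => (inner ℝ (c (r, x)) (d (r, x)) : ℝ))
      (inner ℝ (c (t, x)) (fderiv ℝ d (t, x) (1, 0))) t := by
    intro x
    have hcx : ContinuousAt (fun r => c (r, x)) t := by fun_prop
    rw [hasDerivAt_iff_isLittleO]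
    have h2 := (hdiff x).isBigO_sub
    have h1 : (fun r => c (r, x) - c (t, x)) =o[𝓝 t] (fun _ => (1 : ℝ)) := by
      rw [Asymptotics.isLittleO_one_iff]
      have := (hcx.sub (continuousAt_const (y := c (t, x)))).tendsto
      simpa [Pi.sub_def] using this
    have h3 := (hasDerivAt_iff_isLittleO).1 (hdiff x)
    simp only [h0 x, sub_zero, inner_zero_right] at h2 h3 ⊢
    have e : (fun r => (inner ℝ (c (r, x)) (d (r, x)) : ℝ)
          - (r - t) • (inner ℝ (c (t, x)) (fderiv ℝ d (t, x) (1, 0)) : ℝ))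
        = (fun r => (inner ℝ (c (r, x) - c (t, x)) (d (r, x)) : ℝ)
          + inner ℝ (c (t, x)) (d (r, x) - (r - t) • fderiv ℝ d (t, x) (1, 0))) := by
      funext r
      rw [inner_sub_left, inner_sub_right, inner_smul_right, smul_eq_mul]; ring
    rw [e]
    refine Asymptotics.IsLittleO.add ?_ ?_
    · have := h1.norm_left.mul_isBigO h2.norm_norm
      refine Asymptotics.IsBigO.trans_isLittleO ?_ (this.trans_isBigO ?_)
      · refine Asymptotics.IsBigO.of_bound 1 ?_
        filter_upwards with r
        simpa using abs_real_inner_le_norm (c (r, x) - c (t, x)) (d (r, x))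
      · refine Asymptotics.IsBigO.of_bound 1 ?_
        filter_upwards with r
        simp
    · refine Asymptotics.IsBigO.trans_isLittleO ?_ h3
      refine Asymptotics.IsBigO.of_bound ‖c (t, x)‖ ?_
      filter_upwards with r
      exact abs_real_inner_le_norm _ _
  have key := hasFDerivAt_integral_of_dominated_loc_of_lip' (𝕜 := ℝ) (μ := (volume : Measure E))
    (F := fun r x => (inner ℝ (c (r, x)) (d (r, x)) : ℝ))
    (F' := fun x => ContinuousLinearMap.toSpanSingleton ℝ
      (inner ℝ (c (t, x)) (fderiv ℝ d (t, x) (1, 0)) : ℝ)) (x₀ := t)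
    (s := Icc (t - 1) (t + 1)) (bound := (closedBall (0 : E) s).indicator fun _ => C1 * C2)
    (Icc_mem_nhds (by linarith) (by linarith)) (fun r _ => (by fun_prop : Continuous fun x =>
      (inner ℝ (c (r, x)) (d (r, x)) : ℝ)).aestronglyMeasurable) ((hin t).integrable (by fun_prop))
    (by
      refine Continuous.aestronglyMeasurable ?_
      have : Continuous fun x => (inner ℝ (c (t, x)) (fderiv ℝ d (t, x) (1, 0)) : ℝ) := by fun_prop
      exact (ContinuousLinearMap.toSpanSingletonCLE (𝕜 := ℝ) (E := ℝ)).continuous.comp this)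
    (by
      filter_upwards with x r hr
      by_cases hx : x ∈ closedBall (0 : E) s
      · rw [indicator_of_mem hx, h0 x, inner_zero_right, sub_zero]
        calc _ ≤ ‖c (r, x)‖ * ‖d (r, x)‖ := norm_inner_le_norm _ _
          _ ≤ C1 * (C2 * ‖r - t‖) := by
            gcongr
            · exact (norm_nonneg _).trans (hC1 (r, x) ⟨hr, hx⟩)
            · exact hC1 (r, x) ⟨hr, hx⟩
            · exact hC2' r hr x hx
          _ = _ := by ring
      · rw [indicator_of_notMem hx, show (inner ℝ (c (r, x)) (d (r, x)) : ℝ) = 0 from hin r x hx,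
          show (inner ℝ (c (t, x)) (d (t, x)) : ℝ) = 0 from hin t x hx]
        simp)
    ((integrable_indicator_iff measurableSet_closedBall).2
      (integrableOn_const (isCompact_closedBall (0 : E) s).measure_ne_top))
    (by
      filter_upwards with x
      exact (hder x).hasFDerivAt)
  have h4 := key.2.hasDerivAt
  have hint : Integrable fun x => (inner ℝ (c (t, x)) (fderiv ℝ d (t, x) (1, 0)) : ℝ) := by
    refine SuppIn.integrable (s := s) fun x hx => ?_
    rw [show c (t, x) = 0 from hs t x hx, inner_zero_left]
  rw [ContinuousLinearMap.integral_apply key.1] at h4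
  simpa using h4

lemma hasDerivAt_integral {s : ℝ} {φ : ℝ × E → ℝ} (hφ : ContDiff ℝ 1 φ)
    (hs : ∀ t, SuppIn s fun x => φ (t, x)) (t : ℝ) :
    HasDerivAt (fun r => ∫ x, φ (r, x)) (∫ x, fderiv ℝ φ (t, x) (1, 0)) t := by
  let b : ContDiffBump (0 : E) := ⟨max s 0 + 1, max s 0 + 2, by positivity, by linarith⟩
  have hb1 : ∀ x ∈ closedBall (0 : E) s, b x = 1 := fun x hx =>
    b.one_of_mem_closedBall (closedBall_subset_closedBall
      (by show s ≤ max s 0 + 1; linarith [le_max_left s 0]) hx)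
  have hb : ∀ _ : ℝ, SuppIn (max s 0 + 2) fun x => b x := fun _ x hx =>
    b.zero_of_le_dist (by simpa using le_of_lt (by simpa using hx))
  have h1 := hasDerivAt_integral_inner (W := ℝ) (s := max s 0 + 2) (c := fun p => b p.2)
    (d := fun p => φ p - φ (t, p.2)) (b.continuous.comp continuous_snd)
    (hφ.sub (hφ.comp (contDiff_const.prodMk contDiff_snd))) hb t (by simp)
  have hcp := hφ.continuous
  have h2 : ∀ r, ∫ x, (inner ℝ (b x) (φ (r, x) - φ (t, x)) : ℝ)
      = (∫ x, φ (r, x)) - ∫ x, φ (t, x) := by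
    intro r
    rw [← integral_sub ((hs r).integrable (by fun_prop)) ((hs t).integrable (by fun_prop))]
    congr 1; funext x
    by_cases hx : x ∈ closedBall (0 : E) s
    · simp [hb1 x hx]
    · rw [show φ (r, x) = 0 from hs r x hx, show φ (t, x) = 0 from hs t x hx]; simp
  have h3 : ∫ x, (inner ℝ (b x) (fderiv ℝ (fun p : ℝ × E => φ p - φ (t, p.2)) (t, x) (1, 0)) : ℝ)
      = ∫ x, fderiv ℝ φ (t, x) (1, 0) := by
    congr 1; funext x
    have hd := hφ.differentiable one_ne_zero
    have e : fderiv ℝ (fun p : ℝ × E => φ p - φ (t, p.2)) (t, x) (1, 0)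
        = fderiv ℝ φ (t, x) (1, 0) := by
      have hA := (hd (t, x)).hasFDerivAt
      have hB : HasFDerivAt (fun p : ℝ × E => φ (t, p.2))
          ((fderiv ℝ φ (t, x)).comp ((0 : (ℝ × E) →L[ℝ] ℝ).prod (ContinuousLinearMap.snd ℝ ℝ E)))
          (t, x) := HasFDerivAt.comp (t, x) (hd (t, x)).hasFDerivAt
          ((hasFDerivAt_const t (t, x)).prodMk hasFDerivAt_snd)
      have h := (hA.sub hB).fderiv
      erw [h]
      simp [← Prod.zero_eq_mk]
    rw [e]
    by_cases hx : x ∈ closedBall (0 : E) s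
    · simp [hb1 x hx]
    · have : (fun r => φ (r, x)) = fun _ => 0 := by
        funext r; exact hs r x hx
      have h5 : HasDerivAt (fun r => φ (r, x)) (fderiv ℝ φ (t, x) (1, 0)) t :=
        (hd (t, x)).hasFDerivAt.comp_hasDerivAt t ((hasDerivAt_id t).prodMk (hasDerivAt_const t x))
      rw [this] at h5
      rw [h5.unique (hasDerivAt_const t 0)]; simp
  simp only [h2, h3] at h1
  simpa using h1.add_const (∫ x, φ (t, x))

/-- Mixed second derivatives may be exchanged in a weak sense. -/
lemma integral_inner_fderiv_comm {s : ℝ} {f g : E → W} (hf : ContDiff ℝ 1 f) (hg : ContDiff ℝ 1 g)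
    (hfs : SuppIn s f) (hgs : SuppIn s g) (u v : E) :
    ∫ x, (inner ℝ (fderiv ℝ f x u) (fderiv ℝ g x v) : ℝ)
      = ∫ x, inner ℝ (fderiv ℝ f x v) (fderiv ℝ g x u) := by
  have hf' : Continuous (fderiv ℝ f) := hf.continuous_fderiv one_ne_zero
  have hg' : Continuous (fderiv ℝ g) := hg.continuous_fderiv one_ne_zero
  have hfd := hf.differentiable one_ne_zero
  have hgd := hg.differentiable one_ne_zero
  have hfc := hf.continuous
  have hgc := hg.continuous
  have step : ∀ r : ℝ, ∫ x, (inner ℝ (fderiv ℝ f x u) (g (x + r • v)) : ℝ)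
      = - ∫ x, inner ℝ (f (x - r • v)) (fderiv ℝ g x u) := by
    intro r
    have h1 : ∫ x, (inner ℝ (f (x - r • v)) (fderiv ℝ g x u) : ℝ)
        = ∫ x, inner ℝ (f x) (fderiv ℝ g (x + r • v) u) := by
      rw [← integral_add_right_eq_self _ (r • v)]
      simp
    rw [h1, eq_neg_iff_add_eq_zero, ← integral_add]
    · have h2 : SuppIn s fun x => (inner ℝ (f x) (g (x + r • v)) : ℝ) := fun x hx => by
        simp [hfs x hx]
      have hcd : ContDiff ℝ 1 fun x => (inner ℝ (f x) (g (x + r • v)) : ℝ) :=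
        hf.inner ℝ (hg.comp (contDiff_id.add contDiff_const))
      rw [← integral_fderiv_eq_zero h2 hcd u]
      congr 1; funext x
      have hG : HasFDerivAt (fun x => g (x + r • v)) (fderiv ℝ g (x + r • v)) x := by
        exact (hgd (x + r • v)).hasFDerivAt.comp x ((hasFDerivAt_id x).add_const (r • v))
      rw [(((hfd x).hasFDerivAt).inner ℝ hG).fderiv]
      simp [add_comm]
    · refine SuppIn.integrable (s := s) fun x hx => ?_
      simp [show fderiv ℝ f x u = 0 from hfs.fderiv u x hx]
    · refine SuppIn.integrable (s := s) fun x hx => ?_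
      rw [hfs x hx, inner_zero_left]
  have D1 := hasDerivAt_integral_inner (s := s) (c := fun p : ℝ × E => fderiv ℝ f p.2 u)
    (d := fun p => g (p.2 + p.1 • v) - g p.2) (by fun_prop)
    ((hg.comp (contDiff_snd.add (contDiff_fst.smul contDiff_const))).sub (hg.comp contDiff_snd))
    (fun _ => hfs.fderiv u) 0 (by simp)
  have D2 := hasDerivAt_integral_inner (s := s) (c := fun p : ℝ × E => fderiv ℝ g p.2 u)
    (d := fun p => f (p.2 - p.1 • v) - f p.2) (by fun_prop)
    ((hf.comp (contDiff_snd.sub (contDiff_fst.smul contDiff_const))).sub (hf.comp contDiff_snd))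
    (fun _ => hgs.fderiv u) 0 (by simp)
  have e1 : ∀ x, fderiv ℝ (fun p : ℝ × E => g (p.2 + p.1 • v) - g p.2) (0, x) (1, 0)
      = fderiv ℝ g x v := by
    intro x
    have hA : HasFDerivAt (fun p : ℝ × E => p.2 + p.1 • v) (ContinuousLinearMap.snd ℝ ℝ E +
      (ContinuousLinearMap.fst ℝ ℝ E).smulRight v) (0, x) :=
      hasFDerivAt_snd.add (hasFDerivAt_fst.smul_const v)
    have hB := (hgd ((0, x) : ℝ × E).2).hasFDerivAt.comp ((0, x) : ℝ × E) (hasFDerivAt_snd (𝕜 := ℝ))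
    have hC := HasFDerivAt.comp (g := g) ((0, x) : ℝ × E) (hgd _).hasFDerivAt hA
    have h := (hC.sub hB).fderiv
    erw [h]
    simp
  have e2 : ∀ x, fderiv ℝ (fun p : ℝ × E => f (p.2 - p.1 • v) - f p.2) (0, x) (1, 0)
      = - fderiv ℝ f x v := by
    intro x
    have hA : HasFDerivAt (fun p : ℝ × E => p.2 - p.1 • v) (ContinuousLinearMap.snd ℝ ℝ E -
      (ContinuousLinearMap.fst ℝ ℝ E).smulRight v) (0, x) :=
      hasFDerivAt_snd.sub (hasFDerivAt_fst.smul_const v)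
    have hB := (hfd ((0, x) : ℝ × E).2).hasFDerivAt.comp ((0, x) : ℝ × E) (hasFDerivAt_snd (𝕜 := ℝ))
    have hC := HasFDerivAt.comp (g := f) ((0, x) : ℝ × E) (hfd _).hasFDerivAt hA
    have h := (hC.sub hB).fderiv
    erw [h]
    simp
  simp only [e1, e2] at D1 D2
  have i1 : Integrable fun x => (inner ℝ (fderiv ℝ f x u) (g x) : ℝ) :=
    SuppIn.integrable (s := s) fun x hx => by rw [hgs x hx, inner_zero_right]
  have i2 : Integrable fun x => (inner ℝ (fderiv ℝ g x u) (f x) : ℝ) :=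
    SuppIn.integrable (s := s) fun x hx => by rw [hfs x hx, inner_zero_right]
  have key : ∀ r : ℝ, ∫ x, (inner ℝ (fderiv ℝ f x u) (g (x + r • v) - g x) : ℝ)
      = - ∫ x, inner ℝ (fderiv ℝ g x u) (f (x - r • v) - f x) := by
    intro r
    simp only [inner_sub_right]
    rw [integral_sub _ i1, integral_sub _ i2, step r]
    · have := step 0
      simp only [zero_smul, add_zero, sub_zero] at this
      simp only [real_inner_comm (fderiv ℝ g _ u)] at this ⊢
      rw [this]; ring
    · refine SuppIn.integrable (s := s) fun x hx => ?_
      simp [show fderiv ℝ g x u = 0 from hgs.fderiv u x hx]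
    · refine SuppIn.integrable (s := s) fun x hx => ?_
      simp [show fderiv ℝ f x u = 0 from hfs.fderiv u x hx]
  simp only [key] at D1
  have := D1.unique D2.neg
  rw [this]
  simp only [inner_neg_right, integral_neg, neg_neg]
  congr 1; funext x; rw [real_inner_comm]

end Integrals

/-! ### A Sobolev inequality -/

lemma norm_fderiv_le_sum {n : ℕ}
    (g : EuclideanSpace ℝ (Fin n) → V) (x : EuclideanSpace ℝ (Fin n)) :
    ‖fderiv ℝ g x‖ ≤ ∑ i, ‖pd i g x‖ := by
  refine ContinuousLinearMap.opNorm_le_bound _ (sum_nonneg fun _ _ => norm_nonneg _) fun y => ?_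
  have hy : y = ∑ i, y i • single i (1 : ℝ) := by
    have := (EuclideanSpace.basisFun (Fin n) ℝ).sum_repr y
    simpa using this.symm
  calc ‖fderiv ℝ g x y‖ = ‖∑ i, y i • pd i g x‖ := by
        conv_lhs => rw [hy]
        rw [map_sum]
        simp only [map_smul, pd]
    _ ≤ ∑ i, ‖y i • pd i g x‖ := norm_sum_le _ _
    _ ≤ ∑ i, ‖pd i g x‖ * ‖y‖ := by
        refine sum_le_sum fun i _ => ?_
        rw [norm_smul, mul_comm]
        gcongr
        exact PiLp.norm_apply_le y i
    _ = _ := by rw [sum_mul]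

lemma exists_sobolev_const (n : ℕ) (hn : 2 ≤ n) : ∃ C : ℝ, 0 ≤ C ∧
    ∀ (s : ℝ) (g A B : EuclideanSpace ℝ (Fin n) → ℝ), ContDiff ℝ 1 g → SuppIn s g →
      (∀ x, 0 ≤ A x) → (∀ x, 0 ≤ B x) → Measurable A → Measurable B →
      Integrable (fun x => A x ^ 2) → Integrable (fun x => B x ^ n) →
      (∀ x, ‖fderiv ℝ g x‖ ≤ A x * B x) →
      ∫ x, g x ^ 2 ≤ C * (∫ x, A x ^ 2) * (∫ x, B x ^ n) ^ (2 / (n : ℝ)) := by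
  have hn0 : (0 : ℝ) < n := by positivity
  have hn2 : (2 : ℝ) ≤ n := by exact_mod_cast hn
  set p : ℝ≥0 := ⟨2 * n / (n + 2), by positivity⟩ with hp
  have hpv : (p : ℝ) = 2 * n / (n + 2) := rfl
  have hp1 : (1 : ℝ) ≤ p := by rw [hpv, le_div_iff₀ (by positivity)]; linarith
  have hp0 : (0 : ℝ) < p := by linarith
  set K : ℝ≥0 := eLpNormLESNormFDerivOfEqInnerConst (volume : Measure (EuclideanSpace ℝ (Fin n))) p
  refine ⟨(K : ℝ) ^ 2, by positivity, ?_⟩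
  intro s g A B hg hgs hA0 hB0 hA hB hAi hBi hle
  have hsob := eLpNorm_le_eLpNorm_fderiv_of_eq_inner
    (volume : Measure (EuclideanSpace ℝ (Fin n))) (p' := 2) hg
    (HasCompactSupport.intro (isCompact_closedBall 0 s) hgs) (p := p) (by exact_mod_cast hp1)
    (by simp; omega) (by
      rw [NNReal.coe_inv, hpv]; simp; field_simp; ring)
  have hIA : ∫⁻ x, ofReal (A x ^ 2) = ofReal (∫ x, A x ^ 2) :=
    (ofReal_integral_eq_lintegral_ofReal hAi (ae_of_all _ fun x => by positivity)).symm
  have hIB : ∫⁻ x, ofReal (B x ^ n) = ofReal (∫ x, B x ^ n) :=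
    (ofReal_integral_eq_lintegral_ofReal hBi (ae_of_all _ fun x => pow_nonneg (hB0 x) n)).symm
  have hgi : Integrable fun x => g x ^ 2 :=
    SuppIn.integrable (s := s) (fun x hx => by simp [hgs x hx]) (hg.continuous.pow 2)
  have hIg : ∫⁻ x, ‖g x‖ₑ ^ (2 : ℝ) = ofReal (∫ x, g x ^ 2) := by
    rw [ofReal_integral_eq_lintegral_ofReal hgi (ae_of_all _ fun x => by positivity)]
    congr 1; funext x
    rw [← ofReal_norm, ofReal_rpow_of_nonneg (norm_nonneg _) (by norm_num)]
    congr 1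
    simp
  have hJ : ∫⁻ x, ‖fderiv ℝ g x‖ₑ ^ (p : ℝ) ≤ ofReal (∫ x, A x ^ 2) ^ ((p : ℝ) / 2)
        * ofReal (∫ x, B x ^ n) ^ ((p : ℝ) / n) := by
    rw [← hIA, ← hIB]
    refine le_trans (lintegral_mono fun x => ?_)
      (ENNReal.lintegral_mul_norm_pow_le (hA.pow_const 2).ennreal_ofReal.aemeasurable
        (hB.pow_const n).ennreal_ofReal.aemeasurable (by positivity) (by positivity) (by
          rw [hpv]; field_simp))
    rw [ofReal_rpow_of_nonneg (by positivity) (by positivity),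
      ofReal_rpow_of_nonneg (pow_nonneg (hB0 x) n) (by positivity),
      ← ofReal_mul (by have := hA0 x; positivity),
      ← ofReal_norm, ofReal_rpow_of_nonneg (norm_nonneg _) hp0.le]
    refine ofReal_le_ofReal ?_
    have e1 : (A x ^ 2) ^ ((p : ℝ) / 2) = A x ^ (p : ℝ) := by
      rw [← rpow_natCast, ← rpow_mul (hA0 x)]; congr 1; push_cast; ring
    have e2 : (B x ^ n) ^ ((p : ℝ) / n) = B x ^ (p : ℝ) := by
      rw [← rpow_natCast, ← rpow_mul (hB0 x)]; congr 1; field_simp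
    rw [e1, e2, ← Real.mul_rpow (hA0 x) (hB0 x)]
    exact Real.rpow_le_rpow (norm_nonneg _) (hle x) hp0.le
  have h2 : eLpNorm g (2 : ℝ≥0) volume = ofReal (∫ x, g x ^ 2) ^ (1 / 2 : ℝ) := by
    rw [← hIg, eLpNorm_eq_lintegral_rpow_enorm_toReal (by norm_num) (by norm_num)]
    norm_num
  have h3 : eLpNorm (fderiv ℝ g) p volume ≤ ofReal (∫ x, A x ^ 2) ^ (1 / 2 : ℝ)
        * ofReal (∫ x, B x ^ n) ^ (1 / n : ℝ) := by
    rw [eLpNorm_eq_lintegral_rpow_enorm_toReal (by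
      have : p ≠ 0 := fun h => hp0.ne' (by rw [h]; rfl)
      exact_mod_cast this) (by simp)]
    simp only [ENNReal.coe_toReal]
    refine (ENNReal.rpow_le_rpow hJ (by positivity)).trans_eq ?_
    rw [ENNReal.mul_rpow_of_nonneg _ _ (by positivity), ← ENNReal.rpow_mul, ← ENNReal.rpow_mul]
    congr 2 <;> field_simp
  rw [h2] at hsob
  have h4 := hsob.trans (mul_le_mul_right h3 (K : ℝ≥0∞))
  have h5 := ENNReal.rpow_le_rpow h4 (show (0 : ℝ) ≤ 2 by norm_num)
  have hA2 : 0 ≤ ∫ x, A x ^ 2 := integral_nonneg fun x => by positivity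
  have hBn : 0 ≤ ∫ x, B x ^ n := integral_nonneg fun x => pow_nonneg (hB0 x) n
  have hg2 : 0 ≤ ∫ x, g x ^ 2 := integral_nonneg fun x => by positivity
  rw [← ENNReal.rpow_mul, ENNReal.mul_rpow_of_nonneg _ _ (by norm_num),
    ENNReal.mul_rpow_of_nonneg _ _ (by norm_num), ← ENNReal.rpow_mul, ← ENNReal.rpow_mul] at h5
  norm_num at h5
  rw [ofReal_rpow_of_nonneg hBn (by positivity),
    ← ofReal_mul hA2, show (K : ℝ≥0∞) = ofReal (K : ℝ) by simp,
    ← ENNReal.ofReal_pow (by positivity), ← ofReal_mul (by positivity),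
    ENNReal.ofReal_le_ofReal_iff (by positivity)] at h5
  refine h5.trans_eq ?_
  rw [mul_assoc]
  congr 3
  field_simp

/-! ### Gradients and matrices acting on them -/

/-- Families of `n` vectors of `W`, with the Hilbert space structure. -/
abbrev Gr (n : ℕ) (W : Type*) := PiLp 2 (fun _ : Fin n => W)

section Algebra


/-- The action of a matrix on families of vectors. -/
def matAct (A : Mat n) (X : Gr n W) : Gr n W := toLp 2 fun i => ∑ j, A i j • X j

/-- `A` is symmetric and close to the identity matrix. -/
structure NearId (A : Mat n) : Prop where
  symm : ∀ i j, A i j = A j i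
  close : ∀ i j, |A i j - (1 : Mat n) i j| ≤ 1 / 4000

lemma gr_norm_sq (X : Gr n W) : ‖X‖ ^ 2 = ∑ i, ‖X i‖ ^ 2 := PiLp.norm_sq_eq_of_L2 _ X

lemma gr_inner (X Y : Gr n W) : (inner ℝ X Y : ℝ) = ∑ i, inner ℝ (X i) (Y i) := rfl

@[simp] lemma matAct_apply (A : Mat n) (X : Gr n W) (i : Fin n) :
    matAct A X i = ∑ j, A i j • X j := rfl

lemma matAct_add (A : Mat n) (X Y : Gr n W) : matAct A (X + Y) = matAct A X + matAct A Y := by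
  ext i; simp [sum_add_distrib]

lemma matAct_smul (A : Mat n) (r : ℝ) (X : Gr n W) : matAct A (r • X) = r • matAct A X := by
  ext i; simp [smul_sum, smul_smul, mul_comm]

lemma inner_matAct (A : Mat n) (X Y : Gr n W) : (inner ℝ X (matAct A Y) : ℝ) = ∑ i, ∑ j, A i j *
    inner ℝ (X i) (Y j) := by
  simp [gr_inner, inner_sum, inner_smul_right]

lemma NearId.inner_comm {A : Mat n} (hA : NearId A) (X Y : Gr n W) : (inner ℝ X (matAct A Y) : ℝ) =
    inner ℝ Y (matAct A X) := by
  rw [inner_matAct, inner_matAct, sum_comm]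
  refine sum_congr rfl fun i _ => sum_congr rfl fun j _ => ?_
  rw [hA.symm, real_inner_comm]

lemma sum_norm_sq_le (hn : n ≤ 4) (X : Gr n W) : (∑ i, ‖X i‖) ^ 2 ≤ 4 * ‖X‖ ^ 2 := by
  have h := sq_sum_le_card_mul_sum_sq (s := (Finset.univ : Finset (Fin n))) (f := fun i => ‖X i‖)
  rw [← gr_norm_sq] at h
  simp only [Finset.card_univ, Fintype.card_fin] at h
  refine h.trans ?_
  gcongr
  exact_mod_cast hn

lemma sum_norm_le (hn : n ≤ 4) (X : Gr n W) : ∑ i, ‖X i‖ ≤ 2 * ‖X‖ := by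
  refine abs_le_of_sq_le_sq' ?_ (by positivity) |>.2
  rw [mul_pow]; norm_num; exact sum_norm_sq_le hn X

lemma NearId.norm_matAct_sub_le (hn : n ≤ 4) {A : Mat n} (hA : NearId A) (X : Gr n W) : ‖matAct A X
    - X‖ ≤ 1 / 1000 * ‖X‖ := by
  refine abs_le_of_sq_le_sq' ?_ (by positivity) |>.2
  rw [gr_norm_sq]
  have h1 : ∀ i, ‖(matAct A X - X) i‖ ≤ 1 / 4000 * ∑ j, ‖X j‖ := by
    intro i
    have : (matAct A X - X) i = ∑ j, (A i j - (1 : Mat n) i j) • X j := by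
      simp [sub_smul, sum_sub_distrib, Matrix.one_apply]
    rw [this, mul_sum]
    refine (norm_sum_le _ _).trans (sum_le_sum fun j _ => ?_)
    rw [norm_smul, norm_eq_abs]
    gcongr
    exact hA.close i j
  calc ∑ i, ‖(matAct A X - X) i‖ ^ 2 ≤ ∑ i : Fin n, (1 / 4000 * (2 * ‖X‖)) ^ 2 := by
        refine sum_le_sum fun i _ => ?_
        gcongr
        exact (h1 i).trans (by gcongr; exact sum_norm_le hn X)
    _ = n * (1 / 4000 * (2 * ‖X‖)) ^ 2 := by simp
    _ ≤ 4 * (1 / 4000 * (2 * ‖X‖)) ^ 2 := by gcongr; exact_mod_cast hn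
    _ = _ := by ring

lemma NearId.norm_matAct_le (hn : n ≤ 4) {A : Mat n} (hA : NearId A) (X : Gr n W) : ‖matAct A X‖ ≤ 2
    * ‖X‖ := by
  have h := hA.norm_matAct_sub_le hn X
  have : ‖matAct A X‖ ≤ ‖matAct A X - X‖ + ‖X‖ := by simpa using norm_add_le (matAct A X - X) X
  linarith [norm_nonneg X]

lemma NearId.abs_inner_sub_le (hn : n ≤ 4) {A : Mat n} (hA : NearId A) (X Y : Gr n W) : |inner ℝ X
    (matAct A Y) - (inner ℝ X Y : ℝ)| ≤ 1 / 1000 * (‖X‖ * ‖Y‖) := by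
  rw [← inner_sub_right]
  refine (abs_real_inner_le_norm _ _).trans ?_
  have := mul_le_mul_of_nonneg_left (hA.norm_matAct_sub_le hn Y) (norm_nonneg X)
  linarith

lemma NearId.le_inner (hn : n ≤ 4) {A : Mat n} (hA : NearId A) (X : Gr n W) : 999 / 1000 * ‖X‖ ^ 2 ≤
    inner ℝ X (matAct A X) := by
  have := (abs_le.1 (hA.abs_inner_sub_le hn X X)).1
  rw [real_inner_self_eq_norm_sq] at this
  nlinarith

lemma NearId.inner_le (hn : n ≤ 4) {A : Mat n} (hA : NearId A) (X Y : Gr n W) :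
    |(inner ℝ X (matAct A Y) : ℝ)| ≤ 1001 / 1000 * (‖X‖ * ‖Y‖) := by
  have h1 := abs_le.1 (hA.abs_inner_sub_le hn X Y)
  have h2 := abs_le.1 (abs_real_inner_le_norm X Y)
  rw [abs_le]
  constructor <;> linarith [h1.1, h1.2, h2.1, h2.2]

lemma norm_sum_smul_sq_le (b : Fin n → ℝ) (X : Gr n W) :
    ‖∑ i, b i • X i‖ ^ 2 ≤ (∑ i, b i ^ 2) * ‖X‖ ^ 2 := by
  have h1 : ‖∑ i, b i • X i‖ ≤ ∑ i, |b i| * ‖X i‖ :=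
    (norm_sum_le _ _).trans_eq (by simp [norm_smul])
  have h2 := Finset.sum_mul_sq_le_sq_mul_sq Finset.univ (fun i => |b i|) (fun i => ‖X i‖)
  rw [gr_norm_sq]
  simp only [sq_abs] at h2
  exact (pow_le_pow_left₀ (norm_nonneg _) h1 2).trans h2

/-- The quadratic form of the second derivatives controls the full Hessian. -/
lemma quadratic_form_ge (hn : n ≤ 4) {c : ℕ} (hc : c ≤ 2) {w K : ℝ} (hw : 0 ≤ w) {X : Gr n W}
    {Y : Fin n → Gr n W} (hY : ∀ i j, Y i j = Y j i) {wd : Fin n → ℝ} (hX : ‖X‖ ^ 2 ≤ 2 * w)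
    (hwd : ∀ j, |wd j - 2 * inner ℝ X (Y j)| ≤ 1 / 500 * (‖X‖ * ‖Y j‖) + 4 * K * ‖X‖ ^ 2)
    {T : Fin n → Gr n W} (hT : ∀ j, T j = √w ^ c • Y j + ((c : ℝ) / 2 * √w ^ c / w * wd j) • X) :
    (√w ^ c) ^ 2 * (1 / 2 * ∑ j, ‖Y j‖ ^ 2 - 128 * K ^ 2 * w)
      ≤ ∑ i, ∑ j, (inner ℝ (T j i) (T i j) : ℝ) := by
  set p := √w ^ c with hp
  set q := (c : ℝ) / 2 * p / w with hq
  have hp0 : 0 ≤ p := by positivity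
  have hq0 : 0 ≤ q := by positivity
  have hsum : ∑ i, ∑ j, (inner ℝ (T j i) (T i j) : ℝ)
      = p ^ 2 * ∑ j, ‖Y j‖ ^ 2 + 2 * (p * q) * ∑ j, wd j * inner ℝ X (Y j)
        + q ^ 2 * ‖∑ i, wd i • X i‖ ^ 2 := by
    have e : ∀ i j, (inner ℝ (T j i) (T i j) : ℝ) = p ^ 2 * inner ℝ (Y j i) (Y j i)
        + p * q * (wd i * inner ℝ (X j) (Y i j)) + p * q * (wd j * inner ℝ (X i) (Y j i))
        + q ^ 2 * inner ℝ (wd i • X i) (wd j • X j) := by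
      intro i j
      simp only [hT, PiLp.add_apply, PiLp.smul_apply, inner_add_left, inner_add_right,
        inner_smul_left, inner_smul_right, ← hp, ← hq, hY i j]
      simp only [conj_trivial, real_inner_comm (Y j i) (X j), real_inner_comm (X i) (X j)]
      ring
    simp only [e, sum_add_distrib, ← mul_sum]
    have e1 : ∑ i, ∑ j, (inner ℝ (Y j i) (Y j i) : ℝ) = ∑ j, ‖Y j‖ ^ 2 := by
      rw [sum_comm]
      simp [gr_norm_sq]
    have e2 : ∑ i, wd i * ∑ j, (inner ℝ (X j) (Y i j) : ℝ) = ∑ j, wd j * inner ℝ X (Y j) := rfl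
    have e3 : ∑ i, ∑ j, wd j * (inner ℝ (X i) (Y j i) : ℝ) = ∑ j, wd j * inner ℝ X (Y j) := by
      rw [sum_comm]
      simp only [← mul_sum]
      rfl
    have e4 : ∑ i, ∑ j, (inner ℝ (wd i • X i) (wd j • X j) : ℝ) = ‖∑ i, wd i • X i‖ ^ 2 := by
      rw [← real_inner_self_eq_norm_sq, sum_inner]
      simp only [inner_sum]
    rw [e1, e2, e3, e4]; ring
  have hz : ∀ j, -(2 * w * (4 / 500 ^ 2 * ‖Y j‖ ^ 2 + 64 * K ^ 2 * w)) ≤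
      8 * (wd j * inner ℝ X (Y j)) := by
    intro j
    have h1 := hwd j
    set z := (inner ℝ X (Y j) : ℝ)
    set e := wd j - 2 * z with he
    have h2 : e ^ 2 ≤ (1 / 500 * (‖X‖ * ‖Y j‖) + 4 * K * ‖X‖ ^ 2) ^ 2 := sq_le_sq' (by
      linarith [(abs_le.1 h1).1]) (abs_le.1 h1).2
    have h3 : (1 / 500 * (‖X‖ * ‖Y j‖) + 4 * K * ‖X‖ ^ 2) ^ 2
        ≤ 2 * ‖X‖ ^ 2 * (1 / 500 ^ 2 * ‖Y j‖ ^ 2 + 16 * K ^ 2 * ‖X‖ ^ 2) := by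
      nlinarith [sq_nonneg (1 / 500 * (‖X‖ * ‖Y j‖) - 4 * K * ‖X‖ ^ 2)]
    have h4 : 2 * ‖X‖ ^ 2 * (1 / 500 ^ 2 * ‖Y j‖ ^ 2 + 16 * K ^ 2 * ‖X‖ ^ 2)
        ≤ 2 * (2 * w) * (1 / 500 ^ 2 * ‖Y j‖ ^ 2 + 16 * K ^ 2 * (2 * w)) := by
      gcongr
    have h5 : wd j = 2 * z + e := by rw [he]; ring
    rw [h5]
    nlinarith [sq_nonneg (4 * z + e), mul_nonneg hw (sq_nonneg ‖Y j‖)]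
  have hpq : p * q * w ≤ p ^ 2 := by
    rcases hw.eq_or_lt with h | h
    · rw [← h, mul_zero]; positivity
    · have : p * q * w = (c : ℝ) / 2 * p ^ 2 := by rw [hq]; field_simp
      rw [this]
      have : (c : ℝ) ≤ 2 := by exact_mod_cast hc
      nlinarith [sq_nonneg p]
  have hS : -(2 * w * (4 / 500 ^ 2 * ∑ j, ‖Y j‖ ^ 2 + 4 * (64 * K ^ 2 * w)))
      ≤ 8 * ∑ j, wd j * inner ℝ X (Y j) := by
    rw [show 8 * ∑ j, wd j * (inner ℝ X (Y j) : ℝ) = ∑ j, 8 * (wd j * inner ℝ X (Y j)) from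
      mul_sum _ _ _]
    refine le_trans ?_ (sum_le_sum fun j _ => hz j)
    rw [Finset.sum_neg_distrib, ← mul_sum, sum_add_distrib, ← mul_sum,
      sum_const, Finset.card_univ, Fintype.card_fin, nsmul_eq_mul]
    have : (n : ℝ) ≤ 4 := by exact_mod_cast hn
    gcongr
  rw [hsum]
  have hY0 : 0 ≤ ∑ j, ‖Y j‖ ^ 2 := by positivity
  have h6 : 0 ≤ p * q := by positivity
  have h7 : 0 ≤ q ^ 2 * ‖∑ i, wd i • X i‖ ^ 2 := by positivity
  have h8 := mul_le_mul_of_nonneg_left hS h6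
  have h9 := mul_le_mul_of_nonneg_right hpq
    (show 0 ≤ 4 / 500 ^ 2 * ∑ j, ‖Y j‖ ^ 2 + 4 * (64 * K ^ 2 * w) by positivity)
  nlinarith [mul_nonneg (sq_nonneg p) hY0]

lemma sum_norm_sq_T_le (hn : n ≤ 4) {c : ℕ} (hc : c ≤ 2) {w K : ℝ} (hw : 0 ≤ w) (hK : 0 ≤ K)
    {X : Gr n W} {Y : Fin n → Gr n W} {wd : Fin n → ℝ} (hX : ‖X‖ ^ 2 ≤ 2 * w)
    (hwd : ∀ j, |wd j - 2 * inner ℝ X (Y j)| ≤ 1 / 500 * (‖X‖ * ‖Y j‖) + 4 * K * ‖X‖ ^ 2)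
    {T : Fin n → Gr n W} (hT : ∀ j, T j = √w ^ c • Y j + ((c : ℝ) / 2 * √w ^ c / w * wd j) • X) :
    ∑ j, ‖T j‖ ^ 2 ≤ (√w ^ c) ^ 2 * (98 * ∑ j, ‖Y j‖ ^ 2 + 1024 * K ^ 2 * w) := by
  set p := √w ^ c with hp
  set q := (c : ℝ) / 2 * p / w with hq
  have hp0 : 0 ≤ p := by positivity
  have hq0 : 0 ≤ q := by positivity
  have hqX : q * ‖X‖ ^ 2 ≤ 2 * p := by
    rcases hw.eq_or_lt with h | h
    · rw [hq, ← h]; simp; positivity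
    · calc q * ‖X‖ ^ 2 ≤ q * (2 * w) := by gcongr
        _ = c * p := by rw [hq]; field_simp
        _ ≤ 2 * p := by gcongr; exact_mod_cast hc
  have hj : ∀ j, ‖T j‖ ^ 2 ≤ p ^ 2 * (98 * ‖Y j‖ ^ 2 + 256 * K ^ 2 * w) := by
    intro j
    have h1 : |wd j| ≤ 3 * (‖X‖ * ‖Y j‖) + 4 * K * ‖X‖ ^ 2 := by
      have h2 := abs_le.1 (hwd j)
      have h3 := abs_le.1 (abs_real_inner_le_norm X (Y j))
      have h4 : 0 ≤ ‖X‖ * ‖Y j‖ := by positivity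
      rw [abs_le]; constructor <;> linarith [h2.1, h2.2, h3.1, h3.2]
    have h2 : ‖T j‖ ≤ p * (7 * ‖Y j‖ + 8 * K * ‖X‖) := by
      rw [hT j]
      refine (norm_add_le _ _).trans ?_
      rw [norm_smul, norm_smul, norm_of_nonneg hp0, norm_eq_abs, abs_mul, abs_of_nonneg hq0]
      have h3 : q * |wd j| * ‖X‖ ≤ q * (3 * (‖X‖ * ‖Y j‖) + 4 * K * ‖X‖ ^ 2) * ‖X‖ := by gcongr
      have h4 : q * ‖X‖ ^ 2 * (3 * ‖Y j‖ + 4 * K * ‖X‖) ≤ 2 * p * (3 * ‖Y j‖ + 4 * K * ‖X‖) := by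
        gcongr
      nlinarith
    have h3 : ‖T j‖ ^ 2 ≤ (p * (7 * ‖Y j‖ + 8 * K * ‖X‖)) ^ 2 := by gcongr
    have h4 : (7 * ‖Y j‖ + 8 * K * ‖X‖) ^ 2 ≤ 98 * ‖Y j‖ ^ 2 + 256 * K ^ 2 * w := by
      have := mul_le_mul_of_nonneg_left hX (sq_nonneg K)
      nlinarith [sq_nonneg (7 * ‖Y j‖ - 8 * K * ‖X‖)]
    rw [mul_pow] at h3
    exact h3.trans (by gcongr)
  refine (sum_le_sum fun j _ => hj j).trans ?_
  rw [← mul_sum, sum_add_distrib, ← mul_sum, sum_const,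
    Finset.card_univ, Fintype.card_fin, nsmul_eq_mul]
  have : (n : ℝ) ≤ 4 := by exact_mod_cast hn
  have h2 : (n : ℝ) * (256 * K ^ 2 * w) ≤ 4 * (256 * K ^ 2 * w) := by gcongr
  refine mul_le_mul_of_nonneg_left ?_ (sq_nonneg p)
  linarith

/-- The pointwise inequality behind the `L²` estimate for second derivatives. -/
lemma elliptic_pointwise (hn : n ≤ 4) {c : ℕ} (hc : c ≤ 2) {w K : ℝ} (hw : 0 ≤ w) (hK : 0 ≤ K)
    {A : Mat n} (hA : NearId A) {X : Gr n W} {Y : Fin n → Gr n W} (hY : ∀ i j, Y i j = Y j i)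
    {wd : Fin n → ℝ} (hX : ‖X‖ ^ 2 ≤ 2 * w)
    (hwd : ∀ j, |wd j - 2 * inner ℝ X (Y j)| ≤ 1 / 500 * (‖X‖ * ‖Y j‖) + 4 * K * ‖X‖ ^ 2)
    {T : Fin n → Gr n W} (hT : ∀ j, T j = √w ^ c • Y j + ((c : ℝ) / 2 * √w ^ c / w * wd j) • X)
    {V : Gr n W} (hV : V = √w ^ c • X) {D : W} (hD : ‖D - ∑ i, ∑ j, A i j • T i j‖ ≤ 16 * K * ‖V‖)
    (φ : ℝ) (φd : Fin n → ℝ) : 1 / 4 * (φ ^ 2 * (√w ^ c) ^ 2 * ∑ j, ‖Y j‖ ^ 2)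
      ≤ (∑ i, ∑ j, (inner ℝ (φ • T j i + φd j • V i) (φ • T i j + φd i • V j) : ℝ))
        - ‖∑ i, (φ • T i i + φd i • V i)‖ ^ 2
        + 4000 * (φ ^ 2 * ‖D‖ ^ 2 + (∑ i, φd i ^ 2 + K ^ 2 * φ ^ 2) * ((√w ^ c) ^ 2 * w)) := by
  have h1 := quadratic_form_ge hn hc hw hY hX hwd hT
  have h2 := sum_norm_sq_T_le hn hc hw hK hX hwd hT
  set p := √w ^ c with hp
  set θ := ∑ j, ‖T j‖ ^ 2 with hθ
  set Q := ∑ j, ‖Y j‖ ^ 2 with hQ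
  set d := ∑ i, φd i ^ 2 with hd
  have hV2 : ‖V‖ ^ 2 ≤ 2 * (p ^ 2 * w) := by
    rw [hV, norm_smul, mul_pow, norm_of_nonneg (by positivity)]
    nlinarith [mul_le_mul_of_nonneg_left hX (sq_nonneg p)]
  have hθ2 : θ = ∑ i, ∑ j, ‖T i j‖ ^ 2 := by simp only [hθ, gr_norm_sq]
  have hdiv : ‖∑ i, T i i‖ ^ 2 ≤ 3 * (‖D‖ ^ 2 + 1 / 1000000 * θ + 256 * K ^ 2 * ‖V‖ ^ 2) := by
    have e1 : ∑ i, T i i = D - (D - ∑ i, ∑ j, A i j • T i j)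
        - ∑ i, ∑ j, (A i j - (1 : Mat n) i j) • T i j := by
      simp [sub_smul, sum_sub_distrib, Matrix.one_apply]
    have e2 : ‖∑ i, ∑ j, (A i j - (1 : Mat n) i j) • T i j‖ ≤ 1 / 1000 * √θ := by
      have e3 : ‖∑ i, ∑ j, (A i j - (1 : Mat n) i j) • T i j‖ ≤ ∑ i, 1 / 4000 * (2 * ‖T i‖) := by
        refine (norm_sum_le _ _).trans (sum_le_sum fun i _ => ?_)
        refine le_trans ?_ (mul_le_mul_of_nonneg_left (sum_norm_le hn (T i)) (by norm_num))
        rw [mul_sum]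
        refine (norm_sum_le _ _).trans (sum_le_sum fun j _ => ?_)
        rw [norm_smul, norm_eq_abs]
        gcongr
        exact hA.close i j
      have e4 : (∑ i, ‖T i‖) ≤ 2 * √θ := by
        refine abs_le_of_sq_le_sq' ?_ (by positivity) |>.2
        have := sq_sum_le_card_mul_sum_sq (s := (Finset.univ : Finset (Fin n)))
          (f := fun i => ‖T i‖)
        rw [mul_pow, sq_sqrt (by positivity)]
        refine this.trans ?_
        norm_num
        gcongr
        exact_mod_cast hn
      rw [← mul_sum, ← mul_sum] at e3
      linarith
    have e5 : ‖∑ i, T i i‖ ≤ ‖D‖ + 16 * K * ‖V‖ + 1 / 1000 * √θ := by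
      rw [e1]
      refine (norm_sub_le _ _).trans (add_le_add ((norm_sub_le _ _).trans ?_) e2)
      gcongr
    have e6 : √θ ^ 2 = θ := sq_sqrt (by positivity)
    have e7 : ‖∑ i, T i i‖ ^ 2 ≤ (‖D‖ + 16 * K * ‖V‖ + 1 / 1000 * √θ) ^ 2 := by gcongr
    nlinarith [sq_nonneg (‖D‖ - 16 * K * ‖V‖), sq_nonneg (‖D‖ - 1 / 1000 * √θ),
      sq_nonneg (16 * K * ‖V‖ - 1 / 1000 * √θ)]
  have hvd : ‖∑ i, φd i • V i‖ ^ 2 ≤ d * ‖V‖ ^ 2 := norm_sum_smul_sq_le φd V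
  have hN : ‖∑ i, (φ • T i i + φd i • V i)‖ ^ 2
      ≤ 2 * (φ ^ 2 * ‖∑ i, T i i‖ ^ 2) + 2 * (d * ‖V‖ ^ 2) := by
    rw [sum_add_distrib, ← smul_sum]
    have e1 := norm_add_le (φ • ∑ i, T i i) (∑ i, φd i • V i)
    have e2 : ‖φ • ∑ i, T i i‖ ^ 2 = φ ^ 2 * ‖∑ i, T i i‖ ^ 2 := by
      rw [norm_smul, mul_pow, norm_eq_abs, sq_abs]
    have e3 : ‖φ • ∑ i, T i i + ∑ i, φd i • V i‖ ^ 2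
        ≤ (‖φ • ∑ i, T i i‖ + ‖∑ i, φd i • V i‖) ^ 2 := by gcongr
    rw [← e2]
    nlinarith [sq_nonneg (‖φ • ∑ i, T i i‖ - ‖∑ i, φd i • V i‖)]
  have hB : φ ^ 2 * ∑ i, ∑ j, (inner ℝ (T j i) (T i j) : ℝ)
      - 2 * (1 / 1000 * φ ^ 2 * θ + 250 * d * ‖V‖ ^ 2)
      ≤ ∑ i, ∑ j, (inner ℝ (φ • T j i + φd j • V i) (φ • T i j + φd i • V j) : ℝ) := by
    have e1 : ∀ i j, φ ^ 2 * (inner ℝ (T j i) (T i j) : ℝ)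
        - (1 / 1000 * φ ^ 2 * ‖T i j‖ ^ 2 + 250 * φd j ^ 2 * ‖V i‖ ^ 2)
        - (1 / 1000 * φ ^ 2 * ‖T j i‖ ^ 2 + 250 * φd i ^ 2 * ‖V j‖ ^ 2)
        + inner ℝ (φd i • V i) (φd j • V j)
        ≤ (inner ℝ (φ • T j i + φd j • V i) (φ • T i j + φd i • V j) : ℝ) := by
      intro i j
      have f1 := (abs_le.1 (abs_real_inner_le_norm (V i) (T i j))).1
      have f2 := (abs_le.1 (abs_real_inner_le_norm (T j i) (V j))).1
      have am : ∀ a b x y z : ℝ, |z| ≤ x * y → 0 ≤ x → 0 ≤ y →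
          -(1 / 1000 * a ^ 2 * y ^ 2 + 250 * b ^ 2 * x ^ 2) ≤ a * b * z := by
        intro a b x y z hz hx hy
        have g1 : |a * b * z| ≤ |a| * |b| * (x * y) := by
          rw [abs_mul, abs_mul]; gcongr
        have g2 := (abs_le.1 g1).1
        have g3 : 0 ≤ (1 / 500 * |a| * y - |b| * x) ^ 2 * 250 := by positivity
        have g4 : |a| ^ 2 = a ^ 2 := sq_abs a
        have g5 : |b| ^ 2 = b ^ 2 := sq_abs b
        rw [← g4, ← g5]
        linarith [g2, g3]
      have g1 := am φ (φd j) ‖V i‖ ‖T i j‖ _ (abs_real_inner_le_norm (V i) (T i j))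
        (norm_nonneg _) (norm_nonneg _)
      have g2 := am φ (φd i) ‖V j‖ ‖T j i‖ (inner ℝ (T j i) (V j))
        ((abs_real_inner_le_norm _ _).trans_eq (mul_comm _ _)) (norm_nonneg _) (norm_nonneg _)
      simp only [inner_add_left, inner_add_right, inner_smul_left, inner_smul_right, conj_trivial]
      linarith [g1, g2]
    refine le_trans ?_ (sum_le_sum fun i _ => sum_le_sum fun j _ => e1 i j)
    simp only [sum_add_distrib, sum_sub_distrib, ← mul_sum]
    have e2 : ∑ i, ∑ j, ‖T j i‖ ^ 2 = θ := by rw [hθ2, sum_comm]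
    have e3 : ∑ i, ∑ j, 250 * φd j ^ 2 * ‖V i‖ ^ 2 = 250 * d * ‖V‖ ^ 2 := by
      rw [hd, gr_norm_sq, show 250 * ∑ i, φd i ^ 2 = ∑ i, 250 * φd i ^ 2 from
        mul_sum _ _ _, Finset.sum_mul_sum, sum_comm]
    have e4 : ∑ i, 250 * φd i ^ 2 * ∑ j, ‖V j‖ ^ 2 = 250 * d * ‖V‖ ^ 2 := by
      rw [hd, gr_norm_sq, show 250 * ∑ i, φd i ^ 2 = ∑ i, 250 * φd i ^ 2 from
        mul_sum _ _ _, sum_mul]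
    have e5 : ∑ i, ∑ j, (inner ℝ (φd i • V i) (φd j • V j) : ℝ) = ‖∑ i, φd i • V i‖ ^ 2 := by
      rw [← real_inner_self_eq_norm_sq, sum_inner]
      simp only [inner_sum]
    rw [e2, e3, e4, e5, ← hθ2]
    nlinarith [sq_nonneg ‖∑ i, φd i • V i‖]
  have hQ0 : 0 ≤ Q := by positivity
  have hd0 : 0 ≤ d := by positivity
  have m1 := mul_le_mul_of_nonneg_left h1 (sq_nonneg φ)
  have m2 := mul_le_mul_of_nonneg_left h2 (sq_nonneg φ)
  have m3 := mul_le_mul_of_nonneg_left hdiv (sq_nonneg φ)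
  have m4 := mul_le_mul_of_nonneg_left hV2 hd0
  have m5 := mul_le_mul_of_nonneg_left hV2 (show 0 ≤ φ ^ 2 * K ^ 2 by positivity)
  have m6 : 0 ≤ φ ^ 2 * (p ^ 2 * Q) := by positivity
  have m7 : 0 ≤ φ ^ 2 * ‖D‖ ^ 2 := by positivity
  have m8 : 0 ≤ φ ^ 2 * K ^ 2 * (p ^ 2 * w) := by positivity
  have m9 : 0 ≤ d * (p ^ 2 * w) := by positivity
  linarith

end Algebra

/-! ### Energy densities and fluxes -/

section Density

variable {Z : Type*} [NormedAddCommGroup Z] [NormedSpace ℝ Z]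

lemma fderiv_gr_apply {X : Z → Gr n W} {z : Z} (hX : DifferentiableAt ℝ X z) (u : Z) (i : Fin n) :
    fderiv ℝ X z u i = fderiv ℝ (fun y => X y i) z u := by
  have h := ((PiLp.proj (𝕜 := ℝ) 2 (fun _ : Fin n => W) i).hasFDerivAt
    (x := X z)).comp z hX.hasFDerivAt
  rw [show (fun y => X y i) = (PiLp.proj (𝕜 := ℝ) 2 (fun _ : Fin n => W) i) ∘ X from rfl, h.fderiv]
  rfl

lemma differentiableAt_gr {X : Z → Gr n W} {z : Z} :
    DifferentiableAt ℝ X z ↔ ∀ i, DifferentiableAt ℝ (fun y => X y i) z := differentiableAt_piLp 2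

/-- The derivative of the entries of a matrix field. -/
def matDeriv (B : Z → Mat n) (z u : Z) : Mat n :=
  Matrix.of fun i j => fderiv ℝ (fun y => B y i j) z u

lemma differentiableAt_matAct {B : Z → Mat n} {X : Z → Gr n W} {z : Z}
    (hB : ∀ i j, DifferentiableAt ℝ (fun y => B y i j) z) (hX : DifferentiableAt ℝ X z) :
    DifferentiableAt ℝ (fun y => matAct (B y) (X y)) z := by
  rw [differentiableAt_gr]
  intro i
  have := differentiableAt_gr.1 hX
  simp only [matAct_apply]
  fun_prop

lemma fderiv_matAct {B : Z → Mat n} {X : Z → Gr n W} {z : Z}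
    (hB : ∀ i j, DifferentiableAt ℝ (fun y => B y i j) z) (hX : DifferentiableAt ℝ X z) (u : Z) :
    fderiv ℝ (fun y => matAct (B y) (X y)) z u
      = matAct (B z) (fderiv ℝ X z u) + matAct (matDeriv B z u) (X z) := by
  ext i
  have hXi := differentiableAt_gr.1 hX
  rw [fderiv_gr_apply (differentiableAt_matAct hB hX)]
  simp only [matAct_apply, PiLp.add_apply, fderiv_gr_apply hX]
  have hd : ∀ j ∈ Finset.univ, DifferentiableAt ℝ (fun y => B y i j • X y j) z :=
    fun j _ => (hB i j).smul (hXi j)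
  rw [fderiv_fun_sum hd]
  simp only [_root_.sum_apply]
  rw [← sum_add_distrib]
  refine sum_congr rfl fun j _ => ?_
  rw [fderiv_fun_smul (hB i j) (hXi j)]
  simp [matDeriv]

lemma contDiff_matAct {k : WithTop ℕ∞} {B : Z → Mat n} {X : Z → Gr n W}
    (hB : ∀ i j, ContDiff ℝ k fun y => B y i j) (hX : ContDiff ℝ k X) :
    ContDiff ℝ k fun y => matAct (B y) (X y) := by
  refine contDiff_piLp' 2 fun i => ?_
  simp only [matAct_apply]
  exact ContDiff.sum fun j _ => (hB i j).smul ((contDiff_piLp 2).1 hX j)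

/-- `ε + ⟨X, B X⟩`. -/
def quad (ε : ℝ) (B : Z → Mat n) (X : Z → Gr n W) (z : Z) : ℝ :=
  ε + inner ℝ (X z) (matAct (B z) (X z))

lemma contDiff_quad {k : WithTop ℕ∞} {B : Z → Mat n} {X : Z → Gr n W} (ε : ℝ)
    (hB : ∀ i j, ContDiff ℝ k fun y => B y i j) (hX : ContDiff ℝ k X) : ContDiff ℝ k (quad ε B X) :=
  contDiff_const.add (hX.inner ℝ (contDiff_matAct hB hX))

lemma fderiv_quad {B : Z → Mat n} {X : Z → Gr n W} {z : Z} (ε : ℝ)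
    (hB : ∀ i j, DifferentiableAt ℝ (fun y => B y i j) z) (hX : DifferentiableAt ℝ X z)
    (hN : NearId (B z)) (u : Z) :
    fderiv ℝ (quad ε B X) z u = 2 * inner ℝ (X z) (matAct (B z) (fderiv ℝ X z u))
      + inner ℝ (X z) (matAct (matDeriv B z u) (X z)) := by
  have h := (hX.hasFDerivAt.inner ℝ (differentiableAt_matAct hB hX).hasFDerivAt).const_add ε
  have : fderiv ℝ (quad ε B X) z = _ := h.fderiv
  rw [this]
  rw [show ∀ L M : Z →L[ℝ] Gr n W, ((fderivInnerCLM ℝ (X z, matAct (B z) (X z))) ∘L L.prod M) u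
    = inner ℝ (X z) (M u) + inner ℝ (L u) (matAct (B z) (X z)) from fun _ _ => rfl]
  rw [fderiv_matAct hB hX, inner_add_right, real_inner_comm _ (fderiv ℝ X z u),
    real_inner_comm (fderiv ℝ X z u), hN.inner_comm (fderiv ℝ X z u)]
  ring

lemma norm_matAct_le_of_entries (hn : n ≤ 4) {B : Mat n} {K : ℝ} (hB : ∀ i j, |B i j| ≤ K)
    (X : Gr n W) : ‖matAct B X‖ ≤ 4 * K * ‖X‖ := by
  rcases Nat.eq_zero_or_pos n with rfl | hn0
  · have : ‖X‖ = 0 := by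
      rw [← sq_eq_zero_iff, gr_norm_sq]; simp
    have h2 : ‖matAct B X‖ = 0 := by
      rw [← sq_eq_zero_iff, gr_norm_sq]; simp
    rw [this, h2]; simp
  have hK : 0 ≤ K := (abs_nonneg _).trans (hB ⟨0, hn0⟩ ⟨0, hn0⟩)
  refine abs_le_of_sq_le_sq' ?_ (by positivity) |>.2
  rw [gr_norm_sq]
  calc ∑ i, ‖matAct B X i‖ ^ 2 ≤ ∑ i : Fin n, (K * (2 * ‖X‖)) ^ 2 := by
        refine sum_le_sum fun i _ => ?_
        gcongr
        rw [matAct_apply]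
        refine (norm_sum_le _ _).trans ?_
        refine le_trans ?_ (mul_le_mul_of_nonneg_left (sum_norm_le hn X) hK)
        rw [mul_sum]
        refine sum_le_sum fun j _ => ?_
        rw [norm_smul, norm_eq_abs]
        gcongr
        exact hB i j
    _ = n * (K * (2 * ‖X‖)) ^ 2 := by simp
    _ ≤ 4 * (K * (2 * ‖X‖)) ^ 2 := by gcongr; exact_mod_cast hn
    _ = _ := by ring

lemma NearId.norm_sq_le_quad (hn : n ≤ 4) {ε : ℝ} (hε : 0 ≤ ε) {B : Z → Mat n} {X : Z → Gr n W}
    {z : Z} (hB : NearId (B z)) : ‖X z‖ ^ 2 ≤ 2 * quad ε B X z := by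
  have h := hB.le_inner hn (X z)
  have : 0 ≤ ‖X z‖ ^ 2 := by positivity
  rw [quad]; linarith

lemma NearId.quad_nonneg (hn : n ≤ 4) {ε : ℝ} (hε : 0 ≤ ε) {B : Z → Mat n} {X : Z → Gr n W} {z : Z}
    (hB : NearId (B z)) : 0 ≤ quad ε B X z := by
  have h := hB.norm_sq_le_quad hn hε (X := X)
  have : 0 ≤ ‖X z‖ ^ 2 := by positivity
  linarith

end Density

section Elliptic


/-- The gradient of a `W`-valued function. -/
def grad (f : Eu n → W) (x : Eu n) : Gr n W := toLp 2 fun i => pd i f x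

/-- The derivative of the gradient in the direction `j`. -/
def hess (f : Eu n → W) (j : Fin n) (x : Eu n) : Gr n W := toLp 2 fun i => pd j (pd i f) x

@[simp] lemma grad_apply (f : Eu n → W) (x : Eu n) (i : Fin n) : grad f x i = pd i f x := rfl

@[simp] lemma hess_apply (f : Eu n → W) (j : Fin n) (x : Eu n) (i : Fin n) :
    hess f j x i = pd j (pd i f) x := rfl

/-- The weighted gradient `e₂^{(n-2)/2} df`. -/
def flux (ε : ℝ) (a : Eu n → Mat n) (f : Eu n → W) (x : Eu n) : Gr n W :=
  √(quad ε a (grad f) x) ^ (n - 2) • grad f x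

/-- The weighted divergence `σ⁻¹ ∂ᵢ (σ aⁱʲ Vⱼ)`. -/
def divg (σ : Eu n → ℝ) (a : Eu n → Mat n) (V : Eu n → Gr n W) (x : Eu n) : W :=
  (σ x)⁻¹ • ∑ i, pd i (fun z => σ z • matAct (a z) (V z) i) x

/-- Smooth coefficients which are close to the Euclidean ones in a ball. -/
structure Coef (K s : ℝ) (a : Eu n → Mat n) (σ : Eu n → ℝ) : Prop where
  smooth_a : ∀ i j, ContDiff ℝ ∞ fun x => a x i j
  smooth_σ : ContDiff ℝ ∞ σ
  near : ∀ x, NearId (a x)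
  pos : ∀ x, 0 < σ x
  ge : ∀ x ∈ 𝔹 s, 1 / 2 ≤ σ x
  le : ∀ x ∈ 𝔹 s, σ x ≤ 2
  da : ∀ x ∈ 𝔹 s, ∀ i j k, |pd k (fun y => a y i j) x| ≤ K
  dσ : ∀ x ∈ 𝔹 s, ∀ k, |pd k σ x| ≤ K

lemma contDiff_pd {f : Eu n → W} (hf : ContDiff ℝ ∞ f) (i : Fin n) : ContDiff ℝ ∞ (pd i f) :=
  (hf.fderiv_right (m := ∞) (by simp)).clm_apply contDiff_const

lemma continuous_pd {f : Eu n → W} (hf : ContDiff ℝ 1 f) (i : Fin n) : Continuous (pd i f) :=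
  (hf.continuous_fderiv one_ne_zero).clm_apply continuous_const

lemma contDiff_grad {f : Eu n → W} (hf : ContDiff ℝ ∞ f) : ContDiff ℝ ∞ (grad f) :=
  contDiff_piLp' 2 fun i => contDiff_pd hf i

lemma fderiv_grad {f : Eu n → W} (hf : ContDiff ℝ ∞ f) (x : Eu n) (j : Fin n) :
    fderiv ℝ (grad f) x (single j 1) = hess f j x := by
  ext i
  rw [fderiv_gr_apply ((contDiff_grad hf).differentiable (by simp) x)]
  rfl

lemma continuous_hess {f : Eu n → W} (hf : ContDiff ℝ ∞ f) (j : Fin n) : Continuous (hess f j) :=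
  (PiLp.continuous_toLp 2 _).comp
    (continuous_pi fun i => (contDiff_pd (contDiff_pd hf i) j).continuous)

lemma pd_comm {f : Eu n → W} (hf : ContDiff ℝ ∞ f) (i j : Fin n) (x : Eu n) :
    pd j (pd i f) x = pd i (pd j f) x := by
  have h := (hf.contDiffAt (x := x)).isSymmSndFDerivAt (by simp [minSmoothness]; exact ENat.LEInfty.out)
  have hd : DifferentiableAt ℝ (fderiv ℝ f) x :=
    (hf.fderiv_right (m := 1) (by norm_num; exact ENat.LEInfty.out)).differentiable one_ne_zero x
  have e : ∀ i j, pd j (pd i f) x = fderiv ℝ (fderiv ℝ f) x (single j 1) (single i 1) := by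
    intro i j
    have : pd i f = fun y => fderiv ℝ f y (single i 1) := rfl
    rw [this, pd, fderiv_clm_apply hd (by fun_prop)]
    simp
  rw [e, e]
  exact h _ _

variable {K s ε : ℝ} {a : Eu n → Mat n} {σ : Eu n → ℝ}

lemma Coef.contDiff_flux (hn : n ≤ 4) (ha : Coef K s a σ) (hε : 0 ≤ ε) {f : Eu n → W}
    (hf : ContDiff ℝ ∞ f) : ContDiff ℝ 1 (flux ε a f) :=
  contDiff_sqrt_pow_smul (n - 2) (fun z => (ha.near z).quad_nonneg hn hε)
    (fun z => (ha.near z).norm_sq_le_quad hn hε)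
    ((contDiff_quad ε ha.smooth_a (contDiff_grad hf)).of_le (by simp))
    ((contDiff_grad hf).of_le (by simp))

lemma Coef.fderiv_flux (hn : n ≤ 4) (ha : Coef K s a σ) (hε : 0 ≤ ε) {f : Eu n → W}
    (hf : ContDiff ℝ ∞ f) (x : Eu n) (j : Fin n) : fderiv ℝ (flux ε a f) x (single j 1)
      = √(quad ε a (grad f) x) ^ (n - 2) • hess f j x
        + (((n - 2 : ℕ) : ℝ) / 2 * √(quad ε a (grad f) x) ^ (n - 2) / quad ε a (grad f) x
          * pd j (quad ε a (grad f)) x) • grad f x := by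
  rw [← fderiv_grad hf]
  exact fderiv_sqrt_pow_smul (n - 2) (fun z => (ha.near z).quad_nonneg hn hε)
    (fun z => (ha.near z).norm_sq_le_quad hn hε) x
    ((contDiff_quad ε ha.smooth_a (contDiff_grad hf)).differentiable (by simp) x)
    ((contDiff_grad hf).differentiable (by simp) x) _

lemma Coef.pd_quad (ha : Coef K s a σ) (hn : n ≤ 4) {f : Eu n → W} (hf : ContDiff ℝ ∞ f) {x : Eu n}
    (hx : x ∈ 𝔹 s) (j : Fin n) :
    |pd j (quad ε a (grad f)) x - 2 * inner ℝ (grad f x) (hess f j x)|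
      ≤ 1 / 500 * (‖grad f x‖ * ‖hess f j x‖) + 4 * K * ‖grad f x‖ ^ 2 := by
  have e := fderiv_quad (z := x) ε (fun i k => (ha.smooth_a i k).differentiable (by simp) x)
    ((contDiff_grad hf).differentiable (by simp) x) (ha.near x) (single j 1)
  rw [fderiv_grad hf] at e
  rw [pd, e]
  have h1 := abs_le.1 ((ha.near x).abs_inner_sub_le hn (grad f x) (hess f j x))
  have h2 : |(inner ℝ (grad f x) (matAct (matDeriv a x (single j 1)) (grad f x)) : ℝ)|
      ≤ 4 * K * ‖grad f x‖ ^ 2 := by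
    refine (abs_real_inner_le_norm _ _).trans ?_
    have := norm_matAct_le_of_entries hn (B := matDeriv a x (single j 1)) (K := K)
      (fun i k => ha.da x hx i k j) (grad f x)
    nlinarith [mul_le_mul_of_nonneg_left this (norm_nonneg (grad f x))]
  rw [abs_le] at h2 ⊢
  constructor <;> linarith [h1.1, h1.2, h2.1, h2.2]

lemma Coef.continuous_divg (ha : Coef K s a σ) {V : Eu n → Gr n W} (hV : ContDiff ℝ 1 V) :
    Continuous (divg σ a V) := by
  refine Continuous.smul (ha.smooth_σ.continuous.inv₀ fun x => (ha.pos x).ne') ?_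
  refine continuous_finsetSum _ fun i _ => continuous_pd ?_ i
  exact (ha.smooth_σ.of_le (by simp)).smul ((contDiff_piLp 2).1
    (contDiff_matAct (fun i j => (ha.smooth_a i j).of_le (by simp)) hV) i)

lemma Coef.divg_sub_le (ha : Coef K s a σ) (hn : n ≤ 4) {V : Eu n → Gr n W} (hV : ContDiff ℝ 1 V)
    {x : Eu n} (hx : x ∈ 𝔹 s) : ‖divg σ a V x - ∑ i, ∑ j, a x i j • fderiv ℝ V x (single i 1) j‖
      ≤ 16 * K * ‖V x‖ := by
  have hσ := ha.pos x
  have hVd := hV.differentiable one_ne_zero x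
  have had := fun i j => (ha.smooth_a i j).differentiable (by simp) x
  have hm := differentiableAt_matAct had hVd
  have e : divg σ a V x - ∑ i, ∑ j, a x i j • fderiv ℝ V x (single i 1) j
      = ∑ i, (((σ x)⁻¹ * pd i σ x) • matAct (a x) (V x) i
        + matAct (matDeriv a x (single i 1)) (V x) i) := by
    rw [divg, smul_sum, ← sum_sub_distrib]
    refine sum_congr rfl fun i _ => ?_
    rw [pd, fderiv_fun_smul (ha.smooth_σ.differentiable (by simp) x) (differentiableAt_gr.1 hm i)]
    simp only [_root_.add_apply, _root_.smul_apply, smulRight_apply]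
    rw [← fderiv_gr_apply hm, fderiv_matAct had hVd]
    simp only [PiLp.add_apply, smul_add, smul_smul, inv_mul_cancel₀ hσ.ne', one_smul, ← matAct_apply]
    rw [pd]
    abel
  rw [e]
  have hge := ha.ge x hx
  have h1 : ∀ i, |(σ x)⁻¹ * pd i σ x| ≤ 2 * K := by
    intro i
    rw [abs_mul, abs_of_pos (inv_pos.2 hσ)]
    have h2 : (σ x)⁻¹ ≤ 2 := by
      rw [inv_le_comm₀ hσ (by norm_num)]; linarith
    have := ha.dσ x hx i
    gcongr
  have h3 : ∀ i : Fin n, ‖matAct (matDeriv a x (single i 1)) (V x) i‖ ≤ 2 * K * ‖V x‖ := by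
    intro i
    have hK : 0 ≤ K := (abs_nonneg _).trans (ha.dσ x hx i)
    rw [matAct_apply]
    refine (norm_sum_le _ _).trans ?_
    have : ∑ j, K * ‖V x j‖ ≤ 2 * K * ‖V x‖ := by
      rw [← mul_sum]
      nlinarith [sum_norm_le hn (V x)]
    refine le_trans (sum_le_sum fun j _ => ?_) this
    rw [norm_smul, norm_eq_abs]
    gcongr
    exact ha.da x hx i j i
  rcases Nat.eq_zero_or_pos n with rfl | hn0
  · have : ‖V x‖ = 0 := by rw [← sq_eq_zero_iff, gr_norm_sq]; simp
    rw [this]; simp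
  have hK : 0 ≤ K := (abs_nonneg _).trans (ha.dσ x hx ⟨0, hn0⟩)
  refine (norm_sum_le _ _).trans ?_
  have h5 : ∑ i, (2 * K * ‖matAct (a x) (V x) i‖ + 2 * K * ‖V x‖) ≤ 16 * K * ‖V x‖ := by
    rw [sum_add_distrib, ← mul_sum, sum_const, Finset.card_univ, Fintype.card_fin, nsmul_eq_mul]
    have h6 := sum_norm_le hn (matAct (a x) (V x))
    have h7 := (ha.near x).norm_matAct_le hn (V x)
    have h8 : (n : ℝ) ≤ 4 := by exact_mod_cast hn
    have h9 : (n : ℝ) * (2 * K * ‖V x‖) ≤ 4 * (2 * K * ‖V x‖) := by gcongr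
    have h10 : 2 * K * ∑ i, ‖matAct (a x) (V x) i‖ ≤ 2 * K * (2 * (2 * ‖V x‖)) := by
      gcongr; linarith
    linarith
  refine le_trans (sum_le_sum fun i _ => ?_) h5
  refine (norm_add_le _ _).trans (add_le_add ?_ (h3 i))
  rw [norm_smul, norm_eq_abs]
  gcongr
  exact h1 i

/-- The weighted `L²` estimate for second derivatives. -/
lemma Coef.elliptic_integral (ha : Coef K s a σ) (hn : n ≤ 4) (hn2 : 2 ≤ n) (hK : 0 ≤ K)
    (hε : 0 ≤ ε) {f : Eu n → W} (hf : ContDiff ℝ ∞ f) {s' : ℝ} (hs : s' < s) {φ : Eu n → ℝ}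
    (hφ : ContDiff ℝ ∞ φ) (hφs : SuppIn s' φ) :
    ∫ x, φ x ^ 2 * (√(quad ε a (grad f) x) ^ (n - 2)) ^ 2 * ∑ j, ‖hess f j x‖ ^ 2
      ≤ 16000 * ((∫ x, φ x ^ 2 * ‖divg σ a (flux ε a f) x‖ ^ 2)
        + ∫ x, (∑ i, pd i φ x ^ 2 + K ^ 2 * φ x ^ 2)
          * ((√(quad ε a (grad f) x) ^ (n - 2)) ^ 2 * quad ε a (grad f) x)) := by
  set w := quad ε a (grad f) with hw
  set V := flux ε a f with hV
  set D := divg σ a V with hD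
  have hVc : ContDiff ℝ 1 V := ha.contDiff_flux hn hε hf
  have hDc : Continuous D := ha.continuous_divg hVc
  have hwc : Continuous w := (contDiff_quad ε ha.smooth_a (contDiff_grad hf)).continuous
  have hφc := hφ.continuous
  have hφ1 : ContDiff ℝ 1 φ := hφ.of_le (by simp)
  have hpφ : ∀ i, Continuous (pd i φ) := fun i => continuous_pd hφ1 i
  have hhc := fun j => continuous_hess hf j
  have hVic : ∀ i, ContDiff ℝ 1 fun x => φ x • V x i := fun i =>
    hφ1.smul ((contDiff_piLp 2).1 hVc i)
  have hVis : ∀ i, SuppIn s' fun x => φ x • V x i := fun i x hx => by simp [hφs x hx]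
  have hder : ∀ i j x, pd j (fun x => φ x • V x i) x
      = φ x • fderiv ℝ V x (single j 1) i + pd j φ x • V x i := by
    intro i j x
    have h1 := hVc.differentiable one_ne_zero x
    rw [pd, fderiv_fun_smul (hφ1.differentiable one_ne_zero x) (differentiableAt_gr.1 h1 i)]
    simp only [_root_.add_apply, _root_.smul_apply, smulRight_apply]
    rw [← fderiv_gr_apply h1]; rfl
  set B : Eu n → ℝ := fun x => (∑ i, ∑ j, (inner ℝ (pd j (fun x => φ x • V x i) x)
      (pd i (fun x => φ x • V x j) x) : ℝ)) - ‖∑ i, pd i (fun x => φ x • V x i) x‖ ^ 2 with hB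
  have hpc : ∀ i j, Continuous (pd j (fun x => φ x • V x i)) := fun i j => continuous_pd (hVic i) j
  have hps : ∀ i j, SuppIn s' (pd j (fun x => φ x • V x i)) := fun i j => (hVis i).fderiv _
  have hBc : Continuous B := by
    simp only [hB]
    fun_prop
  have hBs : SuppIn s' B := by
    intro x hx
    simp [hB, fun i j => hps i j x hx]
  have hB0 : ∫ x, B x = 0 := by
    have hi : ∀ i j, Integrable fun x => (inner ℝ (pd j (fun x => φ x • V x i) x)
        (pd i (fun x => φ x • V x j) x) : ℝ) := fun i j =>
      SuppIn.integrable (s := s') fun x hx => by simp [hps i j x hx]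
    have hi' : ∀ i j, Integrable fun x => (inner ℝ (pd i (fun x => φ x • V x i) x)
        (pd j (fun x => φ x • V x j) x) : ℝ) := fun i j =>
      SuppIn.integrable (s := s') fun x hx => by simp [hps i i x hx]
    have e : ∀ x, B x = ∑ i, ∑ j, ((inner ℝ (pd j (fun x => φ x • V x i) x)
        (pd i (fun x => φ x • V x j) x) : ℝ) - inner ℝ (pd i (fun x => φ x • V x i) x)
        (pd j (fun x => φ x • V x j) x)) := by
      intro x
      simp only [hB, ← real_inner_self_eq_norm_sq, sum_inner, inner_sum, sum_sub_distrib]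
      congr 1
      rw [sum_comm]
    simp only [e]
    have hsub : ∀ i j, Integrable fun x => ((inner ℝ (pd j (fun x => φ x • V x i) x)
        (pd i (fun x => φ x • V x j) x) : ℝ) - inner ℝ (pd i (fun x => φ x • V x i) x)
        (pd j (fun x => φ x • V x j) x)) := fun i j => (hi i j).sub (hi' i j)
    rw [integral_finsetSum _ fun i _ => integrable_finsetSum _ fun j _ => hsub i j]
    refine sum_eq_zero fun i _ => ?_
    rw [integral_finsetSum _ fun j _ => hsub i j]
    refine sum_eq_zero fun j _ => ?_
    rw [integral_sub (hi i j) (hi' i j), sub_eq_zero]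
    exact integral_inner_fderiv_comm (hVic i) (hVic j) (hVis i) (hVis j) _ _
  have hpφs : ∀ i, SuppIn s' (pd i φ) := fun i => hφs.fderiv _
  have i1 : Integrable fun x => φ x ^ 2 * (√(w x) ^ (n - 2)) ^ 2 * ∑ j, ‖hess f j x‖ ^ 2 := hφs.integrable_of
  have i2 : Integrable fun x => φ x ^ 2 * ‖D x‖ ^ 2 := hφs.integrable_of
  have i3 : Integrable fun x => (∑ i, pd i φ x ^ 2 + K ^ 2 * φ x ^ 2)
          * ((√(w x) ^ (n - 2)) ^ 2 * w x) :=
    SuppIn.integrable (s := s') fun x hx => by simp [hφs x hx, fun i => hpφs i x hx]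
  have hpt : ∀ x, 1 / 4 * (φ x ^ 2 * (√(w x) ^ (n - 2)) ^ 2 * ∑ j, ‖hess f j x‖ ^ 2)
      ≤ B x + 4000 * (φ x ^ 2 * ‖D x‖ ^ 2 + (∑ i, pd i φ x ^ 2 + K ^ 2 * φ x ^ 2)
          * ((√(w x) ^ (n - 2)) ^ 2 * w x)) := by
    intro x
    by_cases hx : x ∈ 𝔻 s'
    · have hxs : x ∈ 𝔹 s := closedBall_subset_ball hs hx
      have := elliptic_pointwise hn (c := n - 2) (by omega)
        ((ha.near x).quad_nonneg hn hε (X := grad f)) hK (ha.near x) (X := grad f x)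
        (Y := fun j => hess f j x) (fun i j => pd_comm hf _ _ x)
        (wd := fun j => pd j w x) ((ha.near x).norm_sq_le_quad hn hε)
        (fun j => ha.pd_quad hn hf hxs j)
        (T := fun j => fderiv ℝ V x (single j 1)) (fun j => ha.fderiv_flux hn hε hf x j)
        (V := V x) rfl (D := D x) (ha.divg_sub_le hn hVc hxs) (φ x) (fun j => pd j φ x)
      simp only [hB, hder]
      exact this
    · rw [hBs x hx]
      simp [hφs x hx, fun i => hpφs i x hx]
  have i4 : Integrable fun x => φ x ^ 2 * ‖D x‖ ^ 2 + (∑ i, pd i φ x ^ 2 + K ^ 2 * φ x ^ 2)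
          * ((√(w x) ^ (n - 2)) ^ 2 * w x) := i2.add i3
  have hint := integral_mono (i1.const_mul (1 / 4)) ((hBs.integrable hBc).add (i4.const_mul 4000))
    hpt
  simp only [Pi.add_apply] at hint
  rw [integral_add (hBs.integrable hBc) (i4.const_mul 4000), hB0, integral_const_mul,
    integral_const_mul, integral_add i2 i3] at hint
  linarith

end Elliptic

/-- Hölder's inequality for weights adding up to `1`. -/
lemma integral_rpow_mul_rpow_le {X : Type*} [MeasurableSpace X] {μ : Measure X} {f g : X → ℝ}
    (hf : Integrable f μ) (hg : Integrable g μ) (hf0 : ∀ x, 0 ≤ f x) (hg0 : ∀ x, 0 ≤ g x) {p q : ℝ}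
    (hp : 0 ≤ p) (hq : 0 ≤ q) (hpq : p + q = 1) : Integrable (fun x => f x ^ p * g x ^ q) μ ∧
      ∫ x, f x ^ p * g x ^ q ∂μ ≤ (∫ x, f x ∂μ) ^ p * (∫ x, g x ∂μ) ^ q := by
  have hpow0 : ∀ x, 0 ≤ f x ^ p * g x ^ q := fun x =>
    mul_nonneg (rpow_nonneg (hf0 x) _) (rpow_nonneg (hg0 x) _)
  have hmeas : AEStronglyMeasurable (fun x => f x ^ p * g x ^ q) μ :=
    ((hf.aestronglyMeasurable.aemeasurable.pow_const p).mul
      (hg.aestronglyMeasurable.aemeasurable.pow_const q)).aestronglyMeasurable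
  have hle : ∀ x, f x ^ p * g x ^ q ≤ f x + g x := by
    intro x
    have := Real.geom_mean_le_arith_mean2_weighted hp hq (hf0 x) (hg0 x) hpq
    nlinarith [hf0 x, hg0 x]
  have hint : Integrable (fun x => f x ^ p * g x ^ q) μ := by
    refine Integrable.mono' (hf.add hg) hmeas (ae_of_all _ fun x => ?_)
    rw [norm_of_nonneg (hpow0 x)]
    exact hle x
  refine ⟨hint, ?_⟩
  have hF0 : 0 ≤ ∫ x, f x ∂μ := integral_nonneg hf0
  have hG0 : 0 ≤ ∫ x, g x ∂μ := integral_nonneg hg0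
  have key := ENNReal.lintegral_mul_norm_pow_le (μ := μ)
    hf.aestronglyMeasurable.aemeasurable.ennreal_ofReal
    hg.aestronglyMeasurable.aemeasurable.ennreal_ofReal hp hq hpq
  rw [← ofReal_integral_eq_lintegral_ofReal hf (ae_of_all _ hf0),
    ← ofReal_integral_eq_lintegral_ofReal hg (ae_of_all _ hg0),
    ofReal_rpow_of_nonneg hF0 hp, ofReal_rpow_of_nonneg hG0 hq, ← ofReal_mul (by positivity)] at key
  have e : ∀ x, ofReal (f x) ^ p * ofReal (g x) ^ q = ofReal (f x ^ p * g x ^ q) := by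
    intro x
    rw [ofReal_rpow_of_nonneg (hf0 x) hp, ofReal_rpow_of_nonneg (hg0 x) hq,
      ← ofReal_mul (rpow_nonneg (hf0 x) _)]
  simp only [e] at key
  rw [← ofReal_integral_eq_lintegral_ofReal hint (ae_of_all _ hpow0),
    ENNReal.ofReal_le_ofReal_iff (by positivity)] at key
  exact key

section Elliptic

variable {K s ε : ℝ} {a : Eu n → Mat n} {σ : Eu n → ℝ}

/-- The weighted second derivatives appearing in the Sobolev estimates. -/
def hessInt (ε : ℝ) (a : Eu n → Mat n) (f : Eu n → W) (φ : Eu n → ℝ) : ℝ :=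
  ∫ x, φ x ^ 2 * (√(quad ε a (grad f) x) ^ (n - 2)) ^ 2 * ∑ j, ‖hess f j x‖ ^ 2

/-- The lower order terms. -/
def lowInt (K ε : ℝ) (a : Eu n → Mat n) (f : Eu n → W) (φ : Eu n → ℝ) : ℝ :=
  ∫ x, (∑ i, pd i φ x ^ 2 + K ^ 2 * φ x ^ 2)
          * ((√(quad ε a (grad f) x) ^ (n - 2)) ^ 2 * quad ε a (grad f) x)

/-- A weighted Sobolev inequality for powers of the density. -/
lemma exists_weighted_sobolev (n : ℕ) (hn : n ≤ 4) (hn2 : 2 ≤ n) :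
    ∃ C : ℝ, 0 ≤ C ∧ ∀ {W : Type*} [NormedAddCommGroup W] [InnerProductSpace ℝ W]
      {K s s' ε : ℝ} {a : Eu n → Mat n} {σ : Eu n → ℝ} {f : Eu n → W}
      {φ : Eu n → ℝ} {B : Eu n → ℝ} {l : ℕ} {r : ℝ},
      Coef K s a σ → 0 ≤ K → 0 ≤ ε → ContDiff ℝ ∞ f → s' < s → ContDiff ℝ ∞ φ → SuppIn s' φ →
      1 ≤ l → l ≤ 2 → 1 ≤ r → r ≤ 3 → (n : ℝ) / 2 ≤ r →
      (∀ x, 0 ≤ B x) → Measurable B → Integrable (fun x => B x ^ n) → (∀ x ∈ 𝔻 s',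
        B x = |φ x| ^ (l - 1) * quad ε a (grad f) x ^ (r - ((n : ℝ) - 1) / 2)) →
      ∫ x, (φ x ^ l * quad ε a (grad f) x ^ r) ^ 2
        ≤ C * (hessInt ε a f φ + lowInt K ε a f φ) * (∫ x, B x ^ n) ^ (2 / (n : ℝ)) := by
  obtain ⟨C0, hC0, hsob⟩ := exists_sobolev_const n hn2
  refine ⟨C0 * 30000, by positivity, ?_⟩
  intro W _ _ K s s' ε a σ f φ B l r ha hK hε hf hs hφ hφs hl1 hl2 hr1 hr3 hrn hB0 hBm hBi hB
  set w := quad ε a (grad f) with hw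
  have hw0 : ∀ x, 0 ≤ w x := fun x => (ha.near x).quad_nonneg hn hε
  have hwsm : ContDiff ℝ ∞ w := contDiff_quad ε ha.smooth_a (contDiff_grad hf)
  have hw1 : ContDiff ℝ 1 w := hwsm.of_le (by simp)
  have hwc : Continuous w := hwsm.continuous
  have hφc := hφ.continuous
  have hφ1 : ContDiff ℝ 1 φ := hφ.of_le (by simp)
  have hpφ : ∀ i, Continuous (pd i φ) := fun i => continuous_pd hφ1 i
  have hpφs : ∀ i, SuppIn s' (pd i φ) := fun i => hφs.fderiv _
  have hhc := fun j => continuous_hess hf j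
  set p : Eu n → ℝ := fun x => √(w x) ^ (n - 2) with hp
  have hpc : Continuous p := by simp only [hp]; fun_prop
  have hp0 : ∀ x, 0 ≤ p x := fun x => by simp only [hp]; positivity
  set A : Eu n → ℝ := fun x => ∑ j, (2 * |pd j φ x| * (p x * √(w x))
    + (18 * |φ x| * (p x * ‖hess f j x‖) + 24 * (K * |φ x|) * (p x * √(w x)))) with hA
  have hAc : Continuous A := by simp only [hA]; fun_prop
  have hA0 : ∀ x, 0 ≤ A x := fun x => by
    simp only [hA]; have := hp0 x; positivity
  have hAs : SuppIn s' A := fun x hx => by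
    simp [hA, hφs x hx, fun i => hpφs i x hx]
  have hA2 : ∀ x, A x ^ 2 ≤ 30000 * (φ x ^ 2 * (p x) ^ 2 * ∑ j, ‖hess f j x‖ ^ 2
      + (∑ i, pd i φ x ^ 2 + K ^ 2 * φ x ^ 2) * ((p x) ^ 2 * w x)) := by
    intro x
    have h1 := sq_sum_le_card_mul_sum_sq (s := (Finset.univ : Finset (Fin n)))
      (f := fun j => (2 * |pd j φ x| * (p x * √(w x))
    + (18 * |φ x| * (p x * ‖hess f j x‖) + 24 * (K * |φ x|) * (p x * √(w x)))))
    simp only [Finset.card_univ, Fintype.card_fin] at h1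
    have hn' : (n : ℝ) ≤ 4 := by exact_mod_cast hn
    have h2 : A x ^ 2 ≤ 4 * ∑ j, (2 * |pd j φ x| * (p x * √(w x))
        + (18 * |φ x| * (p x * ‖hess f j x‖) + 24 * (K * |φ x|) * (p x * √(w x)))) ^ 2 :=
      h1.trans (by gcongr)
    have h3 : ∀ j, (2 * |pd j φ x| * (p x * √(w x))
        + (18 * |φ x| * (p x * ‖hess f j x‖) + 24 * (K * |φ x|) * (p x * √(w x)))) ^ 2
        ≤ 12 * (pd j φ x ^ 2 * (p x ^ 2 * w x)) + 972 * (φ x ^ 2 * p x ^ 2 * ‖hess f j x‖ ^ 2)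
          + 1728 * (K ^ 2 * φ x ^ 2 * (p x ^ 2 * w x)) := by
      intro j
      have e1 : pd j φ x ^ 2 = |pd j φ x| ^ 2 := (sq_abs _).symm
      have e2 : φ x ^ 2 = |φ x| ^ 2 := (sq_abs _).symm
      have e3 : w x = √(w x) ^ 2 := (sq_sqrt (hw0 x)).symm
      rw [e1, e2, show p x ^ 2 * w x = p x ^ 2 * √(w x) ^ 2 by rw [← e3]]
      set u := 2 * |pd j φ x| * (p x * √(w x))
      set v := 18 * |φ x| * (p x * ‖hess f j x‖)
      set z := 24 * (K * |φ x|) * (p x * √(w x))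
      have : (u + (v + z)) ^ 2 ≤ 3 * u ^ 2 + 3 * v ^ 2 + 3 * z ^ 2 := by
        nlinarith [sq_nonneg (u - v), sq_nonneg (u - z), sq_nonneg (v - z)]
      refine this.trans_eq ?_
      simp only [u, v, z]; ring
    have h4 := h2.trans (mul_le_mul_of_nonneg_left (sum_le_sum fun j _ => h3 j) (by norm_num))
    simp only [sum_add_distrib, ← mul_sum, ← sum_mul, sum_const,
      Finset.card_univ, Fintype.card_fin, nsmul_eq_mul] at h4
    have h5 : 0 ≤ K ^ 2 * φ x ^ 2 * (p x ^ 2 * w x) := by have := hw0 x; positivity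
    have h6 : (n : ℝ) * (1728 * (K ^ 2 * φ x ^ 2 * (p x ^ 2 * w x)))
        ≤ 4 * (1728 * (K ^ 2 * φ x ^ 2 * (p x ^ 2 * w x))) := by gcongr
    have h7 : 0 ≤ (∑ i, pd i φ x ^ 2) * (p x ^ 2 * w x) := by have := hw0 x; positivity
    have h8 : 0 ≤ φ x ^ 2 * p x ^ 2 * ∑ j, ‖hess f j x‖ ^ 2 := by positivity
    linarith
  have i1 : Integrable fun x => φ x ^ 2 * (p x) ^ 2 * ∑ j, ‖hess f j x‖ ^ 2 := hφs.integrable_of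
  have i2 : Integrable fun x => (∑ i, pd i φ x ^ 2 + K ^ 2 * φ x ^ 2) * ((p x) ^ 2 * w x) :=
    SuppIn.integrable (s := s') fun x hx => by simp [hφs x hx, fun i => hpφs i x hx]
  have hAi : Integrable fun x => A x ^ 2 := hAs.integrable_of
  have hAint : ∫ x, A x ^ 2 ≤ 30000 * (hessInt ε a f φ + lowInt K ε a f φ) := by
    refine (integral_mono hAi ((i1.add i2).const_mul 30000) hA2).trans_eq ?_
    simp only [Pi.add_apply]
    rw [integral_const_mul, integral_add i1 i2]
    rfl
  set β := r - ((n : ℝ) - 1) / 2 with hβ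
  have hβ0 : 0 < β := by rw [hβ]; linarith
  have hw_pow : ∀ x, w x ^ r = p x * √(w x) * w x ^ β := by
    intro x
    have e : p x * √(w x) = w x ^ (((n : ℝ) - 1) / 2) := by
      simp only [hp]
      rw [← pow_succ, sqrt_eq_rpow, ← rpow_natCast, ← rpow_mul (hw0 x)]
      congr 1
      have : ((n - 2 + 1 : ℕ) : ℝ) = (n : ℝ) - 1 := by
        rw [show n - 2 + 1 = n - 1 by omega, Nat.cast_sub (by omega)]; simp
      rw [this]; ring
    rw [e, ← Real.rpow_add' (hw0 x) (by rw [hβ]; linarith)]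
    congr 1; rw [hβ]; ring
  have hw_pow1 : ∀ x, w x ^ (r - 1) * √(w x) = p x * w x ^ β := by
    intro x
    have e : p x = w x ^ (((n : ℝ) - 2) / 2) := by
      simp only [hp]
      rw [sqrt_eq_rpow, ← rpow_natCast, ← rpow_mul (hw0 x), Nat.cast_sub hn2]
      congr 1
      push_cast; ring
    have hn2' : (2 : ℝ) ≤ n := by exact_mod_cast hn2
    rw [e, sqrt_eq_rpow, ← Real.rpow_add' (hw0 x) (by linarith),
      ← Real.rpow_add' (hw0 x) (by rw [hβ]; linarith)]
    congr 1; rw [hβ]; ring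
  have hgsm : ContDiff ℝ 1 fun x => φ x ^ l * w x ^ r :=
    (hφ1.pow l).mul (ContDiff.rpow_const_of_le hw1 (by simpa using hr1))
  have hgs : SuppIn s' fun x => φ x ^ l * w x ^ r := fun x hx => by
    simp [hφs x hx, show l ≠ 0 by omega]
  have hgd : ∀ x, ‖fderiv ℝ (fun x => φ x ^ l * w x ^ r) x‖ ≤ A x * B x := by
    intro x
    by_cases hx : x ∈ 𝔻 s'
    swap
    · have h0 : fderiv ℝ (fun x => φ x ^ l * w x ^ r) x = 0 := by
        ext v; exact hgs.fderiv v x hx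
      rw [h0, norm_zero]
      exact mul_nonneg (hA0 x) (hB0 x)
    have hxs : x ∈ 𝔹 s := closedBall_subset_ball hs hx
    refine (norm_fderiv_le_sum _ _).trans ?_
    rw [hA, sum_mul]
    refine sum_le_sum fun j _ => ?_
    have hd : pd j (fun x => φ x ^ l * w x ^ r) x
        = (l * φ x ^ (l - 1) * pd j φ x) * w x ^ r + φ x ^ l * (r * w x ^ (r - 1) * pd j w x) := by
      have d1 := ((hφ1.differentiable one_ne_zero x).hasFDerivAt.pow l)
      have d2 := (hw1.differentiable one_ne_zero x).hasFDerivAt.rpow_const (p := r) (Or.inr hr1)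
      have d3 : fderiv ℝ (fun x => φ x ^ l * w x ^ r) x = _ := (d1.mul d2).fderiv
      rw [pd, d3]
      simp [pd]
      ring
    have hwj : |pd j w x| ≤ 6 * (√(w x) * ‖hess f j x‖) + 8 * K * w x := by
      have h1 := abs_le.1 (ha.pd_quad hn hf hxs j (ε := ε))
      have h2 := abs_le.1 (abs_real_inner_le_norm (grad f x) (hess f j x))
      have h3 : ‖grad f x‖ ^ 2 ≤ 2 * w x := (ha.near x).norm_sq_le_quad hn hε
      have h4 : ‖grad f x‖ ≤ 3 / 2 * √(w x) := by
        refine abs_le_of_sq_le_sq' ?_ (by positivity) |>.2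
        rw [mul_pow, sq_sqrt (hw0 x)]; linarith [hw0 x]
      have h5 : ‖grad f x‖ * ‖hess f j x‖ ≤ 3 / 2 * √(w x) * ‖hess f j x‖ := by gcongr
      have h6 : 4 * K * ‖grad f x‖ ^ 2 ≤ 4 * K * (2 * w x) := by gcongr
      have h7 : 0 ≤ √(w x) * ‖hess f j x‖ := by positivity
      rw [abs_le]
      constructor <;> linarith [h1.1, h1.2, h2.1, h2.2]
    have hl : (l : ℝ) ≤ 2 := by exact_mod_cast hl2
    have hφl : |φ x ^ l| = |φ x| ^ (l - 1) * |φ x| := by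
      rw [abs_pow, ← pow_succ]; congr 1; omega
    have hwr : 0 ≤ w x ^ (r - 1) := rpow_nonneg (hw0 x) _
    have hwβ : 0 ≤ w x ^ β := rpow_nonneg (hw0 x) _
    have hwr1 : w x ^ (r - 1) * w x = p x * √(w x) * w x ^ β := by
      have := hw_pow1 x
      calc w x ^ (r - 1) * w x = w x ^ (r - 1) * (√(w x) * √(w x)) := by
            rw [mul_self_sqrt (hw0 x)]
        _ = (w x ^ (r - 1) * √(w x)) * √(w x) := by ring
        _ = _ := by rw [this]; ring
    rw [hd, hB x hx, norm_eq_abs]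
    refine (abs_add_le _ _).trans ?_
    have t1 : |l * φ x ^ (l - 1) * pd j φ x * w x ^ r|
        ≤ 2 * |pd j φ x| * (p x * √(w x)) * (|φ x| ^ (l - 1) * w x ^ β) := by
      rw [abs_mul, abs_mul, abs_mul, abs_pow, Nat.abs_cast, abs_of_nonneg (rpow_nonneg (hw0 x) r),
        hw_pow x]
      have : 0 ≤ |φ x| ^ (l - 1) * |pd j φ x| * (p x * √(w x) * w x ^ β) := by
        have := hp0 x; positivity
      nlinarith
    have t2 : |φ x ^ l * (r * w x ^ (r - 1) * pd j w x)|
        ≤ (18 * |φ x| * (p x * ‖hess f j x‖) + 24 * (K * |φ x|) * (p x * √(w x)))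
          * (|φ x| ^ (l - 1) * w x ^ β) := by
      rw [abs_mul, abs_mul, abs_mul, hφl, abs_of_nonneg hwr, abs_of_nonneg (by linarith : 0 ≤ r)]
      calc |φ x| ^ (l - 1) * |φ x| * (r * w x ^ (r - 1) * |pd j w x|)
          ≤ |φ x| ^ (l - 1) * |φ x| * (3 * w x ^ (r - 1)
            * (6 * (√(w x) * ‖hess f j x‖) + 8 * K * w x)) := by gcongr
        _ = |φ x| ^ (l - 1) * |φ x| * (18 * ((w x ^ (r - 1) * √(w x)) * ‖hess f j x‖)
            + 24 * K * (w x ^ (r - 1) * w x)) := by ring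
        _ = _ := by rw [hw_pow1 x, hwr1]; ring
    exact (add_le_add t1 t2).trans_eq (by ring)
  have := hsob s' _ A B hgsm hgs hA0 hB0 hAc.measurable hBm hAi hBi hgd
  refine this.trans ?_
  have h9 : 0 ≤ (∫ x, B x ^ n) ^ (2 / (n : ℝ)) :=
    rpow_nonneg (integral_nonneg fun x => pow_nonneg (hB0 x) n) _
  calc C0 * (∫ x, A x ^ 2) * (∫ x, B x ^ n) ^ (2 / (n : ℝ))
      ≤ C0 * (30000 * (hessInt ε a f φ + lowInt K ε a f φ)) * (∫ x, B x ^ n) ^ (2 / (n : ℝ)) := by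
        gcongr
    _ = _ := by ring

end Elliptic

section Elliptic

lemma sqrt_pow_eq_rpow {w : ℝ} (hw : 0 ≤ w) (k : ℕ) : √w ^ k = w ^ ((k : ℝ) / 2) := by
  rw [sqrt_eq_rpow, ← rpow_natCast, ← rpow_mul hw]; congr 1; ring

lemma cutoff_power_le {n : ℕ} (hn : n ≤ 4) (hn2 : 2 ≤ n) {z w M : ℝ} (z0 : 0 ≤ z) (z1 : z ≤ 1)
    (hw : 0 ≤ w) (hM : 0 ≤ M) : M * z ^ 6 * w ^ (n - 1) ≤ (z ^ 4) ^ 2 * w ^ n + M ^ n := by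
  set y := z ^ 2 * w with hy
  have hy0 : 0 ≤ y := by positivity
  have hwn : w ^ n = w ^ (n - 1) * w := by rw [← pow_succ]; congr 1; omega
  have e4 : 0 ≤ (z ^ 4) ^ 2 * w ^ n := by positivity
  have e5 : 0 ≤ M ^ n := by positivity
  rcases le_or_gt M y with hMy | hMy
  · have : M * z ^ 6 * w ^ (n - 1) ≤ y * z ^ 6 * w ^ (n - 1) := by gcongr
    have e : y * z ^ 6 * w ^ (n - 1) = (z ^ 4) ^ 2 * w ^ n := by
      rw [hwn, hy]; ring
    linarith
  · have e : z ^ 6 * w ^ (n - 1) = z ^ (8 - 2 * n) * y ^ (n - 1) := by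
      rw [hy, mul_pow, ← pow_mul, ← mul_assoc, ← pow_add]; congr 2; omega
    have e2 : z ^ (8 - 2 * n) * y ^ (n - 1) ≤ 1 * M ^ (n - 1) := by
      gcongr
      exact pow_le_one₀ z0 z1
    have e3 : M ^ n = M * M ^ (n - 1) := by rw [← pow_succ']; congr 1; omega
    rw [mul_assoc, e, e3]
    have := mul_le_mul_of_nonneg_left e2 hM
    linarith

set_option maxHeartbeats 1600000 in
/-- The estimate for the second derivatives of a map with small energy, whose tension is
`τ` up to a term of quadratic growth. -/
lemma exists_elliptic (n : ℕ) (hn : n ≤ 4) (hn2 : 2 ≤ n) (CN : ℝ) (hCN : 0 ≤ CN) :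
    ∃ ε₁ : ℝ, 0 < ε₁ ∧ ε₁ ≤ 1 ∧ ∀ (K s s' : ℝ) (ζ : Eu n → ℝ), 0 ≤ K → s' < s →
      ContDiff ℝ ∞ ζ → SuppIn s' ζ → (∀ x, 0 ≤ ζ x) → (∀ x, ζ x ≤ 1) →
      ∃ C : ℝ, 0 ≤ C ∧ ∀ {W : Type*} [NormedAddCommGroup W] [InnerProductSpace ℝ W] (ε : ℝ)
        (a : Eu n → Mat n) (σ : Eu n → ℝ) (f τ : Eu n → W),
        Coef K s a σ → 0 ≤ ε → ContDiff ℝ ∞ f → Continuous τ →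
        (∀ x ∈ 𝔹 s, ‖τ x - divg σ a (flux ε a f) x‖ ≤ CN * √(quad ε a (grad f) x) ^ n) →
        ∫ x in 𝔹 s, √(quad ε a (grad f) x) ^ n ≤ ε₁ →
        hessInt ε a f (fun x => ζ x ^ 4) ≤ C * (1 + ∫ x, (ζ x ^ 4) ^ 2 * ‖τ x‖ ^ 2) ∧
        ∫ x, (ζ x ^ 4) ^ 4 * √(quad ε a (grad f) x) ^ (3 * n)
          ≤ C * (1 + ∫ x, (ζ x ^ 4) ^ 2 * ‖τ x‖ ^ 2) ^ 2 := by
  obtain ⟨C2, hC2, hsob⟩ := exists_weighted_sobolev n hn hn2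
  have hn0 : (0 : ℝ) < n := by positivity
  have hn2' : (2 : ℝ) ≤ n := by exact_mod_cast hn2
  have hn4' : (n : ℝ) ≤ 4 := by exact_mod_cast hn
  set N0 : ℝ := 16000 * (2 * CN ^ 2 + 1) with hN0
  have hN0p : 0 < N0 := by positivity
  set δ : ℝ := 1 / (4 * (N0 + 1)) with hδ
  have hδp : 0 < δ := by positivity
  have hδN : N0 * δ ≤ 1 / 4 := by rw [hδ, mul_one_div, div_le_div_iff₀ (by positivity) (by norm_num)]; linarith
  have hδ4 : δ ≤ 1 / 4 := by rw [hδ]; gcongr; linarith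
  set ε₁ : ℝ := min 1 ((δ / (C2 + 1)) ^ ((n : ℝ) / 2)) with hε₁
  have hε₁p : 0 < ε₁ := lt_min one_pos (by positivity)
  have hε₁δ : C2 * ε₁ ^ (2 / (n : ℝ)) ≤ δ := by
    have h1 : ε₁ ^ (2 / (n : ℝ)) ≤ δ / (C2 + 1) := by
      calc ε₁ ^ (2 / (n : ℝ)) ≤ ((δ / (C2 + 1)) ^ ((n : ℝ) / 2)) ^ (2 / (n : ℝ)) := by
            gcongr; exact min_le_right _ _
        _ = _ := by
            rw [← rpow_mul (by positivity)]
            rw [show (n : ℝ) / 2 * (2 / n) = 1 by field_simp, Real.rpow_one]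
    calc C2 * ε₁ ^ (2 / (n : ℝ)) ≤ C2 * (δ / (C2 + 1)) := by gcongr
      _ ≤ (C2 + 1) * (δ / (C2 + 1)) := by gcongr; linarith
      _ = δ := by field_simp
  refine ⟨ε₁, hε₁p, min_le_left _ _, ?_⟩
  intro K s s' ζ hK hs hζ hζs hζ0 hζ1
  have hζ1' : ContDiff ℝ 1 ζ := hζ.of_le (by simp)
  have hpζ : ∀ i, Continuous (pd i ζ) := fun i => continuous_pd hζ1' i
  have hζc := hζ.continuous
  obtain ⟨G, hG⟩ := (isCompact_closedBall (0 : Eu n) s').exists_bound_of_continuousOn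
    (f := fun x => ∑ i, pd i ζ x ^ 2) (by fun_prop)
  set M : ℝ := 16 * |G| + K ^ 2 with hM
  have hM0 : 0 ≤ M := by positivity
  set vol : ℝ := (volume (𝔻 s')).toReal with hvol
  have hvol0 : 0 ≤ vol := ENNReal.toReal_nonneg
  set C3 : ℝ := M ^ n * vol with hC3
  have hC30 : 0 ≤ C3 := by positivity
  set C4 : ℝ := 200000 + 200000 * C3 with hC4
  have hC40 : 0 ≤ C4 := by positivity
  refine ⟨C4 + C2 ^ 2 * C4 ^ 2, by positivity, ?_⟩
  intro W _ _ ε a σ f τ ha hε hf hτ hτD hsmall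
  set φ : Eu n → ℝ := fun x => ζ x ^ 4 with hφ
  have hφsm : ContDiff ℝ ∞ φ := hζ.pow 4
  have hφs : SuppIn s' φ := fun x hx => by simp [hφ, hζs x hx]
  have hφc := hφsm.continuous
  have hφ1 : ContDiff ℝ 1 φ := hφsm.of_le (by simp)
  have hpφ : ∀ i, Continuous (pd i φ) := fun i => continuous_pd hφ1 i
  have hpφs : ∀ i, SuppIn s' (pd i φ) := fun i => hφs.fderiv _
  have hEll := ha.elliptic_integral hn hn2 hK hε hf hs hφsm hφs
  set w := quad ε a (grad f) with hw
  have hw0 : ∀ x, 0 ≤ w x := fun x => (ha.near x).quad_nonneg hn hε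
  have hwc : Continuous w := (contDiff_quad ε ha.smooth_a (contDiff_grad hf)).continuous
  set D := divg σ a (flux ε a f) with hD
  have hDc : Continuous D := ha.continuous_divg (ha.contDiff_flux hn hε hf)
  set X := hessInt ε a f φ with hX
  set Lo := lowInt K ε a f φ with hLo
  set T := ∫ x, φ x ^ 2 * ‖τ x‖ ^ 2 with hT
  set S := ∫ x, φ x ^ 2 * (√(w x) ^ n) ^ 2 with hS
  set Q := ∫ x, φ x ^ 4 * √(w x) ^ (3 * n) with hQ
  have hX0 : 0 ≤ X := integral_nonneg fun x => by positivity
  have hLo0 : 0 ≤ Lo := integral_nonneg fun x => by have := hw0 x; positivity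
  have hT0 : 0 ≤ T := integral_nonneg fun x => by positivity
  have hS0 : 0 ≤ S := integral_nonneg fun x => by positivity
  have hQ0 : 0 ≤ Q := integral_nonneg fun x => by
    have := hζ0 x; positivity
  have iS : Integrable fun x => φ x ^ 2 * (√(w x) ^ n) ^ 2 := hφs.integrable_of
  have iT : Integrable fun x => φ x ^ 2 * ‖τ x‖ ^ 2 := hφs.integrable_of
  have iD : Integrable fun x => φ x ^ 2 * ‖D x‖ ^ 2 := hφs.integrable_of
  have iL : Integrable fun x => (∑ i, pd i φ x ^ 2 + K ^ 2 * φ x ^ 2)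
          * ((√(w x) ^ (n - 2)) ^ 2 * w x) :=
    SuppIn.integrable (s := s') fun x hx => by simp [hφs x hx, fun i => hpφs i x hx]
  have iQ : Integrable fun x => φ x ^ 4 * √(w x) ^ (3 * n) := hφs.integrable_of
  have isw : IntegrableOn (fun x => √(w x) ^ n) (𝔹 s) :=
    ((by fun_prop : Continuous fun x => √(w x) ^ n).continuousOn.integrableOn_compact
      (isCompact_closedBall (0 : Eu n) s)).mono_set ball_subset_closedBall
  have hsmall' : ∫ x in 𝔻 s', √(w x) ^ n ≤ ε₁ :=
    (setIntegral_mono_set isw (ae_of_all _ fun x => by positivity)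
      (closedBall_subset_ball hs).eventuallyLE).trans hsmall
  have h1 : ∫ x, φ x ^ 2 * ‖D x‖ ^ 2 ≤ 2 * T + 2 * CN ^ 2 * S := by
    rw [hT, hS, ← integral_const_mul, ← integral_const_mul, ← integral_add (iT.const_mul _)
      (iS.const_mul _)]
    refine integral_mono iD ((iT.const_mul _).add (iS.const_mul _)) fun x => ?_
    simp only [Pi.add_apply]
    by_cases hx : x ∈ 𝔻 s'
    · have hxs : x ∈ 𝔹 s := closedBall_subset_ball hs hx
      have e1 : ‖D x‖ ≤ ‖τ x‖ + CN * √(w x) ^ n := by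
        have := norm_sub_norm_le (D x) (τ x)
        rw [norm_sub_rev] at this
        linarith [hτD x hxs]
      have e2 : ‖D x‖ ^ 2 ≤ (‖τ x‖ + CN * √(w x) ^ n) ^ 2 := by gcongr
      have e3 : ‖D x‖ ^ 2 ≤ 2 * ‖τ x‖ ^ 2 + 2 * (CN ^ 2 * (√(w x) ^ n) ^ 2) := by
        have := add_sq_le (a := ‖τ x‖) (b := CN * √(w x) ^ n)
        rw [mul_pow CN] at this
        linarith
      have := mul_le_mul_of_nonneg_left e3 (sq_nonneg (φ x))
      linarith
    · simp [hφs x hx]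
  have h2 : Lo ≤ S + C3 := by
    have iC : Integrable ((𝔻 s').indicator fun _ => M ^ n) :=
      (integrable_indicator_iff measurableSet_closedBall).2
        (integrableOn_const (isCompact_closedBall (0 : Eu n) s').measure_ne_top)
    have e0 : ∫ x, (closedBall (0 : Eu n) s').indicator (fun _ => M ^ n) x = C3 := by
      rw [integral_indicator measurableSet_closedBall, setIntegral_const]
      simp [hC3, hvol, Measure.real, mul_comm]
    rw [← e0, hS, ← integral_add iS iC]
    refine integral_mono iL (iS.add iC) fun x => ?_
    simp only [Pi.add_apply]
    by_cases hx : x ∈ 𝔻 s'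
    · rw [indicator_of_mem hx]
      have d1 : ∀ i, pd i φ x = 4 * ζ x ^ 3 * pd i ζ x := by
        intro i
        have := ((hζ1'.differentiable one_ne_zero x).hasFDerivAt.pow 4).fderiv
        have h' : fderiv ℝ φ x = _ := this
        rw [pd, h']
        simp [pd]
      have z0 := hζ0 x
      have z1 := hζ1 x
      have g1 : ∑ i, pd i ζ x ^ 2 ≤ |G| := by
        have := hG x hx
        rw [norm_of_nonneg (by positivity)] at this
        exact this.trans (le_abs_self G)
      have g2 : ∑ i, pd i φ x ^ 2 + K ^ 2 * φ x ^ 2 ≤ M * ζ x ^ 6 := by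
        have d2 : ∑ i, pd i φ x ^ 2 = 16 * ((ζ x ^ 3) ^ 2 * ∑ i, pd i ζ x ^ 2) := by
          rw [mul_sum, mul_sum]
          exact sum_congr rfl fun i _ => by rw [d1]; ring
        have d3 : (ζ x ^ 3) ^ 2 = ζ x ^ 6 := by ring
        have e2 : K ^ 2 * (ζ x ^ 4) ^ 2 ≤ K ^ 2 * ζ x ^ 6 := by
          have : ζ x ^ 8 ≤ ζ x ^ 6 := pow_le_pow_of_le_one z0 z1 (by norm_num)
          have : (ζ x ^ 4) ^ 2 ≤ ζ x ^ 6 := by rw [← pow_mul]; exact this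
          gcongr
        have e3 : (ζ x ^ 3) ^ 2 * ∑ i, pd i ζ x ^ 2 ≤ (ζ x ^ 3) ^ 2 * |G| := by gcongr
        rw [d2, hM]
        rw [d3] at e3 ⊢
        have : φ x ^ 2 = (ζ x ^ 4) ^ 2 := rfl
        rw [this]
        linarith
      have hp : (√(w x) ^ (n - 2)) ^ 2 * w x = w x ^ (n - 1) := by
        rw [← pow_mul, mul_comm (n - 2) 2, pow_mul, sq_sqrt (hw0 x), ← pow_succ]
        congr 1; omega
      have hp2 : (√(w x) ^ n) ^ 2 = w x ^ n := by
        rw [← pow_mul, mul_comm n 2, pow_mul, sq_sqrt (hw0 x)]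
      have hwx := hw0 x
      rw [hp, hp2]
      have g3 : (∑ i, pd i φ x ^ 2 + K ^ 2 * φ x ^ 2) * w x ^ (n - 1)
          ≤ M * ζ x ^ 6 * w x ^ (n - 1) := by gcongr
      exact g3.trans (cutoff_power_le hn hn2 z0 z1 hwx hM0)
    · rw [indicator_of_notMem hx]
      simp [hφs x hx, fun i => hpφs i x hx]
  set F : Eu n → ℝ := (𝔻 s').indicator fun x => √(w x) ^ n with hF
  have hFi : Integrable F := by
    rw [hF, integrable_indicator_iff measurableSet_closedBall]
    exact isw.mono_set (closedBall_subset_ball hs)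
  have hF0 : ∀ x, 0 ≤ F x := fun x => indicator_nonneg (fun _ _ => by positivity) x
  have hFle : ∫ x, F x ≤ ε₁ := by rwa [hF, integral_indicator measurableSet_closedBall]
  have h3 : S ≤ δ * (X + Lo) := by
    have hr : (n : ℝ) / 2 - ((n : ℝ) - 1) / 2 = 1 / 2 := by ring
    have eF : (fun x => (𝔻 s').indicator (fun x => √(w x)) x ^ n) = F := by
      funext x
      by_cases hx : x ∈ 𝔻 s'
      · simp only [hF, indicator_of_mem hx]
      · simp [hF, indicator_of_notMem hx, show n ≠ 0 by omega]
    have hB := hsob (B := (𝔻 s').indicator fun x => √(w x)) (l := 1)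
      (r := (n : ℝ) / 2) ha hK hε hf hs hφsm hφs le_rfl (by norm_num) (by linarith) (by linarith)
      le_rfl (fun x => indicator_nonneg (fun _ _ => sqrt_nonneg _) x)
      (hwc.sqrt.measurable.indicator measurableSet_closedBall) (by rwa [eF])
      (by
        intro x hx
        rw [indicator_of_mem hx, hr, sqrt_eq_rpow]; simp; rfl)
    rw [eF] at hB
    have e2 : ∫ x, (φ x ^ 1 * w x ^ ((n : ℝ) / 2)) ^ 2 = S := by
      rw [hS]; congr 1; funext x
      rw [sqrt_pow_eq_rpow (hw0 x)]; ring
    have e3 : 0 ≤ ∫ x, F x := integral_nonneg hF0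
    rw [← e2]
    refine hB.trans ?_
    calc C2 * (X + Lo) * _ ≤ C2 * (X + Lo) * ε₁ ^ (2 / (n : ℝ)) := by gcongr
      _ = C2 * ε₁ ^ (2 / (n : ℝ)) * (X + Lo) := by ring
      _ ≤ _ := by gcongr
  have h4 : Q ≤ C2 ^ 2 * (X + Lo) ^ 2 := by
    set β : ℝ := 3 * (n : ℝ) / 4 - ((n : ℝ) - 1) / 2 with hβ
    have hβ0 : 0 < β := by rw [hβ]; linarith
    have hφ0 : ∀ x, 0 ≤ φ x := fun x => by have := hζ0 x; positivity
    have hHol := integral_rpow_mul_rpow_le hFi iQ hF0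
      (fun x => by have := hφ0 x; positivity) (p := 1 - (n : ℝ) / 4) (q := (n : ℝ) / 4)
      (by linarith) (by positivity) (by ring)
    have hBe : (fun x => (|φ x| ^ (2 - 1) * w x ^ β) ^ n)
        = fun x => F x ^ (1 - (n : ℝ) / 4) * (φ x ^ 4 * √(w x) ^ (3 * n)) ^ ((n : ℝ) / 4) := by
      funext x
      by_cases hx : x ∈ 𝔻 s'
      · rw [hF, indicator_of_mem hx, sqrt_pow_eq_rpow (hw0 x), sqrt_pow_eq_rpow (hw0 x),
          Real.mul_rpow (by have := hφ0 x; positivity) (rpow_nonneg (hw0 x) _),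
          ← rpow_mul (hw0 x), ← rpow_mul (hw0 x)]
        have e1 : (φ x ^ 4) ^ ((n : ℝ) / 4) = φ x ^ n := by
          rw [← rpow_natCast, ← rpow_mul (hφ0 x), ← rpow_natCast (φ x) n]
          congr 1; push_cast; ring
        rw [e1, mul_left_comm, ← Real.rpow_add_of_nonneg (hw0 x)
          (mul_nonneg (by positivity) (by linarith)) (by positivity), mul_pow,
          ← rpow_natCast (w x ^ β) n, ← rpow_mul (hw0 x), abs_of_nonneg (hφ0 x)]
        simp only [Nat.add_one_sub_one, pow_one]
        congr 2
        rw [hβ]; push_cast; ring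
      · simp only [hφs x hx]
        rw [abs_zero]
        simp [show n ≠ 0 by omega]
    have hB := hsob (B := fun x => |φ x| ^ (2 - 1) * w x ^ β) (l := 2) (r := 3 * (n : ℝ) / 4)
      ha hK hε hf hs hφsm hφs (by norm_num) le_rfl (by linarith) (by linarith) (by linarith)
      (fun x => mul_nonneg (by positivity) (rpow_nonneg (hw0 x) _))
      (((hφc.abs.pow _).mul (hwc.rpow_const fun x => Or.inr hβ0.le)).measurable)
      (by rw [hBe]; exact hHol.1) (fun x _ => rfl)
    have e2 : ∫ x, (φ x ^ 2 * w x ^ (3 * (n : ℝ) / 4)) ^ 2 = Q := by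
      rw [hQ]; congr 1; funext x
      rw [sqrt_pow_eq_rpow (hw0 x), mul_pow, ← rpow_natCast (w x ^ (3 * (n : ℝ) / 4)) 2,
        ← rpow_mul (hw0 x)]
      rw [← pow_mul]
      congr 2
      push_cast; ring
    rw [e2] at hB
    have e3 : (∫ x, (|φ x| ^ (2 - 1) * w x ^ β) ^ n) ^ (2 / (n : ℝ)) ≤ √Q := by
      have f1 : ∫ x, (|φ x| ^ (2 - 1) * w x ^ β) ^ n ≤ Q ^ ((n : ℝ) / 4) := by
        rw [hBe]
        refine hHol.2.trans ?_
        have : (∫ x, F x) ^ (1 - (n : ℝ) / 4) ≤ 1 :=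
          Real.rpow_le_one (integral_nonneg hF0) (hFle.trans (min_le_left _ _)) (by linarith)
        calc _ ≤ 1 * Q ^ ((n : ℝ) / 4) := by gcongr
          _ = _ := one_mul _
      calc _ ≤ (Q ^ ((n : ℝ) / 4)) ^ (2 / (n : ℝ)) := by
            gcongr
            exact integral_nonneg fun x =>
              pow_nonneg (mul_nonneg (by positivity) (rpow_nonneg (hw0 x) _)) _
        _ = _ := by
            rw [← rpow_mul hQ0, sqrt_eq_rpow]
            congr 1; field_simp; norm_num
    have e4 : Q ≤ C2 * (X + Lo) * √Q := hB.trans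
      (mul_le_mul_of_nonneg_left e3 (mul_nonneg hC2 (add_nonneg hX0 hLo0)))
    have e5 : √Q ≤ C2 * (X + Lo) := by
      rcases (sqrt_nonneg Q).eq_or_lt with h | h
      · rw [← h]; positivity
      · refine le_of_mul_le_mul_right ?_ h
        rwa [mul_self_sqrt hQ0]
    calc Q = √Q ^ 2 := (sq_sqrt hQ0).symm
      _ ≤ (C2 * (X + Lo)) ^ 2 := by gcongr
      _ = _ := by ring
  have h5 : X ≤ 16000 * ((2 * T + 2 * CN ^ 2 * S) + Lo) := hEll.trans (by gcongr; exact le_rfl)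
  have h6 : S ≤ 2 * δ * (X + C3) := by
    have e1 := mul_le_mul_of_nonneg_left h2 hδp.le
    have e2 := mul_le_mul_of_nonneg_right hδ4 hS0
    have e3 : 0 ≤ δ * (X + C3) := by positivity
    linarith
  have h7 : X ≤ 32000 * T + N0 * S + 16000 * C3 := by rw [hN0]; linarith
  have h8 : X ≤ 64000 * T + 32001 * C3 := by
    have e1 : N0 * S ≤ N0 * (2 * δ * (X + C3)) := by gcongr
    have e2 := mul_le_mul_of_nonneg_right hδN (add_nonneg hX0 hC30)
    linarith
  have h9 : X + Lo ≤ C4 * (1 + T) := by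
    have e1 := mul_le_mul_of_nonneg_right hδ4 (add_nonneg hX0 hC30)
    have e2 : C4 * (1 + T) = 200000 + 200000 * T + 200000 * C3 + 200000 * (C3 * T) := by
      rw [hC4]; ring
    have := mul_nonneg hC30 hT0
    linarith
  have hpos : 0 ≤ C2 ^ 2 * C4 ^ 2 := by positivity
  constructor
  · calc X ≤ C4 * (1 + T) := by linarith
      _ ≤ _ := by gcongr; linarith
  · calc Q ≤ C2 ^ 2 * (X + Lo) ^ 2 := h4
      _ ≤ C2 ^ 2 * (C4 * (1 + T)) ^ 2 := by gcongr
      _ = C2 ^ 2 * C4 ^ 2 * (1 + T) ^ 2 := by ring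
      _ ≤ _ := by gcongr; linarith

end Elliptic

section SpaceTime


lemma contDiff_norm_pow_smul {P : Type*} [NormedAddCommGroup P] [NormedSpace ℝ P] (l : ℕ) {v : P → W}
    (hv : ContDiff ℝ 1 v) : ContDiff ℝ 1 fun p => ‖v p‖ ^ l • v p := by
  have h := contDiff_sqrt_pow_smul l (w := fun p => ‖v p‖ ^ 2) (X := v) (C := 1)
    (fun p => by positivity) (fun p => by simp) (hv.norm_sq ℝ) hv
  simpa only [Real.sqrt_sq (norm_nonneg _)] using h

lemma fderiv_norm_pow_smul {P : Type*} [NormedAddCommGroup P] [NormedSpace ℝ P] (l : ℕ) {v : P → W}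
    (hv : ContDiff ℝ 1 v) (p u : P) : fderiv ℝ (fun p => ‖v p‖ ^ l • v p) p u
      = ‖v p‖ ^ l • fderiv ℝ v p u
        + ((l : ℝ) * (‖v p‖ ^ l / ‖v p‖ ^ 2) * inner ℝ (v p) (fderiv ℝ v p u)) • v p := by
  have h := fderiv_sqrt_pow_smul l (w := fun p => ‖v p‖ ^ 2) (X := v) (C := 1)
    (fun p => by positivity) (fun p => by simp) p ((hv.norm_sq ℝ).differentiable one_ne_zero p)
    (hv.differentiable one_ne_zero p) u
  simp only [Real.sqrt_sq (norm_nonneg _)] at h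
  rw [h]
  have e : fderiv ℝ (fun p => ‖v p‖ ^ 2) p u = 2 * inner ℝ (v p) (fderiv ℝ v p u) := by
    have := ((hv.differentiable one_ne_zero p).hasFDerivAt.norm_sq).fderiv
    rw [this]; simp
  rw [e]
  congr 2
  ring

lemma pd_slice {g : ℝ × Eu n → V} {t : ℝ}
    {x : Eu n} (hg : DifferentiableAt ℝ g (t, x)) (i : Fin n) :
    pd i (fun y => g (t, y)) x = fderiv ℝ g (t, x) (0, single i 1) := by
  have h := hg.hasFDerivAt.comp x ((hasFDerivAt_const t x).prodMk (hasFDerivAt_id x))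
  have h' : fderiv ℝ (fun y => g (t, y)) x = _ := h.fderiv
  rw [pd, h']
  simp

/-- The spatial gradient. -/
def gradx (F : ℝ × Eu n → W) (p : ℝ × Eu n) : Gr n W := toLp 2 fun i => fderiv ℝ F p (0, single i 1)

/-- The time derivative. -/
def vel (F : ℝ × Eu n → W) (p : ℝ × Eu n) : W := fderiv ℝ F p (1, 0)

@[simp] lemma gradx_apply (F : ℝ × Eu n → W) (p : ℝ × Eu n) (i : Fin n) :
    gradx F p i = fderiv ℝ F p (0, single i 1) := rfl

lemma grad_slice {F : ℝ × Eu n → W} {t : ℝ} {x : Eu n} (hF : DifferentiableAt ℝ F (t, x)) :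
    grad (fun y => F (t, y)) x = gradx F (t, x) := by
  ext i
  exact pd_slice hF i

lemma contDiff_gradx {F : ℝ × Eu n → W} (hF : ContDiff ℝ ∞ F) : ContDiff ℝ ∞ (gradx F) :=
  contDiff_piLp' 2 fun _ => (hF.fderiv_right (m := ∞) (by simp)).clm_apply contDiff_const

lemma contDiff_vel {F : ℝ × Eu n → W} (hF : ContDiff ℝ ∞ F) : ContDiff ℝ ∞ (vel F) :=
  (hF.fderiv_right (m := ∞) (by simp)).clm_apply contDiff_const

lemma fderiv_gradx {F : ℝ × Eu n → W} (hF : ContDiff ℝ ∞ F) (p : ℝ × Eu n) :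
    fderiv ℝ (gradx F) p (1, 0) = gradx (vel F) p := by
  have h := (hF.contDiffAt (x := p)).isSymmSndFDerivAt (by simp [minSmoothness]; exact ENat.LEInfty.out)
  have hd : DifferentiableAt ℝ (fderiv ℝ F) p :=
    (hF.fderiv_right (m := 1) (by norm_num; exact ENat.LEInfty.out)).differentiable one_ne_zero p
  have e : ∀ u v, fderiv ℝ (fun y => fderiv ℝ F y u) p v = fderiv ℝ (fderiv ℝ F) p v u := by
    intro u v
    rw [fderiv_clm_apply hd (by fun_prop)]
    simp
  ext i
  rw [fderiv_gr_apply ((contDiff_gradx hF).differentiable (by simp) p)]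
  simp only [gradx_apply]
  rw [e]
  have : vel F = fun y => fderiv ℝ F y (1, 0) := rfl
  rw [this, e]
  exact h _ _

variable {K s ε : ℝ} {a : Eu n → Mat n} {σ : Eu n → ℝ}

/-- The energy density. -/
def dens (ε : ℝ) (a : Eu n → Mat n) (F : ℝ × Eu n → W) : ℝ × Eu n → ℝ :=
  quad ε (fun p => a p.2) (gradx F)

/-- The weighted gradient. -/
def fluxx (ε : ℝ) (a : Eu n → Mat n) (F : ℝ × Eu n → W) (p : ℝ × Eu n) : Gr n W :=
  √(dens ε a F p) ^ (n - 2) • gradx F p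

/-- The weighted divergence in the space directions. -/
def divx (σ : Eu n → ℝ) (a : Eu n → Mat n) (V : ℝ × Eu n → Gr n W) (p : ℝ × Eu n) : W :=
  (σ p.2)⁻¹ • ∑ i, fderiv ℝ (fun q : ℝ × Eu n => σ q.2 • matAct (a q.2) (V q) i) p (0, single i 1)

lemma quad_slice {F : ℝ × Eu n → W} (hF : ContDiff ℝ ∞ F) (t : ℝ) (x : Eu n) :
    quad ε a (grad fun y => F (t, y)) x = dens ε a F (t, x) := by
  rw [dens, quad, quad, grad_slice (hF.differentiable (by simp) _)]

lemma flux_slice {F : ℝ × Eu n → W} (hF : ContDiff ℝ ∞ F) (t : ℝ) (x : Eu n) :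
    flux ε a (fun y => F (t, y)) x = fluxx ε a F (t, x) := by
  rw [flux, fluxx, grad_slice (hF.differentiable (by simp) _), quad_slice hF]

lemma Coef.smooth_a_snd (ha : Coef K s a σ) (i j : Fin n) :
    ContDiff ℝ ∞ fun p : ℝ × Eu n => a p.2 i j := (ha.smooth_a i j).comp contDiff_snd

lemma Coef.smooth_σ_snd (ha : Coef K s a σ) :
    ContDiff ℝ ∞ fun p : ℝ × Eu n => σ p.2 := ha.smooth_σ.comp contDiff_snd

lemma Coef.contDiff_dens (ha : Coef K s a σ) {F : ℝ × Eu n → W} (hF : ContDiff ℝ ∞ F) :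
    ContDiff ℝ ∞ (dens ε a F) := contDiff_quad ε ha.smooth_a_snd (contDiff_gradx hF)

lemma Coef.dens_nonneg (ha : Coef K s a σ) (hn : n ≤ 4) (hε : 0 ≤ ε) (F : ℝ × Eu n → W)
    (p : ℝ × Eu n) : 0 ≤ dens ε a F p :=
  NearId.quad_nonneg (B := fun p : ℝ × Eu n => a p.2) hn hε (ha.near p.2)

lemma Coef.norm_gradx_le (ha : Coef K s a σ) (hn : n ≤ 4) (hε : 0 ≤ ε) (F : ℝ × Eu n → W)
    (p : ℝ × Eu n) : ‖gradx F p‖ ^ 2 ≤ 2 * dens ε a F p :=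
  NearId.norm_sq_le_quad (B := fun p : ℝ × Eu n => a p.2) hn hε (ha.near p.2)

lemma Coef.norm_gradx_le' (ha : Coef K s a σ) (hn : n ≤ 4) (hε : 0 ≤ ε) (F : ℝ × Eu n → W)
    (p : ℝ × Eu n) : 999 / 1000 * ‖gradx F p‖ ^ 2 ≤ dens ε a F p := by
  have := (ha.near p.2).le_inner hn (gradx F p)
  rw [dens, quad]; linarith

lemma Coef.fderiv_dens (ha : Coef K s a σ) {F : ℝ × Eu n → W} (hF : ContDiff ℝ ∞ F) (p : ℝ × Eu n) :
    fderiv ℝ (dens ε a F) p (1, 0)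
      = 2 * inner ℝ (gradx F p) (matAct (a p.2) (gradx (vel F) p)) := by
  have h := fderiv_quad (z := p) ε (fun i j => (ha.smooth_a_snd i j).differentiable (by simp) p)
    ((contDiff_gradx hF).differentiable (by simp) p) (ha.near p.2) (1, 0)
  rw [fderiv_gradx hF] at h
  have e : matDeriv (fun p : ℝ × Eu n => a p.2) p (1, 0) = 0 := by
    ext i j
    have h1 := ((ha.smooth_a i j).differentiable (by simp) p.2).hasFDerivAt.comp p
      (hasFDerivAt_snd (𝕜 := ℝ) (E := ℝ) (F := Eu n))
    have h2 : fderiv ℝ (fun q : ℝ × Eu n => a q.2 i j) p = _ := h1.fderiv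
    simp [matDeriv, h2]
  rw [e] at h
  have e2 : matAct (0 : Mat n) (gradx F p) = 0 := by ext i; simp
  rw [e2, inner_zero_right, add_zero] at h
  exact h

lemma Coef.contDiff_fluxx (ha : Coef K s a σ) (hn : n ≤ 4) (hε : 0 ≤ ε) {F : ℝ × Eu n → W}
    (hF : ContDiff ℝ ∞ F) : ContDiff ℝ 1 (fluxx ε a F) :=
  contDiff_sqrt_pow_smul (n - 2) (fun p => ha.dens_nonneg hn hε F p)
    (fun p => ha.norm_gradx_le hn hε F p)
    ((ha.contDiff_dens hF).of_le (by simp)) ((contDiff_gradx hF).of_le (by simp))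

/-- The time derivative of the weighted gradient. -/
def fluxDot (ε : ℝ) (a : Eu n → Mat n) (F : ℝ × Eu n → W) (p : ℝ × Eu n) : Gr n W :=
  √(dens ε a F p) ^ (n - 2) • gradx (vel F) p
    + (((n - 2 : ℕ) : ℝ) * (√(dens ε a F p) ^ (n - 2) / dens ε a F p)
      * inner ℝ (gradx F p) (matAct (a p.2) (gradx (vel F) p))) • gradx F p

lemma Coef.fderiv_fluxx (ha : Coef K s a σ) (hn : n ≤ 4) (hε : 0 ≤ ε) {F : ℝ × Eu n → W}
    (hF : ContDiff ℝ ∞ F) (p : ℝ × Eu n) : fderiv ℝ (fluxx ε a F) p (1, 0) = fluxDot ε a F p := by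
  have h : fderiv ℝ (fluxx ε a F) p (1, 0) = _ :=
    fderiv_sqrt_pow_smul (n - 2) (fun p => ha.dens_nonneg hn hε F p)
    (fun p => ha.norm_gradx_le hn hε F p) p ((ha.contDiff_dens hF).differentiable (by simp) p)
    ((contDiff_gradx hF).differentiable (by simp) p) (1, 0)
  rw [h, ha.fderiv_dens hF, fderiv_gradx hF, fluxDot]
  congr 2
  ring

lemma Coef.contDiff_matAct_snd (ha : Coef K s a σ) {V : ℝ × Eu n → Gr n W} (hV : ContDiff ℝ 1 V) :
    ContDiff ℝ 1 fun p : ℝ × Eu n => matAct (a p.2) (V p) :=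
  contDiff_matAct (fun i j => (ha.smooth_a_snd i j).of_le (by simp)) hV

lemma Coef.fderiv_matAct_snd (ha : Coef K s a σ) {V : ℝ × Eu n → Gr n W} (hV : ContDiff ℝ 1 V)
    (p : ℝ × Eu n) : fderiv ℝ (fun p : ℝ × Eu n => matAct (a p.2) (V p)) p (1, 0)
      = matAct (a p.2) (fderiv ℝ V p (1, 0)) := by
  have h := fderiv_matAct (z := p) (B := fun p : ℝ × Eu n => a p.2)
    (fun i j => (ha.smooth_a_snd i j).differentiable (by simp) p)
    (hV.differentiable one_ne_zero p) (1, 0)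
  rw [h]
  have e : matDeriv (fun p : ℝ × Eu n => a p.2) p (1, 0) = 0 := by
    ext i j
    have h1 := ((ha.smooth_a i j).differentiable (by simp) p.2).hasFDerivAt.comp p
      (hasFDerivAt_snd (𝕜 := ℝ) (E := ℝ) (F := Eu n))
    have h2 : fderiv ℝ (fun q : ℝ × Eu n => a q.2 i j) p = _ := h1.fderiv
    simp [matDeriv, h2]
  have e2 : matAct (0 : Mat n) (V p) = 0 := by ext i; simp
  rw [e, e2, add_zero]

lemma Coef.contDiff_smul_matAct_snd (ha : Coef K s a σ) {V : ℝ × Eu n → Gr n W}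
    (hV : ContDiff ℝ 1 V) (i : Fin n) :
    ContDiff ℝ 1 fun q : ℝ × Eu n => σ q.2 • matAct (a q.2) (V q) i :=
  (ha.smooth_σ_snd.of_le (by simp)).smul ((contDiff_piLp 2).1 (ha.contDiff_matAct_snd hV) i)

lemma Coef.continuous_divx (ha : Coef K s a σ) {V : ℝ × Eu n → Gr n W} (hV : ContDiff ℝ 1 V) :
    Continuous (divx σ a V) := by
  refine Continuous.smul (ha.smooth_σ_snd.continuous.inv₀ fun x => (ha.pos x.2).ne') ?_
  exact continuous_finsetSum _ fun i _ =>
    ((ha.contDiff_smul_matAct_snd hV i).continuous_fderiv one_ne_zero).clm_apply continuous_const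

lemma Coef.divg_slice (ha : Coef K s a σ) (hn : n ≤ 4) (hε : 0 ≤ ε) {F : ℝ × Eu n → W}
    (hF : ContDiff ℝ ∞ F) (t : ℝ) (x : Eu n) :
    divg σ a (flux ε a fun y => F (t, y)) x = divx σ a (fluxx ε a F) (t, x) := by
  rw [divg, divx]
  congr 1
  refine sum_congr rfl fun i _ => ?_
  rw [← pd_slice ((ha.contDiff_smul_matAct_snd
    (ha.contDiff_fluxx hn hε hF) i).differentiable one_ne_zero _)]
  simp only [flux_slice hF]

/-- The weak form of the divergence. -/
lemma Coef.integral_divx (ha : Coef K s a σ) {V : ℝ × Eu n → Gr n W} (hV : ContDiff ℝ 1 V) {s' : ℝ}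
    {ψ : Eu n → W} (hψ : ContDiff ℝ 1 ψ) (hψs : SuppIn s' ψ) (t : ℝ) :
    ∫ x, σ x * inner ℝ (divx σ a V (t, x)) (ψ x)
      = -∫ x, σ x * inner ℝ (matAct (a x) (V (t, x))) (grad ψ x) := by
  have hVt : ContDiff ℝ 1 fun x => V (t, x) := hV.comp (contDiff_prodMk_right t)
  have hb : ∀ i, ContDiff ℝ 1 fun x => σ x • matAct (a x) (V (t, x)) i := fun i =>
    (ha.smooth_σ.of_le (by simp)).smul ((contDiff_piLp 2).1
      (contDiff_matAct (fun i j => (ha.smooth_a i j).of_le (by simp)) hVt) i)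
  have hc : ∀ i, ContDiff ℝ 1 fun x => (inner ℝ (σ x • matAct (a x) (V (t, x)) i) (ψ x) : ℝ) :=
    fun i => (hb i).inner ℝ hψ
  have hcs : ∀ i, SuppIn s' fun x => (inner ℝ (σ x • matAct (a x) (V (t, x)) i) (ψ x) : ℝ) :=
    fun i x hx => by simp [hψs x hx]
  have h0 := fun i => integral_fderiv_eq_zero (hcs i) (hc i) (single i 1)
  have hpd : ∀ i x, fderiv ℝ (fun x => (inner ℝ (σ x • matAct (a x) (V (t, x)) i) (ψ x) : ℝ)) x
      (single i 1) = inner ℝ (σ x • matAct (a x) (V (t, x)) i) (pd i ψ x)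
        + inner ℝ (pd i (fun x => σ x • matAct (a x) (V (t, x)) i) x) (ψ x) := fun i x =>
    fderiv_inner_apply ℝ ((hb i).differentiable one_ne_zero x) (hψ.differentiable one_ne_zero x) _
  have hi : ∀ i, Integrable fun x => fderiv ℝ
      (fun x => (inner ℝ (σ x • matAct (a x) (V (t, x)) i) (ψ x) : ℝ)) x (single i 1) := fun i =>
    ((hcs i).fderiv _).integrable
      (((hc i).continuous_fderiv one_ne_zero).clm_apply continuous_const)
  have hsum : ∫ x, ∑ i, fderiv ℝ (fun x => (inner ℝ (σ x • matAct (a x) (V (t, x)) i) (ψ x) : ℝ)) x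
      (single i 1) = 0 := by
    rw [integral_finsetSum _ fun i _ => hi i]
    exact sum_eq_zero fun i _ => h0 i
  have hpt : ∀ x, ∑ i, fderiv ℝ (fun x => (inner ℝ (σ x • matAct (a x) (V (t, x)) i) (ψ x) : ℝ)) x
      (single i 1) = σ x * inner ℝ (matAct (a x) (V (t, x))) (grad ψ x)
        + σ x * inner ℝ (divx σ a V (t, x)) (ψ x) := by
    intro x
    simp only [hpd, sum_add_distrib]
    congr 1
    · rw [gr_inner, mul_sum]
      exact sum_congr rfl fun i _ => by rw [real_inner_smul_left]; rfl
    · rw [divx, real_inner_smul_left, ← mul_assoc, mul_inv_cancel₀ (ha.pos x).ne', one_mul,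
        sum_inner]
      refine sum_congr rfl fun i _ => ?_
      rw [← pd_slice ((ha.contDiff_smul_matAct_snd hV i).differentiable one_ne_zero _)]
  simp only [hpt] at hsum
  have hgψ : Continuous (grad ψ) :=
    (PiLp.continuous_toLp 2 _).comp (continuous_pi fun i => continuous_pd hψ i)
  have hgs : SuppIn s' (grad ψ) := fun x hx => by
    ext i; exact hψs.fderiv (single i 1) x hx
  have hVc : Continuous fun x => matAct (a x) (V (t, x)) :=
    (contDiff_matAct (k := 1) (fun i j => (ha.smooth_a i j).of_le (by simp)) hVt).continuous
  have hDc : Continuous fun x => divx σ a V (t, x) := (ha.continuous_divx hV).comp (by fun_prop)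
  have hσc := ha.smooth_σ.continuous
  have hψc := hψ.continuous
  have i1 : Integrable fun x => σ x * inner ℝ (matAct (a x) (V (t, x))) (grad ψ x) := hgs.integrable_of
  have i2 : Integrable fun x => σ x * inner ℝ (divx σ a V (t, x)) (ψ x) := hψs.integrable_of
  rw [integral_add i1 i2] at hsum
  linarith

end SpaceTime

section Flow


/-- The difference between `m F_t` and the weighted divergence. -/
def resid (ε : ℝ) (a : Eu n → Mat n) (σ : Eu n → ℝ) (F : ℝ × Eu n → W)
    (m : ℝ × Eu n → ℝ) (p : ℝ × Eu n) : W := m p • vel F p - divx σ a (fluxx ε a F) p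

/-- The local form of the conformal heat flow: `m` stands for `e^{nu}`, and `resid` is the part
normal to the target. -/
structure Flow (K s ε CN A₀ B₀ c T₀ T₁ : ℝ) (a : Eu n → Mat n) (σ : Eu n → ℝ)
    (F : ℝ × Eu n → W) (m : ℝ × Eu n → ℝ) : Prop where
  coef : Coef K s a σ
  ε_nonneg : 0 ≤ ε
  smooth_F : ContDiff ℝ ∞ F
  smooth_m : ContDiff ℝ ∞ m
  orth : ∀ t ∈ Ioo T₀ T₁, ∀ x ∈ 𝔹 s, inner ℝ (resid ε a σ F m (t, x)) (vel F (t, x)) = 0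
  norm_le : ∀ t ∈ Ioo T₀ T₁, ∀ x ∈ 𝔹 s, ‖resid ε a σ F m (t, x)‖ ≤ CN * √(dens ε a F (t, x)) ^ n
  accel : ∀ t ∈ Ioo T₀ T₁, ∀ x ∈ 𝔹 s, -inner ℝ (resid ε a σ F m (t, x)) (vel (vel F) (t, x))
      ≤ CN ^ 2 * (√(dens ε a F (t, x)) ^ n * ‖vel F (t, x)‖ ^ 2)
  m_eq : ∀ t ∈ Ioo T₀ T₁, ∀ x ∈ 𝔹 s, vel m (t, x) = B₀ * √(dens ε a F (t, x)) ^ n - A₀ * m (t, x)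
  m_ge : ∀ t ∈ Ioo T₀ T₁, ∀ x ∈ 𝔹 s, c ≤ m (t, x)

variable {K s ε CN A₀ B₀ c T₀ T₁ : ℝ} {a : Eu n → Mat n} {σ : Eu n → ℝ}
  {F : ℝ × Eu n → W} {m : ℝ × Eu n → ℝ}

lemma Flow.continuous_resid (h : Flow K s ε CN A₀ B₀ c T₀ T₁ a σ F m) (hn : n ≤ 4) :
    Continuous (resid ε a σ F m) :=
  (h.smooth_m.continuous.smul (contDiff_vel h.smooth_F).continuous).sub
    (h.coef.continuous_divx (h.coef.contDiff_fluxx hn h.ε_nonneg h.smooth_F))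

lemma continuous_grad {ψ : Eu n → W} (hψ : ContDiff ℝ 1 ψ) : Continuous (grad ψ) :=
  (PiLp.continuous_toLp 2 _).comp (continuous_pi fun i => continuous_pd hψ i)

lemma SuppIn.grad {s' : ℝ} {ψ : Eu n → W} (hψs : SuppIn s' ψ) : SuppIn s' (grad ψ) := fun x hx => by
  ext i; exact hψs.fderiv (single i 1) x hx

/-- The equation tested with a function. -/
lemma Flow.weak (h : Flow K s ε CN A₀ B₀ c T₀ T₁ a σ F m) (hn : n ≤ 4) {s' : ℝ} {ψ : Eu n → W}
    (hψ : ContDiff ℝ 1 ψ) (hψs : SuppIn s' ψ) (t : ℝ) :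
    (∫ x, σ x * inner ℝ (m (t, x) • vel F (t, x)) (ψ x))
      + ∫ x, σ x * inner ℝ (matAct (a x) (fluxx ε a F (t, x))) (grad ψ x)
      = ∫ x, σ x * inner ℝ (resid ε a σ F m (t, x)) (ψ x) := by
  have hV := h.coef.contDiff_fluxx hn h.ε_nonneg h.smooth_F
  have h1 := h.coef.integral_divx hV hψ hψs t
  have hψc := hψ.continuous
  have hσc := h.coef.smooth_σ.continuous
  have hDc := h.coef.continuous_divx hV
  have hmc := h.smooth_m.continuous
  have hvc := (contDiff_vel h.smooth_F).continuous
  have i1 : Integrable fun x => σ x * inner ℝ (m (t, x) • vel F (t, x)) (ψ x) := hψs.integrable_of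
  have i2 : Integrable fun x => σ x * inner ℝ (divx σ a (fluxx ε a F) (t, x)) (ψ x) := hψs.integrable_of
  have e : ∫ x, σ x * inner ℝ (resid ε a σ F m (t, x)) (ψ x)
      = (∫ x, σ x * inner ℝ (m (t, x) • vel F (t, x)) (ψ x))
        - ∫ x, σ x * inner ℝ (divx σ a (fluxx ε a F) (t, x)) (ψ x) := by
    rw [← integral_sub i1 i2]
    congr 1; funext x
    rw [resid, inner_sub_left]; ring
  rw [e]; linarith

/-- The equation tested with a multiple of the velocity. -/
lemma Flow.weak_vel (h : Flow K s ε CN A₀ B₀ c T₀ T₁ a σ F m) (hn : n ≤ 4) {s' : ℝ} (hs : s' < s)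
    {g : Eu n → ℝ} (hgs : SuppIn s' g) {t : ℝ} (ht : t ∈ Ioo T₀ T₁)
    (hψ : ContDiff ℝ 1 fun x => g x • vel F (t, x)) :
    (∫ x, σ x * (g x * (m (t, x) * ‖vel F (t, x)‖ ^ 2)))
      = -∫ x, σ x * inner ℝ (matAct (a x) (fluxx ε a F (t, x))) (grad (fun x => g x • vel F (t, x)) x) := by
  have h1 := h.weak hn hψ (s' := s') (fun x hx => by simp [hgs x hx]) t
  have e1 : ∫ x, σ x * inner ℝ (resid ε a σ F m (t, x)) (g x • vel F (t, x)) = 0 := by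
    rw [← integral_zero (Eu n) ℝ]
    congr 1; funext x
    by_cases hx : x ∈ 𝔻 s'
    · rw [inner_smul_right, h.orth t ht x (closedBall_subset_ball hs hx)]; simp
    · simp [hgs x hx]
  have e2 : ∫ x, σ x * inner ℝ (m (t, x) • vel F (t, x)) (g x • vel F (t, x))
      = ∫ x, σ x * (g x * (m (t, x) * ‖vel F (t, x)‖ ^ 2)) := by
    congr 1; funext x
    rw [inner_smul_right, real_inner_smul_left, real_inner_self_eq_norm_sq]
  rw [e1, e2] at h1
  linarith

/-- The time derivative of the equation, tested with a multiple of the velocity. -/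
lemma Flow.weak_deriv (h : Flow K s ε CN A₀ B₀ c T₀ T₁ a σ F m) (hn : n ≤ 4) {s' : ℝ} (hs : s' < s)
    {g : Eu n → ℝ} (hg : Continuous g) (hgs : SuppIn s' g) {t : ℝ} (ht : t ∈ Ioo T₀ T₁)
    (hψ : ContDiff ℝ 1 fun x => g x • vel F (t, x)) :
    (∫ x, σ x * (g x * (vel m (t, x) * ‖vel F (t, x)‖ ^ 2
        + m (t, x) * inner ℝ (vel F (t, x)) (vel (vel F) (t, x)))))
      + (∫ x, σ x * inner ℝ (matAct (a x) (fluxDot ε a F (t, x)))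
        (grad (fun x => g x • vel F (t, x)) x))
      + ∫ x, σ x * (g x * inner ℝ (resid ε a σ F m (t, x)) (vel (vel F) (t, x))) = 0 := by
  set ψ : Eu n → W := fun x => g x • vel F (t, x) with hψd
  set V := fluxx ε a F with hVd
  set v := vel F with hv
  set ν := resid ε a σ F m with hνd
  have hψs : SuppIn s' ψ := fun x hx => by simp [hψd, hgs x hx]
  have hV : ContDiff ℝ 1 V := h.coef.contDiff_fluxx hn h.ε_nonneg h.smooth_F
  have hσc := h.coef.smooth_σ.continuous
  have hv1 : ContDiff ℝ 1 v := (contDiff_vel h.smooth_F).of_le (by simp)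
  have hm1 : ContDiff ℝ 1 m := h.smooth_m.of_le (by simp)
  have hνc : Continuous ν := h.continuous_resid hn
  have hψc := hψ.continuous
  have hgψ := continuous_grad hψ
  have hgψs := hψs.grad
  have hAV := h.coef.contDiff_matAct_snd hV
  have hAVt : Continuous fun x => matAct (a x) (V (t, x)) :=
    hAV.continuous.comp (f := fun x => (t, x)) (by fun_prop)
  have hAVr : ∀ r, Continuous fun x => matAct (a x) (V (r, x)) := fun r =>
    hAV.continuous.comp (f := fun x => (r, x)) (by fun_prop)
  have hvc := hv1.continuous
  have hmc := hm1.continuous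
  have hπ : ∀ p : ℝ × Eu n, HasFDerivAt (fun q : ℝ × Eu n => (t, q.2))
      ((0 : ℝ × Eu n →L[ℝ] ℝ).prod (ContinuousLinearMap.snd ℝ ℝ (Eu n))) p := fun p =>
    (hasFDerivAt_const t p).prodMk hasFDerivAt_snd
  have key : ∀ {H : Type _} [NormedAddCommGroup H] [InnerProductSpace ℝ H] (d : ℝ × Eu n → H),
      ContDiff ℝ 1 d → ∀ x, fderiv ℝ (fun q : ℝ × Eu n => d q - d (t, q.2)) (t, x) (1, 0)
        = fderiv ℝ d (t, x) (1, 0) := by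
    intro H _ _ d hd x
    have h1 := (hd.differentiable one_ne_zero (t, x)).hasFDerivAt
    have h2 := (hd.differentiable one_ne_zero (t, x)).hasFDerivAt.comp
      (g := d) (f := fun q : ℝ × Eu n => (t, q.2)) (t, x) (hπ (t, x))
    have h3 : HasFDerivAt (fun q : ℝ × Eu n => d q - d (t, q.2)) _ (t, x) := h1.sub h2
    rw [h3.fderiv]
    simp only [_root_.sub_apply, comp_apply, ContinuousLinearMap.prod_apply, zero_apply, coe_snd']
    rw [show ((0 : ℝ), (0 : Eu n)) = 0 from rfl, map_zero, sub_zero]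
  have d1 := hasDerivAt_integral_inner (s := s') (c := fun q : ℝ × Eu n => σ q.2 • ψ q.2)
    (d := fun q => m q • v q - m (t, q.2) • v (t, q.2)) (by fun_prop)
    ((hm1.smul hv1).sub ((hm1.smul hv1).comp (contDiff_const.prodMk contDiff_snd)))
    (fun r x hx => by simp [hψs x hx]) t (fun x => sub_self _)
  have d2 := hasDerivAt_integral_inner (s := s') (c := fun q : ℝ × Eu n => σ q.2 • grad ψ q.2)
    (d := fun q => matAct (a q.2) (V q) - matAct (a q.2) (V (t, q.2))) (by fun_prop)
    (hAV.sub (hAV.comp (contDiff_const.prodMk contDiff_snd)))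
    (fun r x hx => by simp [hgψs x hx]) t (fun x => sub_self _)
  have d3 := hasDerivAt_integral_inner (s := s') (c := fun q : ℝ × Eu n => (σ q.2 * g q.2) • ν q)
    (d := fun q => v q - v (t, q.2)) (by fun_prop)
    (hv1.sub (hv1.comp (contDiff_const.prodMk contDiff_snd)))
    (fun r x hx => by simp [hgs x hx]) t (fun x => sub_self _)
  have hsum := (d1.add d2).add d3
  have hzero : ((fun r => ∫ x, inner ℝ (σ x • ψ x) (m (r, x) • v (r, x) - m (t, x) • v (t, x)))
      + (fun r => ∫ x, inner ℝ (σ x • grad ψ x) (matAct (a x) (V (r, x)) - matAct (a x) (V (t, x))))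
      + fun r => ∫ x, (inner ℝ ((σ x * g x) • ν (r, x)) (v (r, x) - v (t, x)) : ℝ))
      =ᶠ[𝓝 t] fun _ => (0 : ℝ) := by
    filter_upwards [Ioo_mem_nhds ht.1 ht.2] with r hr
    have w1 := h.weak hn hψ hψs r
    have w2 := h.weak hn hψ hψs t
    have i1 : ∀ r, Integrable fun x => σ x * (inner ℝ (m (r, x) • v (r, x)) (ψ x) : ℝ) := fun r => hψs.integrable_of
    have i2 : ∀ r, Integrable fun x => σ x * (inner ℝ (matAct (a x) (V (r, x))) (grad ψ x) : ℝ) :=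
      fun r => by
      have := hAVr r
      exact hgψs.integrable_of
    have e : ∀ {H : Type _} [NormedAddCommGroup H] [InnerProductSpace ℝ H] {p A B : Eu n → H},
        Integrable (fun x => σ x * (inner ℝ (A x) (p x) : ℝ)) →
        Integrable (fun x => σ x * (inner ℝ (B x) (p x) : ℝ)) →
        ∫ x, (inner ℝ (σ x • p x) (A x - B x) : ℝ)
          = (∫ x, σ x * inner ℝ (A x) (p x)) - ∫ x, σ x * inner ℝ (B x) (p x) := by
      intro H _ _ p A B hA hB
      rw [← integral_sub hA hB]
      congr 1; funext x
      rw [real_inner_smul_left, inner_sub_right, real_inner_comm, real_inner_comm (B x)]; ring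
    have e3 : ∫ x, (inner ℝ ((σ x * g x) • ν (r, x)) (v (r, x) - v (t, x)) : ℝ)
        = -∫ x, σ x * inner ℝ (ν (r, x)) (ψ x) := by
      rw [← integral_neg]
      congr 1; funext x
      by_cases hx : x ∈ 𝔻 s'
      · rw [real_inner_smul_left, inner_sub_right, h.orth r hr x (closedBall_subset_ball hs hx),
          hψd]
        simp only [inner_smul_right]; ring
      · simp [hgs x hx, hψd]
    have e4 : ∫ x, σ x * inner ℝ (ν (t, x)) (ψ x) = 0 := by
      rw [← integral_zero (Eu n) ℝ]
      congr 1; funext x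
      by_cases hx : x ∈ 𝔻 s'
      · rw [hψd]
        simp only [inner_smul_right]
        rw [h.orth t ht x (closedBall_subset_ball hs hx)]; simp
      · simp [hψs x hx]
    simp only [Pi.add_apply]
    rw [e (i1 r) (i1 t), e (i2 r) (i2 t), e3]
    rw [e4] at w2
    linarith
  have h0 := hsum.unique ((hasDerivAt_const t (0 : ℝ)).congr_of_eventuallyEq hzero)
  rw [← h0]
  congr 1
  · congr 1
    · congr 1; funext x
      rw [key (fun q => m q • v q) (hm1.smul hv1) x,
        fderiv_fun_smul (hm1.differentiable one_ne_zero _) (hv1.differentiable one_ne_zero _)]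
      simp only [_root_.add_apply, _root_.smul_apply, smulRight_apply, hψd]
      rw [real_inner_smul_left, real_inner_smul_left, inner_add_right, inner_smul_right,
        inner_smul_right, real_inner_self_eq_norm_sq]
      rw [show fderiv ℝ v (t, x) (1, 0) = vel v (t, x) from rfl,
        show fderiv ℝ m (t, x) (1, 0) = vel m (t, x) from rfl]
      ring
    · congr 1; funext x
      rw [key (fun q => matAct (a q.2) (V q)) hAV x, h.coef.fderiv_matAct_snd hV,
        h.coef.fderiv_fluxx hn h.ε_nonneg h.smooth_F, real_inner_smul_left, real_inner_comm]
  · congr 1; funext x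
    rw [key v hv1 x, real_inner_smul_left, mul_assoc]
    rfl

end Flow

section ParabolicAlgebra


/-- The components of `Y` in the direction of `v`. -/
lemma exists_radial_part (Y : Gr n W) (v : W) :
    ∃ R : Gr n W, (∀ i, R i = (inner ℝ v (Y i) / ‖v‖ ^ 2) • v) ∧ inner ℝ Y R = ‖R‖ ^ 2 ∧
      ‖R‖ ≤ ‖Y‖ := by
  refine ⟨toLp 2 fun i => (inner ℝ v (Y i) / ‖v‖ ^ 2) • v, fun i => rfl, ?_⟩
  set R : Gr n W := toLp 2 fun i => (inner ℝ v (Y i) / ‖v‖ ^ 2) • v with hR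
  have h1 : inner ℝ Y R = ‖R‖ ^ 2 := by
    rw [gr_inner, gr_norm_sq]
    refine sum_congr rfl fun i _ => ?_
    show inner ℝ (Y i) ((inner ℝ v (Y i) / ‖v‖ ^ 2) • v) = ‖(inner ℝ v (Y i) / ‖v‖ ^ 2) • v‖ ^ 2
    rw [inner_smul_right, norm_smul, mul_pow, norm_eq_abs, sq_abs, real_inner_comm]
    rcases eq_or_ne ‖v‖ 0 with h | h
    · simp [h]
    · field_simp
  refine ⟨h1, ?_⟩
  have h2 := real_inner_le_norm Y R
  rw [h1, pow_two] at h2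
  rcases (norm_nonneg R).eq_or_lt with h | h
  · rw [← h]; positivity
  · exact le_of_mul_le_mul_right h2 h

lemma flux_form_real {c l : ℕ} (hc : c ≤ 2) (hl : l ≤ 2) {y ρ g T P : ℝ} (hy : 0 ≤ y) (hρ : 0 ≤ ρ)
    (hρy : ρ ≤ y) (hT : |T| ≤ 1002 / 1000 * (|g| * ρ)) (hg : |g| ≤ 1003 / 1000 * y)
    (hP : |P - ρ ^ 2| ≤ 1 / 1000 * (y * ρ)) :
    1 / 2 * y ^ 2 ≤ 999 / 1000 * y ^ 2 + l * P + c * g ^ 2 + l * c * T := by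
  have h1 := (abs_le.1 hT).1
  have h2 := (abs_le.1 hP).1
  have hg0 := abs_nonneg g
  rw [← sq_abs g]
  set G := |g|
  have h3 : G * ρ ≤ 1003 / 1000 * y ^ 2 := by
    calc G * ρ ≤ 1003 / 1000 * y * y := by gcongr
      _ = _ := by ring
  have h4 : y * ρ ≤ y ^ 2 := by rw [pow_two]; gcongr
  have h5 : 0 ≤ G * ρ := by positivity
  have h6 := sq_nonneg (G - ρ)
  have h7 : 0 ≤ G ^ 2 := by positivity
  have h8 : 0 ≤ ρ ^ 2 := by positivity
  interval_cases c <;> interval_cases l <;> push_cast <;> nlinarith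

/-- The key algebraic inequality for the linearized operator. -/
lemma flux_form_ge (hn : n ≤ 4) {c l : ℕ} (hc : c ≤ 2) (hl : l ≤ 2) {w : ℝ} (hw : 0 ≤ w) {A : Mat n}
    (hA : NearId A) {X Y : Gr n W} {v : W} (hX : 999 / 1000 * ‖X‖ ^ 2 ≤ w) {U : Gr n W}
    (hU : U = √w ^ c • Y + ((c : ℝ) * (√w ^ c / w) * inner ℝ X (matAct A Y)) • X) {Φ : ℝ}
    (hΦ : 0 ≤ Φ) {φ : Fin n → ℝ} {Ψ : Gr n W}
    (hΨ : ∀ i, Ψ i = Φ • (‖v‖ ^ l • Y i + ((l : ℝ) * (‖v‖ ^ l / ‖v‖ ^ 2) * inner ℝ v (Y i)) • v)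
      + φ i • (‖v‖ ^ l • v)) {B : ℝ} (hB : 0 ≤ B) (hφ : ∑ i, φ i ^ 2 ≤ B ^ 2) :
    1 / 2 * Φ * √w ^ c * ‖v‖ ^ l * ‖Y‖ ^ 2 - 8 * B * √w ^ c * ‖Y‖ * ‖v‖ ^ (l + 1)
      ≤ inner ℝ (matAct A U) Ψ := by
  obtain ⟨R, hR, hYR, hRY⟩ := exists_radial_part Y v
  set γ : ℝ := inner ℝ X (matAct A Y) with hγ
  have hY0 := norm_nonneg Y
  have hR0 := norm_nonneg R
  have hX0 := norm_nonneg X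
  have hγ1 : |γ| ≤ 1001 / 1000 * (‖X‖ * ‖Y‖) := hA.inner_le hn X Y
  have hU' : U = √w ^ c • (Y + (c * (γ / w)) • X) := by
    rw [hU, smul_add, smul_smul]; congr 2; ring
  set Z : Gr n W := toLp 2 fun i => φ i • v with hZ
  have hΨ' : Ψ = (Φ * ‖v‖ ^ l) • (Y + (l : ℝ) • R) + ‖v‖ ^ l • Z := by
    ext i
    rw [hΨ]
    simp only [PiLp.add_apply, PiLp.smul_apply, hR, smul_add, smul_smul, hZ]
    congr 2
    · congr 1; ring
    · ring
  have hZn : ‖Z‖ ≤ B * ‖v‖ := by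
    refine abs_le_of_sq_le_sq' ?_ (by positivity) |>.2
    rw [gr_norm_sq]
    simp only [hZ, norm_smul, mul_pow, norm_eq_abs, sq_abs]
    rw [← sum_mul]
    gcongr
  have hmain : 1 / 2 * ‖Y‖ ^ 2 ≤ inner ℝ (matAct A (Y + (c * (γ / w)) • X)) (Y + (l : ℝ) • R) := by
    have e : inner ℝ (matAct A (Y + (c * (γ / w)) • X)) (Y + (l : ℝ) • R)
        = inner ℝ Y (matAct A Y) + l * inner ℝ Y (matAct A R) + c * (γ / w) * γ
          + l * (c * (γ / w * inner ℝ X (matAct A R))) := by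
      rw [matAct_add, matAct_smul, inner_add_left, inner_add_right, inner_add_right,
        real_inner_smul_left, real_inner_smul_left, inner_smul_right, inner_smul_right,
        real_inner_comm _ (matAct A Y), real_inner_comm _ (matAct A Y), real_inner_comm _ (matAct A X),
        real_inner_comm _ (matAct A X), hA.inner_comm R Y, hA.inner_comm Y X, hA.inner_comm R X, hγ]
      ring
    rw [e]
    have h1 := hA.le_inner hn Y
    have h2 := hA.abs_inner_sub_le hn Y R
    rw [hYR] at h2
    rcases hw.eq_or_lt with h0 | hpos
    · have h3 := flux_form_real (T := 0) (g := 0) hc hl hY0 hR0 hRY (by simp) (by simpa using hY0) h2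
      rw [← h0]
      simp only [div_zero, zero_mul, mul_zero, add_zero] at h3 ⊢
      simp only [ne_eq, OfNat.ofNat_ne_zero, not_false_eq_true, zero_pow, mul_zero, add_zero] at h3
      linarith
    · have hs : 0 < √w := sqrt_pos.2 hpos
      have hs2 : √w * √w = w := mul_self_sqrt hw
      have hXs : ‖X‖ ≤ 1001 / 1000 * √w := by
        refine abs_le_of_sq_le_sq' ?_ (by positivity) |>.2
        rw [mul_pow, sq_sqrt hw]; linarith
      have hg : |γ / √w| ≤ 1003 / 1000 * ‖Y‖ := by
        rw [abs_div, abs_of_pos hs, div_le_iff₀ hs]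
        have : ‖X‖ * ‖Y‖ ≤ 1001 / 1000 * √w * ‖Y‖ := by gcongr
        have : 0 ≤ √w * ‖Y‖ := by positivity
        linarith
      have h4 : |(inner ℝ X (matAct A R) : ℝ)| ≤ 1002 / 1000 * (√w * ‖R‖) := by
        refine (hA.inner_le hn X R).trans ?_
        have hXs' : ‖X‖ ≤ 10006 / 10000 * √w := by
          refine abs_le_of_sq_le_sq' ?_ (by positivity) |>.2
          rw [mul_pow, sq_sqrt hw]; linarith
        have : ‖X‖ * ‖R‖ ≤ 10006 / 10000 * √w * ‖R‖ := by gcongr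
        have : 0 ≤ √w * ‖R‖ := by positivity
        linarith
      have e1 : γ / w * γ = (γ / √w) ^ 2 := by
        rw [div_pow, sq_sqrt hw]; ring
      have hT : |γ / w * inner ℝ X (matAct A R)| ≤ 1002 / 1000 * (|γ / √w| * ‖R‖) := by
        rw [abs_mul, abs_div, abs_div, abs_of_pos hpos, abs_of_pos hs]
        calc |γ| / w * |(inner ℝ X (matAct A R) : ℝ)| ≤ |γ| / w * (1002 / 1000 * (√w * ‖R‖)) := by
              gcongr
          _ = _ := by
              have : √w / w = 1 / √w := Real.sqrt_div_self'
              calc _ = 1002 / 1000 * (|γ| * (√w / w) * ‖R‖) := by ring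
                _ = _ := by rw [this]; ring
      have h3 := flux_form_real hc hl hY0 hR0 hRY hT hg h2
      have e2 : (c : ℝ) * (γ / w) * γ = c * (γ / √w) ^ 2 := by rw [mul_assoc, e1]
      rw [e2]
      linarith
  have hUn : ‖Y + (c * (γ / w)) • X‖ ≤ 4 * ‖Y‖ := by
    refine (norm_add_le _ _).trans ?_
    have : ‖((c : ℝ) * (γ / w)) • X‖ ≤ 3 * ‖Y‖ := by
      rw [norm_smul, norm_mul, norm_eq_abs, norm_eq_abs, abs_of_nonneg (Nat.cast_nonneg c)]
      have hc' : (c : ℝ) ≤ 2 := by exact_mod_cast hc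
      have h5 : |γ / w| * ‖X‖ ≤ 3 / 2 * ‖Y‖ := by
        rcases hw.eq_or_lt with h0 | hpos
        · rw [← h0]; simp
        rw [abs_div, abs_of_pos hpos, div_mul_eq_mul_div, div_le_iff₀ hpos]
        calc |γ| * ‖X‖ ≤ 1001 / 1000 * (‖X‖ * ‖Y‖) * ‖X‖ := by gcongr
          _ = 1001 / 1000 * ‖Y‖ * ‖X‖ ^ 2 := by ring
          _ ≤ 1001 / 1000 * ‖Y‖ * (1000 / 999 * w) := by gcongr; linarith
          _ ≤ _ := by
            have : 0 ≤ ‖Y‖ * w := by positivity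
            linarith
      calc c * |γ / w| * ‖X‖ = c * (|γ / w| * ‖X‖) := by ring
        _ ≤ 2 * (3 / 2 * ‖Y‖) := by gcongr
        _ = _ := by ring
    linarith
  have herr : |inner ℝ (matAct A (Y + (c * (γ / w)) • X)) Z| ≤ 8 * ‖Y‖ * (B * ‖v‖) := by
    refine (abs_real_inner_le_norm _ _).trans ?_
    have := hA.norm_matAct_le hn (Y + (c * (γ / w)) • X)
    gcongr
    linarith
  have e : inner ℝ (matAct A U) Ψ = Φ * √w ^ c * ‖v‖ ^ l
      * inner ℝ (matAct A (Y + (c * (γ / w)) • X)) (Y + (l : ℝ) • R)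
      + √w ^ c * ‖v‖ ^ l * inner ℝ (matAct A (Y + (c * (γ / w)) • X)) Z := by
    rw [hU', hΨ', matAct_smul, real_inner_smul_left, inner_add_right, inner_smul_right,
      inner_smul_right]
    ring
  rw [e]
  have h1 : Φ * √w ^ c * ‖v‖ ^ l * (1 / 2 * ‖Y‖ ^ 2) ≤ Φ * √w ^ c * ‖v‖ ^ l
      * inner ℝ (matAct A (Y + (c * (γ / w)) • X)) (Y + (l : ℝ) • R) := by gcongr
  have h2 : √w ^ c * ‖v‖ ^ l * (-(8 * ‖Y‖ * (B * ‖v‖))) ≤ √w ^ c * ‖v‖ ^ l *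
      inner ℝ (matAct A (Y + (c * (γ / w)) • X)) Z := by
    gcongr
    exact (abs_le.1 herr).1
  rw [pow_succ ‖v‖]
  linarith

lemma exists_young_const {n : ℕ} (hn : n ≤ 4) (hn2 : 2 ≤ n) {D δ : ℝ} (hD : 0 ≤ D) (hδ : 0 < δ) :
    ∃ C : ℝ, 0 ≤ C ∧ ∀ z o : ℝ, 0 ≤ z → z ≤ 1 → 0 ≤ o →
      D * (z ^ 2 * o ^ (n - 2)) ≤ δ * (z ^ 4 * o ^ n) + C := by
  refine ⟨D * (1 + D / δ), by positivity, fun z o hz hz1 ho => ?_⟩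
  have hon : o ^ n = o ^ (n - 2) * o ^ 2 := by rw [← pow_add]; congr 1; omega
  have h0 : 0 ≤ δ * (z ^ 4 * o ^ n) := by positivity
  rcases le_or_gt D (δ * (z * o) ^ 2) with h | h
  · have : D * (z ^ 2 * o ^ (n - 2)) ≤ δ * (z * o) ^ 2 * (z ^ 2 * o ^ (n - 2)) := by gcongr
    have e : δ * (z * o) ^ 2 * (z ^ 2 * o ^ (n - 2)) = δ * (z ^ 4 * o ^ n) := by rw [hon]; ring
    have : 0 ≤ D * (1 + D / δ) := by positivity
    linarith
  · have h1 : (z * o) ^ 2 ≤ D / δ := by rw [le_div_iff₀ hδ]; linarith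
    have h2 : z ^ 2 * o ^ (n - 2) ≤ 1 + (z * o) ^ 2 := by
      have hzo : 0 ≤ z * o := by positivity
      have hz2 : z ^ 2 ≤ 1 := pow_le_one₀ hz hz1
      interval_cases n
      · simp; nlinarith
      · simp only [Nat.reduceSub, pow_one]
        nlinarith [sq_nonneg (z * o - 1)]
      · simp only [Nat.reduceSub]; nlinarith
    have : D * (z ^ 2 * o ^ (n - 2)) ≤ D * (1 + D / δ) := by gcongr; linarith
    linarith

/-- The pointwise inequality behind the moment estimates. -/
lemma exists_moment_const {n : ℕ} (hn : n ≤ 4) (hn2 : 2 ≤ n) (k i : ℕ) (hk : 2 ≤ k) (hi : 4 ≤ i)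
    {M A₀ c c₀ : ℝ} (hM : 0 ≤ M) (hA₀ : 0 ≤ A₀) (hc : 0 < c) (hc₀ : 0 < c₀) :
    ∃ C : ℝ, 0 ≤ C ∧ ∀ z o r y μ τ : ℝ, 0 ≤ z → z ≤ 1 → 0 ≤ o → 0 ≤ r → c ≤ μ → |τ| ≤ M →
      i * z ^ (i - 1) * τ * (μ * r ^ k) + (k - 1) * A₀ * (z ^ i * (μ * r ^ k))
        - k * c₀ * (z ^ i * (o ^ n * r ^ k))
        - k * (1 / 2 * z ^ i * o ^ (n - 2) * r ^ (k - 2) * y ^ 2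
          - 8 * (i * M * z ^ (i - 1)) * o ^ (n - 2) * y * r ^ (k - 2 + 1))
      ≤ -(min c₀ (1 / 2) * (z ^ i * (o ^ n * r ^ k + o ^ (n - 2) * r ^ (k - 2) * y ^ 2)))
        + C * (z ^ (i - 4) * (μ * r ^ k)) := by
  obtain ⟨C1, hC1, hY⟩ := exists_young_const hn hn2 (D := 64 * (i * M) ^ 2) (δ := c₀ / 2)
    (by positivity) (by positivity)
  refine ⟨i * M + k * A₀ + k * (C1 / c), by positivity, ?_⟩
  intro z o r y μ τ hz hz1 ho hr hμ hτ
  obtain ⟨j, rfl⟩ : ∃ j, i = j + 4 := ⟨i - 4, by omega⟩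
  obtain ⟨l, rfl⟩ : ∃ l, k = l + 2 := ⟨k - 2, by omega⟩
  have hμ0 : 0 < μ := hc.trans_le hμ
  simp only [Nat.add_sub_cancel, show j + 4 - 1 = j + 3 by omega]
  set I : ℝ := ((j + 4 : ℕ) : ℝ)
  set k : ℝ := ((l + 2 : ℕ) : ℝ) with hkd
  have hk2 : 2 ≤ k := by simp [hkd]
  have hI : 0 ≤ I := Nat.cast_nonneg _
  set Q := o ^ (n - 2)
  set q := r ^ l
  have hQ : 0 ≤ Q := by positivity
  have hq : 0 ≤ q := by positivity
  have t1 : I * z ^ (j + 3) * τ * (μ * r ^ (l + 2)) ≤ I * M * (z ^ j * (μ * r ^ (l + 2))) := by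
    have : z ^ (j + 3) ≤ z ^ j := pow_le_pow_of_le_one hz hz1 (by omega)
    calc I * z ^ (j + 3) * τ * (μ * r ^ (l + 2)) ≤ I * z ^ j * M * (μ * r ^ (l + 2)) := by
          have : z ^ (j + 3) * τ ≤ z ^ j * M :=
            (mul_le_mul_of_nonneg_left ((le_abs_self τ).trans hτ) (by positivity)).trans
              (mul_le_mul_of_nonneg_right this hM)
          have h2 : 0 ≤ μ * r ^ (l + 2) := by positivity
          calc _ = I * (z ^ (j + 3) * τ) * (μ * r ^ (l + 2)) := by ring
            _ ≤ I * (z ^ j * M) * (μ * r ^ (l + 2)) := by gcongr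
            _ = _ := by ring
      _ = _ := by ring
  have t2 : (k - 1) * A₀ * (z ^ (j + 4) * (μ * r ^ (l + 2))) ≤ k * A₀ * (z ^ j * (μ * r ^ (l + 2))) := by
    have : z ^ (j + 4) ≤ z ^ j := pow_le_pow_of_le_one hz hz1 (by omega)
    gcongr
    · linarith
  have t3 : 8 * (I * M * z ^ (j + 3)) * Q * y * r ^ (l + 1)
      ≤ 1 / 4 * (z ^ (j + 4) * (Q * q * y ^ 2)) + 64 * (I * M) ^ 2 * (z ^ 2 * Q) * (z ^ j * r ^ (l + 2)) := by
    have h1 : 0 ≤ z ^ (j + 2) * Q * q := by positivity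
    have h2 : 8 * (I * M) * (z * y) * r ≤ 1 / 4 * (z * y) ^ 2 + 64 * (I * M) ^ 2 * r ^ 2 := by
      nlinarith [sq_nonneg (1 / 2 * (z * y) - 8 * (I * M) * r)]
    have := mul_le_mul_of_nonneg_left h2 h1
    have e1 : z ^ (j + 2) * Q * q * (8 * (I * M) * (z * y) * r)
        = 8 * (I * M * z ^ (j + 3)) * Q * y * r ^ (l + 1) := by simp only [q]; ring
    have e2 : z ^ (j + 2) * Q * q * (1 / 4 * (z * y) ^ 2 + 64 * (I * M) ^ 2 * r ^ 2)
        = 1 / 4 * (z ^ (j + 4) * (Q * q * y ^ 2))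
          + 64 * (I * M) ^ 2 * (z ^ 2 * Q) * (z ^ j * r ^ (l + 2)) := by simp only [q]; ring
    linarith
  have t4 : 64 * (I * M) ^ 2 * (z ^ 2 * Q) * (z ^ j * r ^ (l + 2))
      ≤ c₀ / 2 * (z ^ (j + 4) * (o ^ n * r ^ (l + 2))) + C1 / c * (z ^ j * (μ * r ^ (l + 2))) := by
    have h1 := mul_le_mul_of_nonneg_right (hY z o hz hz1 ho)
      (show 0 ≤ z ^ j * r ^ (l + 2) by positivity)
    have h2 : C1 * (z ^ j * r ^ (l + 2)) ≤ C1 / c * (z ^ j * (μ * r ^ (l + 2))) := by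
      have : C1 / c * (z ^ j * (c * r ^ (l + 2))) ≤ C1 / c * (z ^ j * (μ * r ^ (l + 2))) := by
        gcongr
      refine le_trans (le_of_eq ?_) this
      field_simp
    have e1 : c₀ / 2 * (z ^ 4 * o ^ n) * (z ^ j * r ^ (l + 2))
        = c₀ / 2 * (z ^ (j + 4) * (o ^ n * r ^ (l + 2))) := by ring
    rw [add_mul, e1] at h1
    linarith
  set b1 := z ^ (j + 4) * (o ^ n * r ^ (l + 2)) with hb1
  set b2 := z ^ (j + 4) * (Q * q * y ^ 2) with hb2
  set b3 := z ^ j * (μ * r ^ (l + 2)) with hb3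
  have hb10 : 0 ≤ b1 := by positivity
  have hb20 : 0 ≤ b2 := by positivity
  have t5 := mul_le_mul_of_nonneg_left (t3.trans (add_le_add_right t4 _)) (show 0 ≤ k by linarith)
  have m1 : min c₀ (1 / 2) * b1 ≤ c₀ * b1 := by gcongr; exact min_le_left _ _
  have m2 : min c₀ (1 / 2) * b2 ≤ 1 / 2 * b2 := by gcongr; exact min_le_right _ _
  have m3 : 2 * (c₀ / 2 * b1) ≤ k * (c₀ / 2 * b1) := by gcongr
  have m4 : 2 * (1 / 4 * b2) ≤ k * (1 / 4 * b2) := by gcongr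
  have e : z ^ (j + 4) * (o ^ n * r ^ (l + 2) + Q * q * y ^ 2) = b1 + b2 := by rw [mul_add]
  have e' : 1 / 2 * z ^ (j + 4) * Q * q * y ^ 2 = 1 / 2 * b2 := by rw [hb2]; ring
  rw [e, e']
  linarith

end ParabolicAlgebra

section Moments


lemma hasDerivAt_vel {φ : ℝ × Eu n → ℝ} (hφ : ContDiff ℝ 1 φ) (t : ℝ) (x : Eu n) :
    HasDerivAt (fun r => φ (r, x)) (vel φ (t, x)) t :=
  (hφ.differentiable one_ne_zero (t, x)).hasFDerivAt.comp_hasDerivAt t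
    ((hasDerivAt_id t).prodMk (hasDerivAt_const t x))

lemma hasDerivAt_integral_vel {s : ℝ} {φ : ℝ × Eu n → ℝ} (hφ : ContDiff ℝ 1 φ)
    (hs : ∀ t, SuppIn s fun x => φ (t, x)) (t : ℝ) :
    HasDerivAt (fun r => ∫ x, φ (r, x)) (∫ x, vel φ (t, x)) t ∧
      (SuppIn s fun x => vel φ (t, x)) ∧ Integrable fun x => vel φ (t, x) := by
  have h : SuppIn s fun x => vel φ (t, x) := fun x hx => by
    have h1 := hasDerivAt_vel hφ t x
    rw [show (fun r => φ (r, x)) = fun _ => 0 from funext fun r => hs r x hx] at h1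
    exact h1.unique (hasDerivAt_const t 0)
  exact ⟨hasDerivAt_integral hφ hs t, h, h.integrable (((hφ.continuous_fderiv one_ne_zero).clm_apply
    continuous_const).comp (f := fun x => (t, x)) (by fun_prop))⟩

lemma le_of_hasDerivAt_nonpos {H : ℝ → ℝ} {α β : ℝ} (hαβ : α ≤ β)
    (h : ∀ t ∈ Icc α β, ∃ H', HasDerivAt H H' t ∧ H' ≤ 0) : H β ≤ H α := by
  refine antitoneOn_of_deriv_nonpos (convex_Icc α β)
    (fun t ht => (h t ht).choose_spec.1.continuousAt.continuousWithinAt) (fun t ht =>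
      (h t (interior_subset ht)).choose_spec.1.differentiableAt.differentiableWithinAt)
    (fun t ht => ?_) (left_mem_Icc.2 hαβ) (right_mem_Icc.2 hαβ) hαβ
  obtain ⟨H', h1, h2⟩ := h t (interior_subset ht)
  rwa [h1.deriv]

/-- A cutoff function in space and time. -/
structure Cutoff (M s' t₀ : ℝ) (χ : ℝ × Eu n → ℝ) : Prop where
  smooth : ContDiff ℝ ∞ χ
  nonneg : ∀ p, 0 ≤ χ p
  le_one : ∀ p, χ p ≤ 1
  supp : ∀ t, SuppIn s' fun x => χ (t, x)
  dt : ∀ p, |vel χ p| ≤ M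
  dx : ∀ p, ∑ i, fderiv ℝ χ p (0, single i 1) ^ 2 ≤ M ^ 2
  zero : ∀ x, χ (t₀, x) = 0
  M_nonneg : 0 ≤ M

/-- The moments of the velocity. -/
def moment (σ : Eu n → ℝ) (F : ℝ × Eu n → W) (m χ : ℝ × Eu n → ℝ) (k i : ℕ) (t : ℝ) : ℝ :=
  ∫ x, σ x * (χ (t, x) ^ i * (m (t, x) * ‖vel F (t, x)‖ ^ k))

/-- The quantities controlled by the dissipation. -/
def dissip (ε : ℝ) (a : Eu n → Mat n) (σ : Eu n → ℝ) (F : ℝ × Eu n → W)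
    (χ : ℝ × Eu n → ℝ) (k i : ℕ) (t : ℝ) : ℝ :=
  ∫ x, σ x * (χ (t, x) ^ i * (√(dens ε a F (t, x)) ^ n * ‖vel F (t, x)‖ ^ k
    + √(dens ε a F (t, x)) ^ (n - 2) * ‖vel F (t, x)‖ ^ (k - 2) * ‖gradx (vel F) (t, x)‖ ^ 2))

variable {K s ε CN A₀ B₀ c T₀ T₁ : ℝ} {a : Eu n → Mat n} {σ : Eu n → ℝ}
  {F : ℝ × Eu n → W} {m : ℝ × Eu n → ℝ} {M s' t₀ : ℝ} {χ : ℝ × Eu n → ℝ}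

lemma Flow.continuous_sqrt_dens (h : Flow K s ε CN A₀ B₀ c T₀ T₁ a σ F m) :
    Continuous fun p => √(dens ε a F p) := (h.coef.contDiff_dens h.smooth_F).continuous.sqrt

lemma Flow.continuous_vel (h : Flow K s ε CN A₀ B₀ c T₀ T₁ a σ F m) : Continuous (vel F) :=
  (contDiff_vel h.smooth_F).continuous

lemma Flow.continuous_gradx_vel (h : Flow K s ε CN A₀ B₀ c T₀ T₁ a σ F m) :
    Continuous (gradx (vel F)) := (contDiff_gradx (contDiff_vel h.smooth_F)).continuous

lemma Flow.continuous_moment (h : Flow K s ε CN A₀ B₀ c T₀ T₁ a σ F m) (hχ : Cutoff M s' t₀ χ)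
    (k : ℕ) {i : ℕ} (hi : i ≠ 0) : Continuous (moment σ F m χ k i) := by
  have h1 := h.continuous_vel
  have h2 := h.smooth_m.continuous
  have h3 := h.coef.smooth_σ.continuous
  have h4 := hχ.smooth.continuous
  exact continuous_integral (s := s')
    (φ := fun p => σ p.2 * (χ p ^ i * (m p * ‖vel F p‖ ^ k))) (by fun_prop)
    fun t x hx => by simp [hχ.supp t x hx, hi]

lemma Flow.continuous_dissip (h : Flow K s ε CN A₀ B₀ c T₀ T₁ a σ F m) (hχ : Cutoff M s' t₀ χ)
    (k : ℕ) {i : ℕ} (hi : i ≠ 0) : Continuous (dissip ε a σ F χ k i) := by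
  have h1 := h.continuous_vel
  have h2 := h.continuous_sqrt_dens
  have h3 := h.coef.smooth_σ.continuous
  have h4 := hχ.smooth.continuous
  have h5 := h.continuous_gradx_vel
  exact continuous_integral (s := s')
    (φ := fun p => σ p.2 * (χ p ^ i * (√(dens ε a F p) ^ n * ‖vel F p‖ ^ k
      + √(dens ε a F p) ^ (n - 2) * ‖vel F p‖ ^ (k - 2) * ‖gradx (vel F) p‖ ^ 2))) (by fun_prop)
    fun t x hx => by simp [hχ.supp t x hx, hi]

lemma moment_zero (hχ : Cutoff M s' t₀ χ) (k : ℕ) {i : ℕ} (hi : i ≠ 0) :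
    moment σ F m χ k i t₀ = 0 := by
  simp [moment, hχ.zero, hi]

/-- The test function `χ^i |v|^l v`. -/
lemma grad_test (hF : ContDiff ℝ ∞ F) (hχ : Cutoff M s' t₀ χ) (i l : ℕ) (t : ℝ) :
    (ContDiff ℝ 1 fun x => (χ (t, x) ^ i * ‖vel F (t, x)‖ ^ l) • vel F (t, x)) ∧
    ∀ x j, grad (fun x => (χ (t, x) ^ i * ‖vel F (t, x)‖ ^ l) • vel F (t, x)) x j
      = χ (t, x) ^ i • (‖vel F (t, x)‖ ^ l • gradx (vel F) (t, x) j
          + ((l : ℝ) * (‖vel F (t, x)‖ ^ l / ‖vel F (t, x)‖ ^ 2)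
            * inner ℝ (vel F (t, x)) (gradx (vel F) (t, x) j)) • vel F (t, x))
        + (i * χ (t, x) ^ (i - 1) * fderiv ℝ χ (t, x) (0, single j 1))
          • (‖vel F (t, x)‖ ^ l • vel F (t, x)) := by
  have hv1 : ContDiff ℝ 1 (vel F) := (contDiff_vel hF).of_le (by simp)
  have hχ1 : ContDiff ℝ 1 χ := hχ.smooth.of_le (by simp)
  have hN := contDiff_norm_pow_smul l hv1
  have hP : ContDiff ℝ 1 fun p => χ p ^ i • (‖vel F p‖ ^ l • vel F p) := (hχ1.pow i).smul hN
  have e : (fun x => (χ (t, x) ^ i * ‖vel F (t, x)‖ ^ l) • vel F (t, x))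
      = fun x => (fun p => χ p ^ i • (‖vel F p‖ ^ l • vel F p)) (t, x) := by
    funext x; simp only [smul_smul]
  rw [e]
  refine ⟨hP.comp (contDiff_prodMk_right t), fun x j => ?_⟩
  rw [grad_apply, pd_slice (hP.differentiable one_ne_zero _),
    fderiv_fun_smul ((hχ1.pow i).differentiable one_ne_zero _) (hN.differentiable one_ne_zero _)]
  simp only [_root_.add_apply, _root_.smul_apply, smulRight_apply]
  rw [fderiv_norm_pow_smul l hv1]
  congr 2
  have h1 := ((hχ1.differentiable one_ne_zero (t, x)).hasFDerivAt.pow i).fderiv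
  have h2 : fderiv ℝ (fun p => χ p ^ i) (t, x) = _ := h1
  rw [h2]
  simp

lemma sum_sq_cutoff_le (hχ : Cutoff M s' t₀ χ) (i : ℕ) (p : ℝ × Eu n) :
    ∑ j, (i * χ p ^ (i - 1) * fderiv ℝ χ p (0, single j 1)) ^ 2 ≤ (i * M * χ p ^ (i - 1)) ^ 2 := by
  have h := hχ.dx p
  calc _ = (i * χ p ^ (i - 1)) ^ 2 * ∑ j, fderiv ℝ χ p (0, single j 1) ^ 2 := by
        rw [mul_sum]; exact sum_congr rfl fun j _ => by ring
    _ ≤ (i * χ p ^ (i - 1)) ^ 2 * M ^ 2 := by gcongr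
    _ = _ := by ring

lemma hasFDerivAt_norm_pow {P : Type*} [NormedAddCommGroup P] [NormedSpace ℝ P] (l : ℕ) {v : P → W}
    (hv : ContDiff ℝ 1 v) : (ContDiff ℝ 1 fun p => ‖v p‖ ^ (l + 2)) ∧
      ∀ p u, fderiv ℝ (fun p => ‖v p‖ ^ (l + 2)) p u
        = ((l : ℝ) + 2) * ‖v p‖ ^ l * inner ℝ (v p) (fderiv ℝ v p u) := by
  have hN := contDiff_norm_pow_smul l hv
  have e : (fun p => ‖v p‖ ^ (l + 2)) = fun p => (inner ℝ (‖v p‖ ^ l • v p) (v p) : ℝ) := by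
    funext p; rw [real_inner_smul_left, real_inner_self_eq_norm_sq, pow_add]
  rw [e]
  refine ⟨hN.inner ℝ hv, fun p u => ?_⟩
  rw [fderiv_inner_apply ℝ (hN.differentiable one_ne_zero p) (hv.differentiable one_ne_zero p),
    fderiv_norm_pow_smul l hv, inner_add_left, real_inner_smul_left, real_inner_smul_left,
    real_inner_smul_left, real_inner_self_eq_norm_sq, real_inner_comm (v p)]
  rcases eq_or_ne ‖v p‖ 0 with h0 | h0
  · have : v p = 0 := norm_eq_zero.1 h0
    simp [this]
  · field_simp; ring

set_option maxHeartbeats 1000000 in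
/-- The differential inequality for the moments. -/
lemma exists_moment_estimate (hn : n ≤ 4) (hn2 : 2 ≤ n) (k i : ℕ) (hk : 2 ≤ k) (hk4 : k ≤ 4)
    (hi : 5 ≤ i) {M A₀ B₀ CN c : ℝ} (hM : 0 ≤ M) (hA₀ : 0 ≤ A₀) (hc : 0 < c)
    (hB₀ : 0 < B₀ / 2 - CN ^ 2) :
    ∃ κ C : ℝ, 0 < κ ∧ 0 ≤ C ∧ ∀ {W : Type*} [NormedAddCommGroup W] [InnerProductSpace ℝ W]
      {K s s' ε T₀ T₁ t₀ : ℝ}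
      {a : Eu n → Mat n} {σ : Eu n → ℝ} {F : ℝ × Eu n → W} {m χ : ℝ × Eu n → ℝ},
      Flow K s ε CN A₀ B₀ c T₀ T₁ a σ F m → Cutoff M s' t₀ χ → s' < s → T₀ < t₀ →
      ∀ τ, t₀ ≤ τ → τ < T₁ → moment σ F m χ k i τ + κ * ∫ t in t₀..τ, dissip ε a σ F χ k i t
        ≤ C * ∫ t in t₀..τ, moment σ F m χ k (i - 4) t := by
  obtain ⟨C, hC, hpt⟩ := exists_moment_const hn hn2 k i hk (by omega) (c₀ := B₀ / 2 - CN ^ 2)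
    hM hA₀ hc hB₀
  set κ := min (B₀ / 2 - CN ^ 2) (1 / 2) with hκ
  refine ⟨κ, C, lt_min hB₀ (by norm_num), hC, ?_⟩
  intro W _ _ K s s' ε T₀ T₁ t₀ a σ F m χ h hχ hs hT₀ τ hτ hτ₁
  obtain ⟨l, rfl⟩ : ∃ l, k = l + 2 := ⟨k - 2, by omega⟩
  simp only [Nat.add_sub_cancel] at hpt
  have hi0 : i ≠ 0 := by omega
  have hi4 : i - 4 ≠ 0 := by omega
  have cA := h.continuous_moment hχ (l + 2) hi0
  have cA4 := h.continuous_moment hχ (l + 2) hi4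
  have cB := h.continuous_dissip hχ (l + 2) hi0
  have hv1 : ContDiff ℝ 1 (vel F) := (contDiff_vel h.smooth_F).of_le (by simp)
  have hχ1 : ContDiff ℝ 1 χ := hχ.smooth.of_le (by simp)
  have hm1 : ContDiff ℝ 1 m := h.smooth_m.of_le (by simp)
  have hσ1 : ContDiff ℝ 1 fun p : ℝ × Eu n => σ p.2 := h.coef.smooth_σ_snd.of_le (by simp)
  obtain ⟨hN1, hNd⟩ := hasFDerivAt_norm_pow l hv1
  have hχc := hχ1.continuous
  have hσc := h.coef.smooth_σ.continuous
  have hmc := hm1.continuous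
  have hvc := hv1.continuous
  have hac : Continuous (vel (vel F)) := (contDiff_vel (contDiff_vel h.smooth_F)).continuous
  have hχt : Continuous (vel χ) := (contDiff_vel hχ.smooth).continuous
  have hmt : Continuous (vel m) := (contDiff_vel h.smooth_m).continuous
  have hνc := h.continuous_resid hn
  have hωc := h.continuous_sqrt_dens
  have hgc := h.continuous_gradx_vel
  have hUc : Continuous (fluxDot ε a F) := by
    have : fluxDot ε a F = fun p => fderiv ℝ (fluxx ε a F) p (1, 0) := by
      funext p; rw [h.coef.fderiv_fluxx hn h.ε_nonneg h.smooth_F]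
    rw [this]
    exact ((h.coef.contDiff_fluxx hn h.ε_nonneg h.smooth_F).continuous_fderiv
      one_ne_zero).clm_apply continuous_const
  have hder : ∀ t ∈ Ioo T₀ T₁, ∃ A', HasDerivAt (moment σ F m χ (l + 2) i) A' t ∧
      A' + κ * dissip ε a σ F χ (l + 2) i t ≤ C * moment σ F m χ (l + 2) (i - 4) t := by
    intro t ht
    have hφ : ContDiff ℝ 1 fun p : ℝ × Eu n => σ p.2 * (χ p ^ i * (m p * ‖vel F p‖ ^ (l + 2))) :=
      hσ1.mul ((hχ1.pow i).mul (hm1.mul hN1))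
    let f1 x := σ x * (i * χ (t, x) ^ (i - 1) * vel χ (t, x) * (m (t, x) * ‖vel F (t, x)‖ ^ (l + 2))
      + χ (t, x) ^ i * (vel m (t, x) * ‖vel F (t, x)‖ ^ (l + 2) + m (t, x) * (((l + 2 : ℕ) : ℝ)
        * ‖vel F (t, x)‖ ^ l * inner ℝ (vel F (t, x)) (vel (vel F) (t, x)))))
    have hdφ : ∀ x, vel (fun p : ℝ × Eu n => σ p.2 * (χ p ^ i * (m p * ‖vel F p‖ ^ (l + 2)))) (t, x)
        = f1 x := fun x => by
      have e : vel (fun p => ‖vel F p‖ ^ (l + 2)) (t, x) = _ := hNd (t, x) (1, 0)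
      rw [(hasDerivAt_vel hφ t x).unique ((((hasDerivAt_vel hχ1 t x).pow i).mul
        ((hasDerivAt_vel hm1 t x).mul (hasDerivAt_vel hN1 t x))).const_mul (σ x)), e]
      simp only [f1, Pi.mul_apply, Pi.pow_apply]
      push_cast
      rfl
    obtain ⟨hd, -, i1⟩ := hasDerivAt_integral_vel (s := s') hφ
      (fun t x hx => by simp [hχ.supp t x hx, hi0]) t
    simp only [hdφ] at hd i1
    refine ⟨_, hd, ?_⟩
    obtain ⟨hψ, hψd⟩ := grad_test h.smooth_F hχ i l t
    have hg : Continuous fun x => χ (t, x) ^ i * ‖vel F (t, x)‖ ^ l := by fun_prop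
    have hgs : SuppIn s' fun x => χ (t, x) ^ i * ‖vel F (t, x)‖ ^ l := fun x hx => by
      simp [hχ.supp t x hx, hi0]
    have hw := h.weak_deriv hn hs hg hgs ht hψ
    have hgψ := continuous_grad hψ
    have hgψs : SuppIn s' (grad fun x => (χ (t, x) ^ i * ‖vel F (t, x)‖ ^ l) • vel F (t, x)) :=
      SuppIn.grad fun x hx => by simp [hχ.supp t x hx, hi0]
    set Ψ := grad fun x => (χ (t, x) ^ i * ‖vel F (t, x)‖ ^ l) • vel F (t, x) with hΨ
    have hAU : Continuous fun x => matAct (a x) (fluxDot ε a F (t, x)) := by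
      refine (PiLp.continuous_toLp 2 _).comp (continuous_pi fun j => ?_)
      refine continuous_finsetSum _ fun j' _ => ?_
      exact (h.coef.smooth_a j j').continuous.smul
        ((PiLp.continuous_apply 2 _ j').comp (hUc.comp (by fun_prop)))
    let f2 x := σ x * (χ (t, x) ^ i * ‖vel F (t, x)‖ ^ l * (vel m (t, x) * ‖vel F (t, x)‖ ^ 2
      + m (t, x) * inner ℝ (vel F (t, x)) (vel (vel F) (t, x))))
    let f3 x := σ x * inner ℝ (matAct (a x) (fluxDot ε a F (t, x))) (Ψ x)
    let f4 x := σ x * (χ (t, x) ^ i * ‖vel F (t, x)‖ ^ l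
      * inner ℝ (resid ε a σ F m (t, x)) (vel (vel F) (t, x)))
    have hgt : Continuous fun x => gradx (vel F) (t, x) := hgc.comp (by fun_prop)
    have hωt : Continuous fun x => √(dens ε a F (t, x)) := hωc.comp (f := fun x => (t, x)) (by fun_prop)
    have i2 : Integrable f2 := SuppIn.integrable (s := s') fun x hx => by simp [f2, hχ.supp t x hx, hi0]
    have i3 : Integrable f3 := hgψs.integrable_of fun x hx => by simp [f3, hx]
    have i4 : Integrable f4 := SuppIn.integrable (s := s') fun x hx => by simp [f4, hχ.supp t x hx, hi0]
    let f5 x := σ x * (χ (t, x) ^ i * (√(dens ε a F (t, x)) ^ n * ‖vel F (t, x)‖ ^ (l + 2)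
      + √(dens ε a F (t, x)) ^ (n - 2) * ‖vel F (t, x)‖ ^ (l + 2 - 2) * ‖gradx (vel F) (t, x)‖ ^ 2))
    let f6 x := σ x * (χ (t, x) ^ (i - 4) * (m (t, x) * ‖vel F (t, x)‖ ^ (l + 2)))
    have i5 : Integrable f5 := SuppIn.integrable (s := s') fun x hx => by simp [f5, hχ.supp t x hx, hi0]
    have i6 : Integrable f6 := SuppIn.integrable (s := s') fun x hx => by simp [f6, hχ.supp t x hx, hi4]
    set k : ℝ := ((l + 2 : ℕ) : ℝ) with hk'
    have hk0 : 0 ≤ k := Nat.cast_nonneg _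
    have e234 : ∫ x, k * (f2 x + f3 x + f4 x) = 0 := by
      rw [integral_const_mul, integral_add (f := fun x => f2 x + f3 x) (i2.add i3) i4,
        integral_add i2 i3]
      exact mul_eq_zero_of_right k hw
    have i234 : Integrable fun x => k * (f2 x + f3 x + f4 x) := ((i2.add i3).add i4).const_mul k
    suffices hpw : ∀ x, f1 x - k * (f2 x + f3 x + f4 x) ≤ C * f6 x - κ * f5 x by
      have hle : ∫ x, (f1 x - k * (f2 x + f3 x + f4 x)) ≤ ∫ x, (C * f6 x - κ * f5 x) :=
        integral_mono (i1.sub i234) ((i6.const_mul C).sub (i5.const_mul κ)) hpw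
      rw [integral_sub i1 i234, e234, sub_zero, integral_sub (i6.const_mul C) (i5.const_mul κ),
        integral_const_mul, integral_const_mul] at hle
      change _ + κ * ∫ x, f5 x ≤ C * ∫ x, f6 x
      linarith
    intro x
    have hσx := h.coef.pos x
    simp only [f1, f2, f3, f4, f5, f6]
    by_cases hx : x ∈ 𝔻 s'
    · have hxs := closedBall_subset_ball hs hx
      have hQ := flux_form_ge hn (c := n - 2) (l := l) (by omega) (by omega)
        (h.coef.dens_nonneg hn h.ε_nonneg F (t, x)) (h.coef.near x)
        (h.coef.norm_gradx_le' hn h.ε_nonneg F (t, x)) (v := vel F (t, x)) rfl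
        (pow_nonneg (hχ.nonneg (t, x)) i) (hψd x)
        (mul_nonneg (mul_nonneg (Nat.cast_nonneg i) hM) (pow_nonneg (hχ.nonneg (t, x)) (i - 1)))
        (sum_sq_cutoff_le hχ i (t, x))
      have hp := hpt (χ (t, x)) (√(dens ε a F (t, x))) ‖vel F (t, x)‖ ‖gradx (vel F) (t, x)‖
        (m (t, x)) (vel χ (t, x)) (hχ.nonneg _) (hχ.le_one _) (sqrt_nonneg _) (norm_nonneg _)
        (h.m_ge t ht x hxs) (hχ.dt _)
      have hacc := mul_le_mul_of_nonneg_left (h.accel t ht x hxs)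
        (show 0 ≤ χ (t, x) ^ i * ‖vel F (t, x)‖ ^ l from
          mul_nonneg (pow_nonneg (hχ.nonneg _) _) (by positivity))
      change 1 / 2 * χ (t, x) ^ i * √(dens ε a F (t, x)) ^ (n - 2) * ‖vel F (t, x)‖ ^ l
        * ‖gradx (vel F) (t, x)‖ ^ 2 - 8 * (i * M * χ (t, x) ^ (i - 1))
        * √(dens ε a F (t, x)) ^ (n - 2) * ‖gradx (vel F) (t, x)‖ * ‖vel F (t, x)‖ ^ (l + 1)
        ≤ inner ℝ (matAct (a x) (fluxDot ε a F (t, x))) (Ψ x) at hQ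
      rw [h.m_eq t ht x hxs]
      simp only [Nat.add_sub_cancel]
      have hQ' := mul_le_mul_of_nonneg_left hQ hk0
      have hacc' := mul_le_mul_of_nonneg_left hacc hk0
      set z := χ (t, x)
      set o := √(dens ε a F (t, x))
      set r := ‖vel F (t, x)‖
      set y := ‖gradx (vel F) (t, x)‖
      set μ := m (t, x)
      set ip : ℝ := inner ℝ (vel F (t, x)) (vel (vel F) (t, x))
      set iν : ℝ := inner ℝ (resid ε a σ F m (t, x)) (vel (vel F) (t, x))
      set iU : ℝ := inner ℝ (matAct (a x) (fluxDot ε a F (t, x))) (Ψ x)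
      have hz : 0 ≤ z := hχ.nonneg _
      have hk2 : 2 ≤ k := by rw [hk']; push_cast; linarith [(Nat.cast_nonneg l : (0 : ℝ) ≤ l)]
      have hb : 0 ≤ z ^ i * (o ^ n * r ^ (l + 2)) := by positivity
      have hB : k * (B₀ / 2) * (z ^ i * (o ^ n * r ^ (l + 2)))
          ≤ (k - 1) * B₀ * (z ^ i * (o ^ n * r ^ (l + 2))) := by
        refine mul_le_mul_of_nonneg_right ?_ hb
        have : 0 < B₀ := by nlinarith [sq_nonneg CN]
        nlinarith
      have hfin : 0 ≤ C * (z ^ (i - 4) * (μ * r ^ (l + 2)))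
          - κ * (z ^ i * (o ^ n * r ^ (l + 2) + o ^ (n - 2) * r ^ l * y ^ 2))
          - (i * z ^ (i - 1) * vel χ (t, x) * (μ * r ^ (l + 2))
          + z ^ i * ((B₀ * o ^ n - A₀ * μ) * r ^ (l + 2) + μ * (k * r ^ l * ip))
          - k * (z ^ i * r ^ l * ((B₀ * o ^ n - A₀ * μ) * r ^ 2 + μ * ip) + iU
            + z ^ i * r ^ l * iν)) := by
        have er : r ^ (l + 2) = r ^ l * r ^ 2 := pow_add _ _ _
        have eb : CN ^ 2 * (o ^ n * r ^ 2) * r ^ l = CN ^ 2 * (o ^ n * r ^ (l + 2)) := by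
          rw [er]; ring
        have e1 : k * (z ^ i * r ^ l * (CN ^ 2 * (o ^ n * r ^ 2)))
            = k * CN ^ 2 * (z ^ i * (o ^ n * r ^ (l + 2))) := by rw [er]; ring
        have e2 : k * (z ^ i * r ^ l * ((B₀ * o ^ n - A₀ * μ) * r ^ 2 + μ * ip) + iU
            + z ^ i * r ^ l * iν) = k * B₀ * (z ^ i * (o ^ n * r ^ (l + 2)))
            - k * A₀ * (z ^ i * (μ * r ^ (l + 2))) + z ^ i * (μ * (k * r ^ l * ip))
            + k * iU + k * (z ^ i * r ^ l * iν) := by rw [er]; ring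
        have e3 : z ^ i * ((B₀ * o ^ n - A₀ * μ) * r ^ (l + 2) + μ * (k * r ^ l * ip))
            = B₀ * (z ^ i * (o ^ n * r ^ (l + 2))) - A₀ * (z ^ i * (μ * r ^ (l + 2)))
              + z ^ i * (μ * (k * r ^ l * ip)) := by ring
        rw [e1] at hacc'
        rw [e2, e3]
        linarith
      have := mul_nonneg hσx.le hfin
      linarith
    · have h1 := hχ.supp t x hx
      have h2 := hgψs x hx
      simp only at h1
      simp [h1, h2, hi0, hi4, show i - 1 ≠ 0 by omega]
  have hH := le_of_hasDerivAt_nonpos (H := fun τ => moment σ F m χ (l + 2) i τ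
    + κ * (∫ t in t₀..τ, dissip ε a σ F χ (l + 2) i t)
    - C * ∫ t in t₀..τ, moment σ F m χ (l + 2) (i - 4) t) hτ fun t ht => by
      obtain ⟨A', hA', hle⟩ := hder t ⟨hT₀.trans_le ht.1, ht.2.trans_lt hτ₁⟩
      exact ⟨_, (hA'.add ((cB.integral_hasStrictDerivAt t₀ t).hasDerivAt.const_mul κ)).sub
        ((cA4.integral_hasStrictDerivAt t₀ t).hasDerivAt.const_mul C), by linarith⟩
  simp only [intervalIntegral.integral_same, moment_zero hχ (l + 2) hi0] at hH
  linarith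

end Moments

section LowMoments

variable {K s ε CN A₀ B₀ c T₀ T₁ : ℝ} {a : Eu n → Mat n} {σ : Eu n → ℝ}
  {F : ℝ × Eu n → W} {m : ℝ × Eu n → ℝ} {M s' t₀ : ℝ} {χ : ℝ × Eu n → ℝ}

lemma norm_test_le {l : ℕ} {Y Ψ : Gr n W} {v : W} {Φ : ℝ} (hΦ : 0 ≤ Φ) {φ : Fin n → ℝ}
    (hΨ : ∀ i, Ψ i = Φ • (‖v‖ ^ l • Y i + ((l : ℝ) * (‖v‖ ^ l / ‖v‖ ^ 2) * inner ℝ v (Y i)) • v)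
      + φ i • (‖v‖ ^ l • v)) {B : ℝ} (hB : 0 ≤ B) (hφ : ∑ i, φ i ^ 2 ≤ B ^ 2) :
    ‖Ψ‖ ≤ (1 + l) * (Φ * ‖v‖ ^ l * ‖Y‖) + B * ‖v‖ ^ (l + 1) := by
  obtain ⟨R, hR, -, hRY⟩ := exists_radial_part Y v
  set Z : Gr n W := toLp 2 fun i => φ i • v with hZ
  have hΨ' : Ψ = (Φ * ‖v‖ ^ l) • (Y + (l : ℝ) • R) + ‖v‖ ^ l • Z := by
    ext i
    rw [hΨ]
    simp only [PiLp.add_apply, PiLp.smul_apply, hR, smul_add, smul_smul, hZ]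
    congr 2
    · congr 1; ring
    · ring
  have hZn : ‖Z‖ ≤ B * ‖v‖ := by
    refine abs_le_of_sq_le_sq' ?_ (by positivity) |>.2
    rw [gr_norm_sq]
    simp only [hZ, norm_smul, mul_pow, norm_eq_abs, sq_abs]
    rw [← sum_mul]
    gcongr
  have h1 : ‖Y + (l : ℝ) • R‖ ≤ (1 + l) * ‖Y‖ := by
    refine (norm_add_le _ _).trans ?_
    rw [norm_smul, Real.norm_natCast, add_mul, one_mul]
    gcongr
  rw [hΨ']
  refine (norm_add_le _ _).trans ?_
  rw [norm_smul, norm_smul, norm_of_nonneg (by positivity), norm_of_nonneg (by positivity)]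
  calc Φ * ‖v‖ ^ l * ‖Y + (l : ℝ) • R‖ + ‖v‖ ^ l * ‖Z‖
      ≤ Φ * ‖v‖ ^ l * ((1 + l) * ‖Y‖) + ‖v‖ ^ l * (B * ‖v‖) := by gcongr
    _ = _ := by rw [pow_succ]; ring

lemma Coef.norm_matAct_fluxx_le (ha : Coef K s a σ) (hn : n ≤ 4) (hn2 : 2 ≤ n) (hε : 0 ≤ ε)
    (F : ℝ × Eu n → W) (p : ℝ × Eu n) :
    ‖matAct (a p.2) (fluxx ε a F p)‖ ≤ 3 * √(dens ε a F p) ^ (n - 1) := by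
  have h1 := (ha.near p.2).norm_matAct_le hn (fluxx ε a F p)
  have h2 : ‖gradx F p‖ ≤ 3 / 2 * √(dens ε a F p) := by
    refine abs_le_of_sq_le_sq' ?_ (by positivity) |>.2
    rw [mul_pow, sq_sqrt (ha.dens_nonneg hn hε F p)]
    linarith [ha.norm_gradx_le hn hε F p, ha.dens_nonneg hn hε F p]
  have h3 : ‖fluxx ε a F p‖ ≤ 3 / 2 * √(dens ε a F p) ^ (n - 1) := by
    rw [fluxx, norm_smul, norm_of_nonneg (by positivity), show n - 1 = n - 2 + 1 by omega, pow_succ]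
    calc _ ≤ √(dens ε a F p) ^ (n - 2) * (3 / 2 * √(dens ε a F p)) := by gcongr
      _ = _ := by ring
  linarith

lemma pow_pred_le {n : ℕ} (hn2 : 2 ≤ n) {o : ℝ} (ho : 0 ≤ o) :
    o ^ (n - 1) ≤ 1 + o ^ n ∧ o ^ (n - 2) ≤ 1 + o ^ n := by
  constructor
  all_goals
    rcases le_total o 1 with h | h
    · have : o ^ n ≥ 0 := by positivity
      exact (pow_le_one₀ ho h).trans (by linarith)
    · exact (pow_le_pow_right₀ h (by omega : _ ≤ n)).trans (by linarith)

/-- The equation tested with `χ^i |v|^l v`. -/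
lemma Flow.moment_eq (h : Flow K s ε CN A₀ B₀ c T₀ T₁ a σ F m) (hn : n ≤ 4) (hχ : Cutoff M s' t₀ χ)
    (hs : s' < s) {i : ℕ} (hi : i ≠ 0) (l : ℕ) {t : ℝ} (ht : t ∈ Ioo T₀ T₁) {Ψ : Eu n → Gr n W}
    (hΨ : Ψ = grad fun x => (χ (t, x) ^ i * ‖vel F (t, x)‖ ^ l) • vel F (t, x)) : SuppIn s' Ψ ∧
    Integrable (fun x => -(σ x * inner ℝ (matAct (a x) (fluxx ε a F (t, x))) (Ψ x))) ∧
    moment σ F m χ (l + 2) i t =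
      ∫ x, -(σ x * inner ℝ (matAct (a x) (fluxx ε a F (t, x))) (Ψ x)) := by
  have hψ := (grad_test h.smooth_F hχ i l t).1
  have hgψ : Continuous Ψ := hΨ ▸ continuous_grad hψ
  have hgψs : SuppIn s' Ψ := hΨ ▸ SuppIn.grad fun x hx => by simp [hχ.supp t x hx, hi]
  have hAV : Continuous fun x => matAct (a x) (fluxx ε a F (t, x)) := (h.coef.contDiff_matAct_snd
    (h.coef.contDiff_fluxx hn h.ε_nonneg h.smooth_F)).continuous.comp (f := fun x => (t, x))
    (by fun_prop)
  have hσc := h.coef.smooth_σ.continuous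
  refine ⟨hgψs, hgψs.integrable_of, ?_⟩
  rw [integral_neg, hΨ, ← h.weak_vel hn hs (fun x hx => by simp [hχ.supp t x hx, hi]) ht hψ, moment]
  congr 1; funext x; ring

/-- A higher moment is controlled by the dissipation of a lower one. -/
lemma exists_moment_succ (hn : n ≤ 4) (hn2 : 2 ≤ n) (l i : ℕ) (hi : 2 ≤ i) {M c : ℝ} (hM : 0 ≤ M)
    (hc : 0 < c) : ∃ C : ℝ, 0 ≤ C ∧ ∀ {W : Type*} [NormedAddCommGroup W] [InnerProductSpace ℝ W]
      {K s s' ε CN A₀ B₀ T₀ T₁ t₀ : ℝ}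
      {a : Eu n → Mat n} {σ : Eu n → ℝ} {F : ℝ × Eu n → W} {m χ : ℝ × Eu n → ℝ},
      Flow K s ε CN A₀ B₀ c T₀ T₁ a σ F m → Cutoff M s' t₀ χ → s' < s →
      ∀ t ∈ Ioo T₀ T₁, moment σ F m χ (l + 3) i t
        ≤ C * (dissip ε a σ F χ (l + 2) (i - 1) t + moment σ F m χ (l + 2) (i - 1) t) := by
  refine ⟨3 * (l + 2) + 3 * (i * M) * (1 + 1 / c), by positivity, ?_⟩
  intro W _ _ K s s' ε CN A₀ B₀ T₀ T₁ t₀ a σ F m χ h hχ hs t ht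
  have hi0 : i ≠ 0 := by omega
  have hi1 : i - 1 ≠ 0 := by omega
  have hψd := (grad_test h.smooth_F hχ i (l + 1) t).2
  obtain ⟨hgψs, i1, e1⟩ := h.moment_eq hn hχ hs hi0 (l + 1) ht rfl
  set Ψ := grad fun x => (χ (t, x) ^ i * ‖vel F (t, x)‖ ^ (l + 1)) • vel F (t, x) with hΨ
  have hσc := h.coef.smooth_σ.continuous
  have hχc := hχ.smooth.continuous
  have hmc := h.smooth_m.continuous
  have hvc := h.continuous_vel
  have hgt : Continuous fun x => gradx (vel F) (t, x) := h.continuous_gradx_vel.comp (by fun_prop)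
  have hωt : Continuous fun x => √(dens ε a F (t, x)) :=
    h.continuous_sqrt_dens.comp (f := fun x => (t, x)) (by fun_prop)
  have i5 : Integrable fun x => σ x * (χ (t, x) ^ (i - 1) * (√(dens ε a F (t, x)) ^ n
      * ‖vel F (t, x)‖ ^ (l + 2) + √(dens ε a F (t, x)) ^ (n - 2) * ‖vel F (t, x)‖ ^ (l + 2 - 2)
        * ‖gradx (vel F) (t, x)‖ ^ 2)) :=
    SuppIn.integrable (s := s') fun x hx => by simp [hχ.supp t x hx, hi1]
  have i6 : Integrable fun x => σ x * (χ (t, x) ^ (i - 1) * (m (t, x) * ‖vel F (t, x)‖ ^ (l + 2))) :=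
    SuppIn.integrable (s := s') fun x hx => by simp [hχ.supp t x hx, hi1]
  rw [show l + 3 = l + 1 + 2 from rfl, e1, moment, dissip, ← integral_add i5 i6, ← integral_const_mul]
  refine integral_mono i1 ((i5.add i6).const_mul _) fun x => ?_
  by_cases hx : x ∈ 𝔻 s'
  swap
  · simp [hgψs x hx, hχ.supp t x hx, hi1]
  have hxs := closedBall_subset_ball hs hx
  have hz := hχ.nonneg (t, x)
  have hz1 := hχ.le_one (t, x)
  have hΨn := norm_test_le (pow_nonneg hz i) (hψd x)
    (mul_nonneg (mul_nonneg (Nat.cast_nonneg i) hM) (pow_nonneg hz (i - 1)))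
    (sum_sq_cutoff_le hχ i (t, x))
  change ‖Ψ x‖ ≤ _ at hΨn
  have hVn : ‖matAct (a x) (fluxx ε a F (t, x))‖ ≤ 3 * √(dens ε a F (t, x)) ^ (n - 1) :=
    h.coef.norm_matAct_fluxx_le hn hn2 h.ε_nonneg F (t, x)
  have hin := (abs_le.1 (abs_real_inner_le_norm (matAct (a x) (fluxx ε a F (t, x))) (Ψ x))).1
  have hμ := h.m_ge t ht x hxs
  have hσx := (h.coef.pos x).le
  set z := χ (t, x)
  set o := √(dens ε a F (t, x)) with ho
  set r := ‖vel F (t, x)‖ with hr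
  set y := ‖gradx (vel F) (t, x)‖
  set μ := m (t, x)
  have ho0 : 0 ≤ o := sqrt_nonneg _
  have hr0 : 0 ≤ r := norm_nonneg _
  have hy0 : 0 ≤ y := norm_nonneg _
  simp only [Nat.add_sub_cancel]
  have hprod : ‖matAct (a x) (fluxx ε a F (t, x))‖ * ‖Ψ x‖ ≤ 3 * o ^ (n - 1)
      * ((1 + (l + 1 : ℕ)) * (z ^ i * r ^ (l + 1) * y) + i * M * z ^ (i - 1) * r ^ (l + 1 + 1)) := by
    gcongr
  have hzi : z ^ i ≤ z ^ (i - 1) := pow_le_pow_of_le_one hz hz1 (by omega)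
  have hn1 : o ^ (n - 1) = o ^ (n - 2) * o := by rw [← pow_succ]; congr 1; omega
  have hnn : o ^ n = o ^ (n - 2) * o ^ 2 := by rw [← pow_add]; congr 1; omega
  have hP : o ^ n * r ^ (l + 2) + o ^ (n - 2) * r ^ l * y ^ 2
      = o ^ (n - 2) * r ^ l * ((o * r) ^ 2 + y ^ 2) := by rw [hnn]; ring
  have g1 : o ^ (n - 1) * (z ^ i * r ^ (l + 1) * y)
      ≤ z ^ (i - 1) * (o ^ n * r ^ (l + 2) + o ^ (n - 2) * r ^ l * y ^ 2) := by
    rw [hP, hn1]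
    calc _ = z ^ i * (o ^ (n - 2) * r ^ l * ((o * r) * y)) := by ring
      _ ≤ z ^ (i - 1) * (o ^ (n - 2) * r ^ l * ((o * r) ^ 2 + y ^ 2)) := by
        gcongr
        nlinarith [sq_nonneg (o * r - y), sq_nonneg (o * r), sq_nonneg y]
  have g2 : o ^ (n - 1) * (z ^ (i - 1) * r ^ (l + 2))
      ≤ z ^ (i - 1) * (o ^ n * r ^ (l + 2)) + 1 / c * (z ^ (i - 1) * (μ * r ^ (l + 2))) := by
    have h1 : r ^ (l + 2) ≤ 1 / c * (μ * r ^ (l + 2)) := by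
      have : 1 ≤ 1 / c * μ := by rw [one_div_mul_eq_div, one_le_div hc]; exact hμ
      nlinarith [show 0 ≤ r ^ (l + 2) by positivity]
    have h2 := mul_le_mul_of_nonneg_right (pow_pred_le hn2 ho0).1
      (show 0 ≤ z ^ (i - 1) * r ^ (l + 2) by positivity)
    have h3 := mul_le_mul_of_nonneg_left h1 (show 0 ≤ z ^ (i - 1) by positivity)
    linarith
  set b1 := z ^ (i - 1) * (o ^ n * r ^ (l + 2)) with hb1
  set b2 := z ^ (i - 1) * (o ^ n * r ^ (l + 2) + o ^ (n - 2) * r ^ l * y ^ 2) with hb2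
  set b3 := z ^ (i - 1) * (μ * r ^ (l + 2)) with hb3
  have hb12 : b1 ≤ b2 := by
    rw [hb1, hb2]; gcongr
    have : 0 ≤ o ^ (n - 2) * r ^ l * y ^ 2 := by positivity
    linarith
  have hμ0 : 0 ≤ μ := hc.le.trans hμ
  have hb10 : 0 ≤ b1 := by positivity
  have hb20 : 0 ≤ b2 := hb10.trans hb12
  have hb30 : 0 ≤ b3 := by positivity
  have g3 : -inner ℝ (matAct (a x) (fluxx ε a F (t, x))) (Ψ x)
      ≤ 3 * (l + 2) * b2 + 3 * (i * M) * (b2 + 1 / c * b3) := by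
    have e2 : 3 * o ^ (n - 1)
      * ((1 + (l + 1 : ℕ)) * (z ^ i * r ^ (l + 1) * y) + i * M * z ^ (i - 1) * r ^ (l + 1 + 1))
      = 3 * (l + 2) * (o ^ (n - 1) * (z ^ i * r ^ (l + 1) * y))
        + 3 * (i * M) * (o ^ (n - 1) * (z ^ (i - 1) * r ^ (l + 2))) := by push_cast; ring
    rw [e2] at hprod
    have f1 := mul_le_mul_of_nonneg_left g1 (show 0 ≤ 3 * ((l : ℝ) + 2) by positivity)
    have f2 := mul_le_mul_of_nonneg_left (g2.trans (add_le_add_left hb12 _))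
      (show 0 ≤ 3 * ((i : ℝ) * M) by positivity)
    linarith
  have g4 : 3 * (l + 2) * b2 + 3 * (i * M) * (b2 + 1 / c * b3)
      ≤ (3 * (l + 2) + 3 * (i * M) * (1 + 1 / c)) * (b2 + b3) := by
    have f1 : 0 ≤ (3 * ((l : ℝ) + 2) + 3 * (i * M)) * b3 := by positivity
    have f2 : 0 ≤ 3 * (i * M) * (1 / c) * b2 := by positivity
    linarith
  have := mul_le_mul_of_nonneg_left (g3.trans g4) hσx
  show -(σ x * inner ℝ (matAct (a x) (fluxx ε a F (t, x))) (Ψ x)) ≤ _ * (σ x * b2 + σ x * b3)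
  linarith

/-- The second moment is controlled by the energy. -/
lemma exists_second_moment (hn : n ≤ 4) (hn2 : 2 ≤ n) {M s D δ : ℝ} (hM : 0 ≤ M) (hδ : 0 < δ)
    (hD : 0 ≤ D) : ∃ C : ℝ, 0 ≤ C ∧ ∀ {W : Type*} [NormedAddCommGroup W] [InnerProductSpace ℝ W]
      {K s' ε CN A₀ B₀ c T₀ T₁ t₀ : ℝ}
      {a : Eu n → Mat n} {σ : Eu n → ℝ} {F : ℝ × Eu n → W} {m χ : ℝ × Eu n → ℝ},
      Flow K s ε CN A₀ B₀ c T₀ T₁ a σ F m → Cutoff M s' t₀ χ → s' < s → T₀ < t₀ →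
      ∀ τ, t₀ ≤ τ → τ < T₁ → τ - t₀ ≤ D →
      (∀ t ∈ Icc t₀ τ, ∫ x in 𝔹 s, √(dens ε a F (t, x)) ^ n ≤ 1) →
      ∫ t in t₀..τ, moment σ F m χ 2 6 t ≤ C + δ * ∫ t in t₀..τ, dissip ε a σ F χ 2 10 t := by
  set vol : ℝ := (volume (𝔹 s)).toReal with hvol
  have hvol0 : 0 ≤ vol := ENNReal.toReal_nonneg
  set C1 : ℝ := 2 * (6 * M + (18 * M) ^ 2 / δ) with hC1
  have hC10 : 0 ≤ C1 := by positivity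
  refine ⟨C1 * (vol + 1) * D, by positivity, ?_⟩
  intro W _ _ K s' ε CN A₀ B₀ c T₀ T₁ t₀ a σ F m χ h hχ hs hT₀ τ hτ hτ₁ hτD hsmall
  have cA := h.continuous_moment hχ 2 (i := 6) (by norm_num)
  have cB := h.continuous_dissip hχ 2 (i := 10) (by norm_num)
  have hχ1 : ContDiff ℝ 1 χ := hχ.smooth.of_le (by simp)
  have hσ1 : ContDiff ℝ 1 fun p : ℝ × Eu n => σ p.2 := h.coef.smooth_σ_snd.of_le (by simp)
  have hw1 : ContDiff ℝ 1 (dens ε a F) := (h.coef.contDiff_dens h.smooth_F).of_le (by simp)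
  have hw0 : ∀ p, 0 ≤ dens ε a F p := h.coef.dens_nonneg hn h.ε_nonneg F
  have hn2' : (2 : ℝ) ≤ n := by exact_mod_cast hn2
  have hn0 : (0 : ℝ) < n := by linarith
  have hp1 : (1 : ℝ) ≤ (n : ℝ) / 2 := by linarith
  have eω : (fun p => √(dens ε a F p) ^ n) = fun p => dens ε a F p ^ ((n : ℝ) / 2) := by
    funext p; exact sqrt_pow_eq_rpow (hw0 p) n
  have hω1 : ContDiff ℝ 1 fun p => √(dens ε a F p) ^ n := by
    rw [eω]
    exact hw1.rpow_const_of_le (by exact_mod_cast hp1)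
  have hωd : ∀ p, fderiv ℝ (fun p => √(dens ε a F p) ^ n) p (1, 0)
      = n * (√(dens ε a F p) ^ (n - 2) * inner ℝ (gradx F p) (matAct (a p.2) (gradx (vel F) p))) := by
    intro p
    have h1 := (hw1.differentiable one_ne_zero p).hasFDerivAt.rpow_const (p := (n : ℝ) / 2)
      (Or.inr hp1)
    rw [eω, h1.fderiv, _root_.smul_apply, h.coef.fderiv_dens h.smooth_F, sqrt_pow_eq_rpow (hw0 p),
      Nat.cast_sub hn2, smul_eq_mul]
    rw [show ((n : ℝ) - (2 : ℕ)) / 2 = n / 2 - 1 by push_cast; ring]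
    ring
  have hσc := h.coef.smooth_σ.continuous
  have hχc := hχ1.continuous
  have hmc := h.smooth_m.continuous
  have hvc := h.continuous_vel
  set P : ℝ → ℝ := fun t => ∫ x, σ x * (χ (t, x) ^ 6 * √(dens ε a F (t, x)) ^ n) with hP
  have hder : ∀ t ∈ Ioo T₀ T₁, t ∈ Icc t₀ τ → ∃ P', HasDerivAt P P' t ∧
      P' / n + moment σ F m χ 2 6 t ≤ δ * dissip ε a σ F χ 2 10 t + C1 * (vol + 1) := by
    intro t ht htI
    have hφ : ContDiff ℝ 1 fun p : ℝ × Eu n => σ p.2 * (χ p ^ 6 * √(dens ε a F p) ^ n) :=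
      hσ1.mul ((hχ1.pow 6).mul hω1)
    let f2 x := σ x * (6 * χ (t, x) ^ 5 * vel χ (t, x) * √(dens ε a F (t, x)) ^ n
      + χ (t, x) ^ 6 * (n * (√(dens ε a F (t, x)) ^ (n - 2)
        * inner ℝ (gradx F (t, x)) (matAct (a x) (gradx (vel F) (t, x))))))
    have hdφ : ∀ x, vel (fun p : ℝ × Eu n => σ p.2 * (χ p ^ 6 * √(dens ε a F p) ^ n)) (t, x)
        = f2 x := fun x => by
      rw [(hasDerivAt_vel hφ t x).unique ((((hasDerivAt_vel hχ1 t x).pow 6).mul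
        (hasDerivAt_vel hω1 t x)).const_mul (σ x)), vel, vel, hωd]
      simp [f2, vel]
    obtain ⟨hd, s2, i2⟩ := hasDerivAt_integral_vel (s := s') hφ (fun t x hx => by simp [hχ.supp t x hx]) t
    simp only [hdφ] at hd s2 i2
    refine ⟨_, hd, ?_⟩
    have hψd := (grad_test h.smooth_F hχ 6 0 t).2
    obtain ⟨hgψs, i1, e1⟩ := h.moment_eq hn hχ hs (i := 6) (by norm_num) 0 ht rfl
    set Ψ := grad fun x => (χ (t, x) ^ 6 * ‖vel F (t, x)‖ ^ 0) • vel F (t, x) with hΨ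
    have hgt : Continuous fun x => gradx (vel F) (t, x) := h.continuous_gradx_vel.comp (by fun_prop)
    have hωt : Continuous fun x => √(dens ε a F (t, x)) :=
      h.continuous_sqrt_dens.comp (f := fun x => (t, x)) (by fun_prop)
    let f1 x := -(σ x * inner ℝ (matAct (a x) (fluxx ε a F (t, x))) (Ψ x))
    replace e1 : moment σ F m χ 2 6 t = ∫ x, f1 x := e1
    replace i1 : Integrable f1 := i1
    let f5 x := σ x * (χ (t, x) ^ 10 * (√(dens ε a F (t, x)) ^ n * ‖vel F (t, x)‖ ^ 2
      + √(dens ε a F (t, x)) ^ (n - 2) * ‖vel F (t, x)‖ ^ (2 - 2) * ‖gradx (vel F) (t, x)‖ ^ 2))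
    have s5 : SuppIn s' f5 := fun x hx => by simp [f5, hχ.supp t x hx]
    have i5 : Integrable f5 := s5.integrable
    have hωi : IntegrableOn (fun x => √(dens ε a F (t, x)) ^ n) (𝔹 s) :=
      ((by fun_prop : Continuous fun x => √(dens ε a F (t, x)) ^ n).continuousOn.integrableOn_compact
        (isCompact_closedBall (0 : Eu n) s)).mono_set ball_subset_closedBall
    have hone : IntegrableOn (fun _ : Eu n => (1 : ℝ)) (𝔹 s) :=
      integrableOn_const (isBounded_ball.measure_lt_top).ne
    have hres : ∀ f : Eu n → ℝ, SuppIn s' f → ∫ x, f x = ∫ x in 𝔹 s, f x :=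
      fun f hf => (setIntegral_eq_integral_of_forall_compl_eq_zero fun x hx => hf x fun hx' =>
        hx (closedBall_subset_ball hs hx')).symm
    have e2 : (∫ x, f2 x) / n + moment σ F m χ 2 6 t = ∫ x in 𝔹 s, (f2 x / n + f1 x) := by
      rw [e1, ← integral_div, ← integral_add (i2.div_const _) i1]
      exact hres _ fun x hx => by simp [show f2 x = 0 from s2 x hx, f1, hgψs x hx]
    have e3 : dissip ε a σ F χ 2 10 t = ∫ x in 𝔹 s, f5 x := hres _ s5
    have iR : IntegrableOn (fun x => C1 * (1 + √(dens ε a F (t, x)) ^ n)) (𝔹 s) :=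
      (hone.add hωi).const_mul C1
    have e4 : ∫ x in 𝔹 s, C1 * (1 + √(dens ε a F (t, x)) ^ n) ≤ C1 * (vol + 1) := by
      rw [integral_const_mul, integral_add hone hωi]
      gcongr
      · rw [setIntegral_const]; simp [Measure.real, hvol]
      · exact hsmall t htI
    rw [e2]
    refine le_trans ?_ (add_le_add_right e4 _)
    rw [e3, ← integral_const_mul, ← integral_add (i5.integrableOn.const_mul δ) iR]
    refine setIntegral_mono_on ((i2.div_const _).add i1).integrableOn
      ((i5.integrableOn.const_mul δ).add iR) measurableSet_ball fun x hx => ?_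
    simp only [f1, f2, f5]
    set Y := gradx (vel F) (t, x) with hY
    set Z : Gr n W := toLp 2 fun j => (6 * χ (t, x) ^ 5
      * fderiv ℝ χ (t, x) (0, single j 1)) • vel F (t, x) with hZ
    have hz := hχ.nonneg (t, x)
    have hz1 := hχ.le_one (t, x)
    have hΨx : Ψ x = χ (t, x) ^ 6 • Y + Z := by
      ext j
      rw [hψd x j]
      simp only [pow_zero, one_smul, CharP.cast_eq_zero, zero_mul, zero_smul, add_zero,
        PiLp.add_apply, PiLp.smul_apply]
      simp [hZ, hY]
    have hZn : ‖Z‖ ≤ 6 * M * χ (t, x) ^ 5 * ‖vel F (t, x)‖ := by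
      have := norm_test_le (l := 0) (Y := 0) (Ψ := Z) (v := vel F (t, x)) (Φ := 0) le_rfl
        (φ := fun j => 6 * χ (t, x) ^ 5 * fderiv ℝ χ (t, x) (0, single j 1))
        (fun j => by simp [hZ]) (B := 6 * M * χ (t, x) ^ 5) (by positivity)
        (by have := sum_sq_cutoff_le hχ 6 (t, x); simpa using this)
      simpa using this
    have hin : inner ℝ (matAct (a x) (fluxx ε a F (t, x))) (Ψ x)
        = χ (t, x) ^ 6 * (√(dens ε a F (t, x)) ^ (n - 2)
            * inner ℝ (gradx F (t, x)) (matAct (a x) Y))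
          + inner ℝ (matAct (a x) (fluxx ε a F (t, x))) Z := by
      rw [hΨx, inner_add_right, inner_smul_right, fluxx, matAct_smul, real_inner_smul_left,
        real_inner_comm, (h.coef.near x).inner_comm]
    rw [hin]
    have hVn : ‖matAct (a x) (fluxx ε a F (t, x))‖ ≤ 3 * √(dens ε a F (t, x)) ^ (n - 1) :=
      h.coef.norm_matAct_fluxx_le hn hn2 h.ε_nonneg F (t, x)
    have hZi := (abs_le.1 (abs_real_inner_le_norm (matAct (a x) (fluxx ε a F (t, x))) Z)).1
    have hσx := (h.coef.pos x).le
    have hσ2 := h.coef.le x hx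
    set z := χ (t, x)
    set o := √(dens ε a F (t, x)) with ho
    set r := ‖vel F (t, x)‖ with hr
    set y := ‖Y‖
    have ho0 : 0 ≤ o := sqrt_nonneg _
    have hr0 : 0 ≤ r := norm_nonneg _
    have hZi' : -inner ℝ (matAct (a x) (fluxx ε a F (t, x))) Z
        ≤ 3 * o ^ (n - 1) * (6 * M * z ^ 5 * r) := by
      have : ‖matAct (a x) (fluxx ε a F (t, x))‖ * ‖Z‖ ≤ 3 * o ^ (n - 1) * (6 * M * z ^ 5 * r) := by
        gcongr
      linarith
    have hn1 : o ^ (n - 1) = o ^ (n - 2) * o := by rw [← pow_succ]; congr 1; omega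
    have hnn : o ^ n = o ^ (n - 2) * o ^ 2 := by rw [← pow_add]; congr 1; omega
    have g1 : 3 * o ^ (n - 1) * (6 * M * z ^ 5 * r)
        ≤ δ * (z ^ 10 * (o ^ n * r ^ 2)) + (18 * M) ^ 2 / δ * o ^ (n - 2) := by
      have h1 : 18 * M * (z ^ 5 * (o * r)) ≤ δ * (z ^ 5 * (o * r)) ^ 2 + (18 * M) ^ 2 / δ := by
        have e : δ * (z ^ 5 * (o * r)) ^ 2 + (18 * M) ^ 2 / δ - 18 * M * (z ^ 5 * (o * r))
            = ((δ * (z ^ 5 * (o * r)) - 9 * M) ^ 2 + 3 * (9 * M) ^ 2) / δ := by field_simp; ring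
        have : 0 ≤ ((δ * (z ^ 5 * (o * r)) - 9 * M) ^ 2 + 3 * (9 * M) ^ 2) / δ := by positivity
        linarith
      have := mul_le_mul_of_nonneg_left h1 (show 0 ≤ o ^ (n - 2) by positivity)
      rw [hn1, hnn]
      linarith
    have g2 := mul_le_mul_of_nonneg_left (pow_pred_le hn2 ho0).2 (show 0 ≤ (18 * M) ^ 2 / δ by positivity)
    have g3 : 6 * z ^ 5 * vel χ (t, x) * o ^ n / n ≤ 6 * M * (1 + o ^ n) := by
      have hz5 : z ^ 5 ≤ 1 := pow_le_one₀ hz hz1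
      have hdt := (le_abs_self _).trans (hχ.dt (t, x))
      have h1 : z ^ 5 * vel χ (t, x) ≤ M :=
        (mul_le_mul_of_nonneg_left hdt (by positivity)).trans (mul_le_of_le_one_left hM hz5)
      have hon : 0 ≤ o ^ n := by positivity
      have h2 : z ^ 5 * vel χ (t, x) * o ^ n ≤ M * o ^ n := by gcongr
      rw [div_le_iff₀ hn0]
      have h3 : 6 * M * (1 + o ^ n) * 1 ≤ 6 * M * (1 + o ^ n) * n := by gcongr; linarith
      have h4 : 0 ≤ 6 * M := by positivity
      linarith
    have g4 : 0 ≤ (6 * M + (18 * M) ^ 2 / δ) * (1 + o ^ n) := by positivity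
    have g5 := mul_le_mul_of_nonneg_right hσ2 g4
    have g6 : 0 ≤ δ * (z ^ 10 * (o ^ (n - 2) * r ^ (2 - 2) * y ^ 2)) := by positivity
    have g7 : 6 * z ^ 5 * vel χ (t, x) * o ^ n / n - inner ℝ (matAct (a x) (fluxx ε a F (t, x))) Z
        ≤ δ * (z ^ 10 * (o ^ n * r ^ 2 + o ^ (n - 2) * r ^ (2 - 2) * y ^ 2))
          + (6 * M + (18 * M) ^ 2 / δ) * (1 + o ^ n) := by
      rw [mul_add (z ^ 10), mul_add δ, add_mul]
      have aux : ∀ A I B C D E E' G : ℝ, A ≤ B → -I ≤ C → C ≤ D + E → E ≤ E' → 0 ≤ G →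
          A - I ≤ D + G + (B + E') := by intros; linarith
      exact aux _ _ _ _ _ _ _ _ g3 hZi' g1 g2 g6
    have g8 := mul_le_mul_of_nonneg_left g7 hσx
    have e5 : σ x * (6 * z ^ 5 * vel χ (t, x) * o ^ n + z ^ 6 * (n * (o ^ (n - 2)
            * inner ℝ (gradx F (t, x)) (matAct (a x) Y)))) / n
        = σ x * (6 * z ^ 5 * vel χ (t, x) * o ^ n / n)
          + σ x * (z ^ 6 * (o ^ (n - 2) * inner ℝ (gradx F (t, x)) (matAct (a x) Y))) := by
      field_simp
    rw [e5, hC1]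
    linarith
  have hfin := le_of_hasDerivAt_nonpos (H := fun τ => P τ / n + (∫ t in t₀..τ, moment σ F m χ 2 6 t)
    - δ * (∫ t in t₀..τ, dissip ε a σ F χ 2 10 t) - C1 * (vol + 1) * (τ - t₀)) hτ fun t ht => by
      obtain ⟨A', hA', hle⟩ := hder t ⟨hT₀.trans_le ht.1, ht.2.trans_lt hτ₁⟩ ht
      exact ⟨_, (((hA'.div_const _).add (cA.integral_hasStrictDerivAt t₀ t).hasDerivAt).sub
        ((cB.integral_hasStrictDerivAt t₀ t).hasDerivAt.const_mul δ)).sub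
        (((hasDerivAt_id t).sub_const t₀).const_mul (C1 * (vol + 1))), by linarith⟩
  have hP0 : P t₀ = 0 := by simp [hP, hχ.zero]
  have hPτ : 0 ≤ P τ / n := by
    refine div_nonneg (integral_nonneg fun x => ?_) hn0.le
    have := hχ.nonneg (τ, x)
    have := h.coef.pos x
    positivity
  simp only [intervalIntegral.integral_same, hP0, sub_self, mul_zero, zero_div, add_zero] at hfin
  have : C1 * (vol + 1) * (τ - t₀) ≤ C1 * (vol + 1) * D := by gcongr
  linarith

end LowMoments

section Core


lemma exists_cutoff (hn : n ≤ 4) {s t₀ t₁ t₂ : ℝ} (hs : 0 < s) (h01 : t₀ < t₁) (h12 : t₁ < t₂) :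
    ∃ (M : ℝ) (χ : ℝ × Eu n → ℝ), Cutoff M (3 * s / 4) t₀ χ ∧
      ∀ t ∈ Icc t₁ t₂, ∀ x ∈ 𝔻 (s / 2), χ (t, x) = 1 := by
  let η : ContDiffBump (0 : Eu n) := ⟨s / 2, 3 * s / 4, by positivity, by linarith⟩
  let θ : ContDiffBump ((t₁ + t₂) / 2) := ⟨(t₂ - t₁) / 2, (t₂ - t₁) / 2 + (t₁ - t₀), by linarith, by linarith⟩
  set χ : ℝ × Eu n → ℝ := fun p => θ p.1 * η p.2 with hχ
  have hsm : ContDiff ℝ ∞ χ := (θ.contDiff.comp contDiff_fst).mul (η.contDiff.comp contDiff_snd)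
  have hcs : HasCompactSupport χ := by
    refine HasCompactSupport.intro
      ((isCompact_closedBall ((t₁ + t₂) / 2) θ.rOut).prod (isCompact_closedBall (0 : Eu n) η.rOut)) fun p hp => ?_
    rw [mem_prod, not_and_or] at hp
    rcases hp with h | h
    · simp [hχ, θ.zero_of_le_dist (le_of_lt (by simpa using h))]
    · simp only [hχ]
      rw [η.zero_of_le_dist (le_of_lt (by simpa using h)), mul_zero]
  obtain ⟨C, hC⟩ := (hcs.fderiv (𝕜 := ℝ)).exists_bound_of_continuous
    (hsm.continuous_fderiv (by simp))
  have hC0 : 0 ≤ C := (norm_nonneg _).trans (hC (0, 0))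
  refine ⟨2 * C, χ, ⟨hsm, fun p => mul_nonneg θ.nonneg η.nonneg,
    fun p => mul_le_one₀ θ.le_one η.nonneg η.le_one, ?_, ?_, ?_, ?_, by positivity⟩, ?_⟩
  · intro t x hx
    have : 3 * s / 4 ≤ dist x 0 := le_of_lt (by simpa using hx)
    simp only [hχ]
    rw [η.zero_of_le_dist this, mul_zero]
  · intro p
    rw [vel, ← norm_eq_abs]
    refine ((fderiv ℝ χ p).le_opNorm _).trans ?_
    have h1 : ‖((1 : ℝ), (0 : Eu n))‖ = 1 := by simp [Prod.norm_def]
    rw [h1]; linarith [hC p]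
  · intro p
    have h : ∀ i : Fin n, fderiv ℝ χ p (0, single i 1) ^ 2 ≤ C ^ 2 := by
      intro i
      rw [← sq_abs, ← norm_eq_abs]
      have h1 : ‖((0 : ℝ), (single i (1 : ℝ) : Eu n))‖ = 1 := by simp [Prod.norm_def]
      have := (fderiv ℝ χ p).le_opNorm ((0 : ℝ), (single i (1 : ℝ) : Eu n))
      rw [h1, mul_one] at this
      gcongr
      exact this.trans (hC p)
    calc _ ≤ ∑ _i : Fin n, C ^ 2 := sum_le_sum fun i _ => h i
      _ = n * C ^ 2 := by simp
      _ ≤ 4 * C ^ 2 := by gcongr; exact_mod_cast hn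
      _ = _ := by ring
  · intro x
    have : θ t₀ = 0 := θ.zero_of_le_dist (by
      show (t₂ - t₁) / 2 + (t₁ - t₀) ≤ dist t₀ ((t₁ + t₂) / 2)
      rw [Real.dist_eq, abs_sub_comm]
      exact le_trans (by linarith) (le_abs_self _))
    simp [hχ, this]
  · intro t ht x hx
    have h1 : θ t = 1 := θ.one_of_mem_closedBall (by
      rw [mem_closedBall, Real.dist_eq, abs_le]
      constructor <;> show _ ≤ _ <;> simp only [θ] <;> linarith [ht.1, ht.2])
    have h2 : η x = 1 := η.one_of_mem_closedBall hx
    simp [hχ, h1, h2]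

variable {K s s' ε CN A₀ B₀ c T₀ T₁ M t₀ : ℝ} {a : Eu n → Mat n} {σ : Eu n → ℝ} {F : ℝ × Eu n → W}
  {m χ : ℝ × Eu n → ℝ}

lemma moment_mono (h : Flow K s ε CN A₀ B₀ c T₀ T₁ a σ F m) (hχ : Cutoff M s' t₀ χ)
    (hs : s' < s) (hc : 0 < c) (k : ℕ) {i j : ℕ} (hi : i ≠ 0) (hij : i ≤ j) {t : ℝ}
    (ht : t ∈ Ioo T₀ T₁) : moment σ F m χ k j t ≤ moment σ F m χ k i t := by
  have h1 := h.continuous_vel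
  have h2 := h.smooth_m.continuous
  have h3 := h.coef.smooth_σ.continuous
  have h4 := hχ.smooth.continuous
  have hj : j ≠ 0 := by omega
  have int : ∀ i ≠ 0, Integrable fun x => σ x * (χ (t, x) ^ i * (m (t, x) * ‖vel F (t, x)‖ ^ k)) :=
    fun i hi => SuppIn.integrable (s := s') fun x hx => by simp [hχ.supp t x hx, hi]
  refine integral_mono (int j hj) (int i hi) fun x => ?_
  by_cases hx : x ∈ 𝔻 s'
  · have hm := hc.le.trans (h.m_ge t ht x (closedBall_subset_ball hs hx))
    have hσ := (h.coef.pos x).le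
    have hp := pow_le_pow_of_le_one (hχ.nonneg (t, x)) (hχ.le_one (t, x)) hij
    beta_reduce
    gcongr
  · simp [hχ.supp t x hx, hi, hj]

lemma moment_nonneg (h : Flow K s ε CN A₀ B₀ c T₀ T₁ a σ F m) (hχ : Cutoff M s' t₀ χ)
    (hs : s' < s) (hc : 0 < c) (k : ℕ) {i : ℕ} (hi : i ≠ 0) {t : ℝ} (ht : t ∈ Ioo T₀ T₁) :
    0 ≤ moment σ F m χ k i t := by
  refine integral_nonneg fun x => ?_
  by_cases hx : x ∈ 𝔻 s'
  · have hm := hc.le.trans (h.m_ge t ht x (closedBall_subset_ball hs hx))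
    have hσ := (h.coef.pos x).le
    have hp := hχ.nonneg (t, x)
    positivity
  · simp [hχ.supp t x hx, hi]

lemma dissip_nonneg (h : Flow K s ε CN A₀ B₀ c T₀ T₁ a σ F m) (hχ : Cutoff M s' t₀ χ) (k i : ℕ)
    (t : ℝ) : 0 ≤ dissip ε a σ F χ k i t := by
  refine integral_nonneg fun x => ?_
  have hσ := (h.coef.pos x).le
  have hp := hχ.nonneg (t, x)
  positivity

/-- The fourth moment of the velocity is bounded. -/
lemma exists_fourth_moment (hn : n ≤ 4) (hn2 : 2 ≤ n) {A₀ B₀ CN c s t₀ t₂ M : ℝ} (hA₀ : 0 ≤ A₀)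
    (hB₀ : 0 < B₀ / 2 - CN ^ 2) (hc : 0 < c) (hM : 0 ≤ M) (h02 : t₀ ≤ t₂) :
    ∃ C : ℝ, 0 ≤ C ∧ ∀ {W : Type*} [NormedAddCommGroup W] [InnerProductSpace ℝ W] {K s' ε T₀ T₁ : ℝ}
      {a : Eu n → Mat n} {σ : Eu n → ℝ} {F : ℝ × Eu n → W} {m χ : ℝ × Eu n → ℝ},
      Flow K s ε CN A₀ B₀ c T₀ T₁ a σ F m → Cutoff M s' t₀ χ → s' < s → T₀ < t₀ → t₂ < T₁ →
      (∀ t ∈ Icc t₀ t₂, ∫ x in 𝔹 s, √(dens ε a F (t, x)) ^ n ≤ 1) →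
      ∀ t ∈ Icc t₀ t₂, moment σ F m χ 4 20 t ≤ C := by
  obtain ⟨κ1, C1, hκ1, hC1, v1⟩ := exists_moment_estimate hn hn2 2 10 (by norm_num) (by norm_num)
    (by norm_num) hM hA₀ hc hB₀
  obtain ⟨κ3, C3, hκ3, hC3, v3⟩ := exists_moment_estimate hn hn2 3 15 (by norm_num) (by norm_num)
    (by norm_num) hM hA₀ hc hB₀
  obtain ⟨κ4, C4, hκ4, hC4, v4⟩ := exists_moment_estimate hn hn2 4 20 (by norm_num) (by norm_num)
    (by norm_num) hM hA₀ hc hB₀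
  obtain ⟨C5, hC5, v5⟩ := exists_moment_succ hn hn2 0 11 (by norm_num) hM hc
  obtain ⟨C6, hC6, v6⟩ := exists_moment_succ hn hn2 1 16 (by norm_num) hM hc
  obtain ⟨C0, hC0, v0⟩ := exists_second_moment hn hn2 (M := M) (s := s) (D := t₂ - t₀)
    (δ := κ1 / (2 * (C1 + 1))) hM (by positivity) (by linarith)
  refine ⟨C4 * (C6 * (C3 / κ3 * (C5 * (C1 / κ1 * (2 * C0) + 2 * C0))
    + C5 * (C1 / κ1 * (2 * C0) + 2 * C0))), by positivity, ?_⟩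
  intro W _ _ K s' ε T₀ T₁ a σ F m χ h hχ hs hT₀ hT₁ hsmall
  have cA : ∀ k i, i ≠ 0 → Continuous (moment σ F m χ k i) := fun k i hi => h.continuous_moment hχ k hi
  have cB : ∀ k i, i ≠ 0 → Continuous (dissip ε a σ F χ k i) := fun k i hi => h.continuous_dissip hχ k hi
  have hmem : ∀ t ∈ Icc t₀ t₂, t ∈ Ioo T₀ T₁ := fun t ht => ⟨hT₀.trans_le ht.1, ht.2.trans_lt hT₁⟩
  have step : ∀ {k i j : ℕ} {C : ℝ}, 0 ≤ C → j ≠ 0 → j ≤ i → (∀ t ∈ Ioo T₀ T₁,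
      moment σ F m χ (k + 1) (i + 1) t ≤ C * (dissip ε a σ F χ k i t + moment σ F m χ k i t)) →
      ∫ t in t₀..t₂, moment σ F m χ (k + 1) (i + 1) t ≤ C * ((∫ t in t₀..t₂, dissip ε a σ F χ k i t)
        + ∫ t in t₀..t₂, moment σ F m χ k j t) := by
    intro k i j C hC hj hji hv
    have hB := cB k i (by omega)
    rw [← intervalIntegral.integral_add (hB.intervalIntegrable _ _)
      ((cA k j hj).intervalIntegrable _ _), ← intervalIntegral.integral_const_mul]
    refine intervalIntegral.integral_mono_on h02 ((cA _ _ i.succ_ne_zero).intervalIntegrable _ _)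
      (((hB.add (cA k j hj)).const_mul C).intervalIntegrable _ _) fun t ht =>
      (hv t (hmem t ht)).trans (mul_le_mul_of_nonneg_left (add_le_add le_rfl ?_) hC)
    exact moment_mono h hχ hs hc k hj hji (hmem t ht)
  have nn : ∀ k i, i ≠ 0 → ∀ τ ∈ Icc t₀ t₂, 0 ≤ moment σ F m χ k i τ := fun k i hi τ hτ =>
    moment_nonneg h hχ hs hc k hi (hmem τ hτ)
  have ht₂ : t₂ ∈ Icc t₀ t₂ := right_mem_Icc.2 h02
  set I26 := ∫ t in t₀..t₂, moment σ F m χ 2 6 t with hI26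
  set D2 := ∫ t in t₀..t₂, dissip ε a σ F χ 2 10 t with hD2
  have e1 := v1 h hχ hs hT₀ t₂ h02 hT₁
  have e0 := v0 h hχ hs hT₀ t₂ h02 hT₁ le_rfl hsmall
  have hD2' : D2 ≤ C1 / κ1 * I26 := by
    rw [div_mul_eq_mul_div, le_div_iff₀ hκ1]
    have := nn 2 10 (by norm_num) t₂ ht₂
    linarith
  have hI26n : 0 ≤ I26 := intervalIntegral.integral_nonneg h02 (nn 2 6 (by norm_num))
  have b26 : I26 ≤ 2 * C0 := by
    have h1 : κ1 / (2 * (C1 + 1)) * D2 ≤ κ1 / (2 * (C1 + 1)) * (C1 / κ1 * I26) := by gcongr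
    have h2 : κ1 / (2 * (C1 + 1)) * (C1 / κ1 * I26) = C1 / (C1 + 1) * I26 / 2 := by field_simp
    have h3 : C1 / (C1 + 1) * I26 ≤ 1 * I26 := by
      gcongr
      rw [div_le_one (by positivity)]; linarith
    linarith
  have bD2 : D2 ≤ C1 / κ1 * (2 * C0) := hD2'.trans (by gcongr)
  set I3 := ∫ t in t₀..t₂, moment σ F m χ 3 11 t with hI3
  have b3 : I3 ≤ C5 * (C1 / κ1 * (2 * C0) + 2 * C0) := by
    exact (step hC5 (k := 2) (i := 10) (j := 6) (by norm_num) (by norm_num) (v5 h hχ hs)).trans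
      (by gcongr)
  set D3 := ∫ t in t₀..t₂, dissip ε a σ F χ 3 15 t with hD3
  have e3 := v3 h hχ hs hT₀ t₂ h02 hT₁
  have hD3' : D3 ≤ C3 / κ3 * I3 := by
    rw [div_mul_eq_mul_div, le_div_iff₀ hκ3]
    have := nn 3 15 (by norm_num) t₂ ht₂
    linarith
  set I4 := ∫ t in t₀..t₂, moment σ F m χ 4 16 t with hI4
  have b4 : I4 ≤ C6 * (C3 / κ3 * I3 + I3) := by
    exact (step hC6 (k := 3) (i := 15) (j := 11) (by norm_num) (by norm_num) (v6 h hχ hs)).trans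
      (by gcongr)
  intro τ hτ
  have e4 := v4 h hχ hs hT₀ τ hτ.1 (hτ.2.trans_lt hT₁)
  have hd : 0 ≤ ∫ t in t₀..τ, dissip ε a σ F χ 4 20 t :=
    intervalIntegral.integral_nonneg hτ.1 fun t _ => dissip_nonneg h hχ 4 20 t
  have hI : ∫ t in t₀..τ, moment σ F m χ 4 16 t ≤ I4 := by
    refine intervalIntegral.integral_mono_interval le_rfl hτ.1 hτ.2 ?_
      ((cA 4 16 (by norm_num)).intervalIntegrable _ _)
    rw [EventuallyLE, ae_restrict_iff' measurableSet_Ioc]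
    exact ae_of_all _ fun t ht => nn 4 16 (by norm_num) t (Ioc_subset_Icc_self ht)
  have hκ := mul_nonneg hκ4.le hd
  have : moment σ F m χ 4 20 τ ≤ C4 * ∫ t in t₀..τ, moment σ F m χ 4 16 t := by
    simp only [Nat.reduceSub] at e4
    linarith
  refine this.trans ?_
  gcongr
  refine hI.trans (b4.trans ?_)
  gcongr

end Core

section Main


lemma young_cube {x y : ℝ} (hx : 0 ≤ x) (hy : 0 ≤ y) : 3 * x ^ 2 * y ≤ 2 * x ^ 3 + y ^ 3 := by
  nlinarith [mul_nonneg (add_nonneg (add_nonneg hx hx) hy) (sq_nonneg (x - y))]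

set_option maxHeartbeats 1000000 in
/-- The local regularity estimate. -/
lemma exists_local_regularity (n : ℕ) (hn : n ≤ 4) (hn2 : 2 ≤ n) (CN : ℝ) (hCN : 0 ≤ CN) :
    ∃ ε₁ : ℝ, 0 < ε₁ ∧ ε₁ ≤ 1 ∧ ∀ (K s A₀ B₀ c t₀ t₁ t₂ Z₁ : ℝ), 0 ≤ K → 0 < s → 0 ≤ A₀ →
      0 < B₀ / 2 - CN ^ 2 → 0 < c → t₀ < t₁ → t₁ < t₂ → 0 ≤ Z₁ →
      ∃ C : ℝ, 0 ≤ C ∧ ∀ {W : Type*} [NormedAddCommGroup W] [InnerProductSpace ℝ W] {ε T₀ T₁ : ℝ}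
        {a : Eu n → Mat n} {σ : Eu n → ℝ} {F : ℝ × Eu n → W} {m : ℝ × Eu n → ℝ},
        Flow K s ε CN A₀ B₀ c T₀ T₁ a σ F m → T₀ < t₀ → t₂ < T₁ →
        (∀ t ∈ Icc t₀ t₂, ∫ x in 𝔹 s, √(dens ε a F (t, x)) ^ n ≤ ε₁) →
        ∫ x in 𝔹 s, m (t₁, x) ^ 3 ≤ Z₁ → ∀ t ∈ Icc t₁ t₂,
          ∫ x in 𝔹 (s / 4), (√(dens ε a F (t, x)) ^ (n - 2)) ^ 2
            * ∑ j, ‖hess (fun y => F (t, y)) j x‖ ^ 2 ≤ C ∧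
          ∫ x in 𝔹 (s / 4), √(dens ε a F (t, x)) ^ (3 * n) ≤ C := by
  obtain ⟨ε₁, hε₁, hε₁1, hell⟩ := exists_elliptic n hn hn2 CN hCN
  refine ⟨ε₁, hε₁, hε₁1, ?_⟩
  intro K s A₀ B₀ c t₀ t₁ t₂ Z₁ hK hs hA₀ hB₀ hc h01 h12 hZ₁
  obtain ⟨M, χ, hχ, hχ1⟩ := exists_cutoff hn hs h01 h12
  let ζ : ContDiffBump (0 : Eu n) := ⟨s / 4, s / 2, by positivity, by linarith⟩
  have hζs : SuppIn (s / 2) (ζ : Eu n → ℝ) := fun x hx =>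
    ζ.zero_of_le_dist (le_of_lt (by simpa using hx))
  have hζsm : ContDiff ℝ ∞ (ζ : Eu n → ℝ) := ζ.contDiff
  have hζ0 : ∀ x, 0 ≤ ζ x := fun x => ζ.nonneg
  have hζ1 : ∀ x, ζ x ≤ 1 := fun x => ζ.le_one
  obtain ⟨Ce, hCe, hell⟩ := hell K s (s / 2) ζ hK (by linarith) hζsm hζs hζ0 hζ1
  obtain ⟨Cm, hCm, hmom⟩ := exists_fourth_moment hn hn2 hA₀ hB₀ hc hχ.M_nonneg (s := s)
    (h01.le.trans h12.le)
  have hB₀p : 0 < B₀ := by nlinarith [sq_nonneg CN]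
  set α : ℝ := B₀ * (2 + Ce * (2 + 2 * (Cm + 1) ^ 2)) with hα
  have hα0 : 0 ≤ α := by positivity
  set Zm : ℝ := (Z₁ + 1) * exp (α * (t₂ - t₁)) with hZm
  have hZm0 : 0 ≤ Zm := by positivity
  set Cf : ℝ := Ce * (2 + 2 * (Cm + 1) ^ 2 * Zm) with hCf
  refine ⟨Cf, by positivity, ?_⟩
  intro W _ _ ε T₀ T₁ a σ F m h hT₀ hT₁ hsmall hmZ
  have hmem : ∀ t ∈ Icc t₁ t₂, t ∈ Ioo T₀ T₁ := fun t ht =>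
    ⟨hT₀.trans (h01.trans_le ht.1), ht.2.trans_lt hT₁⟩
  have hχs : 3 * s / 4 < s := by linarith
  have hmom := hmom h hχ hχs hT₀ hT₁ fun t ht => (hsmall t ht).trans hε₁1
  have hζc : Continuous (ζ : Eu n → ℝ) := hζsm.continuous
  have hmc := h.smooth_m.continuous
  have hvc := h.continuous_vel
  have hσc := h.coef.smooth_σ.continuous
  have hχc := hχ.smooth.continuous
  have hFt : ∀ t, ContDiff ℝ ∞ fun y => F (t, y) := fun t => h.smooth_F.comp (contDiff_prodMk_right t)
  have hωt : ∀ t, Continuous fun x => √(dens ε a F (t, x)) := fun t =>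
    h.continuous_sqrt_dens.comp (f := fun x => (t, x)) (by fun_prop)
  set Z : ℝ → ℝ := fun t => ∫ x, (ζ x ^ 4) ^ 4 * m (t, x) ^ 3 with hZ
  set T : ℝ → ℝ := fun t => ∫ x, (ζ x ^ 4) ^ 2 * ‖m (t, x) • vel F (t, x)‖ ^ 2 with hT
  set X : ℝ → ℝ := fun t => hessInt ε a (fun y => F (t, y)) (fun x => ζ x ^ 4) with hX
  set Q : ℝ → ℝ := fun t => ∫ x, (ζ x ^ 4) ^ 4 * √(dens ε a F (t, x)) ^ (3 * n) with hQ
  have hsub : closedBall (0 : Eu n) (s / 2) ⊆ ball 0 s := closedBall_subset_ball (by linarith)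
  have hel : ∀ t ∈ Icc t₁ t₂, X t ≤ Ce * (1 + T t) ∧ Q t ≤ Ce * (1 + T t) ^ 2 := by
    intro t ht
    have e1 := hell ε a σ (fun y => F (t, y)) (fun x => m (t, x) • vel F (t, x)) h.coef h.ε_nonneg
      (hFt t) (by fun_prop) (fun x hx => by
        rw [h.coef.divg_slice hn h.ε_nonneg h.smooth_F, quad_slice h.smooth_F]
        exact h.norm_le t (hmem t ht) x hx)
      (by
        simp only [quad_slice h.smooth_F]
        exact hsmall t ⟨h01.le.trans ht.1, ht.2⟩)
    refine ⟨e1.1, ?_⟩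
    have := e1.2
    simp only [quad_slice h.smooth_F] at this
    exact this
  have hZn : ∀ t ∈ Icc t₁ t₂, 0 ≤ Z t := by
    intro t ht
    refine integral_nonneg fun x => ?_
    by_cases hx : x ∈ 𝔻 (s / 2)
    · have := hc.le.trans (h.m_ge t (hmem t ht) x (hsub hx))
      positivity
    · simp [hζs x hx]
  have hTn : ∀ t, 0 ≤ T t := fun t => integral_nonneg fun x => by positivity
  have iZ : ∀ t, Integrable fun x => (ζ x ^ 4) ^ 4 * m (t, x) ^ 3 := fun t => hζs.integrable_of
  have iT : ∀ t, Integrable fun x => (ζ x ^ 4) ^ 2 * ‖m (t, x) • vel F (t, x)‖ ^ 2 := fun t => hζs.integrable_of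
  have iQ : ∀ t, Integrable fun x => (ζ x ^ 4) ^ 4 * √(dens ε a F (t, x)) ^ (3 * n) := fun t => by
    have := hωt t
    exact hζs.integrable_of
  have hTZ : ∀ t ∈ Icc t₁ t₂, T t ≤ (Cm + 1) * √(1 + Z t) := by
    intro t ht
    set lam := √(1 + Z t) with hlam
    have hlam0 : 0 < lam := sqrt_pos.2 (by linarith [hZn t ht])
    have hlam2 : lam * lam = 1 + Z t := mul_self_sqrt (by linarith [hZn t ht])
    have iA : Integrable fun x => σ x * (χ (t, x) ^ 20 * (m (t, x) * ‖vel F (t, x)‖ ^ 4)) :=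
      (hχ.supp t).integrable_of
    have h1 : T t ≤ lam * moment σ F m χ 4 20 t + 1 / (2 * lam) * Z t := by
      rw [moment, ← integral_const_mul, hZ, ← integral_const_mul,
        ← integral_add (iA.const_mul _) ((iZ t).const_mul _)]
      refine integral_mono (iT t) ((iA.const_mul _).add ((iZ t).const_mul _)) fun x => ?_
      by_cases hx : x ∈ 𝔻 (s / 2)
      · have hμ := hc.le.trans (h.m_ge t (hmem t ht) x (hsub hx))
        have hσ := h.coef.ge x (hsub hx)
        simp only [hχ1 t ht x hx, one_pow, one_mul]
        rw [norm_smul, norm_of_nonneg hμ]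
        set μ := m (t, x)
        set r := ‖vel F (t, x)‖
        set φ := ζ x ^ 4
        have e1 : (1 : ℝ) / 2 * (μ * r ^ 4) ≤ σ x * (μ * r ^ 4) := by gcongr
        have e2 : φ ^ 2 * (μ * r) ^ 2 ≤ lam * (1 / 2 * (μ * r ^ 4)) + 1 / (2 * lam) * (φ ^ 4 * μ ^ 3) := by
          have : lam * (1 / 2 * (μ * r ^ 4)) + 1 / (2 * lam) * (φ ^ 4 * μ ^ 3) - φ ^ 2 * (μ * r) ^ 2
              = μ * (lam * r ^ 2 - φ ^ 2 * μ) ^ 2 / (2 * lam) := by field_simp; ring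
          have h2 : 0 ≤ μ * (lam * r ^ 2 - φ ^ 2 * μ) ^ 2 / (2 * lam) := by positivity
          linarith
        have e3 := mul_le_mul_of_nonneg_left e1 hlam0.le
        linarith
      · have hζx := hζs x hx
        have : 0 ≤ σ x * (χ (t, x) ^ 20 * (m (t, x) * ‖vel F (t, x)‖ ^ 4)) := by
          by_cases hx' : x ∈ 𝔻 (3 * s / 4)
          · have := hc.le.trans (h.m_ge t (hmem t ht) x (closedBall_subset_ball hχs hx'))
            have := h.coef.pos x
            have := hχ.nonneg (t, x)
            positivity
          · simp [hχ.supp t x hx']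
        have := mul_nonneg hlam0.le this
        simpa [hζx] using this
    have h2 := hmom t ⟨h01.le.trans ht.1, ht.2⟩
    have h3 : 1 / (2 * lam) * Z t ≤ lam := by
      rw [one_div_mul_eq_div, div_le_iff₀ (by positivity)]
      nlinarith [hZn t ht]
    calc T t ≤ lam * Cm + lam := h1.trans (by gcongr)
      _ = _ := by ring
  have hT1 : ∀ t ∈ Icc t₁ t₂, (1 + T t) ^ 2 ≤ 2 + 2 * (Cm + 1) ^ 2 * (1 + Z t) := by
    intro t ht
    have h1 : T t ^ 2 ≤ ((Cm + 1) * √(1 + Z t)) ^ 2 := by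
      have := hTn t
      have := hTZ t ht
      gcongr
    rw [mul_pow, sq_sqrt (by linarith [hZn t ht])] at h1
    nlinarith [sq_nonneg (T t - 1)]
  have hm1 : ContDiff ℝ 1 m := h.smooth_m.of_le (by simp)
  have hder : ∀ t ∈ Icc t₁ t₂, ∃ Z', HasDerivAt Z Z' t ∧ Z' ≤ α * (Z t + 1) := by
    intro t ht
    have hφ : ContDiff ℝ 1 fun p : ℝ × Eu n => (ζ p.2 ^ 4) ^ 4 * m p ^ 3 :=
      ((((hζsm.of_le (by simp)).comp contDiff_snd).pow 4).pow 4).mul (hm1.pow 3)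
    have hdφ : ∀ x, vel (fun p : ℝ × Eu n => (ζ p.2 ^ 4) ^ 4 * m p ^ 3) (t, x)
        = (ζ x ^ 4) ^ 4 * (3 * m (t, x) ^ 2 * vel m (t, x)) := fun x => by
      simpa using (hasDerivAt_vel hφ t x).unique
        (((hasDerivAt_vel hm1 t x).pow 3).const_mul ((ζ x ^ 4) ^ 4))
    obtain ⟨hd, -, i1⟩ := hasDerivAt_integral_vel (s := s / 2) hφ (fun t x hx => by simp [hζs x hx]) t
    simp only [hdφ] at hd i1
    refine ⟨_, hd, ?_⟩
    have h1 : ∫ x, (ζ x ^ 4) ^ 4 * (3 * m (t, x) ^ 2 * vel m (t, x)) ≤ B₀ * (2 * Z t + Q t) := by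
      rw [hZ, hQ, ← integral_const_mul, ← integral_add ((iZ t).const_mul 2) (iQ t),
        ← integral_const_mul]
      refine integral_mono i1 ((((iZ t).const_mul 2).add (iQ t)).const_mul B₀) fun x => ?_
      beta_reduce
      by_cases hx : x ∈ 𝔻 (s / 2)
      · have hμ := hc.le.trans (h.m_ge t (hmem t ht) x (hsub hx))
        rw [h.m_eq t (hmem t ht) x (hsub hx)]
        set μ := m (t, x)
        have ho : 0 ≤ √(dens ε a F (t, x)) ^ n := by positivity
        have hy := young_cube hμ ho
        rw [← pow_mul, mul_comm n 3] at hy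
        have e1 : 3 * μ ^ 2 * (B₀ * √(dens ε a F (t, x)) ^ n - A₀ * μ)
            ≤ B₀ * (2 * μ ^ 3 + √(dens ε a F (t, x)) ^ (3 * n)) := by
          have f1 := mul_le_mul_of_nonneg_left hy hB₀p.le
          have f2 : 0 ≤ A₀ * (3 * μ ^ 3) := by positivity
          linarith
        have e2 := mul_le_mul_of_nonneg_left e1 (show 0 ≤ (ζ x ^ 4) ^ 4 by positivity)
        linarith
      · simp [hζs x hx]
    refine h1.trans ?_
    have h2 := (hel t ht).2.trans (mul_le_mul_of_nonneg_left (hT1 t ht) hCe)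
    have hz := hZn t ht
    have h3 : 2 * Z t + Q t ≤ (2 + Ce * (2 + 2 * (Cm + 1) ^ 2)) * (Z t + 1) := by
      have : 0 ≤ Ce * (2 * Z t) := by positivity
      linarith
    have := mul_le_mul_of_nonneg_left h3 hB₀p.le
    rw [hα]; linarith
  have hZb : ∀ t ∈ Icc t₁ t₂, Z t + 1 ≤ Zm := by
    have hd : ∀ t ∈ Icc t₁ t₂, ∃ Y', HasDerivAt (fun t => (Z t + 1) * exp (-(α * (t - t₁)))) Y' t
        ∧ Y' ≤ 0 := by
      intro t ht
      obtain ⟨Z', hZ', hle⟩ := hder t ht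
      have e1 : HasDerivAt (fun t => exp (-(α * (t - t₁)))) (exp (-(α * (t - t₁))) * (-(α * 1))) t :=
        ((((hasDerivAt_id t).sub_const t₁).const_mul α).neg).exp
      refine ⟨_, (hZ'.add_const 1).mul e1, ?_⟩
      have := mul_le_mul_of_nonneg_right hle (exp_pos (-(α * (t - t₁)))).le
      linarith
    have hZ1 : Z t₁ ≤ Z₁ := by
      refine le_trans ?_ hmZ
      have e1 : Z t₁ = ∫ x in 𝔹 s, (ζ x ^ 4) ^ 4 * m (t₁, x) ^ 3 :=
        (setIntegral_eq_integral_of_forall_compl_eq_zero fun x hx => by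
          have : x ∉ 𝔻 (s / 2) := fun h' => hx (hsub h')
          simp [hζs x this]).symm
      rw [e1]
      refine setIntegral_mono_on (iZ t₁).integrableOn ?_ measurableSet_ball fun x hx => ?_
      · exact ((by fun_prop : Continuous fun x => m (t₁, x) ^ 3).continuousOn.integrableOn_compact
          (isCompact_closedBall (0 : Eu n) s)).mono_set ball_subset_closedBall
      · have hμ := hc.le.trans (h.m_ge t₁ (hmem t₁ (left_mem_Icc.2 h12.le)) x hx)
        exact mul_le_of_le_one_left (by positivity)
          (pow_le_one₀ (by positivity) (pow_le_one₀ (hζ0 x) (hζ1 x)))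
    intro t ht
    have := le_of_hasDerivAt_nonpos ht.1 fun τ hτ => hd τ ⟨hτ.1, hτ.2.trans ht.2⟩
    simp only [sub_self, mul_zero, neg_zero, Real.exp_zero, mul_one] at this
    rw [Real.exp_neg, ← div_eq_mul_inv, div_le_iff₀ (exp_pos _)] at this
    refine this.trans ?_
    rw [hZm]
    have hz1 := hZn t₁ (left_mem_Icc.2 h12.le)
    gcongr
    exact ht.2
  intro t ht
  have hb := hT1 t ht
  have hz := hZb t ht
  have hbd : (1 + T t) ^ 2 ≤ 2 + 2 * (Cm + 1) ^ 2 * Zm := hb.trans (by gcongr; linarith)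
  have hbd1 : 1 + T t ≤ (1 + T t) ^ 2 := by nlinarith [hTn t]
  have hXb : X t ≤ Cf := (hel t ht).1.trans (mul_le_mul_of_nonneg_left (hbd1.trans hbd) hCe)
  have hQb : Q t ≤ Cf := (hel t ht).2.trans (mul_le_mul_of_nonneg_left hbd hCe)
  have hhc := fun j => continuous_hess (hFt t) j
  have hωtt := hωt t
  have hζone : ∀ x ∈ 𝔹 (s / 4), ζ x = 1 := fun x hx =>
    ζ.one_of_mem_closedBall (ball_subset_closedBall hx)
  have hle : ∀ {g : Eu n → ℝ} (k : ℕ), Continuous g → (∀ x, 0 ≤ g x) →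
      ∫ x in 𝔹 (s / 4), g x ≤ ∫ x, (ζ x ^ 4) ^ (k + 1) * g x := fun {g} k hg hg0 => by
    refine (setIntegral_congr_fun measurableSet_ball fun x hx => ?_).trans_le
      (setIntegral_le_integral (f := fun x => (ζ x ^ 4) ^ (k + 1) * g x) hζs.integrable_of
        (ae_of_all _ fun x => mul_nonneg (by have := hζ0 x; positivity) (hg0 x)))
    simp [hζone x hx]
  refine ⟨(hle 1 (by fun_prop) fun x => by positivity).trans (le_of_eq_of_le ?_ hXb),
    (hle 3 (by fun_prop) fun x => by positivity).trans hQb⟩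
  simp only [hX, hessInt, quad_slice h.smooth_F, mul_assoc]

end Main

/-! ### Matrices with smooth entries -/

section MatrixSmooth

variable {ι : Type*} [Fintype ι]
  [DecidableEq ι]

lemma contDiffAt_det {A : V → Matrix ι ι ℝ} {x : V} {k : WithTop ℕ∞}
    (hA : ∀ i j, ContDiffAt ℝ k (fun z => A z i j) x) : ContDiffAt ℝ k (fun z => (A z).det) x := by
  simp only [Matrix.det_apply]
  refine ContDiffAt.sum fun τ _ => ContDiffAt.const_smul _ ?_
  exact contDiffAt_prod fun i _ => hA _ _

lemma contDiffAt_inv {A : V → Matrix ι ι ℝ} {x : V} {k : WithTop ℕ∞}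
    (hA : ∀ i j, ContDiffAt ℝ k (fun z => A z i j) x) (hx : (A x).det ≠ 0) (i j : ι) :
    ContDiffAt ℝ k (fun z => (A z)⁻¹ i j) x := by
  have h : ∀ z, (A z)⁻¹ i j = ((A z).det)⁻¹ * (A z).adjugate i j := fun z => by
    rw [Matrix.inv_def, Matrix.smul_apply, Ring.inverse_eq_inv', smul_eq_mul]
  simp only [h]
  refine ((contDiffAt_det hA).inv hx).mul ?_
  simp only [Matrix.adjugate_apply]
  refine contDiffAt_det fun p q => ?_
  by_cases hp : p = j
  · subst hp
    simp only [Matrix.updateRow_self]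
    exact contDiffAt_const
  · simp only [Matrix.updateRow_ne hp]
    exact hA p q

end MatrixSmooth

/-! ### Tangent spaces of an embedded submanifold -/

section Target

variable {N : Set (Eu L)}

lemma fderiv_mem_tangentCone {F : V → Eu L}
    {F' : V →L[ℝ] Eu L} {p : V} (hF : HasFDerivAt F F' p) (h : ∀ᶠ q in 𝓝 p, F q ∈ N) (u : V) :
    F' u ∈ tangentConeAt ℝ N (F p) := by
  have h1 := (hF.hasFDerivWithinAt (s := {q | F q ∈ N})).mapsTo_tangent_cone
  rw [tangentConeAt_of_mem_nhds h] at h1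
  refine tangentConeAt_mono ?_ (h1 (mem_univ u))
  rintro _ ⟨q, hq, rfl⟩
  exact hq

lemma fderiv_mem_tangentSub {F : V → Eu L}
    {F' : V →L[ℝ] Eu L} {p : V} (hF : HasFDerivAt F F' p) (h : ∀ᶠ q in 𝓝 p, F q ∈ N) (u : V) : F' u
    ∈ tangentSub N (F p) := Submodule.subset_span (fderiv_mem_tangentCone hF h u)

variable {Φ : OpenPartialHomeomorph (Eu L) (Eu L)}
  {S : Submodule ℝ (Eu L)}

lemma hasFDerivAt_of_contDiffOn {V W : Type*} [NormedAddCommGroup V] [NormedSpace ℝ V]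
    [NormedAddCommGroup W] [NormedSpace ℝ W] {f : V → W} {U : Set V} (hf : ContDiffOn ℝ ∞ f U)
    (hU : IsOpen U) {x : V} (hx : x ∈ U) : HasFDerivAt f (fderiv ℝ f x) x :=
  ((hf.contDiffAt (hU.mem_nhds hx)).differentiableAt (by simp)).hasFDerivAt

lemma fderiv_symm_comp (h1 : ContDiffOn ℝ ∞ Φ Φ.source) (h2 : ContDiffOn ℝ ∞ Φ.symm Φ.target)
    {z : Eu L} (hz : z ∈ Φ.source) (w : Eu L) : fderiv ℝ Φ.symm (Φ z) (fderiv ℝ Φ z w) = w := by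
  have a := hasFDerivAt_of_contDiffOn h1 Φ.open_source hz
  have b := hasFDerivAt_of_contDiffOn h2 Φ.open_target (Φ.map_source hz)
  have c := b.comp z a
  have d : (Φ.symm ∘ Φ) =ᶠ[𝓝 z] id := by
    filter_upwards [Φ.open_source.mem_nhds hz] with q hq using Φ.left_inv hq
  have e := c.unique ((hasFDerivAt_id z).congr_of_eventuallyEq d)
  exact DFunLike.congr_fun e w

lemma fderiv_symm_mem_tangentCone (h2 : ContDiffOn ℝ ∞ Φ.symm Φ.target)
    (hS : ∀ z ∈ Φ.source, z ∈ N ↔ Φ z ∈ S) {z : Eu L} (hz : z ∈ Φ.source) (hzN : z ∈ N) {s : Eu L}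
    (hs : s ∈ S) : fderiv ℝ Φ.symm (Φ z) s ∈ tangentConeAt ℝ N z := by
  have b := hasFDerivAt_of_contDiffOn h2 Φ.open_target (Φ.map_source hz)
  have c : HasFDerivAt (fun τ : ℝ => Φ z + τ • s) ((1 : ℝ →L[ℝ] ℝ).smulRight s) 0 := by
    have := ((1 : ℝ →L[ℝ] ℝ).smulRight s).hasFDerivAt (x := (0 : ℝ))
    exact this.const_add (Φ z)
  have b' : HasFDerivAt Φ.symm (fderiv ℝ Φ.symm (Φ z)) (Φ z + (0 : ℝ) • s) := by simpa using b
  have d := b'.comp (0 : ℝ) c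
  have e : ∀ᶠ τ : ℝ in 𝓝 0, (Φ.symm ∘ fun τ : ℝ => Φ z + τ • s) τ ∈ N := by
    have ht : ∀ᶠ τ : ℝ in 𝓝 0, Φ z + τ • s ∈ Φ.target := by
      have : ContinuousAt (fun τ : ℝ => Φ z + τ • s) 0 := by fun_prop
      exact this (Φ.open_target.mem_nhds (by simpa using Φ.map_source hz))
    filter_upwards [ht] with τ hτ
    refine (hS _ (Φ.map_target hτ)).2 ?_
    rw [Φ.right_inv hτ]
    exact S.add_mem ((hS z hz).1 hzN) (S.smul_mem _ hs)
  have f := fderiv_mem_tangentCone d e (1 : ℝ)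
  simpa [Φ.left_inv hz] using f

lemma fderiv_mem_of_mem_tangentCone (h1 : ContDiffOn ℝ ∞ Φ Φ.source)
    (hS : ∀ z ∈ Φ.source, z ∈ N ↔ Φ z ∈ S) {z : Eu L} (hz : z ∈ Φ.source) (hzN : z ∈ N) {w : Eu L}
    (hw : w ∈ tangentConeAt ℝ N z) : fderiv ℝ Φ z w ∈ S := by
  have a := hasFDerivAt_of_contDiffOn h1 Φ.open_source hz
  have b := (Sᗮ.starProjection.hasFDerivAt (x := Φ z)).comp z a
  have b' := b.hasFDerivWithinAt (s := N)
  have h0 : ∀ q ∈ Φ.source, q ∈ N → Sᗮ.starProjection (Φ q) = 0 := fun q hq hqN => by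
    rw [Submodule.starProjection_apply_eq_zero_iff, Submodule.orthogonal_orthogonal]
    exact (hS q hq).1 hqN
  have c : HasFDerivWithinAt (Sᗮ.starProjection ∘ Φ) (0 : Eu L →L[ℝ] Eu L) N z := by
    refine (hasFDerivWithinAt_const 0 z N).congr_of_eventuallyEq ?_ (h0 z hz hzN)
    filter_upwards [self_mem_nhdsWithin, mem_nhdsWithin_of_mem_nhds (Φ.open_source.mem_nhds hz)]
      with q hq1 hq2 using h0 q hq2 hq1
  have d : Sᗮ.starProjection (fderiv ℝ Φ z w) = 0 := b'.unique_on c hw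
  rwa [Submodule.starProjection_apply_eq_zero_iff, Submodule.orthogonal_orthogonal] at d

lemma mem_tangentSub_iff (h1 : ContDiffOn ℝ ∞ Φ Φ.source) (h2 : ContDiffOn ℝ ∞ Φ.symm Φ.target)
    (hS : ∀ z ∈ Φ.source, z ∈ N ↔ Φ z ∈ S) {z : Eu L} (hz : z ∈ Φ.source) (hzN : z ∈ N) (w : Eu L) :
    w ∈ tangentSub N z ↔ fderiv ℝ Φ z w ∈ S := by
  constructor
  · intro hw
    have : tangentSub N z ≤ S.comap (fderiv ℝ Φ z).toLinearMap :=
      Submodule.span_le.2 fun q hq => fderiv_mem_of_mem_tangentCone h1 hS hz hzN hq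
    exact this hw
  · intro hw
    have := fderiv_symm_mem_tangentCone h2 hS hz hzN hw
    rw [fderiv_symm_comp h1 h2 hz] at this
    exact Submodule.subset_span this

lemma mem_tangentCone_of_mem_tangentSub (hN : IsSmoothSubmanifold N) {z : Eu L} (hzN : z ∈ N)
    {w : Eu L} (hw : w ∈ tangentSub N z) : w ∈ tangentConeAt ℝ N z := by
  obtain ⟨Φ, S, hz, h1, h2, hS⟩ := hN z hzN
  have := fderiv_symm_mem_tangentCone h2 hS hz hzN ((mem_tangentSub_iff h1 h2 hS hz hzN w).1 hw)
  rwa [fderiv_symm_comp h1 h2 hz] at this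

/-- The orthogonal projection onto the span of a linearly independent family. -/
lemma starProjection_eq_sum_gram {ι E : Type*} [Fintype ι] [DecidableEq ι] [NormedAddCommGroup E]
    [InnerProductSpace ℝ E] [FiniteDimensional ℝ E] {v : ι → E} (hv : (Matrix.gram ℝ v).det ≠ 0)
    (K : Submodule ℝ E) (hK : K = Submodule.span ℝ (range v)) :
    K.starProjection = ∑ i, ∑ j, (Matrix.gram ℝ v)⁻¹ i j • (innerSL ℝ (v i)).smulRight (v j) := by
  ext1 u
  have hmem : ∀ i, v i ∈ K := fun i => hK ▸ Submodule.subset_span (mem_range_self i)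
  refine Submodule.eq_starProjection_of_mem_of_inner_eq_zero ?_ fun w hw => ?_
  · simp only [_root_.sum_apply, _root_.smul_apply, smulRight_apply]
    exact K.sum_mem fun i _ => K.sum_mem fun j _ => K.smul_mem _ (K.smul_mem _ (hmem j))
  · rw [hK] at hw
    induction hw using Submodule.span_induction with
    | zero => simp
    | add x y _ _ hx hy => rw [inner_add_right, hx, hy, add_zero]
    | smul c x _ hx => rw [inner_smul_right, hx, mul_zero]
    | mem x hx =>
      obtain ⟨k, rfl⟩ := hx
      have hinv := nonsing_inv_mul (Matrix.gram ℝ v) (isUnit_iff_ne_zero.2 hv)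
      have key : ∀ i, ∑ j, (Matrix.gram ℝ v)⁻¹ i j * inner ℝ (v j) (v k) = if i = k then 1 else 0 :=
        fun i => by
          have := congrFun (congrFun hinv i) k
          rw [Matrix.mul_apply] at this
          simpa [Matrix.gram_apply, Matrix.one_apply] using this
      rw [inner_sub_left, sub_eq_zero]
      simp only [_root_.sum_apply, _root_.smul_apply, smulRight_apply,
        sum_inner, inner_smul_left, innerSL_apply_apply, conj_trivial]
      have : ∀ i, ∑ j, (Matrix.gram ℝ v)⁻¹ i j * (inner ℝ (v i) u * inner ℝ (v j) (v k))
          = inner ℝ (v i) u * (if i = k then 1 else 0) := fun i => by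
        rw [← key i, mul_sum]
        exact sum_congr rfl fun j _ => by ring
      simp only [this, mul_ite, mul_one, mul_zero, Finset.sum_ite_eq', Finset.mem_univ, if_true]
      exact real_inner_comm _ _

lemma tangentProj_differentiableWithinAt (hN : IsSmoothSubmanifold N) {y : Eu L} (hy : y ∈ N) :
    DifferentiableWithinAt ℝ (tangentProj N) N y := by
  obtain ⟨Φ, S, hyΦ, h1, h2, hS⟩ := hN y hy
  let e := stdOrthonormalBasis ℝ S
  let v : Eu L → Fin (Module.finrank ℝ S) → Eu L := fun z i => fderiv ℝ Φ.symm (Φ z) (e i)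
  have hinj : ∀ z ∈ Φ.source, Function.Injective (fderiv ℝ Φ.symm (Φ z)) := fun z hz => by
    have := fderiv_symm_comp (Φ := Φ.symm) h2 h1 (Φ.map_source hz)
    simp only [OpenPartialHomeomorph.symm_symm, Φ.left_inv hz] at this
    exact Function.LeftInverse.injective this
  have hspan : ∀ z ∈ Φ.source, z ∈ N → tangentSub N z = Submodule.span ℝ (range (v z)) := by
    intro z hz hzN
    have hS' : S = Submodule.span ℝ (range fun i => (e i : Eu L)) := by
      have h : (Submodule.span ℝ (range e)).map S.subtype = S := by
        rw [← OrthonormalBasis.coe_toBasis, e.toBasis.span_eq, Submodule.map_top,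
          Submodule.range_subtype]
      rw [Submodule.map_span, ← range_comp] at h
      exact h.symm
    have h3 : range (v z) = fderiv ℝ Φ.symm (Φ z) '' range fun i => (e i : Eu L) := by
      rw [← range_comp]; rfl
    ext w
    rw [mem_tangentSub_iff h1 h2 hS hz hzN, h3]
    have h4 : Submodule.span ℝ (fderiv ℝ Φ.symm (Φ z) '' range fun i =>
        (e i : Eu L)) = S.map (fderiv ℝ Φ.symm (Φ z)).toLinearMap := by
      conv_rhs => rw [hS']
      rw [Submodule.map_span]
      rfl
    rw [h4, Submodule.mem_map]
    constructor
    · exact fun h => ⟨_, h, fderiv_symm_comp h1 h2 hz w⟩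
    · rintro ⟨s, hs, rfl⟩
      have := fderiv_symm_comp (Φ := Φ.symm) h2 h1 (Φ.map_source hz) s
      simp only [OpenPartialHomeomorph.symm_symm, Φ.left_inv hz] at this
      rw [ContinuousLinearMap.coe_coe, this]
      exact hs
  have hdet : ∀ z ∈ Φ.source, (Matrix.gram ℝ (v z)).det ≠ 0 := fun z hz => by
    rw [Matrix.det_gram_ne_zero_iff_linearIndependent]
    have : LinearIndependent ℝ fun i => (e i : Eu L) := by
      have h := e.toBasis.linearIndependent.map' S.subtype (by simp)
      rwa [OrthonormalBasis.coe_toBasis] at h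
    exact this.map' (fderiv ℝ Φ.symm (Φ z)).toLinearMap (LinearMap.ker_eq_bot.2 (hinj z hz))
  have hv : ∀ i, ContDiffAt ℝ 1 (fun z => v z i) y := fun i => by
    have a : ContDiffAt ℝ 1 (fun z => fderiv ℝ Φ.symm (Φ z)) y := by
      have b : ContDiffAt ℝ 1 (fderiv ℝ Φ.symm) (Φ y) :=
        (h2.contDiffAt (Φ.open_target.mem_nhds (Φ.map_source hyΦ))).fderiv_right
          (by rw [one_add_one_eq_two]; exact ENat.LEInfty.out)
      exact b.comp y ((h1.contDiffAt (Φ.open_source.mem_nhds hyΦ)).of_le (by simp))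
    exact a.clm_apply contDiffAt_const
  have hd : DifferentiableAt ℝ (fun z => ∑ i, ∑ j, (Matrix.gram ℝ (v z))⁻¹ i j •
      (innerSL ℝ (v z i)).smulRight (v z j)) y := by
    refine DifferentiableAt.fun_sum fun i _ => DifferentiableAt.fun_sum fun j _ => ?_
    refine DifferentiableAt.fun_smul ?_ ?_
    · refine (contDiffAt_inv (k := 1) (A := fun z => Matrix.gram ℝ (v z)) (fun p q => ?_)
        (hdet y hyΦ) i j).differentiableAt (by simp)
      exact (hv p).inner ℝ (hv q)
    · have a : DifferentiableAt ℝ (fun z => innerSL ℝ (v z i)) y :=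
        ((innerSL ℝ).differentiableAt).comp y ((hv i).differentiableAt (by simp))
      have b := (hv j).differentiableAt (by simp)
      have c : IsBoundedBilinearMap ℝ fun p : (Eu L →L[ℝ] ℝ) ×
          Eu L => p.1.smulRight p.2 := isBoundedBilinearMap_smulRight
      exact (c.differentiableAt (innerSL ℝ (v y i), v y j)).comp y (a.prodMk b)
  refine hd.differentiableWithinAt.congr_of_eventuallyEq ?_
    (starProjection_eq_sum_gram (hdet y hyΦ) _ (hspan y hyΦ hy))
  filter_upwards [self_mem_nhdsWithin, mem_nhdsWithin_of_mem_nhds (Φ.open_source.mem_nhds hyΦ)]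
    with z hz1 hz2 using starProjection_eq_sum_gram (hdet z hz2) _ (hspan z hz2 hz1)

/-! ### The second fundamental form -/

lemma tangentProj_eq_self {y w : Eu L} (hw : w ∈ tangentSub N y) : tangentProj N y w = w :=
  Submodule.starProjection_eq_self_iff.2 hw

lemma tangentProj_secondFF (hN : IsSmoothSubmanifold N) {y : Eu L} (hy : y ∈ N) {v w : Eu L}
    (hv : v ∈ tangentSub N y) (hw : w ∈ tangentSub N y) : tangentProj N y (secondFF N y v w) = 0 :=
    by
  have h := (tangentProj_differentiableWithinAt hN hy).hasFDerivWithinAt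
  have h2 := h.clm_comp h
  have h3 : HasFDerivWithinAt (fun z => (tangentProj N z).comp (tangentProj N z))
      (fderivWithin ℝ (tangentProj N) N y) N y := by
    refine h.congr (fun z _ => ?_) ?_
    all_goals
      ext1 u
      exact tangentProj_eq_self (Submodule.starProjection_apply_mem _ _)
  have h4 := DFunLike.congr_fun (h2.unique_on h3 (mem_tangentCone_of_mem_tangentSub hN hy hv)) w
  simp only [_root_.add_apply, comp_apply,
    ContinuousLinearMap.compL_apply, ContinuousLinearMap.flip_apply] at h4
  rw [tangentProj_eq_self hw, add_eq_right] at h4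
  simp only [secondFF, _root_.neg_apply, map_neg, neg_eq_zero]
  exact h4

/-- The normal part of the derivative of a tangent field along a map into `N`. -/
lemma sub_tangentProj_fderiv (hN : IsSmoothSubmanifold N) {F X : V → Eu L} {F' X' : V →L[ℝ] Eu L} {p : V} (hF : HasFDerivAt F F' p)
    (hX : HasFDerivAt X X' p) (h : ∀ᶠ q in 𝓝 p, F q ∈ N)
    (hT : ∀ᶠ q in 𝓝 p, X q ∈ tangentSub N (F q)) (u : V) :
    X' u - tangentProj N (F p) (X' u) = -secondFF N (F p) (F' u) (X p) := by
  have hP := (tangentProj_differentiableWithinAt hN h.self_of_nhds).hasFDerivWithinAt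
  have h1 := hP.comp_hasFDerivAt p hF h
  have h2 := h1.clm_apply hX
  have h3 : HasFDerivAt (fun q => (tangentProj N ∘ F) q (X q)) X' p := by
    refine hX.congr_of_eventuallyEq ?_
    filter_upwards [hT] with q hq using tangentProj_eq_self hq
  have h4 := DFunLike.congr_fun (h2.unique h3) u
  simp only [_root_.add_apply, comp_apply, ContinuousLinearMap.flip_apply,
    Function.comp_apply] at h4
  simp only [secondFF, _root_.neg_apply, neg_neg]
  rw [sub_eq_iff_eq_add, add_comm]
  exact h4.symm

lemma neg_inner_fderiv_le (hN : IsSmoothSubmanifold N) {K : ℝ} (hK : SecondFFBound N K) {V : Type*}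
    [NormedAddCommGroup V] [NormedSpace ℝ V] {F X : V → Eu L} {F' X' : V →L[ℝ] Eu L} {p : V}
    (hF : HasFDerivAt F F' p) (hX : HasFDerivAt X X' p) (h : ∀ᶠ q in 𝓝 p, F q ∈ N)
    (hT : ∀ᶠ q in 𝓝 p, X q ∈ tangentSub N (F q)) (u : V) {ν : Eu L} (hν : tangentProj N (F p) ν = 0)
    : -inner ℝ ν (X' u) ≤ ‖ν‖ * (K * ‖F' u‖ * ‖X p‖) := by
  have h1 := sub_tangentProj_fderiv hN hF hX h hT u
  have h2 : inner ℝ ν (tangentProj N (F p) (X' u)) = 0 := by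
    rw [tangentProj, Submodule.starProjection_apply_eq_zero_iff] at hν
    exact (Submodule.mem_orthogonal' _ _).1 hν _ (Submodule.starProjection_apply_mem _ _)
  have h3 : -inner ℝ ν (X' u) = inner ℝ ν (secondFF N (F p) (F' u) (X p)) := by
    rw [← neg_neg (secondFF N (F p) (F' u) (X p)), ← h1, inner_neg_right, inner_sub_right, h2,
      sub_zero]
  rw [h3]
  refine (real_inner_le_norm _ _).trans (mul_le_mul_of_nonneg_left ?_ (norm_nonneg _))
  exact hK _ h.self_of_nhds _ (fderiv_mem_tangentSub hF h u) _ hT.self_of_nhds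

lemma sum_vecMulVec_inner {ι E : Type*} [Fintype ι] [NormedAddCommGroup E] [InnerProductSpace ℝ E]
    {m : ℕ} (v : Fin m → ι → ℝ) (X : ι → E) :
    ∑ i, ∑ j, (∑ k, Matrix.vecMulVec (v k) (star (v k))) i j * inner ℝ (X i) (X j) =
      ∑ k, ‖∑ i, v k i • X i‖ ^ 2 := by
  simp only [Matrix.sum_apply, Matrix.vecMulVec_apply, sum_mul,
    star_trivial, ← real_inner_self_eq_norm_sq, sum_inner, inner_sum, inner_smul_left,
    inner_smul_right, conj_trivial]
  rw [sum_congr rfl fun i _ => sum_comm, sum_comm]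
  refine sum_congr rfl fun k _ => sum_congr rfl fun i _ => ?_
  rw [mul_sum]
  exact sum_congr rfl fun j _ => by rw [real_inner_comm]; ring

lemma sum_inner_nonneg {ι E : Type*} [Fintype ι] [NormedAddCommGroup E] [InnerProductSpace ℝ E]
    {A : Matrix ι ι ℝ} (hA : A.PosSemidef) (X : ι → E) :
    0 ≤ ∑ i, ∑ j, A i j * inner ℝ (X i) (X j) := by
  obtain ⟨m, v, rfl⟩ := Matrix.posSemidef_iff_eq_sum_vecMulVec.1 hA
  rw [sum_vecMulVec_inner]
  exact sum_nonneg fun k _ => sq_nonneg _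

/-- The trace of the second fundamental form over a positive matrix. -/
lemma norm_sum_secondFF_le {K : ℝ} (hK : SecondFFBound N K) {ι : Type*} [Fintype ι]
    {A : Matrix ι ι ℝ} (hA : A.PosSemidef) {y : Eu L} (hy : y ∈ N) {X : ι → Eu L}
    (hX : ∀ i, X i ∈ tangentSub N y) :
    ‖∑ i, ∑ j, A i j • secondFF N y (X i) (X j)‖ ≤ K * ∑ i, ∑ j, A i j * inner ℝ (X i) (X j) := by
  obtain ⟨m, v, rfl⟩ := Matrix.posSemidef_iff_eq_sum_vecMulVec.1 hA
  let Y : Fin m → Eu L := fun k => ∑ i, v k i • X i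
  have hY : ∀ k, Y k ∈ tangentSub N y := fun k =>
    Submodule.sum_mem _ fun i _ => Submodule.smul_mem _ _ (hX i)
  have e1 : ∑ i, ∑ j, (∑ k, Matrix.vecMulVec (v k) (star (v k))) i j • secondFF N y (X i) (X j) =
      ∑ k, secondFF N y (Y k) (Y k) := by
    simp only [Matrix.sum_apply, Matrix.vecMulVec_apply, sum_smul, Y, map_sum, map_smul,
      _root_.sum_apply, _root_.smul_apply, star_trivial, smul_sum, smul_smul]
    rw [sum_congr rfl fun i _ => sum_comm, sum_comm]
    refine sum_congr rfl fun k _ => ?_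
    rw [sum_comm]
    exact sum_congr rfl fun i _ => sum_congr rfl fun j _ => by rw [mul_comm]
  rw [e1, sum_vecMulVec_inner, mul_sum]
  refine (norm_sum_le _ _).trans (sum_le_sum fun k _ => ?_)
  refine (hK y hy _ (hY k) _ (hY k)).trans_eq (by ring)

end Target

/-! ### The derivative of the determinant -/

section Jacobi

variable {ι : Type*} [Fintype ι] [DecidableEq ι]

lemma fderiv_det {A : V → Matrix ι ι ℝ} {x : V}
    (hA : ∀ i j, DifferentiableAt ℝ (fun z => A z i j) x) (hx : (A x).det ≠ 0) (u : V) :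
    fderiv ℝ (fun z => (A z).det) x u =
      (A x).det * ∑ i, ∑ j, (A x)⁻¹ i j * fderiv ℝ (fun z => A z j i) x u := by
  let B : V → ι → ι → ℝ := fun z i j => A z i j
  have hB : DifferentiableAt ℝ B x := differentiableAt_pi.2 fun i => differentiableAt_pi.2 (hA i)
  let D : (ι → ι → ℝ) → ℝ := fun m => (Matrix.of m).det
  have hD : DifferentiableAt ℝ D (B x) := by
    refine (contDiffAt_det (k := 1) (A := fun m : ι → ι → ℝ => Matrix.of m)
      fun i j => ?_).differentiableAt one_ne_zero
    exact contDiffAt_pi.1 (contDiffAt_pi.1 contDiffAt_id i) j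
  have h1 : fderiv ℝ (fun z => (A z).det) x u = fderiv ℝ D (B x) (fderiv ℝ B x u) := by
    have := hD.hasFDerivAt.comp x hB.hasFDerivAt
    have e : fderiv ℝ (D ∘ B) x = _ := this.fderiv
    exact DFunLike.congr_fun e u
  have hBu : ∀ i j, fderiv ℝ B x u i j = fderiv ℝ (fun z => A z i j) x u := fun i j => by
    have a := hasFDerivAt_pi'.1 hB.hasFDerivAt i
    have b := hasFDerivAt_pi'.1 a j
    exact (DFunLike.congr_fun b.fderiv u).symm
  set m := fderiv ℝ B x u with hm
  have h2 : HasDerivAt (fun τ : ℝ => D (B x + τ • m)) (fderiv ℝ D (B x) m) 0 := by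
    have c : HasDerivAt (fun τ : ℝ => B x + τ • m) m 0 := by
      simpa using ((hasDerivAt_id (0 : ℝ)).smul_const m).const_add (B x)
    have d : HasFDerivAt D (fderiv ℝ D (B x)) (B x + (0 : ℝ) • m) := by
      simpa using hD.hasFDerivAt
    exact d.comp_hasDerivAt (0 : ℝ) c
  set M : Matrix ι ι ℝ := (A x)⁻¹ * Matrix.of m with hM
  have hinv := mul_nonsing_inv (A x) (isUnit_iff_ne_zero.2 hx)
  obtain ⟨p, hp⟩ : ∃ p : Polynomial ℝ, ∀ τ : ℝ, D (B x + τ • m) =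
      (A x).det * (1 + M.trace * τ + p.eval τ * τ ^ 2) := by
    refine ⟨(Matrix.det (1 + (Polynomial.X : Polynomial ℝ) • M.map Polynomial.C)).divX.divX,
      fun τ => ?_⟩
    rw [← Matrix.det_one_add_smul τ M, ← Matrix.det_mul, mul_add, mul_one, Matrix.mul_smul, hM,
      ← mul_assoc, hinv, one_mul]
    rfl
  have h3 : HasDerivAt (fun τ : ℝ => D (B x + τ • m)) ((A x).det * M.trace) 0 := by
    have a : HasDerivAt (fun τ : ℝ => M.trace * τ) M.trace 0 := by
      simpa using (hasDerivAt_id (0 : ℝ)).const_mul M.trace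
    have b : HasDerivAt (fun τ : ℝ => p.eval τ * τ ^ 2) 0 0 := by
      have b' : HasDerivAt (fun τ : ℝ => p.eval τ * τ ^ 2) _ 0 :=
        (p.hasDerivAt 0).mul (hasDerivAt_pow 2 (0 : ℝ))
      simpa using b'
    have c := (((a.const_add 1).add b).const_mul (A x).det)
    rw [add_zero] at c
    exact c.congr_of_eventuallyEq (Eventually.of_forall hp)
  rw [h1, h2.unique h3, Matrix.trace]
  congr 1
  refine sum_congr rfl fun i _ => ?_
  rw [Matrix.diag_apply, hM, Matrix.mul_apply]
  exact sum_congr rfl fun j _ => by rw [← hBu]; rfl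

end Jacobi

/-! ### Changes of coordinates -/

section Transition


/-- The Jacobian matrix. -/
def jac (ψ : Eu n → Eu n) (z : Eu n) : Mat n := Matrix.of fun k i => pd i ψ z k

lemma eu_eq_sum (v : Eu n) : v = ∑ k, v k • single k (1 : ℝ) := by
  ext j
  simp [Pi.single_apply]

lemma fderiv_single_eq_sum (ψ : Eu n → Eu n) (z : Eu n) (i : Fin n) : fderiv ℝ ψ z (single i 1) =
      ∑ k, jac ψ z k i • single k (1 : ℝ) := eu_eq_sum _

lemma clm_apply_eq_sum (T : Eu n →L[ℝ] V) (v : Eu n) : T v = ∑ k, v k • T (single k 1) := by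
  conv_lhs => rw [eu_eq_sum v]
  simp

lemma pd_comp {F : Eu n → V} {ψ : Eu n → Eu n} {z : Eu n} (hF : DifferentiableAt ℝ F (ψ z))
    (hψ : DifferentiableAt ℝ ψ z) (i : Fin n) :
    pd i (fun y => F (ψ y)) z = ∑ k, jac ψ z k i • pd k F (ψ z) := by
  have e : fderiv ℝ (F ∘ ψ) z = _ := (hF.hasFDerivAt.comp z hψ.hasFDerivAt).fderiv
  calc pd i (fun y => F (ψ y)) z = fderiv ℝ F (ψ z) (fderiv ℝ ψ z (single i 1)) :=
        DFunLike.congr_fun e _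
    _ = _ := by rw [clm_apply_eq_sum]; rfl

lemma differentiableAt_pd {F : Eu n → V} {z : Eu n} (hF : ContDiffAt ℝ ∞ F z) (i : Fin n) :
    DifferentiableAt ℝ (pd i F) z :=
  ((hF.fderiv_right (m := 1) (by rw [one_add_one_eq_two]; exact ENat.LEInfty.out)).differentiableAt
    one_ne_zero).clm_apply (differentiableAt_const _)

lemma pd_pd_comm {F : Eu n → V} {z : Eu n} (hF : ContDiffAt ℝ ∞ F z) (i j : Fin n) :
    pd i (pd j F) z = pd j (pd i F) z := by
  have h : DifferentiableAt ℝ (fderiv ℝ F) z := (hF.fderiv_right (m := 1)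
      (by rw [one_add_one_eq_two]; exact ENat.LEInfty.out)).differentiableAt one_ne_zero
  have e : ∀ k l : Fin n, pd k (pd l F) z = fderiv ℝ (fderiv ℝ F) z (single k 1)
      (single l 1) := fun k l => by
    have a := (h.hasFDerivAt.clm_apply (hasFDerivAt_const (single l (1 : ℝ)) z)).fderiv
    have b := DFunLike.congr_fun a (single k (1 : ℝ))
    refine b.trans ?_
    simp
  rw [e, e]
  exact (hF.isSymmSndFDerivAt (by simp [ENat.LEInfty.out])).eq _ _

lemma differentiableAt_jac {ψ : Eu n → Eu n} {z : Eu n} (hψ : ContDiffAt ℝ ∞ ψ z) (k i : Fin n) :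
    DifferentiableAt ℝ (fun y => jac ψ y k i) z :=
  (differentiableAt_euclidean.1 (differentiableAt_pd hψ i)) k

lemma pd_coord {f : Eu n → Eu n} {z : Eu n} (hf : DifferentiableAt ℝ f z) (i k : Fin n) :
    pd i (fun y => f y k) z = pd i f z k := by
  have := (EuclideanSpace.proj (𝕜 := ℝ) k).hasFDerivAt.comp z hf.hasFDerivAt
  exact DFunLike.congr_fun this.fderiv _

lemma pd_jac_comm {ψ : Eu n → Eu n} {z : Eu n} (hψ : ContDiffAt ℝ ∞ ψ z) (i j k : Fin n) :
    pd i (fun y => jac ψ y k j) z = pd j (fun y => jac ψ y k i) z := by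
  have h : ∀ l : Fin n, (fun y => jac ψ y k l) = fun y => (pd l ψ y) k := fun l => rfl
  rw [h, h, pd_coord (differentiableAt_pd hψ j), pd_coord (differentiableAt_pd hψ i), pd_pd_comm hψ]

lemma pd_congr {f g : Eu n → V} {z : Eu n} (h : f =ᶠ[𝓝 z] g) (i : Fin n) : pd i f z = pd i g z := by
  rw [pd, pd, h.fderiv_eq]

lemma pd_smul {σ : Eu n → ℝ} {X : Eu n → V} {z : Eu n} (hσ : DifferentiableAt ℝ σ z)
    (hV : DifferentiableAt ℝ X z) (i : Fin n) :
    pd i (fun y => σ y • X y) z = σ z • pd i X z + pd i σ z • X z := by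
  have := (hσ.hasFDerivAt.smul hV.hasFDerivAt)
  exact DFunLike.congr_fun (this.fderiv) _

lemma pd_sum {ι : Type*} (s : Finset ι) {f : ι → Eu n → V} {z : Eu n}
    (h : ∀ k ∈ s, DifferentiableAt ℝ (f k) z) (i : Fin n) :
    pd i (fun y => ∑ k ∈ s, f k y) z = ∑ k ∈ s, pd i (f k) z := by
  rw [pd, fderiv_fun_sum h, _root_.sum_apply]
  rfl

/-- Invariance of the divergence of a vector field. -/
lemma div_transition {ψ : Eu n → Eu n} {y : Eu n} (hψ : ContDiffAt ℝ ∞ ψ y) (hJ : (jac ψ y).det ≠ 0)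
    {X X' : Eu n → Fin n → V} {σ σ' : Eu n → ℝ} (hV : ∀ i, DifferentiableAt ℝ (fun z => X z i) y)
    (hV' : ∀ i, DifferentiableAt ℝ (fun z => X' z i) (ψ y))
    (hVV : ∀ᶠ z in 𝓝 y, ∀ k, X' (ψ z) k = ∑ i, jac ψ z k i • X z i)
    (hσ' : DifferentiableAt ℝ σ' (ψ y)) (hσ0 : σ' (ψ y) ≠ 0)
    (hσ : ∀ᶠ z in 𝓝 y, σ z = |(jac ψ z).det| * σ' (ψ z)) :
    (σ y)⁻¹ • ∑ i, pd i (fun z => σ z • X z i) y =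
      (σ' (ψ y))⁻¹ • ∑ k, pd k (fun z => σ' z • X' z k) (ψ y) := by
  have dψ : DifferentiableAt ℝ ψ y := hψ.differentiableAt (by simp)
  set J := jac ψ y with hJdef
  set δ : Eu n → ℝ := fun z => (jac ψ z).det with hδ
  have dδ : DifferentiableAt ℝ δ y := (contDiffAt_det (k := 1) fun k i => contDiffAt_euclidean.1
      ((hψ.fderiv_right (m := 1) (by rw [one_add_one_eq_two]; exact ENat.LEInfty.out)).clm_apply
        contDiffAt_const) k).differentiableAt one_ne_zero
  obtain ⟨τ, hτ0, hτ⟩ : ∃ τ : ℝ, τ ≠ 0 ∧ ∀ᶠ z in 𝓝 y, |δ z| = τ * δ z := by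
    rcases lt_or_gt_of_ne hJ with h | h
    · refine ⟨-1, by norm_num, ?_⟩
      filter_upwards [dδ.continuousAt.eventually_lt continuousAt_const h] with z hz
      rw [abs_of_neg hz]; ring
    · refine ⟨1, one_ne_zero, ?_⟩
      filter_upwards [continuousAt_const.eventually_lt dδ.continuousAt h] with z hz
      rw [abs_of_pos hz]; ring
  have hσ2 : σ =ᶠ[𝓝 y] fun z => τ * (δ z * σ' (ψ z)) := by
    filter_upwards [hσ, hτ] with z h1 h2
    rw [h1]
    change |δ z| * _ = _
    rw [h2]; ring
  have dσψ : DifferentiableAt ℝ (fun z => σ' (ψ z)) y := hσ'.comp y dψ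
  have dσ : DifferentiableAt ℝ σ y := ((dδ.mul dσψ).const_mul τ).congr_of_eventuallyEq hσ2
  have hJi := nonsing_inv_mul J (isUnit_iff_ne_zero.2 hJ)
  have hJi' := mul_nonsing_inv J (isUnit_iff_ne_zero.2 hJ)
  have hσy : σ y = τ * (J.det * σ' (ψ y)) := hσ2.self_of_nhds
  set S : Fin n → Fin n → Fin n → ℝ := fun k i j => pd i (fun z => jac ψ z k j) y with hS
  have hSs : ∀ k i j, S k i j = S k j i := fun k i j => pd_jac_comm hψ i j k
  have pσ : ∀ i, (σ y)⁻¹ * pd i σ y = ∑ j, ∑ k, J⁻¹ j k * S k i j +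
      (σ' (ψ y))⁻¹ * ∑ k, J k i * pd k σ' (ψ y) := by
    intro i
    have e1 : pd i σ y = τ * (J.det * ∑ k, J k i * pd k σ' (ψ y) +
        (J.det * ∑ j, ∑ k, J⁻¹ j k * S k i j) * σ' (ψ y)) := by
      have hp := pd_comp hσ' dψ i
      have hq : pd i δ y = J.det * ∑ j, ∑ k, J⁻¹ j k * S k i j :=
        fderiv_det (A := jac ψ) (fun k i => differentiableAt_jac hψ k i) hJ _
      have hr := pd_smul dδ dσψ i
      simp only [smul_eq_mul] at hp hr
      have hs : pd i (fun z => τ * (δ z * σ' (ψ z))) y = τ * pd i (fun z => δ z * σ' (ψ z)) y := by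
        have d : DifferentiableAt ℝ (fun z => δ z * σ' (ψ z)) y := dδ.mul dσψ
        rw [pd, fderiv_const_mul d]
        rfl
      rw [pd_congr hσ2, hs, hr, hp, hq]
    rw [e1, hσy]
    field_simp
    ring
  have lhs : (σ y)⁻¹ • ∑ i, pd i (fun z => σ z • X z i) y =
      ∑ i, pd i (fun z => X z i) y + ∑ i, (∑ j, ∑ k, J⁻¹ j k * S k i j) • X y i +
        (σ' (ψ y))⁻¹ • ∑ i, (∑ k, J k i * pd k σ' (ψ y)) • X y i := by
    have h0 : σ y ≠ 0 := by rw [hσy]; positivity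
    rw [smul_sum, smul_sum, ← sum_add_distrib, ← sum_add_distrib]
    refine sum_congr rfl fun i _ => ?_
    rw [pd_smul dσ (hV i), smul_add, smul_smul, smul_smul, pσ i, inv_mul_cancel₀ h0, one_smul,
      add_smul, smul_smul, add_assoc]
  have rhs : (σ' (ψ y))⁻¹ • ∑ k, pd k (fun z => σ' z • X' z k) (ψ y) =
      ∑ k, pd k (fun z => X' z k) (ψ y) + (σ' (ψ y))⁻¹ • ∑ k, pd k σ' (ψ y) • X' (ψ y) k := by
    rw [smul_sum, smul_sum, ← sum_add_distrib]
    refine sum_congr rfl fun i _ => ?_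
    rw [pd_smul hσ' (hV' i), smul_add, smul_smul, smul_smul, inv_mul_cancel₀ hσ0, one_smul]
  have rel : ∀ j k, ∑ l, J l j • pd l (fun z => X' z k) (ψ y) =
      ∑ i, (J k i • pd j (fun z => X z i) y + S k j i • X y i) := by
    intro j k
    have h1 : (fun z => X' (ψ z) k) =ᶠ[𝓝 y] fun z => ∑ i, jac ψ z k i • X z i := by
      filter_upwards [hVV] with z hz using hz k
    have h2 := pd_congr h1 j
    rw [pd_comp (hV' k) dψ, pd_sum _ fun i _ => (differentiableAt_jac hψ k i).fun_smul (hV i)] at h2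
    rw [h2]
    exact sum_congr rfl fun i _ => pd_smul (differentiableAt_jac hψ k i) (hV i) j
  have h1 : ∑ k, pd k (fun z => X' z k) (ψ y) =
      ∑ k, ∑ j, J⁻¹ j k • ∑ l, J l j • pd l (fun z => X' z k) (ψ y) := by
    refine sum_congr rfl fun k _ => ?_
    simp only [smul_sum, smul_smul]
    rw [sum_comm]
    have : ∀ l, ∑ j, (J⁻¹ j k * J l j) • pd l (fun z => X' z k) (ψ y) =
        (if l = k then 1 else 0 : ℝ) • pd l (fun z => X' z k) (ψ y) := fun l => by
      rw [← sum_smul]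
      congr 1
      have := congrFun (congrFun hJi' l) k
      rw [Matrix.mul_apply, Matrix.one_apply] at this
      rw [← this]
      exact sum_congr rfl fun j _ => mul_comm _ _
    simp [this]
  have h2 : ∑ k, ∑ j, J⁻¹ j k • ∑ i, (J k i • pd j (fun z => X z i) y + S k j i • X y i) =
      ∑ i, pd i (fun z => X z i) y + ∑ i, (∑ j, ∑ k, J⁻¹ j k * S k i j) • X y i := by
    have a : ∑ k, ∑ j, ∑ i, (J⁻¹ j k * J k i) • pd j (fun z => X z i) y =
        ∑ i, pd i (fun z => X z i) y := by
      rw [sum_comm]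
      refine sum_congr rfl fun j _ => ?_
      rw [sum_comm]
      have : ∀ i, ∑ k, (J⁻¹ j k * J k i) • pd j (fun z => X z i) y =
          (if j = i then 1 else 0 : ℝ) • pd j (fun z => X z i) y := fun i => by
        rw [← sum_smul, ← Matrix.mul_apply, hJi, Matrix.one_apply]
      simp [this]
    have b : ∑ k, ∑ j, ∑ i, (J⁻¹ j k * S k j i) • X y i =
        ∑ i, (∑ j, ∑ k, J⁻¹ j k * S k i j) • X y i := by
      simp only [sum_smul]
      rw [sum_comm, sum_congr rfl fun j _ => sum_comm, sum_comm]
      exact sum_congr rfl fun i _ => sum_congr rfl fun j _ => sum_congr rfl fun k _ => by rw [hSs]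
    rw [← a, ← b]
    simp only [smul_sum, smul_add, smul_smul, sum_add_distrib]
  have h3 : ∑ k, pd k σ' (ψ y) • X' (ψ y) k = ∑ i, (∑ k, J k i * pd k σ' (ψ y)) • X y i := by
    simp only [hVV.self_of_nhds, smul_sum, sum_smul, smul_smul]
    rw [sum_comm]
    exact sum_congr rfl fun i _ => sum_congr rfl fun j _ => by rw [mul_comm]
  rw [lhs, rhs, h1, h3]
  simp only [rel]
  rw [h2]

end Transition

set_option synthInstance.maxHeartbeats 200000

/-! ### Invariance of the metric quantities -/

section Invariance


lemma sum_bilin_transition {W Z : Type*} [NormedAddCommGroup W] [NormedSpace ℝ W]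
    [NormedAddCommGroup Z] [NormedSpace ℝ Z] (B : W →L[ℝ] W →L[ℝ] Z) {J H H' : Mat n}
    (hH : J * H * Jᵀ = H') {v w v' w' : Fin n → W} (hv : ∀ i, v i = ∑ k, J k i • v' k)
    (hw : ∀ i, w i = ∑ k, J k i • w' k) :
    ∑ i, ∑ j, H i j • B (v i) (w j) = ∑ k, ∑ l, H' k l • B (v' k) (w' l) := by
  have h : ∀ k l, H' k l = ∑ i, ∑ j, J k i * H i j * J l j := fun k l => by
    rw [← hH, Matrix.mul_apply]
    simp only [Matrix.mul_apply, Matrix.transpose_apply, sum_mul]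
    rw [sum_comm]
  simp only [hv, hw, h, map_sum, map_smul, _root_.sum_apply, _root_.smul_apply, smul_sum,
    sum_smul, smul_smul]
  have e2 : ∀ f : Fin n → Fin n → Fin n → Fin n → Z, ∑ i, ∑ j, ∑ k, ∑ l, f i j k l =
      ∑ k, ∑ l, ∑ i, ∑ j, f i j k l := fun f => by
    rw [sum_congr rfl fun i _ => sum_comm]
    rw [sum_comm]
    refine sum_congr rfl fun k _ => ?_
    rw [sum_congr rfl fun i _ => sum_comm]
    rw [sum_comm]
  refine Eq.trans ?_ (e2 fun i j k l => (J k i * H i j * J l j) • B (v' k) (w' l))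
  refine sum_congr rfl fun i _ => sum_congr rfl fun j _ => ?_
  rw [sum_comm]
  exact sum_congr rfl fun k _ => sum_congr rfl fun l _ => by
    congr 1; ring

/-- `ψ` is a change of coordinates on `U` which pulls the metric `G'` back to `G`. -/
structure Transition (U : Set (Eu n)) (G G' : Eu n → Mat n) (ψ : Eu n → Eu n) : Prop where
  isOpen : IsOpen U
  smooth : ∀ z ∈ U, ContDiffAt ℝ ∞ ψ z
  det_ne : ∀ z ∈ U, (jac ψ z).det ≠ 0
  metric : ∀ z ∈ U, G z = (jac ψ z)ᵀ * G' (ψ z) * jac ψ z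
  smooth' : ∀ z ∈ U, ∀ i j, ContDiffAt ℝ ∞ (fun x => G' x i j) (ψ z)
  symm' : ∀ x i j, G' x i j = G' x j i
  pos' : ∀ z ∈ U, 0 < (G' (ψ z)).det

namespace Transition

variable {U : Set (Eu n)} {G G' : Eu n → Mat n} {ψ : Eu n → Eu n} {z : Eu n}

lemma jac_mul_inv (h : Transition U G G' ψ) (hz : z ∈ U) :
    jac ψ z * (G z)⁻¹ * (jac ψ z)ᵀ = (G' (ψ z))⁻¹ := by
  have h1 := isUnit_iff_ne_zero.2 (h.det_ne z hz)
  have h2 : IsUnit (jac ψ z)ᵀ.det := by rwa [Matrix.det_transpose]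
  rw [h.metric z hz, Matrix.mul_inv_rev, Matrix.mul_inv_rev, ← mul_assoc,
    mul_nonsing_inv _ h1, one_mul, mul_assoc, nonsing_inv_mul _ h2, mul_one]

lemma det_eq (h : Transition U G G' ψ) (hz : z ∈ U) : (G z).det = (jac ψ z).det ^ 2 * (G' (ψ z)).det
    := by
  rw [h.metric z hz, Matrix.det_mul, Matrix.det_mul, Matrix.det_transpose]
  ring

lemma sqrt_det_eq (h : Transition U G G' ψ) (hz : z ∈ U) :
    √(G z).det = |(jac ψ z).det| * √(G' (ψ z)).det := by
  rw [h.det_eq hz, Real.sqrt_mul (sq_nonneg _), Real.sqrt_sq_eq_abs]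

lemma det_pos (h : Transition U G G' ψ) (hz : z ∈ U) : 0 < (G z).det := by
  rw [h.det_eq hz]
  have := h.pos' z hz
  have := h.det_ne z hz
  positivity

lemma contDiffAt_jac (h : Transition U G G' ψ) (hz : z ∈ U) (k i : Fin n) :
    ContDiffAt ℝ ∞ (fun x => jac ψ x k i) z :=
  contDiffAt_euclidean.1 (((h.smooth z hz).fderiv_right (m := ∞) (by simp)).clm_apply
    contDiffAt_const) k

lemma contDiffAt_metric (h : Transition U G G' ψ) (hz : z ∈ U) (i j : Fin n) :
    ContDiffAt ℝ ∞ (fun x => G x i j) z := by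
  have e : (fun x => G x i j) =ᶠ[𝓝 z]
      fun x => ∑ l, (∑ k, jac ψ x k i * G' (ψ x) k l) * jac ψ x l j := by
    filter_upwards [h.isOpen.mem_nhds hz] with x hx
    rw [h.metric x hx]
    simp only [Matrix.mul_apply, Matrix.transpose_apply]
  refine ContDiffAt.congr_of_eventuallyEq (ContDiffAt.sum fun l _ => ContDiffAt.mul
    (ContDiffAt.sum fun k _ => ContDiffAt.mul (h.contDiffAt_jac hz k i) ?_)
    (h.contDiffAt_jac hz l j)) e
  exact (h.smooth' z hz k l).comp z (h.smooth z hz)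

variable {F F' : Eu n → Eu L}

lemma pd_eq (h : Transition U G G' ψ) (hF : ∀ x ∈ U, F x = F' (ψ x)) (hz : z ∈ U)
    (hF' : DifferentiableAt ℝ F' (ψ z)) (i : Fin n) :
    pd i F z = ∑ k, jac ψ z k i • pd k F' (ψ z) := by
  have : F =ᶠ[𝓝 z] fun x => F' (ψ x) := by
    filter_upwards [h.isOpen.mem_nhds hz] with x hx using hF x hx
  rw [pd_congr this, pd_comp hF' ((h.smooth z hz).differentiableAt (by simp))]

lemma sum_bilin_pd (h : Transition U G G' ψ) (hF : ∀ x ∈ U, F x = F' (ψ x)) (hz : z ∈ U)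
    (hF' : DifferentiableAt ℝ F' (ψ z)) {Z : Type*} [NormedAddCommGroup Z] [NormedSpace ℝ Z]
    (B : Eu L →L[ℝ] Eu L →L[ℝ] Z) : ∑ i, ∑ j, (G z)⁻¹ i j • B (pd i F z) (pd j F z) =
      ∑ i, ∑ j, (G' (ψ z))⁻¹ i j • B (pd i F' (ψ z)) (pd j F' (ψ z)) :=
  sum_bilin_transition B (h.jac_mul_inv hz) (h.pd_eq hF hz hF') (h.pd_eq hF hz hF')

lemma gradSqCoord_eq (h : Transition U G G' ψ) (hF : ∀ x ∈ U, F x = F' (ψ x)) (hz : z ∈ U)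
    (hF' : DifferentiableAt ℝ F' (ψ z)) : gradSqCoord G F z = gradSqCoord G' F' (ψ z) :=
  h.sum_bilin_pd hF hz hF' (innerSL ℝ)

lemma nLaplaceCoord_eq (h : Transition U G G' ψ) (hF : ∀ x ∈ U, F x = F' (ψ x)) (hz : z ∈ U)
    (hF' : ∀ x ∈ U, DifferentiableAt ℝ F' (ψ x)) {ε : ℝ}
    (hV' : ∀ i, DifferentiableAt ℝ (fun x => (ε + gradSqCoord G' F' x) ^ ((n : ℝ) / 2 - 1) •
      ∑ j, (G' x)⁻¹ i j • pd j F' x) (ψ z)) :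
    nLaplaceCoord ε G F z = nLaplaceCoord ε G' F' (ψ z) := by
  let V : Eu n → Fin n → Eu L := fun x i =>
    (ε + gradSqCoord G F x) ^ ((n : ℝ) / 2 - 1) • ∑ j, (G x)⁻¹ i j • pd j F x
  let V' : Eu n → Fin n → Eu L := fun x i =>
    (ε + gradSqCoord G' F' x) ^ ((n : ℝ) / 2 - 1) • ∑ j, (G' x)⁻¹ i j • pd j F' x
  have hVV : ∀ x ∈ U, ∀ k, V' (ψ x) k = ∑ i, jac ψ x k i • V x i := by
    intro x hx k
    simp only [V, V', ← h.gradSqCoord_eq hF hx (hF' x hx), ← h.jac_mul_inv hx,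
      h.pd_eq hF hx (hF' x hx), Matrix.mul_apply, Matrix.transpose_apply, smul_sum,
      smul_smul, sum_smul, mul_sum, sum_mul]
    have e : ∀ f : Fin n → Fin n → Fin n → Eu L, ∑ l, ∑ j, ∑ i, f l j i =
        ∑ i, ∑ j, ∑ l, f l j i := fun f => by
      rw [sum_comm, sum_congr rfl fun j _ => sum_comm, sum_comm]
    rw [e]
    exact sum_congr rfl fun i _ => sum_congr rfl fun j _ =>
      sum_congr rfl fun l _ => by congr 1; ring
  have hVinv : ∀ x ∈ U, ∀ i, V x i = ∑ k, (jac ψ x)⁻¹ i k • V' (ψ x) k := by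
    intro x hx i
    simp only [hVV x hx, smul_sum, smul_smul]
    rw [sum_comm]
    have : ∀ j, ∑ k, ((jac ψ x)⁻¹ i k * jac ψ x k j) • V x j =
        (if i = j then 1 else 0 : ℝ) • V x j := fun j => by
      rw [← sum_smul, ← Matrix.mul_apply,
        nonsing_inv_mul _ (isUnit_iff_ne_zero.2 (h.det_ne x hx)), Matrix.one_apply]
    simp [this]
  have hV : ∀ i, DifferentiableAt ℝ (fun x => V x i) z := fun i => by
    have e : (fun x => V x i) =ᶠ[𝓝 z] fun x => ∑ k, (jac ψ x)⁻¹ i k • V' (ψ x) k := by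
      filter_upwards [h.isOpen.mem_nhds hz] with x hx using hVinv x hx i
    refine DifferentiableAt.congr_of_eventuallyEq (DifferentiableAt.fun_sum fun k _ =>
      DifferentiableAt.fun_smul ?_ ?_) e
    · exact (contDiffAt_inv (fun p q => h.contDiffAt_jac hz p q) (h.det_ne z hz) i
        k).differentiableAt (by simp)
    · exact DifferentiableAt.comp (g := fun x => V' x k) z (hV' k)
        ((h.smooth z hz).differentiableAt (by simp))
  have hσ' : DifferentiableAt ℝ (fun x => √(G' x).det) (ψ z) :=
    ((contDiffAt_det fun i j => h.smooth' z hz i j).differentiableAt (by simp)).sqrt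
      (h.pos' z hz).ne'
  have key := div_transition (h.smooth z hz) (h.det_ne z hz) hV hV'
    (by filter_upwards [h.isOpen.mem_nhds hz] with x hx using hVV x hx)
    hσ' (sqrt_pos.2 (h.pos' z hz)).ne' (σ := fun x => √(G x).det)
    (by filter_upwards [h.isOpen.mem_nhds hz] with x hx using h.sqrt_det_eq hx)
  simp only [nLaplaceCoord, mul_smul]
  exact key

/-! #### The covariant Hessian -/

/-- A linear combination with a matrix of coefficients. -/
def matSum {Z : Type*} [NormedAddCommGroup Z] [NormedSpace ℝ Z] (c : Fin n → Fin n → Z)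
    (A : Mat n) : Z := ∑ i, ∑ j, A i j • c i j

lemma differentiableAt_matSum {Z : Type*} [NormedAddCommGroup Z] [NormedSpace ℝ Z]
    {A : Eu n → Mat n} (c : Fin n → Fin n → Z) (hA : ∀ i j, DifferentiableAt ℝ (fun x => A x i j) z)
    : DifferentiableAt ℝ (fun x => matSum c (A x)) z :=
  DifferentiableAt.fun_sum fun i _ => DifferentiableAt.fun_sum fun j _ =>
    DifferentiableAt.fun_smul (hA i j) (differentiableAt_const _)

/-- The bilinear form of a matrix. -/
def mform (A : Mat n) : Eu n →L[ℝ] Eu n →L[ℝ] ℝ :=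
  matSum (fun i j => (EuclideanSpace.proj i : Eu n →L[ℝ] ℝ).smulRight
    (EuclideanSpace.proj j : Eu n →L[ℝ] ℝ)) A

lemma mform_apply (A : Mat n) (v w : Eu n) : mform A v w = ∑ i, ∑ j, A i j * (v i * w j) := by
  simp [mform, matSum, _root_.sum_apply]

lemma mform_single (A : Mat n) (i j : Fin n) : mform A (single i 1) (single j 1) = A i j := by
  rw [mform_apply]
  simp [Pi.single_apply]

lemma mform_symm {A : Mat n} (hA : ∀ i j, A i j = A j i) (v w : Eu n) :
    mform A v w = mform A w v := by
  rw [mform_apply, mform_apply, sum_comm]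
  exact sum_congr rfl fun i _ => sum_congr rfl fun j _ => by
    rw [hA, mul_comm (v j)]

lemma mform_pullback (A : Mat n) (ψ : Eu n → Eu n) (z v w : Eu n) :
    mform ((jac ψ z)ᵀ * A * jac ψ z) v w = mform A (fderiv ℝ ψ z v) (fderiv ℝ ψ z w) := by
  have e : ∀ i j, ((jac ψ z)ᵀ * A * jac ψ z) i j = mform A
      (fderiv ℝ ψ z (single i 1)) (fderiv ℝ ψ z (single j 1)) := by
    intro i j
    rw [mform_apply, Matrix.mul_apply]
    simp only [Matrix.mul_apply, Matrix.transpose_apply, sum_mul]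
    rw [sum_comm]
    refine sum_congr rfl fun k _ => sum_congr rfl fun l _ => ?_
    change pd i ψ z k * A k l * pd j ψ z l = A k l * (pd i ψ z k * pd j ψ z l)
    ring
  rw [mform_apply, clm_apply_eq_sum (fderiv ℝ ψ z) v, clm_apply_eq_sum (fderiv ℝ ψ z) w]
  simp only [map_sum, map_smul, _root_.sum_apply, _root_.smul_apply, smul_eq_mul, e, mul_sum]
  rw [sum_comm]
  exact sum_congr rfl fun i _ => sum_congr rfl fun j _ => by ring

/-- The Christoffel symbols of the first kind. -/
def chr (D : Eu n →L[ℝ] Eu n →L[ℝ] Eu n →L[ℝ] ℝ) (u v w : Eu n) : ℝ :=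
  1 / 2 * (D u v w + D v u w - D w u v)

lemma differentiableAt_mform {A : Eu n → Mat n}
    (hA : ∀ i j, DifferentiableAt ℝ (fun x => A x i j) z) :
    DifferentiableAt ℝ (fun x => mform (A x)) z := differentiableAt_matSum _ hA

lemma pd_entry {A : Eu n → Mat n} (hA : ∀ i j, DifferentiableAt ℝ (fun x => A x i j) z)
    (l i j : Fin n) : pd l (fun x => A x i j) z = fderiv ℝ (fun x => mform (A x)) z (single l 1)
      (single i 1) (single j 1) := by
  have h1 := (((differentiableAt_mform hA).hasFDerivAt.clm_apply
    (hasFDerivAt_const (single i (1 : ℝ)) z)).clm_apply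
    (hasFDerivAt_const (single j (1 : ℝ)) z)).fderiv
  have h2 := DFunLike.congr_fun h1 (single l (1 : ℝ))
  simp only [mform_single] at h2
  refine h2.trans ?_
  simp

/-- The vector with components `Γ^k_{ij}`. -/
def chrVec (G : Eu n → Mat n) (i j : Fin n) (z : Eu n) : Eu n :=
  toLp 2 fun k => christoffel G k i j z

lemma mform_chrVec (hG : ∀ i j, DifferentiableAt ℝ (fun x => G x i j) z)
    (hs : ∀ i j, G z i j = G z j i) (h0 : (G z).det ≠ 0) (i j : Fin n) (w : Eu n) :
    mform (G z) (chrVec G i j z) w = chr (fderiv ℝ (fun x => mform (G x)) z)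
      (single i 1) (single j 1) w := by
  have hinv := mul_nonsing_inv (G z) (isUnit_iff_ne_zero.2 h0)
  have key : ∀ l, mform (G z) (chrVec G i j z) (single l 1) =
      chr (fderiv ℝ (fun x => mform (G x)) z) (single i 1) (single j 1) (single l 1) := by
    intro l
    rw [mform_apply, chr, ← pd_entry hG, ← pd_entry hG, ← pd_entry hG]
    set X : Fin n → ℝ := fun m => pd i (fun z => G z j m) z + pd j (fun z => G z i m) z -
      pd m (fun z => G z i j) z with hX
    have e1 : ∀ k, chrVec G i j z k = 1 / 2 * ∑ m, (G z)⁻¹ k m * X m := fun k => rfl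
    have e2 : ∀ k, ∑ m, G z k m * (chrVec G i j z k * (single l (1 : ℝ) : Eu n) m) =
        1 / 2 * ∑ m, G z l k * (G z)⁻¹ k m * X m := fun k => by
      simp only [PiLp.single_apply, mul_ite, mul_one, mul_zero, Finset.sum_ite_eq',
        Finset.mem_univ, if_true, e1, hs k l, mul_sum]
      exact sum_congr rfl fun m _ => by ring
    simp only [e2]
    rw [← mul_sum, sum_comm]
    have e3 : ∀ m, ∑ k, G z l k * (G z)⁻¹ k m * X m = (if l = m then 1 else 0) * X m := fun m => by
      rw [← sum_mul, ← Matrix.mul_apply, hinv, Matrix.one_apply]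
    rw [sum_congr rfl fun m _ => e3 m]
    simp only [ite_mul, one_mul, zero_mul, Finset.sum_ite_eq, Finset.mem_univ, if_true]
    rfl
  rw [clm_apply_eq_sum _ w]
  simp only [key, chr, smul_eq_mul]
  conv_rhs => rw [clm_apply_eq_sum _ w, clm_apply_eq_sum _ w,
    clm_apply_eq_sum (fderiv ℝ (fun x => mform (G x)) z) w]
  simp only [_root_.sum_apply, _root_.smul_apply, smul_eq_mul]
  rw [← sum_add_distrib, ← sum_sub_distrib, mul_sum]
  exact sum_congr rfl fun m _ => by ring

lemma fderiv_chrVec (h : Transition U G G' ψ) (hs : ∀ x i j, G x i j = G x j i) (hz : z ∈ U)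
    (i j : Fin n) : fderiv ℝ ψ z (chrVec G i j z) = fderiv ℝ (fderiv ℝ ψ) z (single i 1)
      (single j 1) + ∑ k, ∑ l, (jac ψ z k i * jac ψ z l j) • chrVec G' k l (ψ z) := by
  have dG : ∀ i j, DifferentiableAt ℝ (fun x => G x i j) z := fun i j =>
    (h.contDiffAt_metric hz i j).differentiableAt (by simp)
  have dG' : ∀ i j, DifferentiableAt ℝ (fun x => G' x i j) (ψ z) := fun i j =>
    (h.smooth' z hz i j).differentiableAt (by simp)
  have dψ : DifferentiableAt ℝ ψ z := (h.smooth z hz).differentiableAt (by simp)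
  have d2 : DifferentiableAt ℝ (fderiv ℝ ψ) z := ((h.smooth z hz).fderiv_right (m := 1)
      (by rw [one_add_one_eq_two]; exact ENat.LEInfty.out)).differentiableAt one_ne_zero
  set S := fderiv ℝ (fderiv ℝ ψ) z with hS
  set J := fderiv ℝ ψ z with hJ
  set D := fderiv ℝ (fun x => mform (G x)) z with hD
  set D' := fderiv ℝ (fun x => mform (G' x)) (ψ z) with hD'
  have hSs : ∀ u v, S u v = S v u := ((h.smooth z hz).isSymmSndFDerivAt
    (by simp [ENat.LEInfty.out])).eq
  have hD2 : ∀ u v w, D u v w = D' (J u) (J v) (J w) + mform (G' (ψ z)) (S u v) (J w) +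
      mform (G' (ψ z)) (J v) (S u w) := by
    intro u v w
    have e1 : (fun x => mform (G x) v w) =ᶠ[𝓝 z]
        fun x => mform (G' (ψ x)) (fderiv ℝ ψ x v) (fderiv ℝ ψ x w) := by
      filter_upwards [h.isOpen.mem_nhds hz] with x hx
      rw [h.metric x hx, mform_pullback]
    have a1 := (((differentiableAt_mform dG).hasFDerivAt.clm_apply
      (hasFDerivAt_const v z)).clm_apply (hasFDerivAt_const w z))
    have a2 := HasFDerivAt.comp (g := fun x => mform (G' x)) z
      (differentiableAt_mform dG').hasFDerivAt dψ.hasFDerivAt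
    have a3 := (a2.clm_apply (d2.hasFDerivAt.clm_apply (hasFDerivAt_const v z))).clm_apply
      (d2.hasFDerivAt.clm_apply (hasFDerivAt_const w z))
    have a4 := DFunLike.congr_fun (a1.unique (a3.congr_of_eventuallyEq e1)) u
    simp only [_root_.add_apply, comp_apply, ContinuousLinearMap.flip_apply,
      ContinuousLinearMap.comp_zero, zero_add, _root_.zero_apply, map_zero, add_zero,
      Function.comp_apply] at a4
    rw [hD, a4]
    ring
  have hJs : ∀ i : Fin n, J (single i 1) =
      ∑ k, jac ψ z k i • single k (1 : ℝ) := fderiv_single_eq_sum ψ z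
  have hJinj : ∀ v : Eu n, (∀ l : Fin n, mform (G' (ψ z)) v (J (single l 1)) = 0) → v = 0 := by
    intro v hv
    have h1 : (fun k => v k) ᵥ* (G' (ψ z) * jac ψ z) = 0 := by
      ext l
      have := hv l
      rw [mform_apply] at this
      rw [Pi.zero_apply, ← this, Matrix.vecMul, dotProduct]
      refine sum_congr rfl fun k _ => ?_
      rw [Matrix.mul_apply, mul_sum]
      refine sum_congr rfl fun m _ => ?_
      change v k * (G' (ψ z) k m * pd l ψ z m) = G' (ψ z) k m * (v k * pd l ψ z m)
      ring
    have h2 : (G' (ψ z) * jac ψ z).det ≠ 0 := by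
      rw [Matrix.det_mul]
      exact mul_ne_zero (h.pos' z hz).ne' (h.det_ne z hz)
    have h3 := Matrix.eq_zero_of_vecMul_eq_zero h2 h1
    ext k
    exact congrFun h3 k
  rw [← sub_eq_zero]
  refine hJinj _ fun l => ?_
  have e1 : mform (G' (ψ z)) (J (chrVec G i j z)) (J (single l 1)) = chr D (single i 1) (single j 1)
        (single l 1) := by
    rw [← mform_pullback, ← h.metric z hz, mform_chrVec dG (hs z) (h.det_pos hz).ne']
  have e2 : ∀ w, ∑ k, ∑ l, (jac ψ z k i * jac ψ z l j) • mform (G' (ψ z)) (chrVec G' k l (ψ z)) w =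
      chr D' (J (single i 1)) (J (single j 1)) w := by
    intro w
    simp only [mform_chrVec dG' (h.symm' _) (h.pos' z hz).ne', hJs, chr, map_sum, map_smul,
      _root_.sum_apply, _root_.smul_apply, smul_eq_mul, mul_sum]
    have c : ∀ f : Fin n → Fin n → ℝ, ∑ k, ∑ l, jac ψ z k j * (jac ψ z l i * f l k) =
        ∑ l, ∑ k, jac ψ z k j * (jac ψ z l i * f l k) := fun f => sum_comm
    rw [c fun l k => D' (single l 1) (single k 1) w, c fun l k => D' w (single l 1) (single k 1),
      ← sum_add_distrib, ← sum_sub_distrib, mul_sum]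
    refine sum_congr rfl fun k _ => ?_
    rw [← sum_add_distrib, ← sum_sub_distrib, mul_sum]
    exact sum_congr rfl fun m _ => by ring
  have e3 := e2 (J (single l 1))
  simp only [map_sub, map_add, map_sum, map_smul, _root_.sub_apply, _root_.add_apply,
    _root_.sum_apply, _root_.smul_apply, e1, e3]
  simp only [chr, hD2]
  rw [hSs (single j 1) (single i 1), hSs (single l 1) (single i 1), hSs (single l 1) (single j 1),
    mform_symm (h.symm' _) (J (single j 1)), mform_symm (h.symm' _) (J (single i 1)) (S _ _)]
  ring

lemma hessCoord_eq (h : Transition U G G' ψ) (hs : ∀ x i j, G x i j = G x j i)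
    (hF : ∀ x ∈ U, F x = F' (ψ x)) (hz : z ∈ U) (hF' : ContDiffAt ℝ ∞ F' (ψ z)) (i j : Fin n) :
    hessCoord G F i j z = ∑ k, jac ψ z k i • ∑ l, jac ψ z l j • hessCoord G' F' k l (ψ z) := by
  have dF' : DifferentiableAt ℝ F' (ψ z) := hF'.differentiableAt (by simp)
  have hψ := h.smooth z hz
  have dψ : DifferentiableAt ℝ ψ z := hψ.differentiableAt (by simp)
  have hFe : F =ᶠ[𝓝 z] F' ∘ ψ := by
    filter_upwards [h.isOpen.mem_nhds hz] with x hx using hF x hx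
  have d2 : DifferentiableAt ℝ (fderiv ℝ ψ) z := (hψ.fderiv_right (m := 1)
      (by rw [one_add_one_eq_two]; exact ENat.LEInfty.out)).differentiableAt one_ne_zero
  have d2' : DifferentiableAt ℝ (fderiv ℝ F') (ψ z) := (hF'.fderiv_right (m := 1)
      (by rw [one_add_one_eq_two]; exact ENat.LEInfty.out)).differentiableAt one_ne_zero
  have e0 : ∀ {X : Eu n → Eu L} {x : Eu n},
      DifferentiableAt ℝ (fderiv ℝ X) x → ∀ k l : Fin n, pd k (pd l X) x =
      fderiv ℝ (fderiv ℝ X) x (single k 1) (single l 1) := by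
    intro X x hX k l
    have a := DFunLike.congr_fun (hX.hasFDerivAt.clm_apply
      (hasFDerivAt_const (single l (1 : ℝ)) x)).fderiv (single k (1 : ℝ))
    refine a.trans ?_
    simp
  have hchr : ∀ (G : Eu n → Mat n) (X : Eu n → Eu L)
      (x : Eu n) (k l : Fin n), ∑ m, christoffel G m k l x • pd m X x =
        fderiv ℝ X x (chrVec G k l x) := fun G X x k l => by
    rw [clm_apply_eq_sum]; rfl
  have hfd : fderiv ℝ F =ᶠ[𝓝 z] fun x => (fderiv ℝ F' (ψ x)).comp (fderiv ℝ ψ x) := by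
    have h1 : ∀ᶠ x in 𝓝 z, DifferentiableAt ℝ F' (ψ x) := by
      have : ∀ᶠ x in 𝓝 (ψ z), DifferentiableAt ℝ F' x :=
        ((hF'.of_le (m := 1) (by simp)).eventually (by simp)).mono fun x hx =>
          hx.differentiableAt one_ne_zero
      exact dψ.continuousAt this
    filter_upwards [h.isOpen.mem_nhds hz, h1, hFe.eventuallyEq_nhds] with x hx hx1 hx2
    rw [hx2.fderiv_eq, fderiv_comp x hx1 ((h.smooth x hx).differentiableAt (by simp))]
  have hfd2 : HasFDerivAt (fun x => (fderiv ℝ F' (ψ x)).comp (fderiv ℝ ψ x)) _ z :=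
    (d2'.hasFDerivAt.comp z dψ.hasFDerivAt).clm_comp d2.hasFDerivAt
  have dF2 : DifferentiableAt ℝ (fderiv ℝ F) z := hfd2.differentiableAt.congr_of_eventuallyEq hfd
  have e2 : fderiv ℝ (fderiv ℝ F) z (single i 1) (single j 1) =
      fderiv ℝ (fderiv ℝ F') (ψ z) (fderiv ℝ ψ z (single i 1)) (fderiv ℝ ψ z (single j 1)) +
      fderiv ℝ F' (ψ z) (fderiv ℝ (fderiv ℝ ψ) z (single i 1) (single j 1)) := by
    rw [hfd.fderiv_eq, hfd2.fderiv]
    simp [add_comm]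
  have e3 : fderiv ℝ F z = (fderiv ℝ F' (ψ z)).comp (fderiv ℝ ψ z) := hfd.self_of_nhds
  rw [hessCoord, hchr, e0 dF2, e2, e3, comp_apply, h.fderiv_chrVec hs hz]
  simp only [hessCoord, hchr, e0 d2', fderiv_single_eq_sum ψ z, map_add, map_sum, map_smul,
    _root_.sum_apply, _root_.smul_apply, smul_sum, smul_sub, smul_smul, sum_sub_distrib]
  rw [sum_comm, add_comm, add_sub_add_left_eq_sub]
  congr 1
  exact sum_congr rfl fun k _ => sum_congr rfl fun l _ => by rw [mul_comm]

lemma hessSqCoord_eq (h : Transition U G G' ψ) (hs : ∀ x i j, G x i j = G x j i)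
    (hF : ∀ x ∈ U, F x = F' (ψ x)) (hz : z ∈ U) (hF' : ContDiffAt ℝ ∞ F' (ψ z)) :
    hessSqCoord G F z = hessSqCoord G' F' (ψ z) := by
  have hH := h.hessCoord_eq hs hF hz hF'
  have hJ := h.jac_mul_inv hz
  have e : ∀ (G : Eu n → Mat n) (X : Eu n → Eu L) (x : Eu n),
      hessSqCoord G X x = ∑ i, ∑ k, (G x)⁻¹ i k * ∑ j, ∑ l, (G x)⁻¹ j l *
        inner ℝ (hessCoord G X i j x) (hessCoord G X k l x) := by
    intro G X x
    rw [hessSqCoord]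
    refine sum_congr rfl fun i _ => ?_
    rw [sum_comm]
    refine sum_congr rfl fun k _ => ?_
    simp only [mul_sum, mul_assoc]
  rw [e, e]
  have e1 : ∀ i k, ∑ j, ∑ l, (G z)⁻¹ j l * inner ℝ (hessCoord G F i j z) (hessCoord G F k l z) =
      ∑ b, ∑ d, (G' (ψ z))⁻¹ b d * inner ℝ (∑ a, jac ψ z a i • hessCoord G' F' a b (ψ z))
        (∑ c, jac ψ z c k • hessCoord G' F' c d (ψ z)) := fun i k => by
    refine sum_bilin_transition (innerSL ℝ) hJ (v := fun j => hessCoord G F i j z)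
      (w := fun j => hessCoord G F k j z)
      (v' := fun b => ∑ a, jac ψ z a i • hessCoord G' F' a b (ψ z))
      (w' := fun b => ∑ a, jac ψ z a k • hessCoord G' F' a b (ψ z)) (fun j => ?_) fun j => ?_
    all_goals
      simp only [hH, smul_sum]
      rw [sum_comm]
      exact sum_congr rfl fun b _ => sum_congr rfl fun a _ => smul_comm _ _ _
  have e2 : ∀ b d, ∑ i, ∑ k, (G z)⁻¹ i k * inner ℝ (∑ a, jac ψ z a i • hessCoord G' F' a b (ψ z))
        (∑ c, jac ψ z c k • hessCoord G' F' c d (ψ z)) = ∑ a, ∑ c, (G' (ψ z))⁻¹ a c *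
        inner ℝ (hessCoord G' F' a b (ψ z)) (hessCoord G' F' c d (ψ z)) := fun b d =>
    sum_bilin_transition (innerSL ℝ) hJ (v := fun i => ∑ a, jac ψ z a i • hessCoord G' F' a b (ψ z))
      (w := fun i => ∑ c, jac ψ z c i • hessCoord G' F' c d (ψ z))
      (v' := fun a => hessCoord G' F' a b (ψ z)) (w' := fun c => hessCoord G' F' c d (ψ z))
      (fun i => rfl) fun i => rfl
  have swap : ∀ (P Q : Fin n → Fin n → ℝ) (f : Fin n → Fin n → Fin n → Fin n → ℝ),
      ∑ i, ∑ k, P i k * ∑ b, ∑ d, Q b d * f i k b d =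
        ∑ b, ∑ d, Q b d * ∑ i, ∑ k, P i k * f i k b d := by
    intro P Q f
    simp only [mul_sum]
    rw [sum_congr rfl fun i _ => sum_comm, sum_comm]
    refine sum_congr rfl fun b _ => ?_
    rw [sum_congr rfl fun i _ => sum_comm, sum_comm]
    exact sum_congr rfl fun d _ => sum_congr rfl fun i _ => sum_congr rfl fun k _ => by ring
  simp only [e1]
  rw [swap (fun i k => (G z)⁻¹ i k) (fun b d => (G' (ψ z))⁻¹ b d) fun i k b d =>
    inner ℝ (∑ a, jac ψ z a i • hessCoord G' F' a b (ψ z))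
      (∑ c, jac ψ z c k • hessCoord G' F' c d (ψ z))]
  simp only [e2]
  rw [swap (fun i k => (G' (ψ z))⁻¹ i k) (fun b d => (G' (ψ z))⁻¹ b d) fun a c b d =>
    inner ℝ (hessCoord G' F' a b (ψ z)) (hessCoord G' F' c d (ψ z))]

end Transition

end Invariance

/-! ### The flow in a coordinate ball -/

section CoordFlow


lemma contDiff_bump_smul {V W : Type*} [NormedAddCommGroup V] [NormedSpace ℝ V]
    [NormedAddCommGroup W] [NormedSpace ℝ W] {β : V → ℝ} {f : V → W} (hβ : ContDiff ℝ ∞ β)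
    (hf : ∀ x ∈ tsupport β, ContDiffAt ℝ ∞ f x) : ContDiff ℝ ∞ fun x => β x • f x := by
  rw [contDiff_iff_contDiffAt]
  intro x
  by_cases hx : x ∈ tsupport β
  · exact hβ.contDiffAt.smul (hf x hx)
  · have h0 : (fun x => β x • f x) =ᶠ[𝓝 x] fun _ => 0 := by
      filter_upwards [(isClosed_tsupport β).isOpen_compl.mem_nhds hx] with z hz
      rw [image_eq_zero_of_notMem_tsupport hz, zero_smul]
    exact contDiffAt_const.congr_of_eventuallyEq h0

/-- A metric on the ball of radius `2 s` which is close to the Euclidean one. -/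
structure CoordMetric (K s : ℝ) (G : Eu n → Mat n) : Prop where
  smooth : ∀ y ∈ 𝔹 (2 * s), ∀ i j, ContDiffAt ℝ ∞ (fun x => G x i j) y
  det_pos : ∀ y ∈ 𝔹 (2 * s), 0 < (G y).det
  near : ∀ y ∈ 𝔹 (2 * s), NearId (G y)⁻¹
  ge : ∀ y ∈ 𝔹 (2 * s), 1 / 2 ≤ √(G y).det
  le : ∀ y ∈ 𝔹 (2 * s), √(G y).det ≤ 2
  da : ∀ y ∈ 𝔹 s, ∀ i j k, |pd k (fun x => (G x)⁻¹ i j) y| ≤ K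
  dσ : ∀ y ∈ 𝔹 s, ∀ k, |pd k (fun x => √(G x).det) y| ≤ K
  dG : ∀ y ∈ 𝔹 s, ∀ i j k, |pd k (fun x => G x i j) y| ≤ K

/-- The coordinate form of the regularized conformal heat flow. -/
structure CoordFlow (N : Set (Eu L)) (ε a b T s : ℝ) (G : Eu n → Mat n)
    (f : ℝ → Eu n → Eu L) (u : ℝ → Eu n → ℝ) : Prop where
  smooth_f : ∀ t ∈ Ioo 0 T, ∀ y ∈ 𝔹 (2 * s), ContDiffAt ℝ ∞ (fun p : ℝ × Eu n => f p.1 p.2) (t, y)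
  smooth_u : ∀ t ∈ Ioo 0 T, ∀ y ∈ 𝔹 (2 * s), ContDiffAt ℝ ∞ (fun p : ℝ × Eu n => u p.1 p.2) (t, y)
  mem : ∀ t ∈ Ioo 0 T, ∀ y ∈ 𝔹 (2 * s), f t y ∈ N
  map_eq : ∀ t ∈ Ioo 0 T, ∀ y ∈ 𝔹 s, deriv (fun τ => f τ y) t =
    exp (-(n * u t y)) • (nLaplaceCoord ε G (f t) y +
      (ε + gradSqCoord G (f t) y) ^ ((n : ℝ) / 2 - 1) •
        ∑ i, ∑ j, (G y)⁻¹ i j • secondFF N (f t y) (pd i (f t) y) (pd j (f t) y))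
  conf_eq : ∀ t ∈ Ioo 0 T, ∀ y ∈ 𝔹 (2 * s), deriv (fun τ => u τ y) t =
    b * exp (-(n * u t y)) * (ε + gradSqCoord G (f t) y) ^ ((n : ℝ) / 2) - a
  u_ge : ∀ t ∈ Ioo 0 T, ∀ y ∈ 𝔹 (2 * s), -(a * t) ≤ u t y

lemma NearId.posSemidef (hn : n ≤ 4) {A : Mat n} (hA : NearId A) : A.PosSemidef := by
  refine Matrix.PosSemidef.of_dotProduct_mulVec_nonneg ?_ fun x => ?_
  · ext i j
    rw [Matrix.conjTranspose_apply, star_trivial, hA.symm]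
  · have h := hA.le_inner (W := ℝ) hn (toLp 2 x)
    rw [gr_inner] at h
    refine le_trans (by positivity) (h.trans_eq ?_)
    rw [dotProduct]
    refine sum_congr rfl fun i _ => ?_
    simp [Matrix.mulVec, dotProduct, mul_comm]

lemma exists_bump (n : ℕ) {s : ℝ} (hs : 0 < s) : ∃ β : Eu n → ℝ, ContDiff ℝ ∞ β ∧
    tsupport β ⊆ 𝔹 (2 * s) ∧ (∀ y ∈ 𝔹 s, β y = 1) ∧ (∀ y, 0 ≤ β y) ∧ ∀ y, β y ≤ 1 := by
  let β : ContDiffBump (0 : Eu n) := ⟨s, 3 / 2 * s, hs, by linarith⟩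
  refine ⟨β, β.contDiff, ?_, fun y hy => β.one_of_mem_closedBall (ball_subset_closedBall hy),
    fun y => β.nonneg, fun y => β.le_one⟩
  rw [β.tsupport_eq]
  exact closedBall_subset_ball (by change 3 / 2 * s < 2 * s; linarith)

lemma CoordMetric.exists_coef {K s : ℝ} (hs : 0 < s) {G : Eu n → Mat n} (h : CoordMetric K s G) :
    ∃ a σ, Coef K s a σ ∧ ∀ y ∈ 𝔹 s, a y = (G y)⁻¹ ∧ σ y = √(G y).det := by
  obtain ⟨β, hβc, hβs, hβ1, hβ0, hβ⟩ := exists_bump n hs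
  have hβz : ∀ y, y ∉ 𝔹 (2 * s) → β y = 0 := fun y hy =>
    image_eq_zero_of_notMem_tsupport fun h => hy (hβs h)
  let a : Eu n → Mat n := fun y => 1 + β y • ((G y)⁻¹ - 1)
  let σ : Eu n → ℝ := fun y => 1 + β y • (√(G y).det - 1)
  have ha : ∀ y ∈ 𝔹 s, a y = (G y)⁻¹ := fun y hy => by
    simp [a, hβ1 y hy]
  have hσ : ∀ y ∈ 𝔹 s, σ y = √(G y).det := fun y hy => by
    simp [σ, hβ1 y hy]
  have hsub : ball (0 : Eu n) s ⊆ 𝔹 (2 * s) := ball_subset_ball (by linarith)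
  refine ⟨a, σ, ⟨fun i j => ?_, ?_, fun y => ?_, fun y => ?_, fun y hy => ?_, fun y hy => ?_,
    fun y hy i j k => ?_, fun y hy k => ?_⟩, fun y hy => ⟨ha y hy, hσ y hy⟩⟩
  · refine contDiff_const.add (contDiff_bump_smul hβc fun x hx => ?_)
    exact (contDiffAt_inv (h.smooth x (hβs hx)) (h.det_pos x (hβs hx)).ne' i j).sub contDiffAt_const
  · refine contDiff_const.add (contDiff_bump_smul hβc fun x hx => ?_)
    exact ((contDiffAt_det (h.smooth x (hβs hx))).sqrt (h.det_pos x (hβs hx)).ne').sub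
      contDiffAt_const
  · by_cases hy : y ∈ 𝔹 (2 * s)
    · have hN := h.near y hy
      refine ⟨fun i j => ?_, fun i j => ?_⟩
      · simp only [a, Matrix.add_apply, Matrix.smul_apply, Matrix.sub_apply, hN.symm i j,
          Matrix.one_apply, eq_comm (a := i)]
      · have e : a y i j - (1 : Mat n) i j = β y * ((G y)⁻¹ i j - (1 : Mat n) i j) := by
          simp [a]
        rw [e, abs_mul, abs_of_nonneg (hβ0 y)]
        exact (mul_le_of_le_one_left (abs_nonneg _) (hβ y)).trans (hN.close i j)
    · have e : a y = 1 := by simp [a, hβz y hy]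
      rw [e]
      refine ⟨fun i j => ?_, fun i j => ?_⟩
      · simp only [Matrix.one_apply, eq_comm (a := i)]
      · rw [sub_self, abs_zero]; norm_num
  · by_cases hy : y ∈ 𝔹 (2 * s)
    · have h1 := h.ge y hy
      simp only [σ, smul_eq_mul]
      nlinarith [hβ0 y, hβ y]
    · simp [σ, hβz y hy]
  · rw [hσ y hy]; exact h.ge y (hsub hy)
  · rw [hσ y hy]; exact h.le y (hsub hy)
  · have e : (fun x => a x i j) =ᶠ[𝓝 y] fun x => (G x)⁻¹ i j := by
      filter_upwards [isOpen_ball.mem_nhds hy] with x hx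
      rw [ha x hx]
    rw [pd_congr e]
    exact h.da y hy i j k
  · have e : σ =ᶠ[𝓝 y] fun x => √(G x).det := by
      filter_upwards [isOpen_ball.mem_nhds hy] with x hx using hσ x hx
    rw [pd_congr e]
    exact h.dσ y hy k

/-! #### Local comparison of the extended and the original data -/

section Germ

variable {s ε t : ℝ} {G a : Eu n → Mat n} {σ : Eu n → ℝ}
  {f : Eu n → Eu L} {F : Eu n → Eu L}

lemma pd_eq_of_eqOn_ball {f F : Eu n → V}
    (hF : ∀ y ∈ 𝔹 s, F y = f y) {y : Eu n} (hy : y ∈ 𝔹 s) (i : Fin n) : pd i F y = pd i f y :=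
  pd_congr (by filter_upwards [isOpen_ball.mem_nhds hy] with x hx using hF x hx) i

lemma quad_eq_gradSqCoord (ha : ∀ y ∈ 𝔹 s, a y = (G y)⁻¹) (hF : ∀ y ∈ 𝔹 s, F y = f y) {y : Eu n}
    (hy : y ∈ 𝔹 s) : quad ε a (grad F) y = ε + gradSqCoord G f y := by
  rw [quad, gr_inner, gradSqCoord]
  congr 1
  refine sum_congr rfl fun i _ => ?_
  simp only [matAct_apply, grad_apply, inner_sum, inner_smul_right, ha y hy,
    pd_eq_of_eqOn_ball hF hy]

lemma matAct_flux_eq (hn2 : 2 ≤ n) (ha : ∀ y ∈ 𝔹 s, a y = (G y)⁻¹)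
    (hq : ∀ y, 0 ≤ quad ε a (grad F) y) (hF : ∀ y ∈ 𝔹 s, F y = f y) {x : Eu n} (hx : x ∈ 𝔹 s)
    (i : Fin n) : matAct (a x) (flux ε a F x) i = (ε + gradSqCoord G f x) ^ ((n : ℝ) / 2 - 1) •
      ∑ j, (G x)⁻¹ i j • pd j f x := by
  rw [matAct_apply, ha x hx, smul_sum]
  refine sum_congr rfl fun j _ => ?_
  have e : √(quad ε a (grad F) x) ^ (n - 2) = (ε + gradSqCoord G f x) ^ ((n : ℝ) / 2 - 1) := by
    rw [sqrt_pow_eq_rpow (hq x), quad_eq_gradSqCoord ha hF hx, Nat.cast_sub hn2]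
    congr 1
    push_cast; ring
  rw [flux, PiLp.smul_apply, grad_apply, e, pd_eq_of_eqOn_ball hF hx, smul_comm]

lemma divg_flux_eq_nLaplaceCoord (hn2 : 2 ≤ n) (ha : ∀ y ∈ 𝔹 s, a y = (G y)⁻¹)
    (hσ : ∀ y ∈ 𝔹 s, σ y = √(G y).det) (hq : ∀ y, 0 ≤ quad ε a (grad F) y)
    (hF : ∀ y ∈ 𝔹 s, F y = f y) {y : Eu n} (hy : y ∈ 𝔹 s) :
    divg σ a (flux ε a F) y = nLaplaceCoord ε G f y := by
  rw [divg, nLaplaceCoord, hσ y hy]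
  congr 1
  refine sum_congr rfl fun i _ => ?_
  refine pd_eq_of_eqOn_ball (s := s) (fun x hx => ?_) hy i
  rw [hσ x hx, matAct_flux_eq hn2 ha hq hF hx, mul_smul]

lemma CoordMetric.differentiableAt_flux (hn : n ≤ 4) (hn2 : 2 ≤ n) {K : ℝ} (hs : 0 < s) (hε : 0 ≤ ε)
    (hG : CoordMetric K s G) (hf : ∀ y ∈ 𝔹 (2 * s), ContDiffAt ℝ ∞ f y) {y : Eu n} (hy : y ∈ 𝔹 s)
    (i : Fin n) : DifferentiableAt ℝ (fun x => (ε + gradSqCoord G f x) ^ ((n : ℝ) / 2 - 1) •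
      ∑ j, (G x)⁻¹ i j • pd j f x) y := by
  obtain ⟨a, σ, hcoef, haσ⟩ := hG.exists_coef hs
  obtain ⟨β, hβc, hβs, hβ1, -⟩ := exists_bump n hs
  let F : Eu n → Eu L := fun x => β x • f x
  have hF : ContDiff ℝ ∞ F := contDiff_bump_smul hβc fun x hx => hf x (hβs hx)
  have hFf : ∀ x ∈ 𝔹 s, F x = f x := fun x hx => by
    simp only [F, hβ1 x hx, one_smul]
  have h1 : ContDiff ℝ 1 fun x => matAct (a x) (flux ε a F x) :=
    contDiff_matAct (fun i j => (hcoef.smooth_a i j).of_le (by simp)) (hcoef.contDiff_flux hn hε hF)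
  have h2 : DifferentiableAt ℝ (fun x => matAct (a x) (flux ε a F x) i) y :=
    ((contDiff_piLp 2).1 h1 i).differentiable one_ne_zero y
  refine h2.congr_of_eventuallyEq ?_
  filter_upwards [isOpen_ball.mem_nhds hy] with x hx
  exact (matAct_flux_eq hn2 (fun y hy => (haσ y hy).1)
    (fun y => NearId.quad_nonneg hn hε (hcoef.near y)) hFf hx i).symm

end Germ

lemma vel_eq_deriv {F : ℝ × Eu n → W}
    {f : ℝ → W} {t : ℝ} {y : Eu n} (hF : DifferentiableAt ℝ F (t, y))
    (h : ∀ᶠ τ in 𝓝 t, F (τ, y) = f τ) : vel F (t, y) = deriv f t := by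
  have h1 := hF.hasFDerivAt.comp_hasDerivAt t ((hasDerivAt_id t).prodMk (hasDerivAt_const t y))
  have h2 : HasDerivAt f (fderiv ℝ F (t, y) (1, 0)) t :=
    h1.congr_of_eventuallyEq (h.mono fun τ hτ => hτ.symm)
  exact h2.deriv.symm

/-- The local data extended to global ones. -/
lemma CoordFlow.exists_flow (hn : n ≤ 4) (hn2 : 2 ≤ n) {N : Set (Eu L)} (hN : IsSmoothSubmanifold N)
    {CN : ℝ} (hCN0 : 0 ≤ CN) (hCN : SecondFFBound N CN) {K s ε a b T T₀ T₁ c : ℝ} (hs : 0 < s)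
    (hε : 0 ≤ ε) (ha0 : 0 ≤ a) {G : Eu n → Mat n} {f : ℝ → Eu n → Eu L} {u : ℝ → Eu n → ℝ}
    (hG : CoordMetric K s G) (h : CoordFlow N ε a b T s G f u) (hT₀ : 0 < T₀) (hT : T₀ < T₁)
    (hT₁ : T₁ < T) (hc : c ≤ exp (-(n * (a * T₁)))) :
    ∃ a' σ F m, Flow K s ε CN (n * a) (n * b) c T₀ T₁ a' σ F m ∧
      ∀ y ∈ 𝔹 s, a' y = (G y)⁻¹ ∧ σ y = √(G y).det ∧
        ∀ t ∈ Ioo T₀ T₁, F (t, y) = f t y ∧ m (t, y) = exp (n * u t y) := by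
  obtain ⟨a', σ, hcoef, haσ⟩ := hG.exists_coef hs
  have ha' : ∀ y ∈ 𝔹 s, a' y = (G y)⁻¹ := fun y hy => (haσ y hy).1
  have hσ' : ∀ y ∈ 𝔹 s, σ y = √(G y).det := fun y hy => (haσ y hy).2
  obtain ⟨δ, hδ0, hδ⟩ := exists_between (lt_min hT₀ (sub_pos.2 hT₁))
  obtain ⟨hδ1, hδ2⟩ := lt_min_iff.1 hδ
  let χ : ContDiffBump ((T₀ + T₁) / 2) :=
    ⟨(T₁ - T₀) / 2, (T₁ - T₀) / 2 + δ, by linarith, by linarith⟩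
  obtain ⟨β, hβc, hβs, hβ1, -⟩ := exists_bump n hs
  let η : ℝ × Eu n → ℝ := fun p => χ p.1 * β p.2
  have hη : ContDiff ℝ ∞ η := (χ.contDiff.comp contDiff_fst).mul (hβc.comp contDiff_snd)
  have hηs : tsupport η ⊆ Ioo 0 T ×ˢ 𝔹 (2 * s) := by
    have h1 : tsupport η ⊆ closedBall ((T₀ + T₁) / 2) ((T₁ - T₀) / 2 + δ) ×ˢ tsupport β := by
      refine closure_minimal (fun p hp => ?_) (isClosed_closedBall.prod
        (isClosed_tsupport β))
      have hp' : χ p.1 * β p.2 ≠ 0 := hp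
      refine ⟨?_, ?_⟩
      · by_contra hcon
        refine hp' ?_
        rw [χ.zero_of_le_dist (le_of_lt (by simpa using hcon)), zero_mul]
      · exact subset_tsupport _ (right_ne_zero_of_mul hp')
    refine h1.trans (prod_mono ?_ hβs)
    rw [Real.closedBall_eq_Icc]
    intro x hx
    constructor
    · have := hx.1; linarith
    · have := hx.2; linarith
  have hη1 : ∀ t ∈ Ioo T₀ T₁, ∀ y ∈ 𝔹 s, η (t, y) = 1 := by
    intro t ht y hy
    have h1 : χ t = 1 := by
      refine χ.one_of_mem_closedBall ?_
      rw [Real.closedBall_eq_Icc]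
      change t ∈ Icc ((T₀ + T₁) / 2 - (T₁ - T₀) / 2) ((T₀ + T₁) / 2 + (T₁ - T₀) / 2)
      constructor
      · linarith [ht.1]
      · linarith [ht.2]
    change χ t * β y = 1
    rw [h1, hβ1 y hy, one_mul]
  let F : ℝ × Eu n → Eu L := fun p => η p • f p.1 p.2
  let m : ℝ × Eu n → ℝ := fun p => exp (n * (η p • u p.1 p.2))
  have hFs : ContDiff ℝ ∞ F := contDiff_bump_smul hη fun p hp =>
    h.smooth_f p.1 (hηs hp).1 p.2 (hηs hp).2
  have hms : ContDiff ℝ ∞ m := Real.contDiff_exp.comp (contDiff_const.mul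
    (contDiff_bump_smul hη fun p hp => h.smooth_u p.1 (hηs hp).1 p.2 (hηs hp).2))
  have hFf : ∀ t ∈ Ioo T₀ T₁, ∀ y ∈ 𝔹 s, F (t, y) = f t y :=
    fun t ht y hy => by simp only [F, hη1 t ht y hy, one_smul]
  have hmu : ∀ t ∈ Ioo T₀ T₁, ∀ y ∈ 𝔹 s, m (t, y) = exp (n * u t y) := fun t ht y hy => by
    simp only [m, hη1 t ht y hy, one_smul]
  have hsub : ball (0 : Eu n) s ⊆ 𝔹 (2 * s) := ball_subset_ball (by linarith)
  have htT : ∀ t ∈ Ioo T₀ T₁, t ∈ Ioo 0 T := fun t ht => ⟨hT₀.trans ht.1, ht.2.trans hT₁⟩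
  have hw : ∀ t ∈ Ioo T₀ T₁, ∀ y ∈ 𝔹 s,
      dens ε a' F (t, y) = ε + gradSqCoord G (f t) y := fun t ht y hy => by
    rw [← quad_slice hFs, quad_eq_gradSqCoord ha' (hFf t ht) hy]
  have hw0 : ∀ p, 0 ≤ dens ε a' F p := hcoef.dens_nonneg hn hε F
  have hvel : ∀ t ∈ Ioo T₀ T₁, ∀ y ∈ 𝔹 s,
      vel F (t, y) = deriv (fun τ => f τ y) t := fun t ht y hy =>
    vel_eq_deriv (hFs.differentiable (by simp) _) (by
      filter_upwards [isOpen_Ioo.mem_nhds ht] with τ hτ using hFf τ hτ y hy)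
  have hpow : ∀ p, √(dens ε a' F p) ^ (n - 2) = dens ε a' F p ^ ((n : ℝ) / 2 - 1) := fun p => by
    rw [sqrt_pow_eq_rpow (hw0 p), Nat.cast_sub hn2]
    congr 1
    push_cast; ring
  let B : ℝ → Eu n → Eu L := fun t y =>
    ∑ i, ∑ j, (G y)⁻¹ i j • secondFF N (f t y) (pd i (f t) y) (pd j (f t) y)
  have hres : ∀ t ∈ Ioo T₀ T₁, ∀ y ∈ 𝔹 s,
      resid ε a' σ F m (t, y) = √(dens ε a' F (t, y)) ^ (n - 2) • B t y := by
    intro t ht y hy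
    have e1 : divx σ a' (fluxx ε a' F) (t, y) = nLaplaceCoord ε G (f t) y := by
      rw [← hcoef.divg_slice hn hε hFs]
      refine divg_flux_eq_nLaplaceCoord hn2 ha' hσ' (fun x => ?_) (hFf t ht) hy
      rw [quad_slice hFs]
      exact hw0 _
    rw [resid, e1, hvel t ht y hy, h.map_eq t (htT t ht) y hy, hmu t ht y hy, smul_smul,
      ← Real.exp_add, add_neg_cancel, Real.exp_zero, one_smul, add_sub_cancel_left, hpow,
      hw t ht y hy]
  have hnear : ∀ t ∈ Ioo T₀ T₁, ∀ y ∈ 𝔹 s,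
      ∀ᶠ q in 𝓝 (t, y), q ∈ Ioo T₀ T₁ ×ˢ ball (0 : Eu n) s := fun t ht y hy =>
    (isOpen_Ioo.prod isOpen_ball).mem_nhds ⟨ht, hy⟩
  have hFN : ∀ t ∈ Ioo T₀ T₁, ∀ y ∈ 𝔹 s, ∀ᶠ q in 𝓝 (t, y), F q ∈ N := by
    intro t ht y hy
    filter_upwards [hnear t ht y hy] with q hq
    rw [show F q = f q.1 q.2 from hFf q.1 hq.1 q.2 hq.2]
    exact h.mem _ (htT _ hq.1) _ (hsub hq.2)
  have hFd : ∀ p, HasFDerivAt F (fderiv ℝ F p) p := fun p =>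
    (hFs.differentiable (by simp) p).hasFDerivAt
  have hVd : ∀ p, HasFDerivAt (vel F) (fderiv ℝ (vel F) p) p := fun p =>
    ((contDiff_vel hFs).differentiable (by simp) p).hasFDerivAt
  have hvT : ∀ t ∈ Ioo T₀ T₁, ∀ y ∈ 𝔹 s, vel F (t, y) ∈ tangentSub N (F (t, y)) := fun t ht y hy =>
    fderiv_mem_tangentSub (hFd _) (hFN t ht y hy) _
  have hpT : ∀ t ∈ Ioo T₀ T₁, ∀ y ∈ 𝔹 s, ∀ i : Fin n, pd i (f t) y ∈ tangentSub N (f t y) := by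
    intro t ht y hy i
    have e : pd i (f t) y = fderiv ℝ F (t, y) (0, single i 1) := by
      rw [← pd_slice (hFs.differentiable (by simp) _), pd_eq_of_eqOn_ball (hFf t ht) hy]
    rw [e, ← hFf t ht y hy]
    exact fderiv_mem_tangentSub (hFd _) (hFN t ht y hy) _
  have hmN : ∀ t ∈ Ioo T₀ T₁, ∀ y ∈ 𝔹 s, f t y ∈ N := fun t ht y hy =>
    h.mem _ (htT _ ht) _ (hsub hy)
  have hnorm : ∀ t ∈ Ioo T₀ T₁, ∀ y ∈ 𝔹 s,
      ‖resid ε a' σ F m (t, y)‖ ≤ CN * √(dens ε a' F (t, y)) ^ n := by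
    intro t ht y hy
    have e1 : ‖B t y‖ ≤ CN * gradSqCoord G (f t) y :=
      norm_sum_secondFF_le hCN ((hG.near y (hsub hy)).posSemidef hn) (hmN t ht y hy) (hpT t ht y hy)
    have e2 : gradSqCoord G (f t) y ≤ √(dens ε a' F (t, y)) ^ 2 := by
      rw [sq_sqrt (hw0 _), hw t ht y hy]; linarith
    rw [hres t ht y hy, norm_smul, norm_of_nonneg (by positivity)]
    calc √(dens ε a' F (t, y)) ^ (n - 2) * ‖B t y‖
        ≤ √(dens ε a' F (t, y)) ^ (n - 2) * (CN * √(dens ε a' F (t, y)) ^ 2) := by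
          gcongr
          exact e1.trans (mul_le_mul_of_nonneg_left e2 hCN0)
      _ = CN * (√(dens ε a' F (t, y)) ^ (n - 2) * √(dens ε a' F (t, y)) ^ 2) := by ring
      _ = _ := by rw [← pow_add, Nat.sub_add_cancel hn2]
  have hB0 : ∀ t ∈ Ioo T₀ T₁, ∀ y ∈ 𝔹 s,
      tangentProj N (F (t, y)) (resid ε a' σ F m (t, y)) = 0 := by
    intro t ht y hy
    rw [hres t ht y hy, hFf t ht y hy]
    simp only [B, map_smul, map_sum]
    rw [sum_eq_zero fun i _ => sum_eq_zero fun j _ => ?_, smul_zero]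
    rw [tangentProj_secondFF hN (hmN t ht y hy) (hpT t ht y hy i) (hpT t ht y hy j), smul_zero]
  refine ⟨a', σ, F, m, ⟨hcoef, hε, hFs, hms, ?_, hnorm, ?_, ?_, ?_⟩, fun y hy =>
    ⟨ha' y hy, hσ' y hy, fun t ht => ⟨hFf t ht y hy, hmu t ht y hy⟩⟩⟩
  · intro t ht y hy
    have h0 := hB0 t ht y hy
    rw [tangentProj, Submodule.starProjection_apply_eq_zero_iff] at h0
    exact (Submodule.mem_orthogonal' _ _).1 h0 _ (hvT t ht y hy)
  · intro t ht y hy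
    have h1 := neg_inner_fderiv_le hN hCN (hFd (t, y)) (hVd (t, y)) (hFN t ht y hy)
      (by filter_upwards [hnear t ht y hy] with q hq using hvT q.1 hq.1 q.2 hq.2) (1, 0)
      (hB0 t ht y hy)
    refine h1.trans ?_
    have h2 := hnorm t ht y hy
    change ‖resid ε a' σ F m (t, y)‖ * (CN * ‖vel F (t, y)‖ * ‖vel F (t, y)‖) ≤ _
    calc _ ≤ CN * √(dens ε a' F (t, y)) ^ n * (CN * ‖vel F (t, y)‖ * ‖vel F (t, y)‖) := by
          gcongr
      _ = _ := by ring
  · intro t ht y hy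
    have dm : DifferentiableAt ℝ m (t, y) := hms.differentiable (by simp) _
    have du : HasDerivAt (fun τ => u τ y) (deriv (fun τ => u τ y) t) t := by
      have a1 := (h.smooth_u t (htT t ht) y (hsub hy)).differentiableAt (by simp)
      have a2 := a1.hasFDerivAt.comp_hasDerivAt t ((hasDerivAt_id t).prodMk (hasDerivAt_const t y))
      have a3 : HasDerivAt (fun τ => u τ y) _ t := a2
      exact a3.differentiableAt.hasDerivAt
    rw [vel_eq_deriv dm (by
      filter_upwards [isOpen_Ioo.mem_nhds ht] with τ hτ using hmu τ hτ y hy),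
      (du.const_mul (n : ℝ)).exp.deriv, h.conf_eq t (htT t ht) y (hsub hy), hmu t ht y hy,
      sqrt_pow_eq_rpow (hw0 _), hw t ht y hy]
    have : exp (n * u t y) * exp (-(n * u t y)) = 1 := by
      rw [← Real.exp_add, add_neg_cancel, Real.exp_zero]
    linear_combination (n * b * (ε + gradSqCoord G (f t) y) ^ ((n : ℝ) / 2)) * this
  · intro t ht y hy
    rw [hmu t ht y hy]
    refine hc.trans (Real.exp_le_exp.2 ?_)
    have h1 := h.u_ge t (htT t ht) y (hsub hy)
    have h2 : a * t ≤ a * T₁ := mul_le_mul_of_nonneg_left ht.2.le ha0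
    have h3 : (0 : ℝ) ≤ n := Nat.cast_nonneg n
    nlinarith

end CoordFlow

section CoordRegularity


lemma sum_sq_le_four (hn : n ≤ 4) (v : Fin n → ℝ) : (∑ i, v i) ^ 2 ≤ 4 * ∑ i, v i ^ 2 := by
  have h := sq_sum_le_card_mul_sum_sq (s := (Finset.univ : Finset (Fin n))) (f := v)
  have h4 : ((Finset.univ : Finset (Fin n)).card : ℝ) ≤ 4 := by
    rw [Finset.card_univ, Fintype.card_fin]; exact_mod_cast hn
  exact h.trans (mul_le_mul_of_nonneg_right h4 (sum_nonneg fun i _ => sq_nonneg _))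

lemma sum_le_four (hn : n ≤ 4) {v : Fin n → ℝ} {c : ℝ} (hc : 0 ≤ c) (hv : ∀ i, v i ≤ c) :
    ∑ i, v i ≤ 4 * c := by
  have h := Finset.sum_le_card_nsmul Finset.univ v c fun i _ => hv i
  rw [Finset.card_univ, Fintype.card_fin, nsmul_eq_mul] at h
  have h4 : (n : ℝ) ≤ 4 := by exact_mod_cast hn
  exact h.trans (mul_le_mul_of_nonneg_right h4 hc)

lemma hessSqCoord_le (hn : n ≤ 4) {K : ℝ} (hK : 0 ≤ K) {G : Eu n → Mat n} {y : Eu n}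
    (hinv : ∀ i j, |(G y)⁻¹ i j| ≤ 2) (hG : ∀ i j k, |pd k (fun x => G x i j) y| ≤ K)
    (f : Eu n → Eu L) : hessSqCoord G f y ≤ 128 * ∑ i, ∑ j, ‖pd i (pd j f) y‖ ^ 2 +
      1179648 * K ^ 2 * ∑ k, ‖pd k f y‖ ^ 2 := by
  obtain ⟨g, hg⟩ : ∃ g, g = ∑ k, ‖pd k f y‖ ^ 2 := ⟨_, rfl⟩
  have hg0 : 0 ≤ g := hg ▸ sum_nonneg fun k _ => sq_nonneg _
  rw [← hg]
  have hΓ : ∀ k i j, |christoffel G k i j y| ≤ 12 * K := by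
    intro k i j
    rw [christoffel, abs_mul, abs_of_nonneg (by norm_num : (0 : ℝ) ≤ 1 / 2)]
    have h1 : ∀ l, |(G y)⁻¹ k l * (pd i (fun z => G z j l) y + pd j (fun z => G z i l) y -
        pd l (fun z => G z i j) y)| ≤ 2 * (3 * K) := by
      intro l
      rw [abs_mul]
      refine mul_le_mul (hinv k l) ?_ (abs_nonneg _) (by norm_num)
      have a1 := abs_le.1 (hG j l i)
      have a2 := abs_le.1 (hG i l j)
      have a3 := abs_le.1 (hG i j l)
      rw [abs_le]
      constructor <;> linarith [a1.1, a1.2, a2.1, a2.2, a3.1, a3.2]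
    have h2 := (Finset.abs_sum_le_sum_abs _ Finset.univ).trans (sum_le_four hn (by positivity) h1)
    linarith
  have hH : ∀ i j, ‖hessCoord G f i j y‖ ^ 2 ≤ 2 * ‖pd i (pd j f) y‖ ^ 2 + 1152 * K ^ 2 * g := by
    intro i j
    have h1 : ‖∑ k, christoffel G k i j y • pd k f y‖ ≤ 12 * K * ∑ k, ‖pd k f y‖ := by
      rw [mul_sum]
      refine (norm_sum_le _ _).trans (sum_le_sum fun k _ => ?_)
      rw [norm_smul, norm_eq_abs]
      exact mul_le_mul_of_nonneg_right (hΓ k i j) (norm_nonneg _)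
    have h2 := sum_sq_le_four hn fun k => ‖pd k f y‖
    rw [← hg] at h2
    have h3 : ‖hessCoord G f i j y‖ ≤ ‖pd i (pd j f) y‖ + 12 * K * ∑ k, ‖pd k f y‖ :=
      (norm_sub_le _ _).trans (by linarith)
    have h4 : ‖hessCoord G f i j y‖ ^ 2 ≤ (‖pd i (pd j f) y‖ + 12 * K * ∑ k, ‖pd k f y‖) ^ 2 :=
      pow_le_pow_left₀ (norm_nonneg _) h3 2
    have h5 : (12 * K) ^ 2 * (∑ k, ‖pd k f y‖) ^ 2 ≤ (12 * K) ^ 2 * (4 * g) :=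
      mul_le_mul_of_nonneg_left h2 (by positivity)
    nlinarith [sq_nonneg (‖pd i (pd j f) y‖ - 12 * K * ∑ k, ‖pd k f y‖)]
  have h1 : hessSqCoord G f y ≤ 4 * (∑ i, ∑ j, ‖hessCoord G f i j y‖) ^ 2 := by
    have e : 4 * (∑ i, ∑ j, ‖hessCoord G f i j y‖) ^ 2 =
        ∑ i, ∑ j, ∑ k, ∑ l, 4 * (‖hessCoord G f i j y‖ * ‖hessCoord G f k l y‖) := by
      simp only [← mul_sum, ← sum_mul]
      ring
    rw [e, hessSqCoord]
    refine sum_le_sum fun i _ => sum_le_sum fun j _ => sum_le_sum fun k _ =>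
      sum_le_sum fun l _ => ?_
    refine (le_abs_self _).trans ?_
    rw [abs_mul, abs_mul]
    have := mul_le_mul (hinv i k) (hinv j l) (abs_nonneg _) (by norm_num)
    exact mul_le_mul (by linarith) (abs_real_inner_le_norm _ _) (abs_nonneg _) (by norm_num)
  have h2 := sum_sq_le_four hn fun i => ∑ j, ‖hessCoord G f i j y‖
  have h3 : ∑ i, (∑ j, ‖hessCoord G f i j y‖) ^ 2 ≤
      ∑ i, 4 * (2 * ∑ j, ‖pd i (pd j f) y‖ ^ 2 + 4 * (1152 * K ^ 2 * g)) := by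
    refine sum_le_sum fun i _ => ?_
    refine (sum_sq_le_four hn _).trans ?_
    refine mul_le_mul_of_nonneg_left ?_ (by norm_num)
    refine (sum_le_sum fun j _ => hH i j).trans ?_
    rw [sum_add_distrib, ← mul_sum]
    have h0 : 0 ≤ 1152 * K ^ 2 * g := by positivity
    have := sum_le_four hn (v := fun _ => 1152 * K ^ 2 * g) h0 fun _ => le_rfl
    linarith
  have h4 : ∑ i, 4 * (2 * ∑ j, ‖pd i (pd j f) y‖ ^ 2 + 4 * (1152 * K ^ 2 * g)) ≤
      8 * ∑ i, ∑ j, ‖pd i (pd j f) y‖ ^ 2 + 4 * (18432 * K ^ 2 * g) := by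
    have h0 : 0 ≤ 18432 * K ^ 2 * g := by positivity
    have := sum_le_four (n := n) hn (v := fun _ => 18432 * K ^ 2 * g) h0 fun _ => le_rfl
    rw [mul_sum]
    calc _ = ∑ i, (8 * ∑ j, ‖pd i (pd j f) y‖ ^ 2) + ∑ _i : Fin n, 18432 * K ^ 2 * g := by
          rw [← sum_add_distrib]
          exact sum_congr rfl fun i _ => by ring
      _ ≤ _ := by linarith
  linarith

lemma setIntegral_le_of_le {X : Type*} [MeasurableSpace X] {μ : Measure X} {f g : X → ℝ} {S : Set X}
    (hS : MeasurableSet S) (hg : IntegrableOn g S μ) (h : ∀ x ∈ S, f x ≤ g x)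
    (hg0 : ∀ x ∈ S, 0 ≤ g x) : ∫ x in S, f x ∂μ ≤ ∫ x in S, g x ∂μ := by
  by_cases hf : IntegrableOn f S μ
  · exact setIntegral_mono_on hf hg hS h
  · rw [integral_undef hf]
    exact setIntegral_nonneg hS hg0

lemma continuous_integrableOn_ball {g : Eu n → ℝ} (hg : Continuous g) (s : ℝ) :
    IntegrableOn g (ball 0 s) := (hg.continuousOn.integrableOn_compact (isCompact_closedBall (0 : Eu n) s)).mono_set
    ball_subset_closedBall

lemma exists_coord_regularity (n : ℕ) (hn : n ≤ 4) (hn2 : 2 ≤ n) (CN : ℝ) (hCN : 0 ≤ CN) :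
    ∃ ε₁ : ℝ, 0 < ε₁ ∧ ∀ (K s a b t₁ t₂ : ℝ), 0 ≤ K → 0 < s → 0 < a → 0 < n * b / 2 - CN ^ 2 →
      0 ≤ t₁ → t₁ < t₂ → ∃ C : ℝ, 0 ≤ C ∧ ∀ {L : ℕ} {N : Set (Eu L)}
        {ε T : ℝ} {G : Eu n → Mat n} {f : ℝ → Eu n → Eu L}
        {u : ℝ → Eu n → ℝ}, IsSmoothSubmanifold N → SecondFFBound N CN → 0 ≤ ε →
        CoordMetric K s G → CoordFlow N ε a b T s G f u → t₂ < T → (∀ t ∈ Icc t₁ t₂, ∫ y in 𝔹 s,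
          √(G y).det * (ε + gradSqCoord G (f t) y) ^ ((n : ℝ) / 2) ≤ ε₁) → ∫ y in 𝔹 s,
          √(G y).det * exp (3 * n * u ((t₁ + t₂) / 2) y) ≤ ε₁ → ∀ t ∈ Icc ((t₁ + t₂) / 2) t₂,
          ∫ y in 𝔹 (s / 4), √(G y).det * (hessSqCoord G (f t) y *
            (ε + gradSqCoord G (f t) y) ^ ((n : ℝ) - 2)) ≤ C ∧ ∫ y in 𝔹 (s / 4), √(G y).det *
            (ε + gradSqCoord G (f t) y) ^ (3 * (n : ℝ) / 2) ≤ C := by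
  obtain ⟨ε₁, hε₁, -, hreg⟩ := exists_local_regularity n hn hn2 CN hCN
  refine ⟨ε₁ / 2, by positivity, fun K s a b t₁ t₂ hK hs ha hb ht₁ h12 => ?_⟩
  set t' := (t₁ + t₂) / 2 with ht'
  set t₀ := (3 * t₁ + t') / 4 with ht₀
  set c := exp (-(n * (a * (t₂ + 1)))) with hc
  obtain ⟨C, hC, hreg⟩ := hreg K s (n * a) (n * b) c t₀ t' t₂ ε₁ hK hs (by positivity) hb
    (exp_pos _) (by rw [ht₀, ht']; linarith) (by rw [ht']; linarith) hε₁.le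
  set v := (volume (𝔹 (s / 4))).toReal with hv
  refine ⟨256 * C + 4718592 * K ^ 2 * (v + C) + 2 * C, by positivity, ?_⟩
  intro L N ε T G f u hN hNb hε hG hf hT hE hZ t ht
  set T₀ := (7 * t₁ + t') / 8 with hT₀
  set T₁ := min ((t₂ + T) / 2) (t₂ + 1) with hT₁
  have hT₁a : T₁ < T := (min_le_left _ _).trans_lt (by linarith)
  have hT₁b : t₂ < T₁ := lt_min (by linarith) (by linarith)
  have hT₀0 : 0 < T₀ := by rw [hT₀, ht']; linarith
  have hT₀a : T₀ < t₀ := by rw [hT₀, ht₀, ht']; linarith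
  have hT₀b : t₀ < t' := by rw [ht₀, ht']; linarith
  have ht't : t' < t₂ := by rw [ht']; linarith
  obtain ⟨a', σ, F, m, hflow, heq⟩ := hf.exists_flow hn hn2 hN hCN hNb (c := c) hs hε ha.le hG hT₀0
    (by linarith) hT₁a (by
      rw [hc]
      refine Real.exp_le_exp.2 (neg_le_neg ?_)
      have : T₁ ≤ t₂ + 1 := min_le_right _ _
      gcongr)
  have hsub : ball (0 : Eu n) s ⊆ 𝔹 (2 * s) := ball_subset_ball (by linarith)
  have hsub4 : ball (0 : Eu n) (s / 4) ⊆ 𝔹 s := ball_subset_ball (by linarith)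
  have hFs := hflow.smooth_F
  have hσc : Continuous σ := hflow.coef.smooth_σ.continuous
  have hQc : ∀ t, Continuous fun x => √(dens ε a' F (t, x)) := fun t =>
    ((hflow.coef.contDiff_dens hFs).continuous.comp (by fun_prop)).sqrt
  have hmc : ∀ t, Continuous fun x => m (t, x) := fun t =>
    hflow.smooth_m.continuous.comp (by fun_prop)
  have hw0 : ∀ p, 0 ≤ dens ε a' F p := hflow.coef.dens_nonneg hn hε F
  have hw : ∀ t ∈ Ioo T₀ T₁, ∀ y ∈ 𝔹 s,
      dens ε a' F (t, y) = ε + gradSqCoord G (f t) y := fun t ht y hy => by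
    rw [← quad_slice hFs, quad_eq_gradSqCoord (fun y hy => (heq y hy).1)
      (fun y hy => ((heq y hy).2.2 t ht).1) hy]
  have half : ∀ {g : Eu n → ℝ}, Continuous g → (∀ y ∈ 𝔹 s, 0 ≤ g y) →
      ∫ y in 𝔹 s, σ y * g y ≤ ε₁ / 2 → ∫ y in 𝔹 s, g y ≤ ε₁ := fun {g} hg hg0 h => by
    have h3 : ∫ y in 𝔹 s, 1 / 2 * g y ≤ ∫ y in 𝔹 s, σ y * g y :=
      setIntegral_mono_on (continuous_integrableOn_ball (continuous_const.mul hg) s)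
        (continuous_integrableOn_ball (hσc.mul hg) s) measurableSet_ball
        fun y hy => mul_le_mul_of_nonneg_right (hflow.coef.ge y hy) (hg0 y hy)
    rw [integral_const_mul] at h3
    linarith
  have hE' : ∀ t ∈ Icc t₀ t₂, ∫ x in 𝔹 s, √(dens ε a' F (t, x)) ^ n ≤ ε₁ := by
    intro t ht
    refine half ((hQc t).pow n) (fun y _ => by positivity)
      ((setIntegral_congr_fun measurableSet_ball fun y hy => ?_).trans_le
        (hE t ⟨by rw [ht₀, ht'] at ht; linarith [ht.1], ht.2⟩))
    rw [sqrt_pow_eq_rpow (hw0 _), hw t ⟨by linarith [ht.1], by linarith [ht.2]⟩ y hy,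
      (heq y hy).2.1]
  have htI' : t' ∈ Ioo T₀ T₁ := ⟨by linarith, by linarith⟩
  have hZ' : ∫ x in 𝔹 s, m (t', x) ^ 3 ≤ ε₁ := by
    refine half ((hmc t').pow 3) (fun y hy => ?_)
      ((setIntegral_congr_fun measurableSet_ball fun y hy => ?_).trans_le hZ)
    · rw [((heq y hy).2.2 t' htI').2]; positivity
    · rw [((heq y hy).2.2 t' htI').2, (heq y hy).2.1, ← Real.exp_nat_mul]
      congr 2
      push_cast; ring
  let q : Eu n → ℝ := fun x => √(dens ε a' F (t, x))
  let H : Eu n → ℝ := fun x => ∑ j, ‖hess (fun y => F (t, y)) j x‖ ^ 2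
  obtain ⟨h1, h2⟩ : ∫ x in 𝔹 (s / 4), (q x ^ (n - 2)) ^ 2 * H x ≤ C ∧
    ∫ x in 𝔹 (s / 4), q x ^ (3 * n) ≤ C := hreg hflow hT₀a hT₁b hE' hZ' t ht
  have htI : t ∈ Ioo T₀ T₁ := ⟨by linarith [ht.1], by linarith [ht.2]⟩
  have hqc : Continuous q := hQc t
  have hHc : Continuous H := by
    have hFt : ContDiff ℝ ∞ fun y => F (t, y) := hFs.comp (by fun_prop)
    exact continuous_finsetSum _ fun j _ => (continuous_hess hFt j).norm.pow 2
  have hq0 : ∀ x, 0 ≤ q x := fun x => sqrt_nonneg _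
  have hH0 : ∀ x, 0 ≤ H x := fun x => sum_nonneg fun _ _ => sq_nonneg _
  have i1 := continuous_integrableOn_ball (g := fun x => (q x ^ (n - 2)) ^ 2 * H x)
    (((hqc.pow (n - 2)).pow 2).mul hHc) (s / 4)
  have i2 := continuous_integrableOn_ball (g := fun x => q x ^ (3 * n)) (hqc.pow (3 * n)) (s / 4)
  have i3 := continuous_integrableOn_ball (n := n) (g := fun _ => (1 : ℝ)) continuous_const (s / 4)
  have hv1 : ∫ _x in ball (0 : Eu n) (s / 4), (1 : ℝ) = v := by
    rw [setIntegral_const, smul_eq_mul, mul_one]; rfl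
  constructor
  · let g x := 128 * ((q x ^ (n - 2)) ^ 2 * H x) + 2359296 * K ^ 2 * (1 + q x ^ (3 * n))
    have i4 : IntegrableOn (fun x => 1 + q x ^ (3 * n)) (𝔹 (s / 4)) := i3.add i2
    have ig : IntegrableOn g (𝔹 (s / 4)) := (i1.const_mul 128).add (i4.const_mul _)
    have hg0 : ∀ x, 0 ≤ g x := fun x => by
      have := hH0 x
      have := hq0 x
      positivity
    refine (setIntegral_le_of_le measurableSet_ball (ig.const_mul 2) (fun y hy4 => ?_)
      fun y _ => mul_nonneg zero_le_two (hg0 y)).trans ?_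
    · have hy := hsub4 hy4
      have hFf : ∀ z ∈ 𝔹 s, F (t, z) = f t z := fun z hz => ((heq z hz).2.2 t htI).1
      have b1 : ∀ i j, |(G y)⁻¹ i j| ≤ 2 := fun i j => by
        have h := abs_le.1 ((hG.near y (hsub hy)).close i j)
        have h0 : |(1 : Mat n) i j| ≤ 1 := by
          rw [Matrix.one_apply]; split_ifs <;> norm_num
        have h0' := abs_le.1 h0
        rw [abs_le]
        constructor <;> linarith [h.1, h.2, h0'.1, h0'.2]
      have b2 := hessSqCoord_le hn hK b1 (hG.dG y hy) (f t)
      have b3 : ∑ i, ∑ j, ‖pd i (pd j (f t)) y‖ ^ 2 = H y := by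
        refine sum_congr rfl fun j _ => ?_
        rw [gr_norm_sq]
        refine sum_congr rfl fun i _ => ?_
        rw [hess_apply, pd_eq_of_eqOn_ball (fun z hz => pd_eq_of_eqOn_ball hFf hz i) hy]
      have b4 : ∑ k, ‖pd k (f t) y‖ ^ 2 ≤ 2 * q y ^ 2 := by
        have e1 : ∑ k, ‖pd k (f t) y‖ ^ 2 = ‖gradx F (t, y)‖ ^ 2 := by
          rw [← grad_slice (hFs.differentiable (by simp) _), gr_norm_sq]
          exact sum_congr rfl fun k _ => by rw [grad_apply, pd_eq_of_eqOn_ball hFf hy]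
        rw [e1, sq_sqrt (hw0 _)]
        exact hflow.coef.norm_gradx_le hn hε F (t, y)
      have b5 : (ε + gradSqCoord G (f t) y) ^ ((n : ℝ) - 2) = (q y ^ (n - 2)) ^ 2 := by
        rw [← pow_mul, sqrt_pow_eq_rpow (hw0 _), hw t htI y hy]
        congr 1
        push_cast [Nat.cast_sub hn2]; ring
      have b6 : (q y ^ (n - 2)) ^ 2 * q y ^ 2 ≤ 1 + q y ^ (3 * n) := by
        rw [← pow_mul, ← pow_add]
        have h0 := pow_nonneg (hq0 y) (3 * n)
        rcases le_total (q y) 1 with h | h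
        · have := pow_le_one₀ (hq0 y) h (n := (n - 2) * 2 + 2)
          linarith
        · have := pow_le_pow_right₀ h (show (n - 2) * 2 + 2 ≤ 3 * n by omega)
          linarith
      rw [b3] at b2
      have b7 := mul_le_mul_of_nonneg_left b4 (show 0 ≤ 1179648 * K ^ 2 by positivity)
      have b8 : hessSqCoord G (f t) y * (q y ^ (n - 2)) ^ 2 ≤ g y := by
        have c1 := mul_le_mul_of_nonneg_right (b2.trans (add_le_add_right b7 _))
          (sq_nonneg (q y ^ (n - 2)))
        have c2 := mul_le_mul_of_nonneg_left b6 (show 0 ≤ 2359296 * K ^ 2 by positivity)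
        refine c1.trans ?_
        simp only [g]
        linarith
      rw [b5]
      exact (mul_le_mul_of_nonneg_left b8 (sqrt_nonneg _)).trans
        (mul_le_mul_of_nonneg_right (hG.le y (hsub hy)) (hg0 y))
    · have c1 : 2359296 * K ^ 2 * (v + ∫ x in 𝔹 (s / 4), q x ^ (3 * n)) ≤
          2359296 * K ^ 2 * (v + C) := mul_le_mul_of_nonneg_left (by linarith) (by positivity)
      rw [integral_const_mul]
      simp only [g]
      rw [integral_add (i1.const_mul 128) (i4.const_mul _), integral_const_mul,
        integral_const_mul, integral_add i3 i2, hv1]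
      linarith
  · have c0 : 0 ≤ 4718592 * K ^ 2 * (v + C) := by positivity
    refine (setIntegral_le_of_le measurableSet_ball (i2.const_mul 2) (fun y hy4 => ?_)
      fun y _ => mul_nonneg zero_le_two (pow_nonneg (hq0 y) _)).trans ?_
    · have b5 : (ε + gradSqCoord G (f t) y) ^ (3 * (n : ℝ) / 2) = q y ^ (3 * n) := by
        rw [sqrt_pow_eq_rpow (hw0 _), hw t htI y (hsub4 hy4)]
        congr 1
        push_cast; ring
      rw [b5]
      exact mul_le_mul_of_nonneg_right (hG.le y (hsub (hsub4 hy4))) (pow_nonneg (hq0 y) _)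
    · rw [integral_const_mul]
      linarith

end CoordRegularity

variable {M : Type*} [EMetricSpace M] [ChartedSpace (Eu n) M] {c c' : Chart n M}

/-! ### Smooth charts of a Riemannian manifold -/

/-- A chart which is smooth in both directions. -/
structure SmoothChart (c : Chart n M) : Prop where
  toFun : ContMDiffOn (𝓡 n) (𝓡 n) ∞ c c.source
  symm : ContMDiffOn (𝓡 n) (𝓡 n) ∞ c.symm c.target

lemma smoothChart_chartAt [IsManifold (𝓡 n) ∞ M] (p : M) : SmoothChart (chartAt (Eu n) p) :=
  ⟨contMDiffOn_chart, contMDiffOn_chart_symm⟩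

lemma SmoothChart.transHomeomorph {c : Chart n M} (hc : SmoothChart c) (e : Eu n ≃ₜ Eu n)
    (he : ContDiff ℝ ∞ e) (he' : ContDiff ℝ ∞ e.symm) : SmoothChart (c.transHomeomorph e) := by
  constructor
  · exact he.contMDiff.comp_contMDiffOn hc.toFun
  · exact hc.symm.comp he'.contMDiff.contMDiffOn fun y hy => hy

/-- The change of coordinates. -/
def chg (c c' : Chart n M) : Eu n → Eu n := c' ∘ c.symm

/-- The domain of the change of coordinates. -/
def chgDom (c c' : Chart n M) : Set (Eu n) := c.target ∩ c.symm ⁻¹' c'.source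

lemma isOpen_chgDom (c c' : Chart n M) : IsOpen (chgDom c c') :=
  c.isOpen_inter_preimage_symm c'.open_source

lemma contDiffAt_chg (hc : SmoothChart c) (hc' : SmoothChart c') {z : Eu n} (hz : z ∈ chgDom c c') :
    ContDiffAt ℝ ∞ (chg c c') z := by
  have h : ContMDiffOn (𝓡 n) (𝓡 n) ∞ (chg c c') (chgDom c c') :=
    hc'.toFun.comp (hc.symm.mono inter_subset_left) inter_subset_right
  rw [contMDiffOn_iff_contDiffOn] at h
  exact h.contDiffAt ((isOpen_chgDom c c').mem_nhds hz)

lemma chg_chg {z : Eu n} (hz : z ∈ chgDom c c') : chg c' c (chg c c' z) = z := by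
  simp [chg, c'.left_inv hz.2, c.right_inv hz.1]

lemma chg_mem {z : Eu n} (hz : z ∈ chgDom c c') : chg c c' z ∈ chgDom c' c := by
  refine ⟨c'.map_source hz.2, ?_⟩
  change c'.symm (c' (c.symm z)) ∈ c.source
  rw [c'.left_inv hz.2]
  exact c.map_target hz.1

lemma fderiv_chg_chg (hc : SmoothChart c) (hc' : SmoothChart c') {z : Eu n} (hz : z ∈ chgDom c c')
    (v : Eu n) : fderiv ℝ (chg c' c) (chg c c' z) (fderiv ℝ (chg c c') z v) = v := by
  have h1 := ((contDiffAt_chg hc hc' hz).differentiableAt (by simp)).hasFDerivAt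
  have h2 := ((contDiffAt_chg hc' hc (chg_mem hz)).differentiableAt (by simp)).hasFDerivAt
  have h3 := h2.comp z h1
  have h4 : (chg c' c ∘ chg c c') =ᶠ[𝓝 z] id := by
    filter_upwards [(isOpen_chgDom c c').mem_nhds hz] with x hx using chg_chg hx
  exact DFunLike.congr_fun (h3.unique ((hasFDerivAt_id z).congr_of_eventuallyEq h4)) v

lemma jac_eq_toMatrix (ψ : Eu n → Eu n) (z : Eu n) :
    jac ψ z = LinearMap.toMatrix (EuclideanSpace.basisFun (Fin n) ℝ).toBasis
      (EuclideanSpace.basisFun (Fin n) ℝ).toBasis (fderiv ℝ ψ z).toLinearMap := by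
  ext k i
  rw [LinearMap.toMatrix_apply]
  simp [jac, pd]

lemma det_jac (ψ : Eu n → Eu n) (z : Eu n) : (jac ψ z).det = (fderiv ℝ ψ z).det := by
  rw [jac_eq_toMatrix, LinearMap.det_toMatrix]

lemma det_jac_chg_ne (hc : SmoothChart c) (hc' : SmoothChart c') {z : Eu n} (hz : z ∈ chgDom c c') :
    (jac (chg c c') z).det ≠ 0 := by
  have h : (fderiv ℝ (chg c' c) (chg c c' z)).comp (fderiv ℝ (chg c c') z) = 1 := by
    ext1 v
    exact fderiv_chg_chg hc hc' hz v
  rw [det_jac]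
  intro h0
  have h1 : ((fderiv ℝ (chg c' c) (chg c c' z)).comp (fderiv ℝ (chg c c') z)).det = 0 := by
    change LinearMap.det ((fderiv ℝ (chg c' c) (chg c c' z)).toLinearMap ∘ₗ
      (fderiv ℝ (chg c c') z).toLinearMap) = 0
    rw [LinearMap.det_comp]
    change _ * (fderiv ℝ (chg c c') z).det = 0
    rw [h0, mul_zero]
  rw [h] at h1
  have h2 : (1 : Eu n →L[ℝ] Eu n).det = 1 := LinearMap.det_id
  rw [h2] at h1
  exact one_ne_zero h1

lemma mdifferentiableAt_symm (hc : SmoothChart c) {z : Eu n} (hz : z ∈ c.target) :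
    MDifferentiableAt (𝓡 n) (𝓡 n) c.symm z :=
  (hc.symm.contMDiffAt (c.open_target.mem_nhds hz)).mdifferentiableAt (by simp)

lemma mfderiv_symm_chg (hc : SmoothChart c) (hc' : SmoothChart c') {z : Eu n} (hz : z ∈ chgDom c c')
    (v : Eu n) : (mfderiv (𝓡 n) (𝓡 n) c.symm z v : Eu n) =
      (mfderiv (𝓡 n) (𝓡 n) c'.symm (chg c c' z) (fderiv ℝ (chg c c') z v) : Eu n) := by
  have e : c.symm =ᶠ[𝓝 z] c'.symm ∘ chg c c' := by
    filter_upwards [(isOpen_chgDom c c').mem_nhds hz] with x hx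
    exact (c'.left_inv hx.2).symm
  have h1 := (mdifferentiableAt_symm hc' (chg_mem hz).1).hasMFDerivAt
  have h2 : HasMFDerivAt (𝓡 n) (𝓡 n) (chg c c') z (fderiv ℝ (chg c c') z) :=
    ((contDiffAt_chg hc hc' hz).differentiableAt (by simp)).hasFDerivAt.hasMFDerivAt
  have h3 := h1.comp z h2
  rw [e.mfderiv_eq, h3.mfderiv]
  rfl

lemma mfderiv_symm_injective (hc : SmoothChart c) {z : Eu n} (hz : z ∈ c.target) {v : Eu n}
    (hv : (mfderiv (𝓡 n) (𝓡 n) c.symm z v : Eu n) = 0) : v = 0 := by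
  have h1 := (mdifferentiableAt_symm hc hz).hasMFDerivAt
  have h2 : HasMFDerivAt (𝓡 n) (𝓡 n) c (c.symm z) (mfderiv (𝓡 n) (𝓡 n) c (c.symm z)) :=
    ((hc.toFun.contMDiffAt (c.open_source.mem_nhds (c.map_target hz))).mdifferentiableAt
      (by simp)).hasMFDerivAt
  have h3 := h2.comp z h1
  have e : (c ∘ c.symm) =ᶠ[𝓝 z] id := by
    filter_upwards [c.open_target.mem_nhds hz] with x hx using c.right_inv hx
  have h4 := (hasMFDerivAt_id (I := 𝓡 n) z).congr_of_eventuallyEq e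
  have h5 := DFunLike.congr_fun (hasMFDerivAt_unique h3 h4) v
  have h6 : mfderiv (𝓡 n) (𝓡 n) c (c.symm z) (mfderiv (𝓡 n) (𝓡 n) c.symm z v) = v := h5
  rw [← h6]
  change mfderiv (𝓡 n) (𝓡 n) c (c.symm z) (mfderiv (𝓡 n) (𝓡 n) c.symm z v : Eu n) = 0
  rw [hv]
  exact map_zero _

variable [RiemannianBundle (𝕋 n M)]

/-- The scalar product of the tangent space at `p`, on the model space. -/
def ip (p : M) (v w : Eu n) : ℝ :=
  inner ℝ (show TangentSpace (𝓡 n) p from v) (show TangentSpace (𝓡 n) p from w)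

lemma ip_comm (p : M) (v w : Eu n) : ip p v w = ip p w v :=
  real_inner_comm (F := TangentSpace (𝓡 n) p) _ _

lemma ip_add_left (p : M) (v v' w : Eu n) : ip p (v + v') w = ip p v w + ip p v' w :=
  inner_add_left (E := TangentSpace (𝓡 n) p) _ _ _

lemma ip_smul_left (p : M) (a : ℝ) (v w : Eu n) : ip p (a • v) w = a * ip p v w :=
  real_inner_smul_left (F := TangentSpace (𝓡 n) p) _ _ _

lemma ip_self_pos (p : M) {v : Eu n} (hv : v ≠ 0) : 0 < ip p v v :=
  real_inner_self_pos (F := TangentSpace (𝓡 n) p) |>.2 hv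

/-- The scalar product as a bilinear form. -/
def ipB (p : M) : Eu n →ₗ[ℝ] Eu n →ₗ[ℝ] ℝ := LinearMap.mk₂ ℝ (ip p) (ip_add_left p) (ip_smul_left p)
    (fun v w w' => by rw [ip_comm, ip_add_left, ip_comm p w, ip_comm p w'])
    (fun a v w => by rw [ip_comm, ip_smul_left, ip_comm p w]; rfl)

lemma gram_eq_ip (c : Chart n M) (y : Eu n) (i j : Fin n) :
    gram c y i j = ip (c.symm y) (mfderiv (𝓡 n) (𝓡 n) c.symm y (single i 1))
      (mfderiv (𝓡 n) (𝓡 n) c.symm y (single j 1)) := rfl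

lemma gram_symm (c : Chart n M) (y : Eu n) (i j : Fin n) : gram c y i j = gram c y j i :=
  ip_comm _ _ _

variable [IsManifold (𝓡 n) ∞ M] [IsContMDiffRiemannianBundle (𝓡 n) ∞ (Eu n) (𝕋 n M)]

lemma contDiffAt_gram (hc : SmoothChart c) {y : Eu n} (hy : y ∈ c.target) (i j : Fin n) :
    ContDiffAt ℝ ∞ (fun z => gram c z i j) y := by
  have : IsManifold (𝓡 n) 1 M := IsManifold.of_le (n := ∞) (by simp)
  have ht := hc.symm.contMDiffOn_tangentMapWithin (m := ∞) (by simp) c.open_target.uniqueMDiffOn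
  have hsec : ∀ k : Fin n, ContMDiffOn (𝓡 n) (𝓡 n).tangent ∞
      (fun z : Eu n => (⟨z, single k (1 : ℝ)⟩ : TangentBundle (𝓡 n) (Eu n))) c.target := fun k =>
    (contMDiffOn_vectorSpace_iff_contDiffOn (𝕜 := ℝ) (E := Eu n)
      (V := fun _ => single k (1 : ℝ))).2 contDiffOn_const
  have hcomp : ∀ k : Fin n, ContMDiffOn (𝓡 n) (𝓡 n).tangent ∞
      (fun z : Eu n => (⟨c.symm z, mfderivWithin (𝓡 n) (𝓡 n) c.symm c.target z
        (single k (1 : ℝ))⟩ : TangentBundle (𝓡 n) M)) c.target := fun k =>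
    ht.comp (hsec k) fun z hz => hz
  have h := (hcomp i).inner_bundle (hcomp j)
  rw [contMDiffOn_iff_contDiffOn] at h
  refine (h.congr fun z hz => ?_).contDiffAt (c.open_target.mem_nhds hy)
  rw [mfderivWithin_of_mem_nhds (c.open_target.mem_nhds hz)]
  rfl

/-- `|v|²` in a chart. -/
lemma ip_mfderiv_symm (c : Chart n M) (z v w : Eu n) :
    ip (c.symm z) (mfderiv (𝓡 n) (𝓡 n) c.symm z v) (mfderiv (𝓡 n) (𝓡 n) c.symm z w) =
      Transition.mform (gram c z) v w := by
  let T : Eu n →L[ℝ] Eu n := mfderiv (𝓡 n) (𝓡 n) c.symm z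
  change ipB (c.symm z) (T v) (T w) = _
  rw [Transition.mform_apply, clm_apply_eq_sum T v, clm_apply_eq_sum T w]
  simp only [map_sum, map_smul, LinearMap.sum_apply, LinearMap.smul_apply, smul_eq_mul, mul_sum]
  rw [sum_comm]
  refine sum_congr rfl fun i _ => sum_congr rfl fun j _ => ?_
  rw [gram_eq_ip]
  change w j * (v i * ip (c.symm z) (T _) (T _)) = ip (c.symm z) (T _) (T _) * (v i * w j)
  ring

lemma posDef_gram (hc : SmoothChart c) {z : Eu n} (hz : z ∈ c.target) : (gram c z).PosDef := by
  refine Matrix.PosDef.of_dotProduct_mulVec_pos ?_ fun x hx => ?_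
  · ext i j
    rw [Matrix.conjTranspose_apply, star_trivial, gram_symm]
  · have h := ip_mfderiv_symm c z (toLp 2 x) (toLp 2 x)
    have h0 : toLp 2 x ≠ (0 : Eu n) := fun h => hx (by simpa using h)
    have h1 := ip_self_pos (c.symm z) fun h => h0 (mfderiv_symm_injective hc hz h)
    rw [h, Transition.mform_apply] at h1
    refine h1.trans_eq ?_
    rw [dotProduct]
    refine sum_congr rfl fun i _ => ?_
    rw [Matrix.mulVec, dotProduct, mul_sum]
    refine sum_congr rfl fun j _ => ?_
    rw [Pi.star_apply, star_trivial]
    change gram c z i j * (x i * x j) = _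
    ring

lemma transition_chg (hc : SmoothChart c) (hc' : SmoothChart c') :
    Transition (chgDom c c') (gram c) (gram c') (chg c c') where
  isOpen := isOpen_chgDom c c'
  smooth z hz := contDiffAt_chg hc hc' hz
  det_ne z hz := det_jac_chg_ne hc hc' hz
  metric z hz := by
    ext i j
    have e : c'.symm (chg c c' z) = c.symm z := c'.left_inv hz.2
    rw [gram_eq_ip, mfderiv_symm_chg hc hc' hz, mfderiv_symm_chg hc hc' hz, ← e,
      ip_mfderiv_symm, ← Transition.mform_pullback, Transition.mform_single]
  smooth' z hz i j := contDiffAt_gram hc' (chg_mem hz).1 i j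
  symm' x i j := gram_symm c' x i j
  pos' z hz := (posDef_gram hc' (chg_mem hz).1).det_pos

lemma contDiffAt_comp_symm {f : M → V}
    (hf : ContMDiff (𝓡 n) 𝓘(ℝ, V) ∞ f) (hc : SmoothChart c) {y : Eu n} (hy : y ∈ c.target) :
    ContDiffAt ℝ ∞ (f ∘ c.symm) y := by
  have h := hf.comp_contMDiffOn hc.symm
  rw [contMDiffOn_iff_contDiffOn] at h
  exact h.contDiffAt (c.open_target.mem_nhds hy)

variable {f : M → Eu L}

lemma mem_chgDom_chartAt {p : M} (hp : p ∈ c.source) :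
    chartAt (Eu n) p p ∈ chgDom (chartAt (Eu n) p) c := ⟨mem_chart_target _ p, by simpa using hp⟩

lemma chg_chartAt (c : Chart n M) (p : M) :
    chg (chartAt (Eu n) p) c (chartAt (Eu n) p p) = c p := by
  simp [chg]

lemma inChart_eq_chg {p : M} {x : Eu n} (hx : x ∈ chgDom (chartAt (Eu n) p) c) :
    inChart n p f x = (f ∘ c.symm) (chg (chartAt (Eu n) p) c x) := by
  simp [inChart, chg, c.left_inv hx.2]

lemma differentiableAt_comp_symm_chg (hf : ContMDiff (𝓡 n) 𝓘(ℝ, Eu L) ∞ f) (hc : SmoothChart c)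
    (p : M) : ∀ x ∈ chgDom (chartAt (Eu n) p) c,
      ContDiffAt ℝ ∞ (f ∘ c.symm) (chg (chartAt (Eu n) p) c x) :=
  fun _ hx => contDiffAt_comp_symm hf hc (chg_mem hx).1

section ChartInvariance

variable (hf : ContMDiff (𝓡 n) 𝓘(ℝ, Eu L) ∞ f) (hc : SmoothChart c)
  {p : M} (hp : p ∈ c.source)

include hf hc hp

lemma e2_eq_chart (ε : ℝ) : e2 n ε f p = ε + gradSqCoord (gram c) (f ∘ c.symm) (c p) := by
  have h := transition_chg (smoothChart_chartAt p) hc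
  rw [e2, h.gradSqCoord_eq (fun x hx => inChart_eq_chg hx) (mem_chgDom_chartAt hp)
    ((differentiableAt_comp_symm_chg hf hc p _ (mem_chgDom_chartAt hp)).differentiableAt (by simp)),
    chg_chartAt]

lemma hessSq_eq_chart : hessSq n f p = hessSqCoord (gram c) (f ∘ c.symm) (c p) := by
  have h := transition_chg (smoothChart_chartAt p) hc
  rw [hessSq, h.hessSqCoord_eq (gram_symm _) (fun x hx => inChart_eq_chg hx) (mem_chgDom_chartAt hp)
    (differentiableAt_comp_symm_chg hf hc p _ (mem_chgDom_chartAt hp)), chg_chartAt]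

lemma nLaplace_eq_chart {ε : ℝ}
    (hV : ∀ i, DifferentiableAt ℝ (fun x => (ε + gradSqCoord (gram c) (f ∘ c.symm) x) ^
      ((n : ℝ) / 2 - 1) • ∑ j, (gram c x)⁻¹ i j • pd j (f ∘ c.symm) x) (c p)) :
    nLaplace n ε f p = nLaplaceCoord ε (gram c) (f ∘ c.symm) (c p) := by
  have h := transition_chg (smoothChart_chartAt p) hc
  rw [nLaplace, h.nLaplaceCoord_eq (fun x hx => inChart_eq_chg hx) (mem_chgDom_chartAt hp)
    (fun x hx => (differentiableAt_comp_symm_chg hf hc p _ hx).differentiableAt (by simp)),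
    chg_chartAt]
  rwa [chg_chartAt]

lemma secondFFTrace_eq_chart (N : Set (Eu L)) :
    secondFFTrace n N f p = ∑ i, ∑ j, (gram c (c p))⁻¹ i j •
      secondFF N (f p) (pd i (f ∘ c.symm) (c p)) (pd j (f ∘ c.symm) (c p)) := by
  have h := transition_chg (smoothChart_chartAt p) hc
  rw [secondFFTrace, h.sum_bilin_pd (fun x hx => inChart_eq_chg hx) (mem_chgDom_chartAt hp)
    ((differentiableAt_comp_symm_chg hf hc p _ (mem_chgDom_chartAt hp)).differentiableAt (by simp)),
    chg_chartAt]

end ChartInvariance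

lemma contDiffAt_gram_inv (hc : SmoothChart c) {y : Eu n} (hy : y ∈ c.target) (i j : Fin n) :
    ContDiffAt ℝ ∞ (fun x => (gram c x)⁻¹ i j) y :=
  contDiffAt_inv (contDiffAt_gram hc hy) (posDef_gram hc hy).det_pos.ne' i j

lemma continuous_of_chart {g : M → ℝ} (h : ∀ p : M, ∃ h : Eu n → ℝ,
    ContinuousAt h (chartAt (Eu n) p p) ∧ ∀ q ∈ (chartAt (Eu n) p).source,
      g q = h (chartAt (Eu n) p q)) : Continuous g := by
  rw [continuous_iff_continuousAt]
  intro p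
  obtain ⟨h, hc, hg⟩ := h p
  have h1 : ContinuousAt (fun q => h (chartAt (Eu n) p q)) p :=
    hc.comp ((chartAt (Eu n) p).continuousAt (mem_chart_source _ p))
  refine h1.congr ?_
  filter_upwards [(chartAt (Eu n) p).open_source.mem_nhds (mem_chart_source _ p)] with q hq
  exact (hg q hq).symm

lemma continuousAt_pd {F : Eu n → V} {z : Eu n}
    (hF : ContDiffAt ℝ ∞ F z) (i : Fin n) : ContinuousAt (pd i F) z :=
  (differentiableAt_pd hF i).continuousAt

lemma contDiffAt_pd {F : Eu n → V} {z : Eu n}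
    (hF : ContDiffAt ℝ ∞ F z) (i : Fin n) : ContDiffAt ℝ ∞ (pd i F) z :=
  (hF.fderiv_right (m := ∞) (by simp)).clm_apply contDiffAt_const

lemma continuous_e2 (hf : ContMDiff (𝓡 n) 𝓘(ℝ, Eu L) ∞ f) (ε : ℝ) : Continuous (e2 n ε f) := by
  refine continuous_of_chart fun p => ⟨fun x => ε + gradSqCoord (gram (chartAt (Eu n) p))
    (f ∘ (chartAt (Eu n) p).symm) x, ?_, fun q hq => e2_eq_chart hf (smoothChart_chartAt p) hq ε⟩
  have hy := mem_chart_target (Eu n) p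
  have hF := contDiffAt_comp_symm hf (smoothChart_chartAt p) hy
  refine continuousAt_const.add (tendsto_finsetSum _ fun i _ => tendsto_finsetSum _ fun j _ => ?_)
  exact (contDiffAt_gram_inv (smoothChart_chartAt p) hy i j).continuousAt.mul
    ((continuousAt_pd hF i).inner (𝕜 := ℝ) (continuousAt_pd hF j))

lemma continuous_hessSq (hf : ContMDiff (𝓡 n) 𝓘(ℝ, Eu L) ∞ f) : Continuous (hessSq n f) := by
  refine continuous_of_chart fun p => ⟨hessSqCoord (gram (chartAt (Eu n) p))
    (f ∘ (chartAt (Eu n) p).symm), ?_, fun q hq => hessSq_eq_chart hf (smoothChart_chartAt p) hq⟩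
  have hy := mem_chart_target (Eu n) p
  have hc := smoothChart_chartAt (n := n) p
  have hF := contDiffAt_comp_symm hf hc hy
  have hΓ : ∀ k i j, ContinuousAt (christoffel (gram (chartAt (Eu n) p)) k i j)
      (chartAt (Eu n) p p) := fun k i j => by
    refine continuousAt_const.mul (tendsto_finsetSum _ fun l _ => ?_)
    refine (contDiffAt_gram_inv hc hy k l).continuousAt.mul (ContinuousAt.sub (ContinuousAt.add
      ?_ ?_) ?_)
    all_goals exact continuousAt_pd (contDiffAt_gram hc hy _ _) _
  have hH : ∀ i j, ContinuousAt (hessCoord (gram (chartAt (Eu n) p))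
      (f ∘ (chartAt (Eu n) p).symm) i j) (chartAt (Eu n) p p) := fun i j => by
    refine (continuousAt_pd (contDiffAt_pd hF j) i).sub (tendsto_finsetSum _ fun k _ => ?_)
    exact (hΓ k i j).smul (continuousAt_pd hF k)
  refine tendsto_finsetSum _ fun i _ => tendsto_finsetSum _ fun j _ => tendsto_finsetSum _
    fun k _ => tendsto_finsetSum _ fun l _ => ?_
  exact ((contDiffAt_gram_inv hc hy i k).continuousAt.mul
    (contDiffAt_gram_inv hc hy j l).continuousAt).mul ((hH i j).inner (𝕜 := ℝ) (hH k l))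

lemma gradSqCoord_nonneg {G : Eu n → Mat n} {y : Eu n} (hG : (G y).PosDef) (F : Eu n → Eu L) : 0 ≤
    gradSqCoord G F y := sum_inner_nonneg hG.inv.posSemidef _

lemma e2_nonneg {ε : ℝ} (hε : 0 ≤ ε) (f : M → Eu L) (p : M) : 0 ≤ e2 n ε f p :=
  add_nonneg hε (gradSqCoord_nonneg (posDef_gram (smoothChart_chartAt p) (mem_chart_target _ p)) _)

/-! ### Distances in a chart -/

lemma edist_symm_le [IsRiemannianManifold (𝓡 n) M] (hc : SmoothChart c) {S : Set (Eu n)} (hS : Convex ℝ S) (hSt : S ⊆ c.target)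
    (hG : ∀ z ∈ S, ∀ v, Transition.mform (gram c z) v v ≤ 4 * ‖v‖ ^ 2) {y y' : Eu n} (hy : y ∈ S)
    (hy' : y' ∈ S) : edist (c.symm y) (c.symm y') ≤ ofReal (2 * ‖y' - y‖) := by
  rw [IsRiemannianManifold.out (I := 𝓡 n)]
  let l : ℝ → Eu n := fun τ => y + τ • (y' - y)
  have hl : ∀ τ ∈ Icc (0 : ℝ) 1, l τ ∈ S := fun τ hτ => hS.add_smul_sub_mem hy hy' hτ
  have hlc : ContDiff ℝ ∞ l := contDiff_const.add (contDiff_id.smul contDiff_const)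
  have hγ : ContMDiffOn 𝓘(ℝ, ℝ) (𝓡 n) ∞ (c.symm ∘ l) (Icc 0 1) :=
    hc.symm.comp hlc.contMDiff.contMDiffOn fun τ hτ => hSt (hl τ hτ)
  refine (Manifold.riemannianEDist_le_pathELength (γ := c.symm ∘ l) (hγ.of_le (by simp))
    (by simp [l]) (by simp [l]) zero_le_one).trans ?_
  rw [Manifold.pathELength_eq_lintegral_mfderiv_Ioo]
  have hb : ∀ τ ∈ Ioo (0 : ℝ) 1, ‖mfderiv 𝓘(ℝ, ℝ) (𝓡 n) (c.symm ∘ l) τ 1‖ₑ ≤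
      ofReal (2 * ‖y' - y‖) := by
    intro τ hτ
    have hz := hl τ (Ioo_subset_Icc_self hτ)
    have h1 := (mdifferentiableAt_symm hc (hSt hz)).hasMFDerivAt
    have h2 : HasFDerivAt l ((1 : ℝ →L[ℝ] ℝ).smulRight (y' - y)) τ := by
      have := ((1 : ℝ →L[ℝ] ℝ).smulRight (y' - y)).hasFDerivAt (x := τ)
      exact this.const_add y
    have h3 := (h1.comp τ h2.hasMFDerivAt).mfderiv
    have h4 : mfderiv 𝓘(ℝ, ℝ) (𝓡 n) (c.symm ∘ l) τ 1 =
        mfderiv (𝓡 n) (𝓡 n) c.symm (l τ) (y' - y) := by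
      rw [h3]
      change mfderiv (𝓡 n) (𝓡 n) c.symm (l τ) ((1 : ℝ) • (y' - y)) = _
      rw [one_smul]
    rw [h4, ← ofReal_norm]
    refine ofReal_le_ofReal ?_
    rw [norm_eq_sqrt_real_inner]
    have h5 := hG _ hz (y' - y)
    rw [← ip_mfderiv_symm] at h5
    refine (Real.sqrt_le_sqrt h5).trans ?_
    rw [show 4 * ‖y' - y‖ ^ 2 = (2 * ‖y' - y‖) ^ 2 by ring, Real.sqrt_sq (by positivity)]
  refine (setLIntegral_mono' measurableSet_Ioo hb).trans ?_
  rw [setLIntegral_const, Real.volume_Ioo]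
  simp

/-! ### The Riemannian volume in a chart -/

section Volume

variable [MeasurableSpace M] [BorelSpace M]

/-- `√(det g) dx` in the chart `c`. -/
def chartVol (c : Chart n M) : Measure M :=
  Measure.map c.symm ((volume.restrict c.target).withDensity fun y => ofReal √(gram c y).det)

lemma aemeasurable_symm (c : Chart n M) (h : Eu n → ℝ≥0∞) :
    AEMeasurable c.symm ((volume.restrict c.target).withDensity h) :=
  (c.continuousOn_symm.aemeasurable c.open_target.measurableSet).mono_ac
    (withDensity_absolutelyContinuous _ _)

lemma measurableSet_target_inter (c : Chart n M) {A : Set M} (hA : MeasurableSet A) : MeasurableSet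
    (c.symm ⁻¹' A ∩ c.target) := by
  have h := (continuousOn_iff_continuous_domRestrict.1 c.continuousOn_symm).measurable hA
  have h1 := c.open_target.measurableSet.subtype_image h
  convert h1 using 1
  ext y
  simp [and_comm]

lemma chartVol_apply (c : Chart n M) {A : Set M} (hA : MeasurableSet A) :
    chartVol c A = ∫⁻ y in c.symm ⁻¹' A ∩ c.target, ofReal √(gram c y).det := by
  rw [chartVol, Measure.map_apply_of_aemeasurable (aemeasurable_symm c _) hA, withDensity_apply',
    Measure.restrict_restrict' c.open_target.measurableSet]

lemma chartVol_overlap (hc : SmoothChart c) (hc' : SmoothChart c') {A : Set M}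
    (hA : MeasurableSet A) (h1 : A ⊆ c.source) (h2 : A ⊆ c'.source) :
    chartVol c A = chartVol c' A := by
  have hsub : c.symm ⁻¹' A ∩ c.target ⊆ chgDom c c' := fun y hy => ⟨hy.2, h2 hy.1⟩
  have him : chg c c' '' (c.symm ⁻¹' A ∩ c.target) = c'.symm ⁻¹' A ∩ c'.target := by
    ext y
    constructor
    · rintro ⟨z, hz, rfl⟩
      refine ⟨?_, (chg_mem (hsub hz)).1⟩
      change c'.symm (c' (c.symm z)) ∈ A
      rw [c'.left_inv (hsub hz).2]
      exact hz.1
    · intro hy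
      refine ⟨c (c'.symm y), ⟨?_, c.map_source (h1 hy.1)⟩, ?_⟩
      · change c.symm (c (c'.symm y)) ∈ A
        rw [c.left_inv (h1 hy.1)]
        exact hy.1
      · simp [chg, c.left_inv (h1 hy.1), c'.right_inv hy.2]
  have hT := transition_chg hc hc'
  rw [chartVol_apply c hA, chartVol_apply c' hA, ← him,
    lintegral_image_eq_lintegral_abs_det_fderiv_mul volume (measurableSet_target_inter c hA)
      (f' := fderiv ℝ (chg c c')) (fun z hz =>
        ((contDiffAt_chg hc hc' (hsub hz)).differentiableAt (by simp)).hasFDerivAt.hasFDerivWithinAt)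
      (fun z hz z' hz' h => by rw [← chg_chg (hsub hz), h, chg_chg (hsub hz')])]
  refine setLIntegral_congr_fun (measurableSet_target_inter c hA) fun z hz => ?_
  rw [hT.sqrt_det_eq (hsub hz), ofReal_mul (abs_nonneg _), det_jac]

lemma chartVol_inter_source (c : Chart n M) {A : Set M} (hA : MeasurableSet A) : chartVol c
    (A ∩ c.source) = chartVol c A := by
  rw [chartVol_apply c hA, chartVol_apply c (hA.inter c.open_source.measurableSet)]
  congr 2
  ext y
  constructor
  · exact fun h => ⟨h.1.1, h.2⟩
  · exact fun h => ⟨⟨h.1, c.map_target h.2⟩, h.2⟩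

lemma chartVol_le_riemVol (p : M) : chartVol (chartAt (Eu n) p) ≤ riemVol n M :=
  le_iSup (fun p : M => chartVol (chartAt (Eu n) p)) p

lemma riemVol_le (hc : SmoothChart c) :
    riemVol n M ≤ chartVol c + (riemVol n M).restrict c.sourceᶜ := by
  have hs := c.open_source.measurableSet
  refine iSup_le fun p => ?_
  change chartVol (chartAt (Eu n) p) ≤ _
  refine Measure.le_iff.2 fun A hA => ?_
  rw [← measure_inter_add_diff A hs, Measure.add_apply]
  refine add_le_add ?_ ?_
  · rw [← chartVol_inter_source _ (hA.inter hs), chartVol_overlap (smoothChart_chartAt p) hc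
      ((hA.inter hs).inter (chartAt (Eu n) p).open_source.measurableSet) inter_subset_right
      fun q hq => hq.1.2]
    exact measure_mono fun q hq => hq.1.1
  · rw [Measure.restrict_apply hA, ← diff_eq]
    exact chartVol_le_riemVol p _

variable [CompactSpace M]

lemma chartVol_le (hc : SmoothChart c) {A : Set M} (hA : MeasurableSet A) (h : A ⊆ c.source) :
    chartVol c A ≤ riemVol n M A := by
  have hcov : ∀ t : Finset M, ∀ A : Set M, MeasurableSet A → A ⊆ c.source →
      A ⊆ ⋃ p ∈ t, (chartAt (Eu n) p).source → chartVol c A ≤ riemVol n M A := by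
    intro t
    classical
    induction t using Finset.induction_on with
    | empty =>
      intro A _ _ h
      have : A = ∅ := subset_empty_iff.1 (h.trans (by simp))
      simp [this]
    | insert p t _ ih =>
      intro A hA h1 h2
      have hs := (chartAt (Eu n) p).open_source.measurableSet
      rw [← measure_inter_add_diff A hs, ← measure_inter_add_diff (μ := riemVol n M) A hs]
      refine add_le_add ?_ (ih _ (hA.diff hs) (diff_subset.trans h1) fun q hq => ?_)
      · rw [chartVol_overlap hc (smoothChart_chartAt p) (hA.inter hs)
          (inter_subset_left.trans h1) inter_subset_right]
        exact chartVol_le_riemVol p _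
      · have := h2 hq.1
        rw [Finset.set_biUnion_insert] at this
        exact this.resolve_left hq.2
  obtain ⟨t, ht⟩ := isCompact_univ.elim_finite_subcover
    (fun p : M => (chartAt (Eu n) p).source) (fun p => (chartAt (Eu n) p).open_source)
    fun p _ => mem_iUnion.2 ⟨p, mem_chart_source _ p⟩
  exact hcov t A hA h ((subset_univ A).trans ht)

lemma riemVol_restrict_source (hc : SmoothChart c) : (riemVol n M).restrict c.source = chartVol c :=
    by
  ext A hA
  have hs := c.open_source.measurableSet
  rw [Measure.restrict_apply hA]
  refine le_antisymm ?_ ?_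
  · refine (riemVol_le hc (A ∩ c.source)).trans ?_
    rw [Measure.add_apply, Measure.restrict_apply (hA.inter hs), inter_assoc, inter_compl_self,
      inter_empty, measure_empty, add_zero]
    exact measure_mono inter_subset_left
  · rw [← chartVol_inter_source c hA]
    exact chartVol_le hc (hA.inter hs) inter_subset_right

lemma measurableSet_symm_image (c : Chart n M) {S : Set (Eu n)} (hS : IsOpen S) (hSt : S ⊆ c.target)
    : MeasurableSet (c.symm '' S) := (c.isOpen_image_symm_of_subset_target hS hSt).measurableSet

lemma riemVol_symm_image (hc : SmoothChart c) {S : Set (Eu n)} (hS : IsOpen S) (hSt : S ⊆ c.target)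
    : riemVol n M (c.symm '' S) = ∫⁻ y in S, ofReal √(gram c y).det := by
  have hm := measurableSet_symm_image c hS hSt
  have hsub : c.symm '' S ⊆ c.source := by
    rintro _ ⟨y, hy, rfl⟩
    exact c.map_target (hSt hy)
  rw [← Measure.restrict_eq_self _ hsub, riemVol_restrict_source hc, chartVol_apply c hm]
  congr 2
  ext y
  constructor
  · rintro ⟨⟨z, hz, h⟩, hy⟩
    rwa [← c.symm.injOn (hSt hz) hy h]
  · exact fun hy => ⟨mem_image_of_mem _ hy, hSt hy⟩

instance isFiniteMeasure_riemVol : IsFiniteMeasure (riemVol n M) := by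
  refine ⟨isCompact_univ.measure_lt_top_of_nhdsWithin fun p _ => ?_⟩
  rw [nhdsWithin_univ]
  have hc := smoothChart_chartAt (n := n) p
  obtain ⟨c, hcp⟩ : ∃ c, c = chartAt (Eu n) p := ⟨_, rfl⟩
  rw [← hcp] at hc
  have hp : p ∈ c.source := hcp ▸ mem_chart_source _ p
  have hcont : ContinuousAt (fun y => √(gram c y).det) (c p) :=
    ((contDiffAt_det (contDiffAt_gram hc (c.map_source hp))).continuousAt).sqrt
  have h1 := hcont.eventually_lt_const (lt_add_one _)
  obtain ⟨δ, hδ, hb⟩ := eventually_nhds_iff_ball.1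
    (h1.and (c.open_target.mem_nhds (c.map_source hp)))
  have hSt : ball (c p) δ ⊆ c.target := fun y hy => (hb y hy).2
  refine ⟨c.symm '' ball (c p) δ, ?_, ?_⟩
  · refine (c.isOpen_image_symm_of_subset_target isOpen_ball hSt).mem_nhds
      ⟨c p, mem_ball_self hδ, c.left_inv hp⟩
  · rw [riemVol_symm_image hc isOpen_ball hSt]
    refine (setLIntegral_mono' (g := fun _ => ofReal (√(gram c (c p)).det + 1))
      measurableSet_ball fun y hy => ofReal_le_ofReal (hb y hy).1.le).trans_lt ?_
    rw [setLIntegral_const]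
    exact ENNReal.mul_lt_top ENNReal.ofReal_lt_top measure_ball_lt_top

lemma integrable_riemVol {h : M → ℝ} (hh : Continuous h) : Integrable h (riemVol n M) :=
  hh.integrable_of_hasCompactSupport (HasCompactSupport.of_compactSpace _)

lemma integral_symm_image (hc : SmoothChart c) {S : Set (Eu n)} (hS : IsOpen S) (hSt : S ⊆ c.target)
    {h : M → ℝ} (hh : Continuous h) :
    ∫ p in c.symm '' S, h p ∂riemVol n M = ∫ y in S, √(gram c y).det * h (c.symm y) := by
  have hm := measurableSet_symm_image c hS hSt
  have hsub : c.symm '' S ⊆ c.source := by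
    rintro _ ⟨y, hy, rfl⟩
    exact c.map_target (hSt hy)
  have hdet : ContinuousOn (fun y => √(gram c y).det) c.target := fun y hy =>
    ((contDiffAt_det (contDiffAt_gram hc hy)).continuousAt.sqrt).continuousWithinAt
  have hmem : ∀ y ∈ c.target, c.symm y ∈ c.symm '' S ↔ y ∈ S := fun y hy =>
    ⟨fun ⟨z, hz, e⟩ => by rwa [← c.symm.injOn (hSt hz) hy e], mem_image_of_mem _⟩
  rw [← inter_eq_self_of_subset_left hsub, ← Measure.restrict_restrict hm,
    riemVol_restrict_source hc, ← integral_indicator hm, chartVol,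
    integral_map (aemeasurable_symm c _) (hh.measurable.indicator hm).aestronglyMeasurable,
    integral_withDensity_eq_integral_toReal_smul₀
      (hdet.aemeasurable c.open_target.measurableSet).ennreal_ofReal
      (Eventually.of_forall fun _ => ENNReal.ofReal_lt_top)]
  have e : ∫ y in c.target, (ofReal √(gram c y).det).toReal • (c.symm '' S).indicator h (c.symm y) =
      ∫ y in c.target, S.indicator (fun y => √(gram c y).det * h (c.symm y)) y := by
    refine setIntegral_congr_fun c.open_target.measurableSet fun y hy => ?_
    change _ • _ = _
    rw [ENNReal.toReal_ofReal (sqrt_nonneg _), smul_eq_mul]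
    by_cases hyS : y ∈ S
    · rw [indicator_of_mem hyS, indicator_of_mem ((hmem y hy).2 hyS)]
    · rw [indicator_of_notMem hyS, indicator_of_notMem fun h => hyS ((hmem y hy).1 h), mul_zero]
  rw [e, setIntegral_indicator hS.measurableSet, inter_eq_self_of_subset_right hSt]

end Volume

open scoped MatrixOrder in
lemma exists_transpose_mul_mul_eq_one {n : ℕ} {A : Mat n} (hA : A.PosDef) :
    ∃ Q : Mat n, IsUnit Q.det ∧ (Q⁻¹)ᵀ * A * Q⁻¹ = 1 := by
  have h0 : 0 ≤ A := hA.posSemidef.nonneg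
  have hs : CFC.sqrt A * CFC.sqrt A = A := CFC.sqrt_mul_sqrt_self A h0
  have ht : (CFC.sqrt A)ᵀ = CFC.sqrt A := by
    have := (Matrix.nonneg_iff_posSemidef.1 (CFC.sqrt_nonneg A)).isHermitian.eq
    rwa [Matrix.conjTranspose_eq_transpose_of_trivial] at this
  have hu : IsUnit (CFC.sqrt A).det := by
    rw [isUnit_iff_ne_zero]
    intro h
    have := hA.det_pos
    rw [← hs, Matrix.det_mul, h, mul_zero] at this
    exact lt_irrefl _ this
  refine ⟨CFC.sqrt A, hu, ?_⟩
  have h1 : (CFC.sqrt A)⁻¹ * A * (CFC.sqrt A)⁻¹ =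
      (CFC.sqrt A)⁻¹ * (CFC.sqrt A * CFC.sqrt A) * (CFC.sqrt A)⁻¹ := by rw [hs]
  rw [Matrix.transpose_nonsing_inv, ht, h1, ← mul_assoc, nonsing_inv_mul _ hu, one_mul, mul_nonsing_inv _ hu]

lemma gram_transHomeomorph (hc : SmoothChart c) {e : Eu n ≃ₜ Eu n} (he : ContDiff ℝ ∞ e)
    (he' : ContDiff ℝ ∞ e.symm) {y : Eu n} (hy : e.symm y ∈ c.target) :
    gram (c.transHomeomorph e) y = (jac e.symm y)ᵀ * gram c (e.symm y) * jac e.symm y := by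
  have hmem : ∀ z, e.symm z ∈ c.target → z ∈ chgDom (c.transHomeomorph e) c := fun z hz =>
    ⟨hz, c.map_target hz⟩
  have hchg : ∀ z, e.symm z ∈ c.target → chg (c.transHomeomorph e) c z = e.symm z := fun z hz =>
    c.right_inv hz
  have h := (transition_chg (hc.transHomeomorph e he he') hc).metric y (hmem y hy)
  rw [hchg y hy] at h
  rw [h]
  have hev : chg (c.transHomeomorph e) c =ᶠ[𝓝 y] e.symm := by
    filter_upwards [(c.open_target.preimage e.symm.continuous).mem_nhds hy] with z hz using hchg z hz
  have : jac (chg (c.transHomeomorph e) c) y = jac e.symm y := by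
    ext k i
    simp only [jac, pd, Matrix.of_apply, hev.fderiv_eq]
  rw [this]

/-- The linear homeomorphism of a regular matrix. -/
def matEquiv (Q : Mat n) (hQ : IsUnit Q.det) : Eu n ≃L[ℝ] Eu n :=
  ContinuousLinearEquiv.equivOfInverse (Matrix.toEuclideanCLM (𝕜 := ℝ) Q)
    (Matrix.toEuclideanCLM (𝕜 := ℝ) Q⁻¹) (fun x => by
      rw [← mul_apply_eq_comp, ← map_mul, nonsing_inv_mul _ hQ, map_one]; rfl)
    (fun x => by
      rw [← mul_apply_eq_comp, ← map_mul, mul_nonsing_inv _ hQ, map_one]; rfl)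

lemma exists_normal_chart (p : M) : ∃ c : Chart n M, SmoothChart c ∧
    p ∈ c.source ∧ c p = 0 ∧ gram c 0 = 1 := by
  have hc := smoothChart_chartAt (n := n) p
  have hp := mem_chart_target (Eu n) p
  obtain ⟨z, hz⟩ : ∃ z, z = chartAt (Eu n) p p := ⟨_, rfl⟩
  rw [← hz] at hp
  obtain ⟨Q, hQ, hQ1⟩ := exists_transpose_mul_mul_eq_one (posDef_gram hc hp)
  let e : Eu n ≃ₜ Eu n := (Homeomorph.addRight (-z)).trans (matEquiv Q hQ).toHomeomorph
  have he : ContDiff ℝ ∞ e := (matEquiv Q hQ).contDiff.comp (contDiff_id.add contDiff_const)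
  have es : ∀ y, e.symm y = (matEquiv Q hQ).symm y + z := fun y => by
    change (matEquiv Q hQ).symm y + - -z = _
    rw [neg_neg]
  have he' : ContDiff ℝ ∞ e.symm := by
    have : (e.symm : Eu n → Eu n) = fun y => (matEquiv Q hQ).symm y + z := funext es
    rw [this]
    exact (matEquiv Q hQ).symm.contDiff.add contDiff_const
  have e0 : e.symm 0 = z := by rw [es, map_zero, zero_add]
  refine ⟨(chartAt (Eu n) p).transHomeomorph e, hc.transHomeomorph e he he', mem_chart_source _ p,
    ?_, ?_⟩
  · change e (chartAt (Eu n) p p) = 0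
    rw [← hz, ← e0, e.apply_symm_apply]
  · have hj : jac e.symm 0 = Q⁻¹ := by
      have hd : HasFDerivAt e.symm ((matEquiv Q hQ).symm : Eu n →L[ℝ] Eu n) 0 := by
        have : (e.symm : Eu n → Eu n) = fun y => (matEquiv Q hQ).symm y + z := funext es
        rw [this]
        exact (matEquiv Q hQ).symm.hasFDerivAt.add_const z
      ext k i
      simp only [jac, pd, Matrix.of_apply, hd.fderiv]
      change (Q⁻¹ *ᵥ (Pi.single i 1)) k = _
      simp
    rw [gram_transHomeomorph hc he he' (by rw [e0]; exact hp), hj, e0, hQ1]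

/-- A chart in which the metric is close to the Euclidean one on the ball of radius `R`. -/
structure GoodChart (c : Chart n M) (R K : ℝ) : Prop where
  smooth : SmoothChart c
  sub : ball 0 R ⊆ c.target
  near : ∀ y ∈ 𝔹 R, NearId (gram c y)⁻¹
  near' : ∀ y ∈ 𝔹 R, NearId (gram c y)
  ge : ∀ y ∈ 𝔹 R, 1 / 2 ≤ √(gram c y).det
  le : ∀ y ∈ 𝔹 R, √(gram c y).det ≤ 2
  da : ∀ y ∈ 𝔹 R, ∀ i j k, |pd k (fun x => (gram c x)⁻¹ i j) y| ≤ K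
  dσ : ∀ y ∈ 𝔹 R, ∀ k, |pd k (fun x => √(gram c x).det) y| ≤ K
  dG : ∀ y ∈ 𝔹 R, ∀ i j k, |pd k (fun x => gram c x i j) y| ≤ K

lemma exists_eventually_abs_le {X ι : Type*} [TopologicalSpace X] [Finite ι] {f : ι → X → ℝ} {x : X}
    (hf : ∀ i, ContinuousAt (f i) x) : ∃ K : ℝ, ∀ᶠ y in 𝓝 x, ∀ i, |f i y| ≤ K := by
  cases nonempty_fintype ι
  refine ⟨∑ i, (|f i x| + 1), eventually_all.2 fun i => ?_⟩
  filter_upwards [(hf i).abs.eventually_lt_const (lt_add_one _)] with y hy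
  exact hy.le.trans (Finset.single_le_sum (f := fun i => |f i x| + 1) (fun _ _ => by positivity)
    (Finset.mem_univ i))

lemma exists_goodChart (p : M) : ∃ (c : Chart n M) (R K : ℝ), 0 < R ∧
    R ≤ 1 ∧ p ∈ c.source ∧ c p = 0 ∧ GoodChart c R K := by
  obtain ⟨c, hc, hp, hp0, hG⟩ := exists_normal_chart (n := n) p
  have h0 : (0 : Eu n) ∈ c.target := hp0 ▸ c.map_source hp
  have hsm := contDiffAt_gram hc h0
  have hsi := contDiffAt_gram_inv hc h0
  have hd : ContDiffAt ℝ ∞ (fun y => √(gram c y).det) 0 :=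
    (contDiffAt_det hsm).sqrt (posDef_gram hc h0).det_pos.ne'
  have hGi : (gram c 0)⁻¹ = 1 := by rw [hG, inv_one]
  have hdet : √(gram c 0).det = 1 := by rw [hG, Matrix.det_one, Real.sqrt_one]
  have hnear : ∀ {A : Eu n → Mat n}, A 0 = 1 →
      (∀ i j, ContinuousAt (fun y => A y i j) 0) → ∀ᶠ y in 𝓝 (0 : Eu n), ∀ i j,
        |A y i j - (1 : Mat n) i j| ≤ 1 / 4000 := by
    intro A hA0 hA
    refine eventually_all.2 fun i => eventually_all.2 fun j => ?_
    have h1 : ContinuousAt (fun y => |A y i j - (1 : Mat n) i j|) 0 :=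
      ((hA i j).sub continuousAt_const).abs
    filter_upwards [h1.eventually_lt_const (u := 1 / 4000) (by beta_reduce; simp [hA0])]
      with y hy using hy.le
  obtain ⟨K₁, hK₁⟩ := exists_eventually_abs_le (f := fun (i : Fin n × Fin n × Fin n) y =>
    pd i.2.2 (fun x => (gram c x)⁻¹ i.1 i.2.1) y) fun i => continuousAt_pd (hsi _ _) _
  obtain ⟨K₂, hK₂⟩ := exists_eventually_abs_le (f := fun (i : Fin n) y =>
    pd i (fun x => √(gram c x).det) y) fun i => continuousAt_pd hd _
  obtain ⟨K₃, hK₃⟩ := exists_eventually_abs_le (f := fun (i : Fin n × Fin n × Fin n) y =>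
    pd i.2.2 (fun x => gram c x i.1 i.2.1) y) fun i => continuousAt_pd (hsm _ _) _
  have ht : ∀ᶠ y in 𝓝 (0 : Eu n), y ∈ c.target := c.open_target.mem_nhds h0
  obtain ⟨δ, hδ, hb⟩ := eventually_nhds_iff_ball.1 (ht.and
    ((hnear hGi fun i j => (hsi i j).continuousAt).and
    ((hnear hG fun i j => (hsm i j).continuousAt).and
    ((hd.continuousAt.eventually_const_lt (u := 1 / 2) (by beta_reduce; rw [hdet]; norm_num)).and
    ((hd.continuousAt.eventually_lt_const (u := 2) (by beta_reduce; rw [hdet]; norm_num)).and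
    (hK₁.and (hK₂.and hK₃)))))))
  have hb' := fun (y : Eu n) (hy : y ∈ 𝔹 (min δ 1)) =>
    hb y (ball_subset_ball (min_le_left _ _) hy)
  refine ⟨c, min δ 1, max K₁ (max K₂ K₃), lt_min hδ one_pos, min_le_right _ _, hp, hp0, hc,
    fun y hy => (hb' y hy).1, fun y hy => ⟨fun i j => ?_, (hb' y hy).2.1⟩,
    fun y hy => ⟨fun i j => gram_symm _ _ _ _, (hb' y hy).2.2.1⟩,
    fun y hy => (hb' y hy).2.2.2.1.le, fun y hy => (hb' y hy).2.2.2.2.1.le,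
    fun y hy i j k => ((hb' y hy).2.2.2.2.2.1 (i, j, k)).trans (le_max_left _ _),
    fun y hy k => ((hb' y hy).2.2.2.2.2.2.1 k).trans ((le_max_left _ _).trans (le_max_right _ _)),
    fun y hy i j k => ((hb' y hy).2.2.2.2.2.2.2 (i, j, k)).trans
      ((le_max_right _ _).trans (le_max_right _ _))⟩
  have h := (posDef_gram hc (hb' y hy).1).inv.isHermitian.eq
  have h1 := congrFun (congrFun h j) i
  rwa [Matrix.conjTranspose_apply, star_trivial] at h1

variable {R K : ℝ}

lemma NearId.mform_le (hn : n ≤ 4) {A : Mat n} (hA : NearId A) (v : Eu n) :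
    Transition.mform A v v ≤ 4 * ‖v‖ ^ 2 := by
  have h1 := (abs_le.1 (hA.inner_le (W := ℝ) hn v v)).2
  have h2 : Transition.mform A v v = (inner ℝ v (matAct A v : Gr n ℝ) : ℝ) := by
    rw [Transition.mform_apply, gr_inner]
    refine sum_congr rfl fun i _ => ?_
    rw [matAct_apply, inner_sum]
    refine sum_congr rfl fun j _ => ?_
    simp
    ring
  rw [h2]
  refine h1.trans ?_
  nlinarith [sq_nonneg ‖v‖]

/-- The chart with origin moved to `y₀`. -/
def shift (c : Chart n M) (y₀ : Eu n) : Chart n M := c.transHomeomorph (Homeomorph.addRight (-y₀))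

lemma shift_symm_apply (c : Chart n M) (y₀ y : Eu n) : (shift c y₀).symm y = c.symm (y + y₀) := by
  change c.symm (y + - -y₀) = _
  rw [neg_neg]

lemma mem_shift_target (c : Chart n M) (y₀ y : Eu n) :
    y ∈ (shift c y₀).target ↔ y + y₀ ∈ c.target := by
  change y + - -y₀ ∈ c.target ↔ _
  rw [neg_neg]

lemma SmoothChart.shift (hc : SmoothChart c) (y₀ : Eu n) : SmoothChart (shift c y₀) :=
  hc.transHomeomorph _ (contDiff_id.add contDiff_const) (contDiff_id.add contDiff_const)

lemma gram_shift (hc : SmoothChart c) {y₀ y : Eu n} (hy : y + y₀ ∈ c.target) :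
    gram (shift c y₀) y = gram c (y + y₀) := by
  have e : (Homeomorph.addRight (-y₀)).symm y = y + y₀ := by
    change y + - -y₀ = _
    rw [neg_neg]
  have h := gram_transHomeomorph (e := Homeomorph.addRight (-y₀)) hc
    (contDiff_id.add contDiff_const) (contDiff_id.add contDiff_const) (y := y) (by rwa [e])
  have hj : jac (Homeomorph.addRight (-y₀)).symm y = 1 := by
    have hd : HasFDerivAt (Homeomorph.addRight (-y₀)).symm (ContinuousLinearMap.id ℝ (Eu n)) y :=
      (hasFDerivAt_id y).add_const (- -y₀)
    ext k i
    simp only [jac, pd, Matrix.of_apply, hd.fderiv]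
    simp [Matrix.one_apply, Pi.single_apply]
  rw [hj, e, Matrix.transpose_one, one_mul, mul_one] at h
  exact h

lemma symm_image_shift (c : Chart n M) (y₀ : Eu n) (s : ℝ) : (shift c y₀).symm '' ball 0 s = c.symm
    '' ball y₀ s := by
  ext p
  constructor
  · rintro ⟨y, hy, rfl⟩
    exact ⟨y + y₀, by simpa using hy, (shift_symm_apply c y₀ y).symm⟩
  · rintro ⟨y, hy, rfl⟩
    exact ⟨y - y₀, by simpa [dist_eq_norm] using hy, by rw [shift_symm_apply, sub_add_cancel]⟩

lemma GoodChart.coordMetric (h : GoodChart c R K) {K' s : ℝ} (hs : 0 < s) (hK : K ≤ K') {y₀ : Eu n}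
    (hy₀ : ball y₀ (2 * s) ⊆ ball 0 R) : CoordMetric K' s (gram (shift c y₀)) := by
  have hm : ∀ y ∈ 𝔹 (2 * s), y + y₀ ∈ 𝔹 R := fun y hy => hy₀ (by simpa using hy)
  have hm' : ∀ y ∈ 𝔹 s, y + y₀ ∈ 𝔹 R := fun y hy => hm y (ball_subset_ball (by linarith) hy)
  have hg : ∀ y ∈ 𝔹 (2 * s), gram (shift c y₀) y = gram c (y + y₀) :=
    fun y hy => gram_shift h.smooth (h.sub (hm y hy))
  have hpd : ∀ (φ : Mat n → ℝ), ∀ y ∈ 𝔹 s, ∀ k,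
      pd k (fun x => φ (gram (shift c y₀) x)) y = pd k (fun x => φ (gram c x)) (y + y₀) := by
    intro φ y hy k
    have e : (fun x => φ (gram (shift c y₀) x)) =ᶠ[𝓝 y] fun x => φ (gram c (x + y₀)) := by
      filter_upwards [isOpen_ball.mem_nhds
        (ball_subset_ball (by linarith : s ≤ 2 * s) hy)] with x hx
      rw [hg x hx]
    rw [pd, e.fderiv_eq, fderiv_comp_add_right (f := fun x => φ (gram c x)), pd]
  have ht : ∀ y ∈ 𝔹 (2 * s), y ∈ (shift c y₀).target := fun y hy =>
    (mem_shift_target _ _ _).2 (h.sub (hm y hy))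
  refine ⟨fun y hy => contDiffAt_gram (h.smooth.shift y₀) (ht y hy),
    fun y hy => (posDef_gram (h.smooth.shift y₀) (ht y hy)).det_pos, fun y hy => ?_,
    fun y hy => ?_, fun y hy => ?_, fun y hy i j k => ?_, fun y hy k => ?_, fun y hy i j k => ?_⟩
  · rw [hg y hy]; exact h.near _ (hm y hy)
  · rw [hg y hy]; exact h.ge _ (hm y hy)
  · rw [hg y hy]; exact h.le _ (hm y hy)
  · rw [hpd (fun A => A⁻¹ i j) y hy]; exact (h.da _ (hm' y hy) i j k).trans hK
  · rw [hpd (fun A => √A.det) y hy]; exact (h.dσ _ (hm' y hy) k).trans hK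
  · rw [hpd (fun A => A i j) y hy]; exact (h.dG _ (hm' y hy) i j k).trans hK

lemma exists_card_cover (n : ℕ) : ∃ m : ℝ → ℕ, ∀ s : ℝ, 0 < s → ∀ A : Set (Eu n),
    A ⊆ closedBall 0 1 → ∃ F : Finset (Eu n), ↑F ⊆ A ∧ F.card ≤ m s ∧ A ⊆ ⋃ y ∈ F, ball y s := by
  classical
  have h : ∀ s : ℝ, ∃ t : Finset (Eu n), 0 < s → 𝔻 1 ⊆ ⋃ y ∈ t, ball y (s / 2) := by
    intro s
    by_cases hs : 0 < s
    · obtain ⟨t, ht, h⟩ := totallyBounded_iff.1 (isCompact_closedBall (0 : Eu n) 1).totallyBounded (s / 2) (by linarith)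
      exact ⟨ht.toFinset, fun _ => by simpa using h⟩
    · exact ⟨∅, fun h => absurd h hs⟩
  choose t ht using h
  refine ⟨fun s => (t s).card, fun s hs A hA => ?_⟩
  have hg : ∀ y : Eu n, ∃ z, (ball y (s / 2) ∩ A).Nonempty → z ∈ ball y (s / 2) ∩ A := fun y => by
      by_cases h : (ball y (s / 2) ∩ A).Nonempty
      · exact ⟨h.choose, fun _ => h.choose_spec⟩
      · exact ⟨0, fun h' => absurd h' h⟩
  choose g hg using hg
  refine ⟨((t s).filter fun y => (ball y (s / 2) ∩ A).Nonempty).image g, ?_,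
    Finset.card_image_le.trans (Finset.card_filter_le _ _), fun z hz => ?_⟩
  · intro z hz
    obtain ⟨y, hy, rfl⟩ := Finset.mem_image.1 (Finset.mem_coe.1 hz)
    exact (hg y (Finset.mem_filter.1 hy).2).2
  · obtain ⟨y, hy, hzy⟩ := mem_iUnion₂.1 (ht s hs (hA hz))
    have hne : (ball y (s / 2) ∩ A).Nonempty := ⟨z, hzy, hz⟩
    refine mem_iUnion₂.2 ⟨g y, Finset.mem_image_of_mem _ (Finset.mem_filter.2 ⟨hy, hne⟩), ?_⟩
    have h1 := mem_ball.1 (hg y hne).1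
    have h2 := mem_ball.1 hzy
    have h3 := dist_triangle_right z (g y) y
    rw [mem_ball]
    linarith

lemma setIntegral_le_sum {X ι : Type*} [MeasurableSpace X] {μ : Measure X} {h : X → ℝ}
    (hh : Integrable h μ) (h0 : ∀ x, 0 ≤ h x) (t : Finset ι) {A : Set X} {S : ι → Set X}
    (hA : MeasurableSet A) (hS : ∀ i ∈ t, MeasurableSet (S i)) (hAS : A ⊆ ⋃ i ∈ t, S i) :
    ∫ x in A, h x ∂μ ≤ ∑ i ∈ t, ∫ x in S i, h x ∂μ := by
  have e : ∑ i ∈ t, ∫ x in S i, h x ∂μ = ∫ x, ∑ i ∈ t, (S i).indicator h x ∂μ := by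
    rw [integral_finsetSum _ fun i hi => hh.indicator (hS i hi)]
    exact sum_congr rfl fun i hi => (integral_indicator (hS i hi)).symm
  rw [e, ← integral_indicator hA]
  refine integral_mono (hh.indicator hA)
    (integrable_finsetSum _ fun i hi => hh.indicator (hS i hi)) fun x => ?_
  have hnn : ∀ i ∈ t, 0 ≤ (S i).indicator h x := fun i _ => indicator_nonneg (fun y _ => h0 y) x
  by_cases hx : x ∈ A
  · obtain ⟨i, hi, hxi⟩ := mem_iUnion₂.1 (hAS hx)
    rw [indicator_of_mem hx, ← indicator_of_mem hxi h]
    exact Finset.single_le_sum hnn hi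
  · rw [indicator_of_notMem hx]
    exact sum_nonneg hnn

variable {N : Set (Eu L)} {ε a b T : ℝ} {f : ℝ → M → Eu L}
  {u : ℝ → M → ℝ}

lemma hessSq_nonneg (f : M → Eu L) (p : M) : 0 ≤ hessSq n f p := by
  have h := (posDef_gram (smoothChart_chartAt (n := n) p) (mem_chart_target _ p)).inv.posSemidef
  have h1 := sum_inner_nonneg (h.kronecker h) fun i : Fin n × Fin n =>
    hessCoord (gram (chartAt (Eu n) p)) (inChart n p f) i.1 i.2 (chartAt (Eu n) p p)
  simp only [Fintype.sum_prod_type, Matrix.kroneckerMap_apply] at h1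
  exact h1

lemma contMDiff_slice {g : ℝ → M → V}
    (hg : ContMDiffOn (𝓘(ℝ, ℝ).prod (𝓡 n)) 𝓘(ℝ, V) ∞ (fun q : ℝ × M => g q.1 q.2)
      (Ico 0 T ×ˢ univ)) {t : ℝ} (ht : t ∈ Ico 0 T) : ContMDiff (𝓡 n) 𝓘(ℝ, V) ∞ (g t) :=
  hg.comp_contMDiff (contMDiff_const.prodMk contMDiff_id) fun _ => ⟨ht, mem_univ _⟩

lemma contDiffOn_time {g : ℝ → M → V}
    (hg : ContMDiffOn (𝓘(ℝ, ℝ).prod (𝓡 n)) 𝓘(ℝ, V) ∞ (fun q : ℝ × M => g q.1 q.2)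
      (Ico 0 T ×ˢ univ)) (p : M) : ContDiffOn ℝ ∞ (fun t => g t p) (Ico 0 T) := by
  rw [← contMDiffOn_iff_contDiffOn]
  exact hg.comp (contMDiff_id.prodMk contMDiff_const).contMDiffOn fun _ ht => ⟨ht, mem_univ _⟩

lemma contDiffAt_chart {g : ℝ → M → V}
    (hg : ContMDiffOn (𝓘(ℝ, ℝ).prod (𝓡 n)) 𝓘(ℝ, V) ∞ (fun q : ℝ × M => g q.1 q.2)
      (Ico 0 T ×ˢ univ)) (hc : SmoothChart c) {t : ℝ} (ht : t ∈ Ioo 0 T) {y : Eu n}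
    (hy : y ∈ c.target) : ContDiffAt ℝ ∞ (fun q : ℝ × Eu n => g q.1 (c.symm q.2)) (t, y) := by
  have h1 : ContMDiffOn 𝓘(ℝ, ℝ × Eu n) (𝓘(ℝ, ℝ).prod (𝓡 n)) ∞
      (fun q : ℝ × Eu n => (q.1, c.symm q.2)) (Ioo 0 T ×ˢ c.target) :=
    contDiff_fst.contMDiff.contMDiffOn.prodMk
      (hc.symm.comp contDiff_snd.contMDiff.contMDiffOn fun q hq => hq.2)
  have h2 := hg.comp h1 fun q hq => ⟨Ioo_subset_Ico_self hq.1, mem_univ _⟩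
  rw [contMDiffOn_iff_contDiffOn] at h2
  exact h2.contDiffAt ((isOpen_Ioo.prod c.open_target).mem_nhds ⟨ht, hy⟩)

lemma timeDeriv_eq_deriv (g : ℝ → M → V)
    {t : ℝ} (ht : 0 < t) (p : M) : timeDeriv g t p = deriv (fun τ => g τ p) t :=
  derivWithin_of_mem_nhds (Ici_mem_nhds ht)

lemma neg_mul_le_of_isRegularizedCHF (h : IsRegularizedCHF n N ε a b T f u) (hε : 0 ≤ ε)
    (hb : 0 ≤ b) {t : ℝ} (ht : t ∈ Ioo 0 T) (p : M) : -(a * t) ≤ u t p := by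
  have hs := contDiffOn_time h.smooth_u p
  have hsub : Icc 0 t ⊆ Ico 0 T := fun τ hτ => ⟨hτ.1, hτ.2.trans_lt ht.2⟩
  have hsub' : interior (Icc 0 t) ⊆ Ioo 0 T := by
    rw [interior_Icc]
    exact fun τ hτ => ⟨hτ.1, hτ.2.trans ht.2⟩
  have h1 := (convex_Icc 0 t).mul_sub_le_image_sub_of_le_deriv (hs.continuousOn.mono hsub)
    (fun τ hτ => ((hs.contDiffAt (Ico_mem_nhds (hsub' hτ).1 (hsub' hτ).2)).differentiableAt
      (by simp)).differentiableWithinAt) (C := -a) (fun τ hτ => ?_) 0 ⟨le_rfl, ht.1.le⟩ t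
    ⟨ht.1.le, le_rfl⟩ ht.1.le
  · rw [h.init] at h1
    linarith
  · rw [← timeDeriv_eq_deriv u (hsub' hτ).1, h.conf_eq τ (Ioo_subset_Ico_self (hsub' hτ))]
    have : 0 ≤ b * exp (-(n * u τ p)) * e2 n ε (f τ) p ^ ((n : ℝ) / 2) :=
      mul_nonneg (mul_nonneg hb (exp_pos _).le) (rpow_nonneg (e2_nonneg hε _ _) _)
    linarith

lemma coordFlow_of_isRegularizedCHF (hn : n ≤ 4) (hn2 : 2 ≤ n)
    (h : IsRegularizedCHF n N ε a b T f u) (hε : 0 ≤ ε) (hb : 0 ≤ b) (hc : SmoothChart c) {K s : ℝ}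
    (hs : 0 < s) (hst : ball 0 (2 * s) ⊆ c.target) (hG : CoordMetric K s (gram c)) :
    CoordFlow N ε a b T s (gram c) (fun t => f t ∘ c.symm) (fun t => u t ∘ c.symm) := by
  have hsm : ∀ t ∈ Ioo 0 T, ContMDiff (𝓡 n) 𝓘(ℝ, Eu L) ∞ (f t) :=
    fun t ht => contMDiff_slice h.smooth_f (Ioo_subset_Ico_self ht)
  have he : ∀ t ∈ Ioo 0 T, ∀ y ∈ 𝔹 (2 * s), e2 n ε (f t) (c.symm y) =
      ε + gradSqCoord (gram c) (f t ∘ c.symm) y := fun t ht y hy => by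
    rw [e2_eq_chart (hsm t ht) hc (c.map_target (hst hy)), c.right_inv (hst hy)]
  refine ⟨fun t ht y hy => contDiffAt_chart h.smooth_f hc ht (hst hy),
    fun t ht y hy => contDiffAt_chart h.smooth_u hc ht (hst hy),
    fun t ht y hy => h.mem t (Ioo_subset_Ico_self ht) _, fun t ht y hy => ?_,
    fun t ht y hy => ?_, fun t ht y hy => neg_mul_le_of_isRegularizedCHF h hε hb ht _⟩
  · have hy2 := ball_subset_ball (by linarith : s ≤ 2 * s) hy
    have h1 := h.map_eq t (Ioo_subset_Ico_self ht) (c.symm y)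
    have hp := c.map_target (hst hy2)
    rw [timeDeriv_eq_deriv f ht.1, he t ht y hy2, secondFFTrace_eq_chart (hsm t ht) hc hp,
      nLaplace_eq_chart (hsm t ht) hc hp, c.right_inv (hst hy2)] at h1
    · exact h1
    · rw [c.right_inv (hst hy2)]
      exact hG.differentiableAt_flux hn hn2 hs hε
        (fun z hz => contDiffAt_comp_symm (hsm t ht) hc (hst hz)) hy
  · have h1 := h.conf_eq t (Ioo_subset_Ico_self ht) (c.symm y)
    rw [timeDeriv_eq_deriv u ht.1, he t ht y hy] at h1
    exact h1

lemma continuous_e2_rpow {f : M → Eu L} (hf : ContMDiff (𝓡 n) 𝓘(ℝ, Eu L) ∞ f) (ε : ℝ) {q : ℝ}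
    (hq : 0 ≤ q) : Continuous fun p => e2 n ε f p ^ q :=
  (continuous_e2 hf ε).rpow_const fun _ => Or.inr hq

/-- Regularity on the part of a geodesic ball that lies in a chart. -/
lemma exists_chart_regularity (n : ℕ) (hn : n ≤ 4) (hn2 : 2 ≤ n) (CN : ℝ) (hCN : 0 ≤ CN) :
    ∃ ε₁ : ℝ, 0 < ε₁ ∧ ∀ (K s a b t₁ t₂ : ℝ), 0 ≤ K → 0 < s → 0 < a → 0 < n * b / 2 - CN ^ 2 →
      0 ≤ t₁ → t₁ < t₂ → ∃ C : ℝ, ∀ {L : ℕ} {M : Type*} [EMetricSpace M] [CompactSpace M]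
        [MeasurableSpace M] [BorelSpace M] [ChartedSpace (Eu n) M]
        [IsManifold (𝓡 n) ∞ M] [RiemannianBundle (𝕋 n M)]
        [IsContMDiffRiemannianBundle (𝓡 n) ∞ (Eu n) (𝕋 n M)] [IsRiemannianManifold (𝓡 n) M]
        {N : Set (Eu L)} {ε T : ℝ} {f : ℝ → M → Eu L}
        {u : ℝ → M → ℝ} {c : Chart n M} {R K₀ ρ r : ℝ} {x : M},
        IsSmoothSubmanifold N → SecondFFBound N CN → 0 ≤ ε → IsRegularizedCHF n N ε a b T f u →
        GoodChart c R K₀ → K₀ ≤ K → R ≤ 1 → 8 * s ≤ R → 0 < ρ → 8 * s ≤ r - ρ → t₂ < T →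
        (∀ t ∈ Icc t₁ t₂, ∫ p in eball x (ofReal r),
          e2 n ε (f t) p ^ ((n : ℝ) / 2) ∂riemVol n M ≤ ε₁) → ∫ p in eball x (ofReal r),
          exp (3 * n * u ((t₁ + t₂) / 2) p) ∂riemVol n M ≤ ε₁ → ∀ t ∈ Icc ((t₁ + t₂) / 2) t₂,
          ∫ p in eball x (ofReal ρ) ∩ c.symm '' ball 0 (R / 4),
            hessSq n (f t) p * e2 n ε (f t) p ^ ((n : ℝ) - 2) ∂riemVol n M ≤ C ∧
          ∫ p in eball x (ofReal ρ) ∩ c.symm '' ball 0 (R / 4),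
            e2 n ε (f t) p ^ (3 * (n : ℝ) / 2) ∂riemVol n M ≤ C := by
  obtain ⟨ε₁, hε₁, H⟩ := exists_coord_regularity n hn hn2 CN hCN
  obtain ⟨m, hm⟩ := exists_card_cover n
  refine ⟨ε₁, hε₁, fun K s a b t₁ t₂ hK hs ha hb ht₁ h12 => ?_⟩
  obtain ⟨C, hC, H⟩ := H K s a b t₁ t₂ hK hs ha hb ht₁ h12
  refine ⟨m (s / 4) * C, ?_⟩
  intro L M _ _ _ _ _ _ _ _ _ N ε T f u c R K₀ ρ r x hN hNb hε hf hc hK₀ hR hsR hρ hsr hT hE hZ t ht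
  obtain ⟨A, hA⟩ : ∃ A, A = {y ∈ 𝔹 (R / 4) | c.symm y ∈ eball x (ofReal ρ)} := ⟨_, rfl⟩
  obtain ⟨F, hFA, hFm, hFc⟩ := hm (s / 4) (by linarith) A fun y hy => by
    rw [hA] at hy
    exact ball_subset_closedBall (ball_subset_ball (by linarith) hy.1)
  have hball : ∀ y ∈ F, ball y (2 * s) ⊆ ball 0 R := fun y hy => by
    have h1 : y ∈ A := hFA hy
    rw [hA] at h1
    refine ball_subset_ball' ?_
    linarith [mem_ball.1 h1.1]
  have hball' : ∀ y ∈ F, ∀ s' ≤ 2 * s, ball y s' ⊆ c.target := fun y hy s' hs' =>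
    (ball_subset_ball hs').trans ((hball y hy).trans hc.sub)
  have himg : ∀ y ∈ F, c.symm '' ball y s ⊆ eball x (ofReal r) := by
    rintro y hy _ ⟨z, hz, rfl⟩
    have h1 : y ∈ A := hFA hy
    rw [hA] at h1
    have hzR := hball y hy (ball_subset_ball (by linarith) hz)
    have h2 := edist_symm_le hc.smooth (convex_ball 0 R) hc.sub
      (fun z hz v => (hc.near' z hz).mform_le hn v) hzR (hball y hy (mem_ball_self (by linarith)))
    rw [mem_eball]
    rw [mem_ball, dist_comm, dist_eq_norm] at hz
    have h3 : ofReal (2 * ‖y - z‖) ≤ ofReal (r - ρ) := ofReal_le_ofReal (by linarith)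
    calc edist (c.symm z) x ≤ edist (c.symm z) (c.symm y) + edist (c.symm y) x := edist_triangle _ _ _
      _ < ofReal (r - ρ) + ofReal ρ :=
        ENNReal.add_lt_add_of_le_of_lt (ne_top_of_le_ne_top ENNReal.ofReal_ne_top (h2.trans h3))
          (h2.trans h3) h1.2
      _ = ofReal r := by
        rw [← ENNReal.ofReal_add (by linarith) hρ.le, sub_add_cancel]
  have hn2' : (2 : ℝ) ≤ n := by exact_mod_cast hn2
  have hsm : ∀ t ∈ Icc t₁ t₂, ContMDiff (𝓡 n) 𝓘(ℝ, Eu L) ∞ (f t) :=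
    fun t ht => contMDiff_slice hf.smooth_f ⟨ht₁.trans ht.1, ht.2.trans_lt hT⟩
  have ht' : t ∈ Icc t₁ t₂ := ⟨le_trans (by linarith) ht.1, ht.2⟩
  have hu : Continuous (u ((t₁ + t₂) / 2)) :=
    (contMDiff_slice hf.smooth_u (t := (t₁ + t₂) / 2) ⟨by linarith, by linarith⟩).continuous
  have hb0 : 0 ≤ b := by
    have h1 : (0 : ℝ) < n := by positivity
    exact (pos_of_mul_pos_right (by nlinarith [sq_nonneg CN] : 0 < n * b) h1.le).le
  have hcu : Continuous fun p => exp (3 * n * u ((t₁ + t₂) / 2) p) :=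
    Real.continuous_exp.comp (continuous_const.mul hu)
  have hce : ∀ τ ∈ Icc t₁ t₂, ∀ q : ℝ, 0 ≤ q → Continuous fun p => e2 n ε (f τ) p ^ q :=
    fun τ hτ q hq => (continuous_e2 (hsm τ hτ) ε).rpow_const fun _ => Or.inr hq
  have hch : Continuous fun p => hessSq n (f t) p * e2 n ε (f t) p ^ ((n : ℝ) - 2) :=
    (continuous_hessSq (hsm t ht')).mul (hce t ht' _ (by linarith))
  have hreg : ∀ y ∈ F, ∫ p in c.symm '' ball y (s / 4),
      hessSq n (f t) p * e2 n ε (f t) p ^ ((n : ℝ) - 2) ∂riemVol n M ≤ C ∧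
      ∫ p in c.symm '' ball y (s / 4), e2 n ε (f t) p ^ (3 * (n : ℝ) / 2) ∂riemVol n M ≤ C := by
    intro y hy
    have hc' := hc.smooth.shift y
    have hst : ball 0 (2 * s) ⊆ (shift c y).target := fun z hz =>
      (mem_shift_target _ _ _).2 (hball' y hy _ le_rfl (by simpa using hz))
    have hst1 : ball 0 s ⊆ (shift c y).target := (ball_subset_ball (by linarith)).trans hst
    have hst4 : ball 0 (s / 4) ⊆ (shift c y).target := (ball_subset_ball (by linarith)).trans hst
    have hG := hc.coordMetric hs hK₀ (hball y hy)
    have he : ∀ t ∈ Icc t₁ t₂, ∀ z ∈ (shift c y).target, e2 n ε (f t) ((shift c y).symm z) =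
        ε + gradSqCoord (gram (shift c y)) (f t ∘ (shift c y).symm) z := fun t ht z hz => by
      rw [e2_eq_chart (hsm t ht) hc' ((shift c y).map_target hz), (shift c y).right_inv hz]
    have h := H hN hNb hε hG (coordFlow_of_isRegularizedCHF hn hn2 hf hε hb0 hc' hs hst hG) hT
      (fun τ hτ => ?_) ?_ t ht
    · rw [← symm_image_shift, integral_symm_image hc' isOpen_ball hst4 hch,
        integral_symm_image hc' isOpen_ball hst4 (hce t ht' _ (by positivity))]
      refine ⟨(setIntegral_congr_fun measurableSet_ball fun z hz => ?_).trans_le h.1,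
        (setIntegral_congr_fun measurableSet_ball fun z hz => ?_).trans_le h.2⟩
      · change √_ * (_ * _) = _
        rw [he t ht' z (hst4 hz), hessSq_eq_chart (hsm t ht') hc'
          ((shift c y).map_target (hst4 hz)), (shift c y).right_inv (hst4 hz)]
      · change √_ * _ = _
        rw [he t ht' z (hst4 hz)]
    · have h1 := (setIntegral_mono_set (integrable_riemVol (hce τ hτ _ (by positivity))).integrableOn
        (ae_of_all _ fun p => rpow_nonneg (e2_nonneg hε _ _) _)
        (himg y hy).eventuallyLE).trans (hE τ hτ)
      rw [← symm_image_shift, integral_symm_image hc' isOpen_ball hst1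
        (hce τ hτ _ (by positivity))] at h1
      refine (setIntegral_congr_fun measurableSet_ball fun z hz => ?_).trans_le h1
      change √_ * _ = √_ * _
      rw [he τ hτ z (hst1 hz)]
    · have h1 := (setIntegral_mono_set (integrable_riemVol hcu).integrableOn
        (ae_of_all _ fun p => (exp_pos _).le) (himg y hy).eventuallyLE).trans hZ
      rw [← symm_image_shift, integral_symm_image hc' isOpen_ball hst1 hcu] at h1
      exact h1
  have hms : MeasurableSet (eball x (ofReal ρ) ∩ c.symm '' ball 0 (R / 4)) :=
    isOpen_eball.measurableSet.inter (measurableSet_symm_image c isOpen_ball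
      ((ball_subset_ball (by linarith)).trans hc.sub))
  have hcov : eball x (ofReal ρ) ∩ c.symm '' ball 0 (R / 4) ⊆
      ⋃ y ∈ F, c.symm '' ball y (s / 4) := by
    rintro _ ⟨hp, y, hy, rfl⟩
    have h1 : y ∈ A := by rw [hA]; exact ⟨hy, hp⟩
    obtain ⟨z, hz, hyz⟩ := mem_iUnion₂.1 (hFc h1)
    exact mem_iUnion₂.2 ⟨z, hz, mem_image_of_mem _ hyz⟩
  have hsum : ∀ {h : M → ℝ}, Continuous h → (∀ p, 0 ≤ h p) → (∀ y ∈ F,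
      ∫ p in c.symm '' ball y (s / 4), h p ∂riemVol n M ≤ C) →
      ∫ p in eball x (ofReal ρ) ∩ c.symm '' ball 0 (R / 4), h p ∂riemVol n M ≤ m (s / 4) * C := by
    intro h hh h0 hb
    refine (setIntegral_le_sum (integrable_riemVol hh) h0 F hms (fun y hy =>
      measurableSet_symm_image c isOpen_ball (hball' y hy _ (by linarith))) hcov).trans ?_
    refine (Finset.sum_le_card_nsmul F _ C hb).trans ?_
    rw [nsmul_eq_mul]
    exact mul_le_mul_of_nonneg_right (by exact_mod_cast hFm) hC
  exact ⟨hsum hch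
      (fun p => mul_nonneg (hessSq_nonneg _ _) (rpow_nonneg (e2_nonneg hε _ _) _))
      fun y hy => (hreg y hy).1, hsum (hce t ht' _ (by positivity))
      (fun p => rpow_nonneg (e2_nonneg hε _ _) _) fun y hy => (hreg y hy).2⟩

variable (n M) in
/-- Finitely many good charts with a uniform scale. -/
lemma exists_good_cover [CompactSpace M] : ∃ (t : Finset M) (c : M → Chart n M) (R K : M → ℝ) (δ : ℝ), 0 < δ ∧
    (∀ p ∈ t, GoodChart (c p) (R p) (K p) ∧ R p ≤ 1 ∧ δ ≤ R p ∧
      K p ≤ δ⁻¹) ∧ univ ⊆ (⋃ p ∈ t, (c p).symm '' ball 0 (R p / 4)) ∧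
      ∀ x : M, ∃ p ∈ t, eball x (ofReal δ) ⊆ (c p).symm '' ball 0 (R p / 4) := by
  choose c R K hR hR1 hp hp0 hc using fun p : M => exists_goodChart (n := n) p
  have hop : ∀ p, IsOpen ((c p).symm '' ball 0 (R p / 4)) := fun p =>
    (c p).isOpen_image_symm_of_subset_target isOpen_ball
      ((ball_subset_ball (by linarith [hR p])).trans (hc p).sub)
  obtain ⟨t, ht⟩ := isCompact_univ.elim_finite_subcover
    (fun p : M => (c p).symm '' ball 0 (R p / 4)) hop fun p _ => mem_iUnion.2
      ⟨p, 0, mem_ball_self (by linarith [hR p]), by rw [← hp0 p, (c p).left_inv (hp p)]⟩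
  obtain ⟨δ', hδ', hL⟩ := lebesgue_number_lemma_of_emetric (ι := t) isCompact_univ
    (c := fun p : t => (c p).symm '' ball 0 (R p / 4)) (fun p => hop p) (by rwa [iUnion_subtype])
  have h1 : ∀ᶠ δ in 𝓝[>] (0 : ℝ), ∀ p ∈ t, δ ≤ R p ∧ K p ≤ δ⁻¹ := by
    refine (Finset.eventually_all t).2 fun p _ => Eventually.and ?_ ?_
    · exact mem_of_superset (mem_nhdsWithin_of_mem_nhds (Iio_mem_nhds (hR p)))
        fun δ (h : δ < R p) => h.le
    · exact tendsto_inv_nhdsGT_zero.eventually_ge_atTop (K p)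
  have h2 : ∀ᶠ δ in 𝓝[>] (0 : ℝ), ofReal δ < δ' :=
    ((ENNReal.tendsto_ofReal tendsto_id).mono_left nhdsWithin_le_nhds).eventually_lt_const
      (by simpa using hδ')
  obtain ⟨δ, h1, h2, hδ⟩ := (h1.and (h2.and self_mem_nhdsWithin)).exists
  refine ⟨t, c, R, K, δ, hδ, fun p hp => ⟨hc p, hR1 p, h1 p hp⟩, ht, fun x => ?_⟩
  obtain ⟨p, hp⟩ := hL x (mem_univ x)
  exact ⟨p, p.2, (eball_subset_eball h2.le).trans hp⟩

end CHF

end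

theorem theorem5p1 (n L : ℕ) (hn : 2 ≤ n) (hn' : n ≤ 4) (C_N Λ : ℝ) (hC_N : 0 ≤ C_N) :
    ∃ ε₁ : ℝ, 0 < ε₁ ∧
    -- the constant, as a function of `(a, b, E, ρ, r, t₁, t₂)`
    ∃ C : ℝ → ℝ → ℝ → ℝ → ℝ → ℝ → ℝ → ℝ,
    ∀ (M : Type*) [EMetricSpace M] [CompactSpace M] [MeasurableSpace M] [BorelSpace M]
      [ChartedSpace (EuclideanSpace ℝ (Fin n)) M] [IsManifold (𝓡 n) ∞ M]
      [RiemannianBundle (fun p : M => TangentSpace (𝓡 n) p)]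
      [IsContMDiffRiemannianBundle (𝓡 n) ∞ (EuclideanSpace ℝ (Fin n))
        (fun p : M => TangentSpace (𝓡 n) p)]
      [IsRiemannianManifold (𝓡 n) M],
    RicciBound n M Λ →
    ∃ r₀ : ℝ, 0 < r₀ ∧ ∃ C' : ℝ → ℝ → ℝ → ℝ → ℝ → ℝ → ℝ → ℝ,
    ∀ (N : Set (EuclideanSpace ℝ (Fin L))), IsSmoothSubmanifold N → SecondFFBound N C_N →
    ∀ (a b ε T E : ℝ), 0 < a → 0 < n * b / 2 - C_N - 2 * C_N ^ 2 → 0 ≤ ε → ε ≤ 1 →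
    ∀ (f : ℝ → M → EuclideanSpace ℝ (Fin L)) (u : ℝ → M → ℝ),
    IsRegularizedCHF n N ε a b T f u → nEnergy n ε (f 0) ≤ E →
    ∀ (x : M) (ρ r t₁ t₂ : ℝ), 0 < ρ → ρ < r → 0 ≤ t₁ → t₁ < t₂ → t₂ < T →
    (∀ t ∈ Icc t₁ t₂,
      ∫ p in Metric.eball x (ENNReal.ofReal r), e2 n ε (f t) p ^ ((n : ℝ) / 2) ∂riemVol n M ≤ ε₁) →
    ∫ p in Metric.eball x (ENNReal.ofReal r),
      Real.exp (n * u t₁ p) * ‖timeDeriv f t₁ p‖ ^ 2 ∂riemVol n M ≤ ε₁ →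
    ∫ p in Metric.eball x (ENNReal.ofReal r),
      Real.exp (3 * n * u ((t₁ + t₂) / 2) p) ∂riemVol n M ≤ ε₁ →
    ∀ t ∈ Icc ((t₁ + t₂) / 2) t₂,
      IntegrableOn (fun p => hessSq n (f t) p * e2 n ε (f t) p ^ ((n : ℝ) - 2))
        (Metric.eball x (ENNReal.ofReal ρ)) (riemVol n M) ∧
      IntegrableOn (fun p => e2 n ε (f t) p ^ (3 * (n : ℝ) / 2))
        (Metric.eball x (ENNReal.ofReal ρ)) (riemVol n M) ∧
      ∫ p in Metric.eball x (ENNReal.ofReal ρ),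
        hessSq n (f t) p * e2 n ε (f t) p ^ ((n : ℝ) - 2) ∂riemVol n M ≤ C' a b E ρ r t₁ t₂ ∧
      ∫ p in Metric.eball x (ENNReal.ofReal ρ),
        e2 n ε (f t) p ^ (3 * (n : ℝ) / 2) ∂riemVol n M ≤ C' a b E ρ r t₁ t₂ ∧
      (r ≤ r₀ →
        ∫ p in Metric.eball x (ENNReal.ofReal ρ),
          hessSq n (f t) p * e2 n ε (f t) p ^ ((n : ℝ) - 2) ∂riemVol n M ≤ C a b E ρ r t₁ t₂ ∧
        ∫ p in Metric.eball x (ENNReal.ofReal ρ),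
          e2 n ε (f t) p ^ (3 * (n : ℝ) / 2) ∂riemVol n M ≤ C a b E ρ r t₁ t₂) := by
  obtain ⟨ε₁, hε₁, H⟩ := CHF.exists_chart_regularity n hn' hn C_N hC_N
  choose! C HC using H
  refine ⟨ε₁, hε₁, fun a b _ ρ r t₁ t₂ => C r⁻¹ ((r - ρ) / 8) a b t₁ t₂, ?_⟩
  intro M _ _ _ _ _ _ _ _ _ _
  obtain ⟨I, c, R, K, δ, hδ, hI, hcov, hleb⟩ := CHF.exists_good_cover n M
  refine ⟨δ, hδ, fun a b _ ρ r t₁ t₂ => I.card • C δ⁻¹ (min (r - ρ) δ / 8) a b t₁ t₂, ?_⟩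
  intro N hN hNb a b ε T E ha hb hε _ f u hf _ x ρ r t₁ t₂ hρ hρr ht₁ h12 hT hE _ hZ t ht
  have hb' : 0 < n * b / 2 - C_N ^ 2 := by nlinarith [sq_nonneg C_N]
  have hn2 : (2 : ℝ) ≤ n := by exact_mod_cast hn
  have hm : 0 < min (r - ρ) δ := lt_min (by linarith) hδ
  have hft := CHF.contMDiff_slice hf.smooth_f (t := t)
    ⟨le_trans (by linarith) ht.1, ht.2.trans_lt hT⟩
  have hc₁ : Continuous fun p => hessSq n (f t) p * e2 n ε (f t) p ^ ((n : ℝ) - 2) :=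
    (CHF.continuous_hessSq hft).mul (CHF.continuous_e2_rpow hft ε (by linarith))
  have hc₂ : Continuous fun p => e2 n ε (f t) p ^ (3 * (n : ℝ) / 2) :=
    CHF.continuous_e2_rpow hft ε (by positivity)
  have h₁ : ∀ p, 0 ≤ hessSq n (f t) p * e2 n ε (f t) p ^ ((n : ℝ) - 2) := fun p =>
    mul_nonneg (CHF.hessSq_nonneg _ _) (Real.rpow_nonneg (CHF.e2_nonneg hε _ _) _)
  have h₂ : ∀ p, 0 ≤ e2 n ε (f t) p ^ (3 * (n : ℝ) / 2) := fun p =>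
    Real.rpow_nonneg (CHF.e2_nonneg hε _ _) _
  have hreg := fun p (hp : p ∈ I) => HC δ⁻¹ (min (r - ρ) δ / 8) a b t₁ t₂ (by positivity)
    (by positivity) ha hb' ht₁ h12 hN hNb hε hf (hI p hp).1 (hI p hp).2.2.2 (hI p hp).2.1
    (by linarith [min_le_right (r - ρ) δ, (hI p hp).2.2.1]) hρ
    (by linarith [min_le_left (r - ρ) δ]) hT hE hZ t ht
  have hsum : ∀ {h : M → ℝ} {B : ℝ}, Continuous h → (∀ p, 0 ≤ h p) → (∀ p ∈ I,
      ∫ q in Metric.eball x (ENNReal.ofReal ρ) ∩ (c p).symm '' Metric.ball 0 (R p / 4),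
        h q ∂riemVol n M ≤ B) →
      ∫ q in Metric.eball x (ENNReal.ofReal ρ), h q ∂riemVol n M ≤ I.card • B := by
    intro h B hh h0 hB
    refine (CHF.setIntegral_le_sum (CHF.integrable_riemVol hh) h0 I
      Metric.isOpen_eball.measurableSet (fun p hp => Metric.isOpen_eball.measurableSet.inter
        (CHF.measurableSet_symm_image (c p) Metric.isOpen_ball ((Metric.ball_subset_ball
          (by linarith [(hI p hp).2.2.1])).trans (hI p hp).1.sub))) fun q hq => ?_).trans
      (Finset.sum_le_card_nsmul I _ B hB)
    obtain ⟨p, hp, hqp⟩ := mem_iUnion₂.1 (hcov (mem_univ q))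
    exact mem_iUnion₂.2 ⟨p, hp, hq, hqp⟩
  refine ⟨(CHF.integrable_riemVol hc₁).integrableOn, (CHF.integrable_riemVol hc₂).integrableOn,
    hsum hc₁ h₁ fun p hp => (hreg p hp).1, hsum hc₂ h₂ fun p hp => (hreg p hp).2, fun hr => ?_⟩
  obtain ⟨p, hp, hsub⟩ := hleb x
  have h := HC r⁻¹ ((r - ρ) / 8) a b t₁ t₂ (inv_nonneg.2 (by linarith)) (by linarith) ha hb' ht₁
    h12 hN hNb hε hf (hI p hp).1 ((hI p hp).2.2.2.trans (inv_anti₀ (by linarith) hr)) (hI p hp).2.1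
    (by linarith [(hI p hp).2.2.1]) hρ (by linarith) hT hE hZ t ht
  rwa [inter_eq_self_of_subset_left ((Metric.eball_subset_eball
    (ENNReal.ofReal_le_ofReal (hρr.le.trans hr))).trans hsub)] at h
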